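/- For $m\ge 1$, $\lambda,q\in\mathbb C\setminus\{0\}$ with $m^mq\ne 1$, and a primitive $m$th root of unity $\zeta$, put $\lambda_i=\zeta^i\lambda$ and consider the Landau–Ginzburg potential $$W(x_0,\dots,x_{m-1})=\sum_{i=0}^{m-1}(x_i+\lambda_i\ln x_i)-\Big(q^{-1}\prod_{i=0}^{m-1}x_i\Big)^{1/m}$$ of the $(\mathbb C^*)^m$-equivariant $\mathcal O(m)$-twisted theory of $\mathbb P^{m-1}$, as a holomorphic function on the universal cover of $(\mathbb C^*)^m$. Let $L=(1-m^mq)^{-1/m}$ (any branch) and $L_\alpha=\zeta^\alpha\lambda L$ for $\alpha=0,\dots,m-1$. The $\alpha$th critical point of $W$ is, up to deck transformations, the one at which $(q^{-1}\prod_i x_i)^{1/m}=mL_\alpha$ (equivalently $x_i=L_\alpha-\lambda_i$ for all $i$). Let $u_\alpha$ be the value of $W$ there, and let $\gamma_\alpha$ be a Lefschetz thimble through it: a smoothly embedded copy of $\mathbb R^m$ with a parametrization $\gamma$ such that $\gamma(0)$ is the critical point and $W(\gamma(t))=u_\alpha+|t|^2$ for all $t$. Suppose that $$\mathcal I_\alpha(q,z)=\int_{\gamma_\alpha}e^{W/z}\,\frac{dx_0\wedge\cdots\wedge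 dx_{m-1}}{x_0\cdots x_{m-1}}$$ converges absolutely for some $z<0$. Then it converges absolutely for all $z<0$ close to $0$, and as $z\to0^-$ it has an asymptotic expansion $$\mathcal I_\alpha(q,z)\asymp e^{u_\alpha/z}\,(-2\pi z)^{m/2}\,\Psi\,\Big(1+\sum_{k>0}r_{k\alpha}\,(-z)^k\Big),\qquad \Psi^2=(-\lambda^m)^{-1}$$ (the sign of $\Psi$ depends on the orientation of $\gamma_\alpha$). For all $k\ge 0$ (with $r_{0\alpha}=1$), $L_\alpha^kr_{k\alpha}=p_{m,k}(L^m)$ for a polynomial $p_{m,k}\in\mathbb Q[T]$ that depends only on $m$ and $k$, and: 1. (Regularity) $L_\alpha^k r_{k\alpha}\in L^k\mathbb Q[L]\cap\mathbb Q[L^m]$, that is, $X^k$ divides $p_{m,k}(X^m)$ in $\mathbb Q[X]$. 2. (Degree) $\deg_{L^m}(L_\alpha^kr_{k\alpha})\le k$, with equality for every $k$ if $m\neq 2$. 3. (Polynomiality in $m$) $(mL_\alpha)^kr_{k\alpha}\in\mathbb Q[m,L^m]$: for every $k$ there is one polynomial $P_k\in\mathbb Q[M,T]$ such that $m^kp_{m,k}(T)=P_k(m,T)$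 for all $m\ge1$. -/

import Mathlib

open scoped ContDiff Topology Polynomial
open MeasureTheory Filter

/-- The Landau--Ginzburg potential
`W = ∑ i, (x i + lam i * ln (x i)) - (q⁻¹ * ∏ i, x i) ^ (1 / m)`
on the universal cover of the torus `(ℂ^*)^m`, in logarithmic coordinates `x i = exp (s i)`.
There the logarithms are `ln (x i) = s i`, and the branches of the `m`-th root are
`κ * exp ((∑ i, s i) / m)`, with `κ` an `m`-th root of `q⁻¹`. -/
noncomputable def lgPotential {m : ℕ} (lam : Fin m → ℂ) (κ : ℂ) (s : Fin m → ℂ) : ℂ :=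
  ∑ i, (Complex.exp (s i) + lam i * s i) - κ * Complex.exp ((∑ i, s i) / m)

/-- `γ` parametrizes a Lefschetz thimble of the holomorphic function `W` at its critical point `p`,
for integrals of `exp (W / z)` with `z < 0`: a smoothly embedded copy of `ℝ^m` through `p` which
`W` maps to the ray `W p + [0, ∞)`, the preimage of `W p + ρ ^ 2` being the vanishing cycle
`γ {‖t‖ = ρ}`, a sphere which shrinks to `p` as `ρ → 0`. (Such a `γ` is automatically proper.) -/
structure IsLefschetzThimble {m : ℕ} (W : (Fin m → ℂ) → ℂ) (p : Fin m → ℂ)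
    (γ : EuclideanSpace ℝ (Fin m) → (Fin m → ℂ)) : Prop where
  isCritical : HasFDerivAt W (0 : (Fin m → ℂ) →L[ℂ] ℂ) p
  smooth : ContDiff ℝ ∞ γ
  injective : Function.Injective γ
  immersion : ∀ t, Function.Injective (fderiv ℝ γ t)
  map_zero : γ 0 = p
  height : ∀ t, W (γ t) = W p + ((‖t‖ ^ 2 : ℝ) : ℂ)

/-- The coefficient of `dt 0 ∧ ⋯ ∧ dt (m - 1)` in the pullback under `γ` of the form
`exp (W / z) * (dx 0 ∧ ⋯ ∧ dx (m - 1)) / (x 0 ⋯ x (m - 1)) = exp (W / z) * ds 0 ∧ ⋯ ∧ ds (m - 1)`,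
where `x i = exp (s i)`. -/
noncomputable def oscIntegrand {m : ℕ} (W : (Fin m → ℂ) → ℂ)
    (γ : EuclideanSpace ℝ (Fin m) → (Fin m → ℂ)) (z : ℝ) (t : EuclideanSpace ℝ (Fin m)) : ℂ :=
  Complex.exp (W (γ t) / (z : ℂ)) *
    (Matrix.of fun i j : Fin m => fderiv ℝ γ t (EuclideanSpace.single j 1) i).det

/-- The oscillatory integral of `exp (W / z) * (dx 0 ∧ ⋯ ∧ dx (m - 1)) / (x 0 ⋯ x (m - 1))`
over the thimble parametrized by `γ`. -/
noncomputable def oscIntegral {m : ℕ} (W : (Fin m → ℂ) → ℂ)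
    (γ : EuclideanSpace ℝ (Fin m) → (Fin m → ℂ)) (z : ℝ) : ℂ :=
  ∫ t, oscIntegrand W γ z t

/-- The asymptotic expansion
`I z ≍ exp (u / z) * (-2 π z) ^ (m / 2) * Ψ * (∑ k, r k * (-z) ^ k)` as `z → 0⁻`
(in the sense of Poincaré). -/
def HasOscExpansion (m : ℕ) (I : ℝ → ℂ) (u Ψ : ℂ) (r : ℕ → ℂ) : Prop :=
  ∀ N : ℕ,
    (fun z : ℝ =>
      I z / (Complex.exp (u / (z : ℂ)) * (((-2 * Real.pi * z) ^ ((m : ℝ) / 2) : ℝ) : ℂ))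
        - Ψ * ∑ k ∈ Finset.range N, r k * (-(z : ℂ)) ^ k)
      =O[𝓝[<] (0 : ℝ)] fun z : ℝ => z ^ N

/-- An algebra `R` over `A` of "functions of the coordinates `T i`", with the commuting partial
derivatives `d i` and the evaluation `ev` at the origin. -/
structure JetAlgebra (ι A R : Type*) [DecidableEq ι] [CommRing A] [CommRing R] [Algebra A R] where
  d : ι → Derivation A R R
  comm : ∀ i j f, d i (d j f) = d j (d i f)
  ev : R →ₐ[A] A
  T : ι → R
  dT : ∀ i j, d i (T j) = if i = j then 1 else 0
  evT : ∀ i, ev (T i) = 0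

namespace JetAlgebra

variable {ι A R : Type*} [DecidableEq ι] [CommRing A] [CommRing R] [Algebra A R]

/-- The ideal of elements which vanish to order `n` at the origin. -/
def vanish (J : JetAlgebra ι A R) : ℕ → Ideal R
  | 0 => ⊤
  | n + 1 =>
    { carrier := {f | f ∈ J.vanish n ∧ J.ev f = 0 ∧ ∀ i, J.d i f ∈ J.vanish n}
      add_mem' := fun {a b} ha hb =>
        ⟨add_mem ha.1 hb.1, by rw [map_add, ha.2.1, hb.2.1, add_zero],
          fun i => by rw [map_add]; exact add_mem (ha.2.2 i) (hb.2.2 i)⟩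
      zero_mem' := ⟨zero_mem _, map_zero _, fun i => by rw [map_zero]; exact zero_mem _⟩
      smul_mem' := fun c f hf =>
        ⟨Ideal.mul_mem_left _ c hf.1, by rw [smul_eq_mul, map_mul, hf.2.1, mul_zero],
          fun i => by
            rw [smul_eq_mul, Derivation.leibniz]
            exact add_mem (Ideal.mul_mem_left _ _ (hf.2.2 i)) (Ideal.mul_mem_right _ _ hf.1)⟩ }

variable (J : JetAlgebra ι A R)

theorem mem_vanish_succ {n : ℕ} {f : R} :
    f ∈ J.vanish (n + 1) ↔ f ∈ J.vanish n ∧ J.ev f = 0 ∧ ∀ i, J.d i f ∈ J.vanish n := Iff.rfl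

theorem mem_vanish_zero (f : R) : f ∈ J.vanish 0 := by
  simp [vanish]

theorem vanish_anti {a b : ℕ} (h : a ≤ b) : J.vanish b ≤ J.vanish a := by
  induction h with
  | refl => exact le_rfl
  | step _ ih => exact le_trans (fun f hf => hf.1) ih

theorem d_mem_vanish {n : ℕ} {f : R} (hf : f ∈ J.vanish (n + 1)) (i : ι) :
    J.d i f ∈ J.vanish n := hf.2.2 i

theorem d_mem_vanish' {n : ℕ} {f : R} (hf : f ∈ J.vanish n) (i : ι) :
    J.d i f ∈ J.vanish (n - 1) := by
  cases n with
  | zero => exact J.mem_vanish_zero _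
  | succ n => exact hf.2.2 i

theorem mem_vanish_of {n : ℕ} {f : R} (h0 : J.ev f = 0) (h : ∀ i, J.d i f ∈ J.vanish n) :
    f ∈ J.vanish (n + 1) := by
  induction n with
  | zero => exact ⟨J.mem_vanish_zero _, h0, h⟩
  | succ n ih => exact ⟨ih fun i => (h i).1, h0, h⟩

theorem mem_vanish_one {f : R} : f ∈ J.vanish 1 ↔ J.ev f = 0 :=
  ⟨fun h => h.2.1, fun h => J.mem_vanish_of h fun _ => J.mem_vanish_zero _⟩

theorem mul_mem_vanish {a b : ℕ} {f g : R} (hf : f ∈ J.vanish a) (hg : g ∈ J.vanish b) :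
    f * g ∈ J.vanish (a + b) := by
  suffices ∀ n a b : ℕ, a + b = n → ∀ f g : R, f ∈ J.vanish a → g ∈ J.vanish b →
      f * g ∈ J.vanish n from this _ a b rfl f g hf hg
  intro n
  induction n with
  | zero => intros; exact J.mem_vanish_zero _
  | succ n ih =>
    intro a b hab f g hf hg
    rcases Nat.eq_zero_or_pos a with rfl | ha
    · rw [← hab, zero_add]; exact Ideal.mul_mem_left _ _ hg
    rcases Nat.eq_zero_or_pos b with rfl | hb
    · rw [← hab, add_zero]; exact Ideal.mul_mem_right _ _ hf
    obtain ⟨a, rfl⟩ := Nat.exists_eq_succ_of_ne_zero ha.ne'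
    obtain ⟨b, rfl⟩ := Nat.exists_eq_succ_of_ne_zero hb.ne'
    refine J.mem_vanish_of (by rw [map_mul, hf.2.1, zero_mul]) fun i => ?_
    rw [Derivation.leibniz, smul_eq_mul, smul_eq_mul]
    refine add_mem (ih (a + 1) b (by omega) _ _ hf (hg.2.2 i)) ?_
    exact ih (b + 1) a (by omega) _ _ hg (hf.2.2 i)

theorem pow_mem_vanish {a : ℕ} {f : R} (hf : f ∈ J.vanish a) (n : ℕ) :
    f ^ n ∈ J.vanish (a * n) := by
  induction n with
  | zero => simpa using J.mem_vanish_zero 1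
  | succ n ih => rw [pow_succ, Nat.mul_succ]; exact J.mul_mem_vanish ih hf

theorem smul_mem_vanish {n : ℕ} {f : R} (c : A) (hf : f ∈ J.vanish n) : c • f ∈ J.vanish n := by
  rw [Algebra.smul_def]; exact Ideal.mul_mem_left _ _ hf

theorem T_mem_vanish (i : ι) : J.T i ∈ J.vanish 1 := J.mem_vanish_one.2 (J.evT i)

variable [Fintype ι]

/-- Euler's identity: the Euler field `∑ i, T i * d i` acts on elements of order `n` as
multiplication by `n`, up to elements of order `n + 1`. -/
theorem euler_mem_vanish {n : ℕ} {f : R} (hf : f ∈ J.vanish n) :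
    (n : R) * f - ∑ i, J.T i * J.d i f ∈ J.vanish (n + 1) := by
  induction n generalizing f with
  | zero =>
    rw [J.mem_vanish_one]
    simp [J.evT]
  | succ n ih =>
    refine J.mem_vanish_of ?_ fun j => ?_
    · simp [J.evT, hf.2.1]
    have h := ih (hf.2.2 j)
    have e : J.d j (((n + 1 : ℕ) : R) * f - ∑ i, J.T i * J.d i f) =
        (n : R) * J.d j f - ∑ i, J.T i * J.d i (J.d j f) := by
      simp only [map_sub, map_sum, Derivation.leibniz, smul_eq_mul, J.dT, Finset.sum_add_distrib,
        mul_ite, mul_one, mul_zero, Finset.sum_ite_eq, Finset.mem_univ, if_true]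
      rw [Derivation.map_natCast]
      simp only [J.comm j]
      push_cast
      ring
    rw [e]
    exact h

section Gauss

/-- The Laplacian `∑ i j, C i j * d i * d j`. -/
noncomputable def lap (C : ι → ι → A) : R →ₗ[A] R :=
  ∑ i, ∑ j, C i j • ((J.d i).toLinearMap ∘ₗ (J.d j).toLinearMap)

theorem lap_apply (C : ι → ι → A) (f : R) :
    J.lap C f = ∑ i, ∑ j, C i j • J.d i (J.d j f) := by
  simp [lap, LinearMap.sum_apply]

theorem d_lap (C : ι → ι → A) (l : ι) (f : R) : J.d l (J.lap C f) = J.lap C (J.d l f) := by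
  simp only [lap_apply, map_sum, Derivation.map_smul]
  refine Finset.sum_congr rfl fun i _ => Finset.sum_congr rfl fun j _ => ?_
  rw [J.comm l i, J.comm l j]

theorem lap_mem_vanish (C : ι → ι → A) {n : ℕ} {f : R} (hf : f ∈ J.vanish (n + 2)) :
    J.lap C f ∈ J.vanish n := by
  rw [lap_apply]
  exact sum_mem fun i _ => sum_mem fun j _ =>
    J.smul_mem_vanish _ (J.d_mem_vanish (J.d_mem_vanish hf j) i)

theorem lap_pow_mem_vanish (C : ι → ι → A) (k n : ℕ) {f : R} (hf : f ∈ J.vanish (n + 2 * k)) :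
    (J.lap C ^ k) f ∈ J.vanish n := by
  induction k generalizing f with
  | zero => exact hf
  | succ k ih =>
    rw [pow_succ, Module.End.mul_apply]
    exact ih (J.lap_mem_vanish C hf)

theorem lap_T_mul {C : ι → ι → A} (hC : ∀ i j, C i j = C j i) (l : ι) (f : R) :
    J.lap C (J.T l * f) = J.T l * J.lap C f + (2 : A) • ∑ j, C l j • J.d j f := by
  have h : ∀ i j, J.d i (J.d j (J.T l * f)) = J.T l * J.d i (J.d j f) +
      ((if j = l then J.d i f else 0) + if i = l then J.d j f else 0) := by
    intro i j
    rw [Derivation.leibniz, map_add, smul_eq_mul, smul_eq_mul, J.dT, Derivation.leibniz, J.dT]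
    split_ifs <;> simp
    ring
  simp only [lap_apply, h, smul_add, Finset.sum_add_distrib, Finset.mul_sum, mul_smul_comm]
  congr 1
  simp only [smul_ite, smul_zero, Finset.sum_ite_eq', Finset.mem_univ, if_true]
  rw [Finset.sum_comm]
  simp only [Finset.sum_ite_eq', Finset.mem_univ, if_true]
  rw [two_smul, Finset.sum_congr rfl fun i _ => by rw [hC i l]]

theorem lap_pow_T_mul {C : ι → ι → A} (hC : ∀ i j, C i j = C j i) (k : ℕ) (l : ι) (f : R) :
    (J.lap C ^ (k + 1)) (J.T l * f) = J.T l * (J.lap C ^ (k + 1)) f +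
      (2 * (k + 1) : A) • ∑ j, C l j • (J.lap C ^ k) (J.d j f) := by
  induction k generalizing f with
  | zero => simp [J.lap_T_mul hC]
  | succ k ih =>
    rw [pow_succ, Module.End.mul_apply, J.lap_T_mul hC, map_add, ih, map_smul, map_sum]
    simp only [map_smul]
    rw [← Module.End.mul_apply, ← pow_succ, add_assoc]
    congr 1
    have : ∀ j, (J.lap C ^ k) (J.d j (J.lap C f)) = (J.lap C ^ (k + 1)) (J.d j f) := by
      intro j; rw [J.d_lap, pow_succ, Module.End.mul_apply]
    simp only [this, ← add_smul]
    congr 1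
    push_cast
    ring

variable [Algebra ℚ A]

/-- The `k`-th coefficient `(½ ∑ i j, C i j * d i * d j) ^ k f / k!` at the origin of the
normalized Gaussian integral of `f` with covariance `C`. -/
noncomputable def gauss (C : ι → ι → A) (k : ℕ) : R →ₗ[A] A :=
  algebraMap ℚ A ((2 ^ k * k.factorial)⁻¹) • (J.ev.toLinearMap ∘ₗ (J.lap C ^ k))

theorem gauss_apply (C : ι → ι → A) (k : ℕ) (f : R) :
    J.gauss C k f = algebraMap ℚ A ((2 ^ k * k.factorial)⁻¹) * J.ev ((J.lap C ^ k) f) := rfl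

theorem gauss_zero (C : ι → ι → A) (f : R) : J.gauss C 0 f = J.ev f := by
  simp [gauss_apply]

theorem gauss_eq_zero (C : ι → ι → A) (k : ℕ) {f : R} (hf : f ∈ J.vanish (2 * k + 1)) :
    J.gauss C k f = 0 := by
  have := J.lap_pow_mem_vanish C k 1 (by rwa [add_comm 1])
  rw [gauss_apply, this.2.1, mul_zero]

theorem gauss_lap (C : ι → ι → A) (k : ℕ) (f : R) :
    J.gauss C k (J.lap C f) = algebraMap ℚ A (2 * (k + 1)) * J.gauss C (k + 1) f := by
  rw [gauss_apply, gauss_apply, ← mul_assoc, ← map_mul, pow_succ (J.lap C), Module.End.mul_apply]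
  congr 2
  rw [Nat.factorial_succ]
  have := Nat.factorial_ne_zero k
  push_cast
  field_simp
  ring

/-- Integration by parts for Gaussian integrals. -/
theorem gauss_T_mul {C : ι → ι → A} (hC : ∀ i j, C i j = C j i) (k : ℕ) (l : ι) (f : R) :
    J.gauss C (k + 1) (J.T l * f) = ∑ j, C l j * J.gauss C k (J.d j f) := by
  rw [gauss_apply, J.lap_pow_T_mul hC, map_add, map_mul, J.evT, zero_mul, zero_add, map_smul,
    smul_eq_mul, map_sum, ← mul_assoc]
  have : (2 * (k + 1) : A) = algebraMap ℚ A (2 * (k + 1)) := by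
    rw [map_mul, map_ofNat, map_add, map_natCast, map_one]
  rw [this, ← map_mul]
  have e : ((2 ^ (k + 1) * ((k + 1).factorial : ℚ)) : ℚ)⁻¹ * (2 * (k + 1)) =
      ((2 ^ k * (k.factorial : ℚ)) : ℚ)⁻¹ := by
    rw [Nat.factorial_succ]
    have := Nat.factorial_ne_zero k
    push_cast
    field_simp
    ring
  rw [e, Finset.mul_sum]
  refine Finset.sum_congr rfl fun j _ => ?_
  rw [map_smul, smul_eq_mul, gauss_apply]
  ring

theorem gauss_T_mul_T_mul {C : ι → ι → A} (hC : ∀ i j, C i j = C j i) (k : ℕ) (i j : ι) (f : R) :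
    J.gauss C (k + 1) (J.T i * (J.T j * f)) =
      C i j * J.gauss C k f + ∑ l, C i l * J.gauss C k (J.T j * J.d l f) := by
  rw [J.gauss_T_mul hC]
  have : ∀ l, J.d l (J.T j * f) = J.T j * J.d l f + if l = j then f else 0 := by
    intro l
    rw [Derivation.leibniz, J.dT]
    split_ifs <;> simp
  simp only [this, map_add, mul_add, Finset.sum_add_distrib]
  rw [add_comm]
  congr 1
  rw [Finset.sum_eq_single j] <;> simp +contextual

theorem sum_gauss_T_mul_d {C : ι → ι → A} (hC : ∀ i j, C i j = C j i) (k : ℕ) (f : R) :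
    ∑ j, J.gauss C k (J.T j * J.d j f) = (2 * k : A) * J.gauss C k f := by
  cases k with
  | zero => simp [gauss_zero, J.evT]
  | succ k =>
    simp only [J.gauss_T_mul hC]
    have := J.gauss_lap C k f
    rw [lap_apply] at this
    simp only [map_sum, map_smul, smul_eq_mul] at this
    rw [Finset.sum_comm] at this
    simp only [fun i j => hC i j, map_mul, map_add, map_one, map_ofNat, map_natCast] at this
    push_cast
    rw [← this]

/-- Homogeneity of Gaussian integrals: multiplication by the quadratic form with matrix `H = C⁻¹`
acts as a scalar. -/
theorem gauss_quadratic_mul {C H : ι → ι → A} (hC : ∀ i j, C i j = C j i)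
    (hCH : ∀ i j, ∑ l, H i l * C l j = if i = j then 1 else 0) (k : ℕ) (f : R) :
    J.gauss C (k + 1) ((∑ i, ∑ j, H i j • (J.T i * J.T j)) * f) =
      (2 * k + Fintype.card ι : A) * J.gauss C k f := by
  have h1 : ∀ i j l, H i j * (C i l * J.gauss C k (J.T j * J.d l f)) =
    (H i j * C i l) * J.gauss C k (J.T j * J.d l f) := fun _ _ _ => by ring
  have hHC : ∀ i j, ∑ l, C i l * H l j = if i = j then 1 else 0 := by
    have e : (Matrix.of H) * (Matrix.of C) = 1 := by
      ext i j; simp [Matrix.mul_apply, hCH, Matrix.one_apply]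
    have e2 := mul_eq_one_comm.1 e
    intro i j
    have := congrFun (congrFun e2 i) j
    simpa [Matrix.mul_apply, Matrix.one_apply] using this
  simp only [Finset.sum_mul, map_sum, smul_mul_assoc, map_smul, mul_assoc, smul_eq_mul,
    J.gauss_T_mul_T_mul hC, mul_add, Finset.sum_add_distrib]
  rw [add_comm, add_mul]
  congr 1
  · rw [← J.sum_gauss_T_mul_d hC, Finset.sum_comm]
    refine Finset.sum_congr rfl fun j _ => ?_
    simp only [Finset.mul_sum, h1]
    rw [Finset.sum_comm]
    simp only [← Finset.sum_mul]
    have h2 : ∀ l, ∑ i, H i j * C i l = if l = j then 1 else 0 := fun l => by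
      rw [← hHC l j]
      exact Finset.sum_congr rfl fun i _ => by rw [hC i l, mul_comm]
    simp [h2]
  · simp only [← mul_assoc, ← Finset.sum_mul]
    congr 1
    rw [Finset.sum_congr rfl fun i _ =>
      (Finset.sum_congr rfl fun j _ => by rw [hC i j]).trans ((hCH i i).trans (if_pos rfl))]
    simp

end Gauss
end JetAlgebra

namespace JetAlgebra

variable {ι A R : Type*} [DecidableEq ι] [Fintype ι] [CommRing A] [CommRing R] [Algebra A R]
  (J : JetAlgebra ι A R)

/-- `S` is, up to elements `V` of order three, the nondegenerate quadratic form `½ ∑ H i j T i T j`,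
with `C = H⁻¹`. -/
structure IsPotential (H C : ι → ι → A) (S V : R) : Prop where
  symm : ∀ i j, C i j = C j i
  inv : ∀ i j, ∑ l, H i l * C l j = if i = j then 1 else 0
  d_eq : ∀ i, J.d i S = ∑ j, H i j • J.T j + J.d i V
  two_mul_eq : 2 * S = (∑ i, ∑ j, H i j • (J.T i * J.T j)) + 2 * V
  mem : V ∈ J.vanish 3

/-- The functionals `F k` behave like the coefficients of `h ^ k` in the asymptotic expansion of the
normalized integrals `∫ e ^ (-S / h) f` as functions of `f`. -/
structure IsOscillatory (S : R) (F : ℕ → R →ₗ[A] A) : Prop where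
  ibp : ∀ k i f, F (k + 1) (J.d i S * f) = F k (J.d i f)
  euler : ∀ k, 2 * F (k + 1) S = (2 * k + Fintype.card ι : A) * F k 1
  vanish : ∀ k f, f ∈ J.vanish (2 * k + 1) → F k f = 0

variable {J} {H C : ι → ι → A} {S V : R}

theorem IsPotential.inv' (h : J.IsPotential H C S V) (i j : ι) :
    ∑ l, C i l * H l j = if i = j then 1 else 0 := by
  have e : (Matrix.of H) * (Matrix.of C) = 1 := by
    ext i j; simp [Matrix.mul_apply, h.inv, Matrix.one_apply]
  have e' : (Matrix.of C) * (Matrix.of H) = 1 := mul_eq_one_comm.1 e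
  have := congrFun (congrFun e' i) j
  simpa [Matrix.mul_apply, Matrix.one_apply] using this

theorem IsPotential.T_eq (h : J.IsPotential H C S V) (j : ι) :
    J.T j = ∑ i, C j i • (J.d i S - J.d i V) := by
  simp only [h.d_eq, add_sub_cancel_right, Finset.smul_sum, smul_smul]
  rw [Finset.sum_comm]
  simp only [← Finset.sum_smul, h.inv']
  simp

theorem IsPotential.sub_euler_mem (h : J.IsPotential H C S V) :
    2 * S - ∑ i, J.T i * J.d i S ∈ J.vanish 3 := by
  have : 2 * S - ∑ i, J.T i * J.d i S = 2 * V - ∑ i, J.T i * J.d i V := by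
    rw [h.two_mul_eq]
    simp only [h.d_eq, mul_add, Finset.sum_add_distrib, Finset.mul_sum, mul_smul_comm]
    ring
  rw [this]
  refine sub_mem (Ideal.mul_mem_left _ _ h.mem) (sum_mem fun i _ => ?_)
  exact J.mul_mem_vanish (J.T_mem_vanish i) (J.d_mem_vanish h.mem i)

theorem IsOscillatory.smul {F : ℕ → R →ₗ[A] A} (h : J.IsOscillatory S F) (c : A) :
    J.IsOscillatory S fun k => c • F k where
  ibp k i f := by simp [h.ibp]
  euler k := by
    have := h.euler k
    simp only [LinearMap.smul_apply, smul_eq_mul]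
    linear_combination c * this
  vanish k f hf := by simp [h.vanish k f hf]

theorem IsOscillatory.sub {F G : ℕ → R →ₗ[A] A} (h : J.IsOscillatory S F)
    (h' : J.IsOscillatory S G) : J.IsOscillatory S fun k => F k - G k where
  ibp k i f := by simp [h.ibp, h'.ibp]
  euler k := by
    simp only [LinearMap.sub_apply]
    linear_combination h.euler k - h'.euler k
  vanish k f hf := by simp [h.vanish k f hf, h'.vanish k f hf]

variable [Algebra ℚ A]

theorem eq_zero_of_natCast_mul {n : ℕ} (hn : n ≠ 0) {a : A} (h : (n : A) * a = 0) : a = 0 := by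
  have : algebraMap ℚ A ((n : ℚ)⁻¹) * ((n : A) * a) = a := by
    rw [← mul_assoc, ← map_natCast (algebraMap ℚ A), ← map_mul,
      inv_mul_cancel₀ (by exact_mod_cast hn), map_one, one_mul]
  rw [← this, h, mul_zero]

/-- An oscillatory functional whose leading coefficient vanishes is zero: integration by parts
lowers the index `k` or raises the order of vanishing of the argument, until only `F k 1` is left,
which is determined by Euler's relation. -/
theorem IsOscillatory.eq_zero (h : J.IsPotential H C S V) {F : ℕ → R →ₗ[A] A}
    (hF : J.IsOscillatory S F) (h0 : F 0 1 = 0) (k : ℕ) : F k = 0 := by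
  have const : ∀ k, F k 1 = 0 → (∀ f ∈ J.vanish 1, F k f = 0) → F k = 0 := by
    intro k h1 h2
    ext f
    have e : f = J.ev f • (1 : R) + (f - J.ev f • (1 : R)) := by ring
    rw [e, map_add, map_smul, h1, h2 _ (J.mem_vanish_one.2 (by simp)), smul_zero, add_zero]
    rfl
  -- descending induction on the order of vanishing
  have desc : ∀ (k a : ℕ), (∀ i j f n, a ≤ n → f ∈ J.vanish n → F k (J.d i (J.d j f)) = 0) → 1 ≤ a →
      ∀ f ∈ J.vanish a, F (k + 1) f = 0 := by
    intro k a hk ha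
    suffices ∀ N n, a ≤ n → 2 * k + 3 ≤ n + N → ∀ f ∈ J.vanish n, F (k + 1) f = 0 from
      this (2 * k + 3) a le_rfl (by omega)
    intro N
    induction N with
    | zero => exact fun n _ hn f hf => hF.vanish _ _ (J.vanish_anti (by omega) hf)
    | succ N ih =>
      intro n han hn f hf
      have h1 := ih (n + 1) (by omega) (by omega) _ (J.euler_mem_vanish hf)
      have h2 : ∀ j, F (k + 1) (J.T j * J.d j f) = 0 := by
        intro j
        rw [h.T_eq, Finset.sum_mul, map_sum]
        refine Finset.sum_eq_zero fun i _ => ?_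
        rw [smul_mul_assoc, map_smul, sub_mul, map_sub, hF.ibp]
        have h3 : F (k + 1) (J.d i V * J.d j f) = 0 := by
          refine ih (n + 1) (by omega) (by omega) _ ?_
          have := J.mul_mem_vanish (J.d_mem_vanish h.mem i) (J.d_mem_vanish' hf j)
          exact J.vanish_anti (by omega) this
        rw [h3, sub_zero, hk i j f n han hf, smul_zero]
      rw [map_sub, map_sum, Finset.sum_eq_zero fun j _ => h2 j, sub_zero, ← nsmul_eq_mul, map_nsmul,
        nsmul_eq_mul] at h1
      exact eq_zero_of_natCast_mul (by omega) h1
  induction k with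
  | zero =>
    exact const 0 h0 fun f hf => hF.vanish 0 f hf
  | succ k ih =>
    have h1 : ∀ f ∈ J.vanish 1, F (k + 1) f = 0 := desc k 1 (by simp [ih]) le_rfl
    refine const _ ?_ h1
    have h3 := desc (k + 1) 3 (fun i j f n hn hf => h1 _
      (J.vanish_anti (by omega) (J.d_mem_vanish' (J.d_mem_vanish' hf j) i))) (by norm_num) _
      h.sub_euler_mem
    have h4 : ∀ i, F (k + 1 + 1) (J.T i * J.d i S) = F (k + 1) 1 := by
      intro i
      rw [mul_comm, hF.ibp, J.dT, if_pos rfl]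
    have h5 := hF.euler (k + 1)
    have h6 : F (k + 1 + 1) (2 * S) = 2 * F (k + 1 + 1) S := by
      rw [two_mul, map_add, two_mul]
    rw [map_sub, map_sum, Finset.sum_congr rfl fun i _ => h4 i, h6, h5] at h3
    refine eq_zero_of_natCast_mul (n := 2 * (k + 1)) (by omega) ?_
    rw [← h3]
    push_cast
    simp
    ring

section Feynman

variable (J C V)

/-- The sum over Feynman diagrams: the coefficient of `h ^ k` in the asymptotic expansion of
`∫ e ^ (-(Q + V) / h) f`, where `Q` is the quadratic form inverse to `C`. -/
noncomputable def feynman (k : ℕ) : R →ₗ[A] A :=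
  ∑ n ∈ Finset.range (2 * k + 1), algebraMap ℚ A ((n.factorial : ℚ)⁻¹) •
    (J.gauss C (k + n) ∘ₗ LinearMap.mulLeft A ((-V) ^ n))

theorem feynman_apply (k : ℕ) (f : R) :
    J.feynman C V k f = ∑ n ∈ Finset.range (2 * k + 1), algebraMap ℚ A ((n.factorial : ℚ)⁻¹) *
      J.gauss C (k + n) ((-V) ^ n * f) := by
  rw [feynman, LinearMap.sum_apply]
  rfl

variable {J V}

theorem gauss_pow_mul_eq_zero (hV : V ∈ J.vanish 3) {a n l : ℕ} {f : R} (hf : f ∈ J.vanish a)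
    (h : 2 * l + 1 ≤ 3 * n + a) : J.gauss C l ((-V) ^ n * f) = 0 :=
  J.gauss_eq_zero C l (J.vanish_anti h (J.mul_mem_vanish (J.pow_mem_vanish (neg_mem hV) n) hf))

theorem feynman_apply_of_le (hV : V ∈ J.vanish 3) {k N : ℕ} (hN : 2 * k + 1 ≤ N) (f : R) :
    J.feynman C V k f = ∑ n ∈ Finset.range N, algebraMap ℚ A ((n.factorial : ℚ)⁻¹) *
      J.gauss C (k + n) ((-V) ^ n * f) := by
  rw [feynman_apply]
  refine Finset.sum_subset (Finset.range_mono hN) fun n _ hn => ?_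
  rw [gauss_pow_mul_eq_zero C hV (J.mem_vanish_zero f), mul_zero]
  simp only [Finset.mem_range, not_lt] at hn
  omega

variable {C}

theorem IsPotential.gauss_linear_mul (h : J.IsPotential H C S V) (k : ℕ) (i : ι) (f : R) :
    J.gauss C (k + 1) ((∑ j, H i j • J.T j) * f) = J.gauss C k (J.d i f) := by
  simp only [Finset.sum_mul, map_sum, smul_mul_assoc, map_smul, J.gauss_T_mul h.symm, smul_eq_mul,
    Finset.mul_sum]
  rw [Finset.sum_comm]
  simp only [← mul_assoc, ← Finset.sum_mul, h.inv]
  simp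

theorem inv_factorial_succ (n : ℕ) :
    algebraMap ℚ A (((n + 1).factorial : ℚ)⁻¹) * ((n + 1 : ℕ) : A) =
      algebraMap ℚ A ((n.factorial : ℚ)⁻¹) := by
  rw [← map_natCast (algebraMap ℚ A), ← map_mul, Nat.factorial_succ]
  congr 1
  have := Nat.factorial_ne_zero n
  push_cast
  field_simp

/-- Homogeneity: multiplication by the potential acts as a scalar. -/
theorem IsPotential.feynman_mul (h : J.IsPotential H C S V) (k : ℕ) (f : R) :
    2 * J.feynman C V (k + 1) (S * f) =
      (2 * k + Fintype.card ι : A) * J.feynman C V k f := by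
  set N := 2 * k + 3 with hN
  rw [feynman_apply_of_le C h.mem (N := N) (by omega),
    feynman_apply_of_le C h.mem (N := N + 1) (by omega)]
  have e1 : ∀ n, 2 * J.gauss C (k + 1 + n) ((-V) ^ n * (S * f)) =
      (2 * (k + n) + Fintype.card ι : A) * J.gauss C (k + n) ((-V) ^ n * f) -
        2 * J.gauss C (k + 1 + n) ((-V) ^ (n + 1) * f) := by
    intro n
    have e2 : 2 * J.gauss C (k + 1 + n) ((-V) ^ n * (S * f)) =
        J.gauss C (k + 1 + n) ((-V) ^ n * (2 * (S * f))) := by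
      rw [two_mul, two_mul, mul_add, map_add]
    have e3 : (-V) ^ n * (2 * (S * f)) =
        (∑ i, ∑ j, H i j • (J.T i * J.T j)) * ((-V) ^ n * f) -
        ((-V) ^ (n + 1) * f + (-V) ^ (n + 1) * f) := by
      linear_combination (-V) ^ n * f * h.two_mul_eq
    rw [e2, e3, map_sub, map_add, show k + 1 + n = k + n + 1 by ring,
      J.gauss_quadratic_mul h.symm h.inv]
    push_cast
    ring
  rw [Finset.mul_sum]
  have e5 : ∀ n, 2 * (algebraMap ℚ A ((n.factorial : ℚ)⁻¹) *
      J.gauss C (k + 1 + n) ((-V) ^ n * (S * f))) = algebraMap ℚ A ((n.factorial : ℚ)⁻¹) *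
      ((2 * (k + n) + Fintype.card ι : A) * J.gauss C (k + n) ((-V) ^ n * f)) -
      algebraMap ℚ A (((n + 1).factorial : ℚ)⁻¹) * (((n + 1 : ℕ) : A) *
        (2 * J.gauss C (k + (n + 1)) ((-V) ^ (n + 1) * f))) := by
    intro n
    rw [← mul_assoc (algebraMap ℚ A (((n + 1).factorial : ℚ)⁻¹)), inv_factorial_succ,
      mul_left_comm, e1, show k + (n + 1) = k + 1 + n by ring]
    ring
  have e6 : J.gauss C (k + N) ((-V) ^ N * f) = 0 :=
    gauss_pow_mul_eq_zero C h.mem (J.mem_vanish_zero f) (by omega)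
  simp only [e5, Finset.sum_sub_distrib]
  have e7 := Finset.sum_range_succ' (fun n => algebraMap ℚ A ((n.factorial : ℚ)⁻¹) *
    ((n : A) * (2 * J.gauss C (k + n) ((-V) ^ n * f)))) N
  rw [Finset.sum_range_succ] at e7
  simp only [e6, Nat.cast_zero, mul_zero, zero_mul, add_zero] at e7
  rw [← e7, Finset.sum_range_succ _ N, e6, mul_zero, add_zero, Finset.mul_sum,
    ← Finset.sum_sub_distrib]
  refine Finset.sum_congr rfl fun n _ => ?_
  ring

theorem IsPotential.isOscillatory_feynman (h : J.IsPotential H C S V) :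
    J.IsOscillatory S (J.feynman C V) where
  ibp k i f := by
    set N := 2 * k + 3 with hN
    rw [feynman_apply_of_le C h.mem (N := N + 1) (by omega),
      feynman_apply_of_le C h.mem (N := N + 1) (by omega)]
    have e1 : ∀ n, J.gauss C (k + 1 + n) ((-V) ^ n * (J.d i S * f)) =
        J.gauss C (k + n) ((-V) ^ n * J.d i f) -
          n * J.gauss C (k + n) ((-V) ^ (n - 1) * (J.d i V * f)) +
          J.gauss C (k + 1 + n) ((-V) ^ n * (J.d i V * f)) := by
      intro n
      have e2 : (-V) ^ n * (J.d i S * f) =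
          (∑ j, H i j • J.T j) * ((-V) ^ n * f) + (-V) ^ n * (J.d i V * f) := by
        rw [h.d_eq]; ring
      have e3 : J.d i ((-V) ^ n * f) =
          (-V) ^ n * J.d i f - n • ((-V) ^ (n - 1) * (J.d i V * f)) := by
        rw [Derivation.leibniz, Derivation.leibniz_pow]
        simp only [smul_eq_mul, map_neg, nsmul_eq_mul]
        ring
      rw [e2, map_add, show k + 1 + n = k + n + 1 by ring, h.gauss_linear_mul, e3, map_sub, map_nsmul,
        nsmul_eq_mul]
    simp only [e1, mul_add, mul_sub, Finset.sum_add_distrib, Finset.sum_sub_distrib]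
    have e4 : ∑ n ∈ Finset.range (N + 1), algebraMap ℚ A ((n.factorial : ℚ)⁻¹) *
          (n * J.gauss C (k + n) ((-V) ^ (n - 1) * (J.d i V * f))) =
        ∑ n ∈ Finset.range (N + 1), algebraMap ℚ A ((n.factorial : ℚ)⁻¹) *
          J.gauss C (k + 1 + n) ((-V) ^ n * (J.d i V * f)) := by
      rw [Finset.sum_range_succ', Finset.sum_range_succ _ N]
      rw [gauss_pow_mul_eq_zero (n := N) C h.mem
        (Ideal.mul_mem_right f _ (J.d_mem_vanish h.mem i)) (by omega)]
      simp only [Nat.cast_zero, zero_mul, mul_zero, add_zero]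
      refine Finset.sum_congr rfl fun n _ => ?_
      rw [← inv_factorial_succ n, show k + (n + 1) = k + 1 + n by ring, Nat.add_sub_cancel,
        mul_assoc]
    rw [e4]
    ring
  euler k := by simpa using h.feynman_mul k 1
  vanish k f hf := by
    rw [feynman_apply]
    refine Finset.sum_eq_zero fun n _ => ?_
    rw [gauss_pow_mul_eq_zero C h.mem hf (by omega), mul_zero]

theorem feynman_zero_apply (f : R) : J.feynman C V 0 f = J.ev f := by
  simp [feynman_apply, gauss_zero]

/-- An oscillatory functional is determined by its leading coefficient. -/
theorem IsOscillatory.eq_feynman (h : J.IsPotential H C S V) {F : ℕ → R →ₗ[A] A}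
    (hF : J.IsOscillatory S F) (k : ℕ) (f : R) : F k f = F 0 1 * J.feynman C V k f := by
  have := ((hF.sub (h.isOscillatory_feynman.smul (F 0 1))).eq_zero h
    (by simp [feynman_zero_apply]) k)
  have := LinearMap.congr_fun this f
  simpa [sub_eq_zero] using this

end Feynman

end JetAlgebra

section Piola

variable {A R : Type*} [CommRing A] [CommRing R] [Algebra A R]

theorem Derivation.map_prod {ι : Type*} [DecidableEq ι] (D : Derivation A R R) (s : Finset ι)
    (f : ι → R) : D (∏ i ∈ s, f i) = ∑ l ∈ s, ∏ i ∈ s, if i = l then D (f i) else f i := by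
  induction s using Finset.induction_on with
  | empty => simp
  | insert a s ha ih =>
    rw [Finset.prod_insert ha, Derivation.leibniz, ih, Finset.sum_insert ha, Finset.prod_insert ha,
      if_pos rfl, add_comm, smul_eq_mul, smul_eq_mul, Finset.mul_sum, mul_comm]
    congr 1
    · congr 1
      refine Finset.prod_congr rfl fun i hi => (if_neg ?_).symm
      rintro rfl; exact ha hi
    · refine Finset.sum_congr rfl fun l hl => ?_
      rw [Finset.prod_insert ha, if_neg]
      rintro rfl; exact ha hl

theorem Derivation.map_det {n : Type*} [DecidableEq n] [Fintype n] (D : Derivation A R R)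
    (M : Matrix n n R) : D M.det = ∑ l, (M.updateCol l fun i => D (M i l)).det := by
  simp only [Matrix.det_apply', map_sum, Derivation.leibniz, Derivation.map_prod, smul_eq_mul,
    Derivation.map_intCast, mul_zero, add_zero, Finset.mul_sum]
  rw [Finset.sum_comm]
  refine Finset.sum_congr rfl fun l _ => Finset.sum_congr rfl fun σ _ => ?_
  congr 1
  refine Finset.prod_congr rfl fun i _ => ?_
  by_cases h : i = l
  · subst h; simp
  · simp [h]

theorem Matrix.det_updateCol_sum_smul {n κ : Type*} [DecidableEq n] [Fintype n]
    (M : Matrix n n R) (p : n) (s : Finset κ) (c : κ → R) (v : κ → n → R) :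
    (M.updateCol p (∑ q ∈ s, c q • v q)).det = ∑ q ∈ s, c q * (M.updateCol p (v q)).det := by
  classical
  induction s using Finset.induction_on with
  | empty => exact Matrix.det_eq_zero_of_column_eq_zero p fun i => by simp
  | insert a s ha ih =>
    rw [Finset.sum_insert ha, Finset.sum_insert ha, Matrix.det_updateCol_add,
      Matrix.det_updateCol_smul, ih]

/-- The Piola identity: the rows of the adjugate of a Jacobian matrix are divergence-free. -/
theorem sum_derivation_adjugate [Algebra ℚ A] {n : Type*} [DecidableEq n] [Fintype n] (d : n → Derivation A R R)
    (M : Matrix n n R) (hM : ∀ i j l, d j (M l i) = d i (M l j)) (l : n) :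
    ∑ j, d j (M.adjugate j l) = 0 := by
  classical
  have h1 : ∀ j, M.adjugate j l = (M.transpose.updateCol l (Pi.single j 1)).det := fun j => by
    rw [Matrix.adjugate_apply, ← Matrix.det_transpose, ← Matrix.updateCol_transpose]
  simp only [h1, Derivation.map_det]
  rw [Finset.sum_comm]
  refine Finset.sum_eq_zero fun p _ => ?_
  by_cases hp : p = l
  · subst hp
    refine Finset.sum_eq_zero fun j _ => Matrix.det_eq_zero_of_column_eq_zero p fun i => ?_
    rw [Matrix.updateCol_self, Matrix.updateCol_self, Pi.single_apply]
    split_ifs <;> simp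
  -- antisymmetry of the determinant against symmetry of second derivatives
  set B : n → n → R := fun j q =>
    ((M.transpose.updateCol l (Pi.single j 1)).updateCol p (Pi.single q 1)).det with hB
  have h2 : ∀ j, ((M.transpose.updateCol l (Pi.single j 1)).updateCol p fun i =>
      d j ((M.transpose.updateCol l (Pi.single j 1)) i p)).det = ∑ q, d j (M p q) * B j q := by
    intro j
    have e : (fun i => d j ((M.transpose.updateCol l (Pi.single j 1)) i p)) =
        ∑ q, d j (M p q) • (Pi.single q 1 : n → R) := by
      ext i
      rw [Matrix.updateCol_ne hp]
      simp [Finset.sum_apply, Pi.single_apply]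
    rw [e, Matrix.det_updateCol_sum_smul]
  have h3 : ∀ j q, B j q = - B q j := by
    intro j q
    have e : (M.transpose.updateCol l (Pi.single q 1)).updateCol p (Pi.single j 1) =
        ((M.transpose.updateCol l (Pi.single j 1)).updateCol p (Pi.single q 1)).submatrix id
          (Equiv.swap l p) := by
      ext i c
      rw [Matrix.submatrix_apply]
      rcases eq_or_ne c l with rfl | hc
      · rw [Equiv.swap_apply_left, Matrix.updateCol_ne (Ne.symm hp)]; simp
      rcases eq_or_ne c p with rfl | hc'
      · rw [Equiv.swap_apply_right, Matrix.updateCol_ne (Ne.symm hp)]; simp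
      rw [Equiv.swap_apply_of_ne_of_ne hc hc']
      simp [hc, hc']
    rw [hB]
    simp only []
    rw [e, Matrix.det_permute', Equiv.Perm.sign_swap (Ne.symm hp)]
    simp
  simp only [h2]
  have h4 : ∑ j, ∑ q, d j (M p q) * B j q = - ∑ j, ∑ q, d j (M p q) * B j q := by
    conv_lhs => rw [Finset.sum_comm]
    rw [← Finset.sum_neg_distrib]
    refine Finset.sum_congr rfl fun q _ => ?_
    rw [← Finset.sum_neg_distrib]
    refine Finset.sum_congr rfl fun j _ => ?_
    rw [hM, h3]; ring
  have h5 := eq_neg_iff_add_eq_zero.1 h4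
  rw [← two_smul A] at h5
  have h6 : algebraMap ℚ A 2⁻¹ * 2 = 1 := by
    rw [← map_ofNat (algebraMap ℚ A) 2, ← map_mul]; norm_num
  rw [← one_smul A (∑ j, _), ← h6, mul_smul, h5, smul_zero]

end Piola

namespace JetAlgebra

variable {ι A R R' : Type*} [DecidableEq ι] [CommRing A] [CommRing R] [Algebra A R]
  [CommRing R'] [Algebra A R']

/-- A substitution `Φ` between jet algebras which respects the origins, with Jacobian matrix `M`. -/
structure IsSubst (J : JetAlgebra ι A R) (J' : JetAlgebra ι A R') [Fintype ι] (Φ : R →ₐ[A] R')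
    (M : Matrix ι ι R') : Prop where
  ev_map : ∀ f, J'.ev (Φ f) = J.ev f
  chain : ∀ j f, J'.d j (Φ f) = ∑ i, M i j * Φ (J.d i f)
  symm : ∀ i j l, J'.d j (M l i) = J'.d i (M l j)

variable [Fintype ι] {J : JetAlgebra ι A R} {J' : JetAlgebra ι A R'} {Φ : R →ₐ[A] R'}
  {M : Matrix ι ι R'}

theorem IsSubst.map_mem_vanish (h : IsSubst J J' Φ M) {n : ℕ} {f : R} (hf : f ∈ J.vanish n) :
    Φ f ∈ J'.vanish n := by
  induction n generalizing f with
  | zero => exact J'.mem_vanish_zero _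
  | succ n ih =>
    refine J'.mem_vanish_of (by rw [h.ev_map, hf.2.1]) fun j => ?_
    rw [h.chain]
    exact sum_mem fun i _ => Ideal.mul_mem_left _ _ (ih (hf.2.2 i))

/-- If the substitution `Φ` brings the potential `S` to the Morse normal form `∑ i, T i ^ 2`, then
Gaussian integration of `Φ f` against the Jacobian determinant is oscillatory for `S`. The
integration by parts formula is a consequence of the Piola identity. -/
theorem IsSubst.isOscillatory [Algebra ℚ A] (h : IsSubst J J' Φ M) {S : R}
    (hS : Φ S = ∑ i, J'.T i * J'.T i) :
    J.IsOscillatory S fun k => (J'.gauss (fun i j => if i = j then algebraMap ℚ A 2⁻¹ else 0) k) ∘ₗ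
      (LinearMap.mulRight A M.det) ∘ₗ Φ.toLinearMap := by
  set C : ι → ι → A := fun i j => if i = j then algebraMap ℚ A 2⁻¹ else 0 with hCdef
  have hC : ∀ i j, C i j = C j i := fun i j => by simp only [hCdef, eq_comm]
  have half : algebraMap ℚ A 2⁻¹ * 2 = 1 := by
    rw [← map_ofNat (algebraMap ℚ A) 2, ← map_mul]; norm_num
  have hT : ∀ k j f, J'.gauss C (k + 1) ((2 * J'.T j) * f) = J'.gauss C k (J'.d j f) := by
    intro k j f
    rw [two_mul, add_mul, map_add, J'.gauss_T_mul hC]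
    simp only [hCdef, ite_mul, zero_mul, Finset.sum_ite_eq, Finset.mem_univ, if_true]
    linear_combination (J'.gauss C k (J'.d j f)) * half
  have hdS : ∀ j, ∑ i, M i j * Φ (J.d i S) = 2 * J'.T j := by
    intro j
    rw [← h.chain, hS, map_sum]
    simp only [Derivation.leibniz, J'.dT, smul_eq_mul, mul_ite, mul_one, mul_zero,
      Finset.sum_add_distrib, Finset.sum_ite_eq, Finset.mem_univ, if_true]
    ring
  have hadj : ∀ i, Φ (J.d i S) * M.det = ∑ j, 2 * J'.T j * M.adjugate j i := by
    intro i
    have e1 : ∀ l, ∑ j, M l j * M.adjugate j i = if l = i then M.det else 0 := by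
      intro l
      have := congrFun (congrFun (Matrix.mul_adjugate M) l) i
      rw [Matrix.mul_apply] at this
      rw [this]
      simp [Matrix.one_apply]
    simp only [← hdS, Finset.sum_mul]
    rw [Finset.sum_comm]
    have e2 : ∀ l, ∑ j, M l j * Φ (J.d l S) * M.adjugate j i =
        Φ (J.d l S) * if l = i then M.det else 0 := by
      intro l
      rw [← e1, Finset.mul_sum]
      exact Finset.sum_congr rfl fun j _ => by ring
    simp [e2]
  refine ⟨fun k i f => ?_, fun k => ?_, fun k f hf => ?_⟩
  · simp only [LinearMap.comp_apply, LinearMap.mulRight_apply, AlgHom.toLinearMap_apply, map_mul]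
    have e1 : Φ (J.d i S) * Φ f * M.det = ∑ j, 2 * J'.T j * (M.adjugate j i * Φ f) := by
      rw [mul_right_comm, hadj, Finset.sum_mul]
      exact Finset.sum_congr rfl fun j _ => by ring
    rw [e1, map_sum]
    simp only [hT]
    rw [← map_sum]
    congr 1
    have e2 : ∀ l, ∑ j, M.adjugate j i * M l j = if l = i then M.det else 0 := by
      intro l
      have := congrFun (congrFun (Matrix.mul_adjugate M) l) i
      rw [Matrix.mul_apply] at this
      rw [← Finset.sum_congr rfl fun j _ => mul_comm (M l j) _, this]
      simp [Matrix.one_apply]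
    simp only [Derivation.leibniz, Finset.sum_add_distrib, smul_eq_mul, ← Finset.mul_sum,
      sum_derivation_adjugate J'.d M h.symm, h.chain, mul_zero, add_zero]
    simp only [Finset.mul_sum]
    rw [Finset.sum_comm]
    simp only [← mul_assoc, ← Finset.sum_mul, e2]
    simp [mul_comm]
  · simp only [LinearMap.comp_apply, LinearMap.mulRight_apply, AlgHom.toLinearMap_apply, map_one,
      one_mul, hS]
    have := J'.gauss_quadratic_mul (C := C) (H := fun i j => if i = j then 2 else 0) hC
      (fun i j => by simp only [hCdef]; simp; rw [mul_comm, half]) k M.det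
    rw [← this, two_mul, ← map_add]
    congr 1
    simp only [ite_smul, zero_smul, Finset.sum_ite_eq, Finset.mem_univ, if_true, two_smul,
      Finset.sum_add_distrib]
    ring
  · exact J'.gauss_eq_zero C k (Ideal.mul_mem_right _ _ (h.map_mem_vanish hf))

end JetAlgebra

/-- The variables of the ring in which the Landau--Ginzburg potential lives: `t i` is the `i`th
logarithmic coordinate, `e i` its exponential, `y` the exponential of the mean of the `t i`. -/
inductive LGVar (m : ℕ) : Type
  | t (i : Fin m) : LGVar m
  | e (i : Fin m) : LGVar m
  | y : LGVar m

namespace LGVar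

variable {m : ℕ} {A : Type*} [CommRing A]

/-- The values of the `i`th partial derivative on the variables. -/
noncomputable def deriv [Algebra ℚ A] (i : Fin m) : LGVar m → MvPolynomial (LGVar m) A
  | t j => if i = j then 1 else 0
  | e j => if i = j then MvPolynomial.X (e j) else 0
  | y => algebraMap ℚ A (m : ℚ)⁻¹ • MvPolynomial.X y

/-- The values of the variables at the origin. -/
def value (m : ℕ) (A : Type*) [CommRing A] : LGVar m → A
  | t _ => 0
  | e _ => 1
  | y => 1

end LGVar

section lgJet

open MvPolynomial

variable (m : ℕ) (A : Type*) [CommRing A] [Algebra ℚ A]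

/-- The jet algebra of polynomials in the logarithmic coordinates, their exponentials, and the
exponential of their mean. -/
noncomputable def lgJet : JetAlgebra (Fin m) A (MvPolynomial (LGVar m) A) where
  d i := mkDerivation A (LGVar.deriv i)
  comm i j f := by
    have : ⁅mkDerivation A (LGVar.deriv (A := A) i), mkDerivation A (LGVar.deriv (A := A) j)⁆ =
        (0 : Derivation A (MvPolynomial (LGVar m) A) _) := by
      refine derivation_ext fun v => ?_
      rw [Derivation.commutator_apply]
      cases v with
      | t k => simp only [mkDerivation_X, LGVar.deriv]; split_ifs <;> simp
      | e k =>
        simp only [mkDerivation_X, LGVar.deriv]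
        split_ifs with h1 h2 h2 <;> simp [LGVar.deriv, *]
      | y =>
        simp only [mkDerivation_X, LGVar.deriv, Derivation.map_smul]
        simp
    have h := Derivation.congr_fun this f
    rw [Derivation.commutator_apply] at h
    exact sub_eq_zero.1 h
  ev := aeval (LGVar.value m A)
  T i := X (LGVar.t i)
  dT i j := by rw [mkDerivation_X]; rfl
  evT i := by simp [LGVar.value]

variable {m A}

theorem lgJet_d_t (i j : Fin m) :
    (lgJet m A).d i (X (LGVar.t j)) = if i = j then 1 else 0 := mkDerivation_X ..

theorem lgJet_d_e (i j : Fin m) :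
    (lgJet m A).d i (X (LGVar.e j)) = if i = j then X (LGVar.e j) else 0 := mkDerivation_X ..

theorem lgJet_d_y (i : Fin m) :
    (lgJet m A).d i (X LGVar.y) = algebraMap ℚ A (m : ℚ)⁻¹ • X LGVar.y := mkDerivation_X ..

theorem lgJet_ev_t (i : Fin m) : (lgJet m A).ev (X (LGVar.t i)) = 0 := by
  simp [lgJet, LGVar.value]

theorem lgJet_ev_e (i : Fin m) : (lgJet m A).ev (X (LGVar.e i)) = 1 := by
  simp [lgJet, LGVar.value]

theorem lgJet_ev_y : (lgJet m A).ev (X LGVar.y) = 1 := by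
  simp [lgJet, LGVar.value]

/-- The Landau--Ginzburg potential near a critical point: in terms of the values `x i` of the
coordinates there and `ℓ` of the root divided by `m`, it is
`∑ x i * (exp (t i) - 1 - t i) - ℓ * (m * (exp (mean t) - 1) - ∑ t i)` up to a constant. -/
noncomputable def lgS (x : Fin m → A) (ℓ : A) : MvPolynomial (LGVar m) A :=
  ∑ i, x i • (X (LGVar.e i) - 1 - X (LGVar.t i)) -
    ℓ • ((m : MvPolynomial (LGVar m) A) * (X LGVar.y - 1) - ∑ i, X (LGVar.t i))

/-- The Hessian of `lgS x ℓ` at the origin. -/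
noncomputable def lgH (x : Fin m → A) (ℓ : A) (i j : Fin m) : A :=
  (if i = j then x i else 0) - algebraMap ℚ A (m : ℚ)⁻¹ * ℓ

/-- The inverse of a diagonal matrix with a rank one perturbation; `y` is the inverse of the
diagonal. -/
def lgC (y : Fin m → A) (c : A) (i j : Fin m) : A :=
  (if i = j then y i else 0) - c * (y i * y j)

/-- The part of `lgS x ℓ` of order at least three. -/
noncomputable def lgV (x : Fin m → A) (ℓ : A) : MvPolynomial (LGVar m) A :=
  lgS x ℓ - algebraMap ℚ A 2⁻¹ • ∑ i, ∑ j, lgH x ℓ i j • (X (LGVar.t i) * X (LGVar.t j))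

theorem algebraMap_inv_natCast_mul (i : Fin m) :
    algebraMap ℚ A (m : ℚ)⁻¹ * (m : A) = 1 := by
  have : (m : ℚ) ≠ 0 := by exact_mod_cast (Fin.pos i).ne'
  rw [← map_natCast (algebraMap ℚ A), ← map_mul, inv_mul_cancel₀ this, map_one]

theorem lgJet_d_lgS (x : Fin m → A) (ℓ : A) (i : Fin m) :
    (lgJet m A).d i (lgS x ℓ) = x i • (X (LGVar.e i) - 1) - ℓ • (X LGVar.y - 1) := by
  have h : (m : MvPolynomial (LGVar m) A) * (algebraMap ℚ A (m : ℚ)⁻¹ • X LGVar.y) =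
      X LGVar.y := by
    rw [mul_smul_comm, ← nsmul_eq_mul, ← Nat.cast_smul_eq_nsmul A, smul_smul,
      algebraMap_inv_natCast_mul i, one_smul]
  simp only [lgS, map_sub, map_sum, Derivation.map_smul, lgJet_d_t, lgJet_d_e, lgJet_d_y,
    Derivation.leibniz, Derivation.map_natCast, smul_zero, smul_eq_mul, h, mul_zero, add_zero,
    Derivation.map_one_eq_zero, sub_zero, smul_sub, smul_ite, Finset.sum_sub_distrib,
    Finset.sum_ite_eq, Finset.mem_univ, if_true, Finset.sum_const_zero]

theorem lgJet_d_lgV (x : Fin m → A) (ℓ : A) (i : Fin m) :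
    (lgJet m A).d i (lgS x ℓ) = ∑ j, lgH x ℓ i j • X (LGVar.t j) + (lgJet m A).d i (lgV x ℓ) := by
  have hs : ∀ j, lgH x ℓ i j = lgH x ℓ j i := fun j => by
    rcases eq_or_ne i j with rfl | h
    · rfl
    · simp [lgH, h, h.symm]
  have h2 : algebraMap ℚ A 2⁻¹ * 2 = 1 := by
    rw [← map_ofNat (algebraMap ℚ A) 2, ← map_mul]; norm_num
  rw [lgV, map_sub, add_sub, eq_sub_iff_add_eq, add_comm, add_left_inj]
  simp only [Derivation.map_smul, map_sum, Derivation.leibniz, lgJet_d_t, smul_eq_mul, mul_ite,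
    mul_one, mul_zero, smul_add, Finset.sum_add_distrib, smul_ite, smul_zero, Finset.sum_ite_eq,
    Finset.mem_univ, if_true]
  rw [Finset.sum_comm]
  simp only [Finset.sum_ite_eq, Finset.mem_univ, if_true]
  rw [Finset.sum_congr rfl fun j _ => by rw [← hs j], ← smul_add, ← two_smul A, smul_smul, h2,
    one_smul]

theorem lgV_mem (x : Fin m → A) (ℓ : A) : lgV x ℓ ∈ (lgJet m A).vanish 3 := by
  refine (lgJet m A).mem_vanish_of ?_ fun i => ?_
  · simp only [lgV, lgS, map_sub, map_sum, map_smul, map_mul, lgJet_ev_t, lgJet_ev_e, lgJet_ev_y]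
    simp
  have h := lgJet_d_lgV x ℓ i
  rw [lgJet_d_lgS, ← sub_eq_iff_eq_add'] at h
  rw [← h]
  refine (lgJet m A).mem_vanish_of ?_ fun j => ?_
  · simp [lgJet_ev_t, lgJet_ev_e, lgJet_ev_y]
  refine (lgJet m A).mem_vanish_one.2 ?_
  simp only [map_sub, map_sum, Derivation.map_smul, lgJet_d_t, lgJet_d_e, lgJet_d_y, lgH,
    Derivation.map_one_eq_zero, sub_zero, map_smul, lgJet_ev_y, smul_eq_mul, mul_one]
  have : ∀ k, (lgJet m A).ev (if j = k then 1 else 0) = if j = k then 1 else 0 := fun k => by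
    split_ifs <;> simp
  simp only [this]
  rcases eq_or_ne i j with rfl | hij
  · simp [lgJet_ev_e]; ring
  · simp [hij, hij.symm]; ring

theorem lgJet_isPotential {x y : Fin m → A} {ℓ c : A} (hxy : ∀ i, x i * y i = 1)
    (hc : (m : A) * c + ℓ = ℓ * (c * ∑ i, y i)) :
    (lgJet m A).IsPotential (lgH x ℓ) (lgC y c) (lgS x ℓ) (lgV x ℓ) where
  symm i j := by
    rcases eq_or_ne i j with rfl | h
    · rfl
    · simp [lgC, h, h.symm, mul_comm]
  inv i j := by
    simp only [lgH, lgC, sub_mul, mul_sub, Finset.sum_sub_distrib, ite_mul, mul_ite, zero_mul,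
      mul_zero, Finset.sum_ite_eq, Finset.sum_ite_eq', Finset.mem_univ, if_true]
    have h1 := algebraMap_inv_natCast_mul (A := A) i
    have e : ∑ l, algebraMap ℚ A (m : ℚ)⁻¹ * ℓ * (c * (y l * y j)) =
      algebraMap ℚ A (m : ℚ)⁻¹ * y j * (ℓ * (c * ∑ l, y l)) := by
      simp only [Finset.mul_sum]
      exact Finset.sum_congr rfl fun l _ => by ring
    rw [e, ← hc]
    have h3 : (if i = j then x i * y j else 0) = if i = j then 1 else 0 := by
      split_ifs with h
      · rw [← h, hxy]
      · rfl
    rw [h3]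
    linear_combination (-c * y j) * hxy i + (c * y j) * h1
  d_eq i := lgJet_d_lgV x ℓ i
  two_mul_eq := by
    have h2 : (2 : MvPolynomial (LGVar m) A) * (algebraMap ℚ A 2⁻¹ •
        ∑ i, ∑ j, lgH x ℓ i j • (X (LGVar.t i) * X (LGVar.t j))) =
        ∑ i, ∑ j, lgH x ℓ i j • (X (LGVar.t i) * X (LGVar.t j)) := by
      rw [two_mul, ← add_smul, ← two_mul, ← map_ofNat (algebraMap ℚ A) 2, ← map_mul,
        mul_inv_cancel₀ two_ne_zero, map_one, one_smul]
    rw [lgV, mul_sub, h2]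
    exact (add_sub_cancel _ _).symm
  mem := lgV_mem x ℓ

end lgJet

section smooth

variable (m : ℕ)

/-- The algebra of smooth complex-valued functions on `ℝ^m`. -/
def smoothAlg : Subalgebra ℂ (EuclideanSpace ℝ (Fin m) → ℂ) where
  carrier := {f | ContDiff ℝ ∞ f}
  mul_mem' {f g} hf hg := show ContDiff ℝ ∞ (f * g) from
    ContDiff.mul (show ContDiff ℝ ∞ f from hf) (show ContDiff ℝ ∞ g from hg)
  add_mem' {f g} hf hg := show ContDiff ℝ ∞ (f + g) from
    ContDiff.add (show ContDiff ℝ ∞ f from hf) (show ContDiff ℝ ∞ g from hg)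
  algebraMap_mem' c := show ContDiff ℝ ∞ fun _ => c from contDiff_const

variable {m}

theorem contDiff_coe (f : smoothAlg m) : ContDiff ℝ ∞ (f : EuclideanSpace ℝ (Fin m) → ℂ) := f.2

theorem differentiable_coe (f : smoothAlg m) :
    Differentiable ℝ (f : EuclideanSpace ℝ (Fin m) → ℂ) :=
  (contDiff_coe f).differentiable (by simp)

/-- The `i`th partial derivative of a smooth function. -/
noncomputable def partialDeriv (i : Fin m) : Derivation ℂ (smoothAlg m) (smoothAlg m) :=
  Derivation.mk'
    { toFun := fun f => ⟨fun t => fderiv ℝ (f : EuclideanSpace ℝ (Fin m) → ℂ) t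
          (EuclideanSpace.single i 1), by
        have h : ContDiff ℝ ∞ (fderiv ℝ (f : EuclideanSpace ℝ (Fin m) → ℂ)) :=
          (contDiff_coe f).fderiv_right (by simp)
        exact show ContDiff ℝ ∞ _ from h.clm_apply contDiff_const⟩
      map_add' := fun f g => by
        ext t
        have := fderiv_add (differentiable_coe f t) (differentiable_coe g t)
        simp only [Subalgebra.coe_add, Pi.add_apply] at this ⊢
        rw [this]; rfl
      map_smul' := fun c f => by
        ext t
        have := fderiv_const_smul (differentiable_coe f t) c
        simp only [Subalgebra.coe_smul, RingHom.id_apply, Pi.smul_apply] at this ⊢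
        rw [this]; rfl }
    (fun f g => by
      ext t
      have := fderiv_mul (differentiable_coe f t) (differentiable_coe g t)
      simp only [LinearMap.coe_mk, AddHom.coe_mk, Subalgebra.coe_mul, Subalgebra.coe_add,
        smul_eq_mul, Pi.add_apply, Pi.mul_apply] at this ⊢
      rw [this]; rfl)

theorem partialDeriv_apply (i : Fin m) (f : smoothAlg m) (t : EuclideanSpace ℝ (Fin m)) :
    (partialDeriv i f : EuclideanSpace ℝ (Fin m) → ℂ) t =
      fderiv ℝ (f : EuclideanSpace ℝ (Fin m) → ℂ) t (EuclideanSpace.single i 1) := rfl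

theorem partialDeriv_comm (i j : Fin m) (f : smoothAlg m) :
    partialDeriv i (partialDeriv j f) = partialDeriv j (partialDeriv i f) := by
  ext t
  have h : ContDiff ℝ ∞ (fderiv ℝ (f : EuclideanSpace ℝ (Fin m) → ℂ)) :=
    (contDiff_coe f).fderiv_right (by simp)
  have key : ∀ i j : Fin m, (partialDeriv i (partialDeriv j f) : EuclideanSpace ℝ (Fin m) → ℂ) t =
      fderiv ℝ (fderiv ℝ (f : EuclideanSpace ℝ (Fin m) → ℂ)) t (EuclideanSpace.single i 1)
        (EuclideanSpace.single j 1) := by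
    intro i j
    rw [partialDeriv_apply]
    have : (partialDeriv j f : EuclideanSpace ℝ (Fin m) → ℂ) = fun t =>
      fderiv ℝ (f : EuclideanSpace ℝ (Fin m) → ℂ) t (EuclideanSpace.single j 1) := rfl
    rw [this, fderiv_clm_apply ((h.differentiable (by simp)) t) (differentiableAt_const _)]
    simp
  rw [key, key]
  have hs : IsSymmSndFDerivAt ℝ (f : EuclideanSpace ℝ (Fin m) → ℂ) t :=
    (contDiff_coe f).contDiffAt.isSymmSndFDerivAt (by simp; exact WithTop.coe_le_coe.2 le_top)
  exact hs _ _

/-- The jet algebra of smooth functions on `ℝ^m`. -/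
noncomputable def smoothJet (m : ℕ) : JetAlgebra (Fin m) ℂ (smoothAlg m) where
  d := partialDeriv
  comm := partialDeriv_comm
  ev := (Pi.evalAlgHom ℂ (fun _ : EuclideanSpace ℝ (Fin m) => ℂ) 0).comp (smoothAlg m).val
  T i := ⟨fun t => (t i : ℂ), show ContDiff ℝ ∞ _ from
    Complex.ofRealCLM.contDiff.comp (EuclideanSpace.proj (𝕜 := ℝ) i).contDiff⟩
  dT i j := by
    ext t
    have : (fun t : EuclideanSpace ℝ (Fin m) => (t j : ℂ)) =
      (Complex.ofRealCLM.comp (EuclideanSpace.proj (𝕜 := ℝ) j)) := rfl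
    rw [partialDeriv_apply]
    simp only [this, ContinuousLinearMap.fderiv]
    by_cases h : i = j
    · subst h; simp
    · simp [h, Ne.symm h]
  evT i := by simp

theorem smoothJet_ev (f : smoothAlg m) :
    (smoothJet m).ev f = (f : EuclideanSpace ℝ (Fin m) → ℂ) 0 := rfl

theorem smoothJet_d (i : Fin m) (f : smoothAlg m) (t : EuclideanSpace ℝ (Fin m)) :
    ((smoothJet m).d i f : EuclideanSpace ℝ (Fin m) → ℂ) t =
      fderiv ℝ (f : EuclideanSpace ℝ (Fin m) → ℂ) t (EuclideanSpace.single i 1) := rfl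

theorem smoothJet_T (i : Fin m) (t : EuclideanSpace ℝ (Fin m)) :
    ((smoothJet m).T i : EuclideanSpace ℝ (Fin m) → ℂ) t = t i := rfl

theorem smoothJet_mem_vanish_of_eventuallyEq {f : smoothAlg m}
    (hf : (f : EuclideanSpace ℝ (Fin m) → ℂ) =ᶠ[𝓝 0] 0) (n : ℕ) :
    f ∈ (smoothJet m).vanish n := by
  induction n generalizing f with
  | zero => exact (smoothJet m).mem_vanish_zero _
  | succ n ih =>
    refine (smoothJet m).mem_vanish_of hf.eq_of_nhds fun i => ih ?_
    filter_upwards [hf.eventuallyEq_nhds] with t ht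
    rw [smoothJet_d, ht.fderiv_eq]
    simp

end smooth

section Laplace

variable {m : ℕ}

/-- The covariance matrix `1 / 2` of the weight `exp (-‖t‖ ^ 2)`. -/
noncomputable def halfOne (i j : Fin m) : ℂ := if i = j then algebraMap ℚ ℂ 2⁻¹ else 0

/-- The unnormalized Gaussian mean of `u ↦ f (s • u)`. -/
noncomputable def gaussMean (f : EuclideanSpace ℝ (Fin m) → ℂ) (s : ℝ) : ℂ :=
  ∫ u : EuclideanSpace ℝ (Fin m), (Real.exp (-‖u‖ ^ 2) : ℂ) * f (s • u)

theorem integrable_exp_neg_sq_norm {b : ℝ} (hb : 0 < b) :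
    Integrable fun u : EuclideanSpace ℝ (Fin m) => Real.exp (-b * ‖u‖ ^ 2) := by
  have := GaussianFourier.integrable_cexp_neg_mul_sq_norm_add (b := (b : ℂ)) (by simpa) 0
    (0 : EuclideanSpace ℝ (Fin m))
  have h := this.norm
  refine h.congr (ae_of_all _ fun u => ?_)
  simp [Complex.norm_exp, ← Complex.ofReal_pow]

theorem integrable_gauss_mul {f : EuclideanSpace ℝ (Fin m) → ℂ} (hf : Continuous f) {C : ℝ}
    (hC : ∀ u, ‖f u‖ ≤ C * Real.exp (‖u‖ ^ 2 / 2)) :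
    Integrable fun u => (Real.exp (-‖u‖ ^ 2) : ℂ) * f u := by
  have h1 := (integrable_exp_neg_sq_norm (m := m) (b := 1 / 2) (by norm_num)).const_mul C
  refine h1.mono' (by fun_prop) (ae_of_all _ fun u => ?_)
  rw [norm_mul, Complex.norm_real, Real.norm_of_nonneg (Real.exp_pos _).le]
  calc _ ≤ Real.exp (-‖u‖ ^ 2) * (C * Real.exp (‖u‖ ^ 2 / 2)) := by gcongr; exact hC u
    _ = C * Real.exp (-(1 / 2) * ‖u‖ ^ 2) := by
      rw [mul_left_comm, ← Real.exp_add]; ring_nf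

theorem le_exp_sq_half (x : ℝ) : x ≤ Real.exp (x ^ 2 / 2) := by
  have := Real.add_one_le_exp (x ^ 2 / 2)
  nlinarith [sq_nonneg (x - 1)]

theorem integrable_gauss_mul_of_le {f : EuclideanSpace ℝ (Fin m) → ℂ} (hf : Continuous f) {C : ℝ}
    (hC : ∀ u, ‖f u‖ ≤ C * ‖u‖) :
    Integrable fun u => (Real.exp (-‖u‖ ^ 2) : ℂ) * f u := by
  refine integrable_gauss_mul hf (C := |C|) fun u => (hC u).trans ?_
  exact mul_le_mul (le_abs_self _) (le_exp_sq_half _) (norm_nonneg _) (abs_nonneg _)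

theorem integrable_gauss_mul_of_bdd {f : EuclideanSpace ℝ (Fin m) → ℂ} (hf : Continuous f) {C : ℝ}
    (hC : ∀ u, ‖f u‖ ≤ C) :
    Integrable fun u => (Real.exp (-‖u‖ ^ 2) : ℂ) * f u := by
  refine integrable_gauss_mul hf (C := |C|) fun u => (hC u).trans ((le_abs_self _).trans ?_)
  exact le_mul_of_one_le_right (abs_nonneg _) (Real.one_le_exp (by positivity))

theorem exists_norm_le {f : smoothAlg m}
    (hf : HasCompactSupport (f : EuclideanSpace ℝ (Fin m) → ℂ)) :
    ∃ C, ∀ t, ‖(f : EuclideanSpace ℝ (Fin m) → ℂ) t‖ ≤ C :=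
  hf.exists_bound_of_continuous (contDiff_coe f).continuous

theorem hasCompactSupport_partialDeriv {f : smoothAlg m}
    (hf : HasCompactSupport (f : EuclideanSpace ℝ (Fin m) → ℂ)) (i : Fin m) :
    HasCompactSupport (partialDeriv i f : EuclideanSpace ℝ (Fin m) → ℂ) :=
  hf.fderiv_apply ℝ _

theorem hasCompactSupport_lap {f : smoothAlg m}
    (hf : HasCompactSupport (f : EuclideanSpace ℝ (Fin m) → ℂ)) (C : Fin m → Fin m → ℂ) :
    HasCompactSupport ((smoothJet m).lap C f : EuclideanSpace ℝ (Fin m) → ℂ) := by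
  have key : ∀ i j, HasCompactSupport
      ((C i j • (smoothJet m).d i ((smoothJet m).d j f) : smoothAlg m) :
        EuclideanSpace ℝ (Fin m) → ℂ) := fun i j => by
    have := hasCompactSupport_partialDeriv (hasCompactSupport_partialDeriv hf j) i
    exact this.smul_left (f := fun _ => C i j)
  let S : Submodule ℂ (smoothAlg m) :=
    { carrier := {f | HasCompactSupport (f : EuclideanSpace ℝ (Fin m) → ℂ)}
      add_mem' := fun ha hb => HasCompactSupport.add ha hb
      zero_mem' := HasCompactSupport.zero
      smul_mem' := fun c f hf => HasCompactSupport.smul_left (f := fun _ => c) hf }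
  rw [JetAlgebra.lap_apply]
  exact S.sum_mem fun i _ => S.sum_mem fun j _ => key i j

theorem smoothJet_lap_halfOne (f : smoothAlg m) (t : EuclideanSpace ℝ (Fin m)) :
    ((smoothJet m).lap halfOne f : EuclideanSpace ℝ (Fin m) → ℂ) t =
      ∑ i, (1 / 2 : ℂ) * (partialDeriv i (partialDeriv i f) : EuclideanSpace ℝ (Fin m) → ℂ) t := by
  rw [JetAlgebra.lap_apply]
  simp only [halfOne, ite_smul, zero_smul, Finset.sum_ite_eq, Finset.mem_univ, if_true]
  rw [← Subalgebra.coe_val, map_sum, Finset.sum_apply]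
  refine Finset.sum_congr rfl fun i _ => ?_
  simp [smoothJet]

theorem hasFDerivAt_gauss (u : EuclideanSpace ℝ (Fin m)) :
    HasFDerivAt (fun u : EuclideanSpace ℝ (Fin m) => (Real.exp (-‖u‖ ^ 2) : ℂ))
      (Complex.ofRealCLM.comp ((Real.exp (-‖u‖ ^ 2)) • -(2 • innerSL ℝ u))) u := by
  have h := (hasStrictFDerivAt_norm_sq u).hasFDerivAt.neg.exp
  exact Complex.ofRealCLM.hasFDerivAt.comp u h

/-- Gaussian integration by parts. -/
theorem integral_gauss_mul_coord {f : smoothAlg m}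
    (hf : HasCompactSupport (f : EuclideanSpace ℝ (Fin m) → ℂ)) (s : ℝ) (i : Fin m) :
    ∫ u : EuclideanSpace ℝ (Fin m), (Real.exp (-‖u‖ ^ 2) : ℂ) *
        (u i * (f : EuclideanSpace ℝ (Fin m) → ℂ) (s • u)) =
      s / 2 * gaussMean (partialDeriv i f : EuclideanSpace ℝ (Fin m) → ℂ) s := by
  obtain ⟨C, hC⟩ := exists_norm_le hf
  obtain ⟨C', hC'⟩ := exists_norm_le (hasCompactSupport_partialDeriv hf i)
  have hfc : Continuous fun u => (f : EuclideanSpace ℝ (Fin m) → ℂ) (s • u) :=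
    (contDiff_coe f).continuous.comp (continuous_const_smul s)
  have hfc' : Continuous fun u => (partialDeriv i f : EuclideanSpace ℝ (Fin m) → ℂ) (s • u) :=
    (contDiff_coe (partialDeriv i f)).continuous.comp (continuous_const_smul s)
  have hd : ∀ u, fderiv ℝ (fun u => (f : EuclideanSpace ℝ (Fin m) → ℂ) (s • u)) u
      (EuclideanSpace.single i 1) =
      s * (partialDeriv i f : EuclideanSpace ℝ (Fin m) → ℂ) (s • u) := by
    intro u
    have h1 : HasFDerivAt (fun u : EuclideanSpace ℝ (Fin m) => s • u)
      (s • ContinuousLinearMap.id ℝ _) u := (hasFDerivAt_id u).const_smul s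
    have h2 := (differentiable_coe f (s • u)).hasFDerivAt.comp u h1
    have h3 : fderiv ℝ (fun u => (f : EuclideanSpace ℝ (Fin m) → ℂ) (s • u)) u = _ := h2.fderiv
    rw [h3, partialDeriv_apply]
    simp
  have hg : ∀ u : EuclideanSpace ℝ (Fin m),
      fderiv ℝ (fun u : EuclideanSpace ℝ (Fin m) => (Real.exp (-‖u‖ ^ 2) : ℂ)) u
      (EuclideanSpace.single i 1) = (Real.exp (-‖u‖ ^ 2) : ℂ) * (-2 * u i) := by
    intro u
    rw [(hasFDerivAt_gauss u).fderiv]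
    simp [EuclideanSpace.inner_single_right]
  have hui : ∀ u : EuclideanSpace ℝ (Fin m), ‖(u i : ℂ)‖ ≤ ‖u‖ := fun u => by
    rw [Complex.norm_real]; exact PiLp.norm_apply_le u i
  have hI : Integrable fun u : EuclideanSpace ℝ (Fin m) => (Real.exp (-‖u‖ ^ 2) : ℂ) *
      (u i * (f : EuclideanSpace ℝ (Fin m) → ℂ) (s • u)) := by
    have hci : Continuous fun u : EuclideanSpace ℝ (Fin m) => (u i : ℂ) := by fun_prop
    refine integrable_gauss_mul_of_le (hci.mul hfc) (C := C) fun u => ?_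
    rw [norm_mul, mul_comm C]
    exact mul_le_mul (hui u) (hC _) (norm_nonneg _) (norm_nonneg _)
  have key := integral_mul_fderiv_eq_neg_fderiv_mul_of_integrable (μ := volume)
    (f := fun u : EuclideanSpace ℝ (Fin m) => (Real.exp (-‖u‖ ^ 2) : ℂ))
    (g := fun u => (f : EuclideanSpace ℝ (Fin m) → ℂ) (s • u))
    (v := EuclideanSpace.single i 1)
    (by
      simp only [hg]
      refine (hI.const_mul (-2)).congr (ae_of_all _ fun u => ?_)
      simp only []; ring)
    (by
      simp only [hd]
      refine ((integrable_gauss_mul_of_bdd hfc' fun u => hC' _).const_mul (s : ℂ)).congr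
        (ae_of_all _ fun u => ?_)
      simp only []; ring)
    (integrable_gauss_mul_of_bdd hfc fun u => hC _)
    (fun u _ => (hasFDerivAt_gauss u).differentiableAt)
    (fun u _ => (differentiable_coe f _).comp u ((differentiable_id.const_smul s) u))
  simp only [hd, hg] at key
  have e1 : (∫ u : EuclideanSpace ℝ (Fin m), (Real.exp (-‖u‖ ^ 2) : ℂ) * (-2 * u i) *
      (f : EuclideanSpace ℝ (Fin m) → ℂ) (s • u)) = -2 * ∫ u : EuclideanSpace ℝ (Fin m),
        (Real.exp (-‖u‖ ^ 2) : ℂ) * (u i * (f : EuclideanSpace ℝ (Fin m) → ℂ) (s • u)) := by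
    rw [← integral_const_mul]
    congr 1; ext u; ring
  have e2 : (∫ u : EuclideanSpace ℝ (Fin m), (Real.exp (-‖u‖ ^ 2) : ℂ) *
      (s * (partialDeriv i f : EuclideanSpace ℝ (Fin m) → ℂ) (s • u))) =
      s * gaussMean (partialDeriv i f : EuclideanSpace ℝ (Fin m) → ℂ) s := by
    rw [gaussMean, ← integral_const_mul]
    congr 1; ext u; ring
  rw [e1, e2] at key
  linear_combination (-1 / 2) * key

theorem hasDerivAt_gaussMean {f : smoothAlg m}
    (hf : HasCompactSupport (f : EuclideanSpace ℝ (Fin m) → ℂ)) (s : ℝ) :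
    HasDerivAt (gaussMean (f : EuclideanSpace ℝ (Fin m) → ℂ))
      (s * gaussMean ((smoothJet m).lap halfOne f : EuclideanSpace ℝ (Fin m) → ℂ) s) s := by
  have hf' : ContDiff ℝ ∞ (fderiv ℝ (f : EuclideanSpace ℝ (Fin m) → ℂ)) :=
    (contDiff_coe f).fderiv_right (by simp)
  obtain ⟨C, hC⟩ := exists_norm_le hf
  obtain ⟨C', hC'⟩ := (hf.fderiv (𝕜 := ℝ)).exists_bound_of_continuous hf'.continuous
  have hCc : ∀ s : ℝ, Continuous fun u => (f : EuclideanSpace ℝ (Fin m) → ℂ) (s • u) := fun s =>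
    (contDiff_coe f).continuous.comp (continuous_const_smul s)
  have hCc' : ∀ s : ℝ, Continuous fun u : EuclideanSpace ℝ (Fin m) =>
    fderiv ℝ (f : EuclideanSpace ℝ (Fin m) → ℂ) (s • u) u := fun s =>
    (hf'.continuous.comp (continuous_const_smul s)).clm_apply continuous_id
  have hbd : ∀ s : ℝ, ∀ u : EuclideanSpace ℝ (Fin m),
      ‖fderiv ℝ (f : EuclideanSpace ℝ (Fin m) → ℂ) (s • u) u‖ ≤ C' * ‖u‖ := fun s u =>
    (ContinuousLinearMap.le_opNorm _ _).trans (by gcongr; exact hC' _)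
  have key := (hasDerivAt_integral_of_dominated_loc_of_deriv_le (μ := volume)
    (F := fun (s : ℝ) (u : EuclideanSpace ℝ (Fin m)) =>
      (Real.exp (-‖u‖ ^ 2) : ℂ) * (f : EuclideanSpace ℝ (Fin m) → ℂ) (s • u))
    (F' := fun (s : ℝ) (u : EuclideanSpace ℝ (Fin m)) => (Real.exp (-‖u‖ ^ 2) : ℂ) *
      fderiv ℝ (f : EuclideanSpace ℝ (Fin m) → ℂ) (s • u) u)
    (bound := fun u => ‖(Real.exp (-‖u‖ ^ 2) : ℂ) * ((C' * ‖u‖ : ℝ) : ℂ)‖)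
    (x₀ := s) (s := Set.univ) univ_mem
    (Eventually.of_forall fun s => (integrable_gauss_mul_of_bdd (hCc s) fun u => hC _).1)
    (integrable_gauss_mul_of_bdd (hCc s) fun u => hC _)
    (integrable_gauss_mul_of_le (hCc' s) (hbd s)).1
    (ae_of_all _ fun u s _ => by
      rw [norm_mul, norm_mul]
      gcongr
      rw [Complex.norm_real]
      exact (hbd s u).trans (le_abs_self _))
    (integrable_gauss_mul_of_le (by fun_prop) (C := |C'|) fun u => by
      rw [Complex.norm_real, norm_mul, norm_norm, Real.norm_eq_abs]).norm
    (ae_of_all _ fun u s _ => by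
      have h1 : HasDerivAt (fun s : ℝ => s • u) u s := by
        simpa using (hasDerivAt_id s).smul_const u
      exact ((differentiable_coe f (s • u)).hasFDerivAt.comp_hasDerivAt s h1).const_mul _)).2
  refine HasDerivAt.congr_deriv key ?_
  have e1 : ∀ u : EuclideanSpace ℝ (Fin m), (Real.exp (-‖u‖ ^ 2) : ℂ) *
      fderiv ℝ (f : EuclideanSpace ℝ (Fin m) → ℂ) (s • u) u = ∑ i, (Real.exp (-‖u‖ ^ 2) : ℂ) *
        (u i * (partialDeriv i f : EuclideanSpace ℝ (Fin m) → ℂ) (s • u)) := by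
    intro u
    rw [← Finset.mul_sum]
    congr 1
    have hu : u = ∑ i, u i • (EuclideanSpace.single i (1 : ℝ)) := by
      ext j
      simp [Finset.sum_apply, Pi.single_apply]
    conv_lhs => rw [hu, map_sum]
    rw [← hu]
    refine Finset.sum_congr rfl fun i _ => ?_
    rw [map_smul, partialDeriv_apply]
    simp
  have hui : ∀ i, ∀ u : EuclideanSpace ℝ (Fin m), ‖(u i : ℂ)‖ ≤ ‖u‖ := fun i u => by
    rw [Complex.norm_real]; exact PiLp.norm_apply_le u i
  have hI : ∀ i, Integrable fun u : EuclideanSpace ℝ (Fin m) => (Real.exp (-‖u‖ ^ 2) : ℂ) *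
      (u i * (partialDeriv i f : EuclideanSpace ℝ (Fin m) → ℂ) (s • u)) := fun i => by
    obtain ⟨D, hD⟩ := exists_norm_le (hasCompactSupport_partialDeriv hf i)
    have := (contDiff_coe (partialDeriv i f)).continuous.comp (continuous_const_smul s)
    have hci : Continuous fun u : EuclideanSpace ℝ (Fin m) => (u i : ℂ) := by fun_prop
    refine integrable_gauss_mul_of_le (hci.mul this) (C := D) fun u => ?_
    rw [norm_mul, mul_comm D]
    exact mul_le_mul (hui i u) (hD _) (norm_nonneg _) (norm_nonneg _)
  rw [integral_congr_ae (ae_of_all _ e1), integral_finsetSum _ fun i _ => hI i]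
  rw [Finset.sum_congr rfl fun i _ =>
    integral_gauss_mul_coord (hasCompactSupport_partialDeriv hf i) s i]
  simp only [gaussMean]
  simp only [smoothJet_lap_halfOne, Finset.mul_sum]
  rw [integral_finsetSum, Finset.mul_sum]
  · refine Finset.sum_congr rfl fun i _ => ?_
    rw [← integral_const_mul, ← integral_const_mul]
    congr 1; ext u; ring
  · intro i _
    obtain ⟨D, hD⟩ := exists_norm_le
      (hasCompactSupport_partialDeriv (hasCompactSupport_partialDeriv hf i) i)
    have := (contDiff_coe (partialDeriv i (partialDeriv i f))).continuous.comp (continuous_const_smul s)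
    refine integrable_gauss_mul_of_bdd (C := 1 / 2 * D) (continuous_const.mul this) fun u => ?_
    rw [norm_mul]
    gcongr
    · simp
    · exact hD _

theorem gaussMean_zero (f : smoothAlg m) :
    gaussMean (f : EuclideanSpace ℝ (Fin m) → ℂ) 0 =
      ((Real.pi ^ ((m : ℝ) / 2) : ℝ) : ℂ) * (smoothJet m).ev f := by
  simp only [gaussMean, zero_smul, smoothJet_ev]
  rw [integral_mul_const]
  congr 1
  have := GaussianFourier.integral_rexp_neg_mul_sq_norm (V := EuclideanSpace ℝ (Fin m))
    (b := 1) one_pos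
  simp only [neg_mul, one_mul, div_one, finrank_euclideanSpace, Fintype.card_fin] at this
  rw [← this]
  exact integral_ofReal

theorem exists_gaussMean_sub_le (N : ℕ) (f : smoothAlg m)
    (hf : HasCompactSupport (f : EuclideanSpace ℝ (Fin m) → ℂ)) :
    ∃ C, ∀ s, 0 ≤ s → ‖gaussMean (f : EuclideanSpace ℝ (Fin m) → ℂ) s -
      ((Real.pi ^ ((m : ℝ) / 2) : ℝ) : ℂ) *
        ∑ k ∈ Finset.range N, (smoothJet m).gauss halfOne k f * (s : ℂ) ^ (2 * k)‖ ≤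
          C * s ^ (2 * N) := by
  induction N generalizing f with
  | zero =>
    obtain ⟨C, hC⟩ := exists_norm_le hf
    refine ⟨∫ u : EuclideanSpace ℝ (Fin m), Real.exp (-1 * ‖u‖ ^ 2) * C, fun s _ => ?_⟩
    simp only [Finset.range_zero, Finset.sum_empty, mul_zero, sub_zero, pow_zero, mul_one]
    refine norm_integral_le_of_norm_le
      ((integrable_exp_neg_sq_norm one_pos).mul_const C) (ae_of_all _ fun u => ?_)
    rw [norm_mul, Complex.norm_real, Real.norm_of_nonneg (Real.exp_pos _).le, neg_one_mul]
    gcongr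
    exact hC _
  | succ N ih =>
    obtain ⟨C, hC⟩ := ih _ (hasCompactSupport_lap hf halfOne)
    refine ⟨C, fun s hs => ?_⟩
    set P : ℂ := ((Real.pi ^ ((m : ℝ) / 2) : ℝ) : ℂ) with hP
    have hder : ∀ x : ℝ, HasDerivAt (fun s : ℝ => gaussMean (f : EuclideanSpace ℝ (Fin m) → ℂ) s -
        P * ∑ k ∈ Finset.range (N + 1), (smoothJet m).gauss halfOne k f * (s : ℂ) ^ (2 * k))
        (x * (gaussMean ((smoothJet m).lap halfOne f : EuclideanSpace ℝ (Fin m) → ℂ) x -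
        P * ∑ k ∈ Finset.range N, (smoothJet m).gauss halfOne k ((smoothJet m).lap halfOne f) *
          (x : ℂ) ^ (2 * k))) x := by
      intro x
      have h1 : HasDerivAt (fun s : ℝ => ∑ k ∈ Finset.range (N + 1),
          (smoothJet m).gauss halfOne k f * (s : ℂ) ^ (2 * k))
          (∑ k ∈ Finset.range (N + 1), (smoothJet m).gauss halfOne k f *
            ((2 * k : ℕ) * (x : ℂ) ^ (2 * k - 1) * 1)) x :=
        HasDerivAt.fun_sum fun k _ => (((hasDerivAt_id x).ofReal_comp).pow (2 * k)).const_mul _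
      refine ((hasDerivAt_gaussMean hf x).sub (h1.const_mul P)).congr_deriv ?_
      rw [Finset.sum_range_succ', mul_sub]
      congr 1
      rw [mul_left_comm (x : ℂ)]
      congr 1
      simp only [JetAlgebra.gauss_lap, Finset.mul_sum, mul_zero, Nat.cast_zero, zero_mul, add_zero]
      refine Finset.sum_congr rfl fun k _ => ?_
      rw [show 2 * (k + 1) - 1 = 2 * k + 1 by omega]
      push_cast
      simp only [map_ofNat]
      ring
    have hmv := (convex_Icc (0 : ℝ) s).norm_image_sub_le_of_norm_hasDerivWithin_le
      (C := s * (C * s ^ (2 * N)))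
      (fun x _ => (hder x).hasDerivWithinAt) (fun x hx => by
        rw [norm_mul, Complex.norm_real, Real.norm_of_nonneg hx.1]
        have h2 := hC x hx.1
        have hC0 : 0 ≤ C := by
          by_contra! h
          have := (norm_nonneg _).trans (hC 1 zero_le_one)
          simp at this; linarith
        calc _ ≤ x * (C * x ^ (2 * N)) := by gcongr; exact hx.1
          _ ≤ s * (C * s ^ (2 * N)) := by
            gcongr
            · exact mul_nonneg hC0 (pow_nonneg hx.1 _)
            · exact hx.2
            · exact hx.1
            · exact hx.2)
      (Set.left_mem_Icc.2 hs) (Set.right_mem_Icc.2 hs)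
    have h0 : gaussMean (f : EuclideanSpace ℝ (Fin m) → ℂ) 0 -
        P * ∑ k ∈ Finset.range (N + 1), (smoothJet m).gauss halfOne k f *
          ((0 : ℝ) : ℂ) ^ (2 * k) = 0 := by
      rw [Finset.sum_range_succ', gaussMean_zero, Finset.sum_eq_zero fun k _ => by simp]
      simp [JetAlgebra.gauss_zero, hP]
    simp only [h0, sub_zero] at hmv
    refine hmv.trans (le_of_eq ?_)
    rw [Real.norm_of_nonneg hs]
    ring

end Laplace

section Laplace

variable {m : ℕ}

theorem integrable_exp_neg_div_mul {D : EuclideanSpace ℝ (Fin m) → ℂ} (hD : Continuous D) {h₀ : ℝ}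
    (hint : Integrable fun t => (Real.exp (-‖t‖ ^ 2 / h₀) : ℂ) * D t) {h : ℝ} (hh : 0 < h)
    (hle : h ≤ h₀) : Integrable fun t => (Real.exp (-‖t‖ ^ 2 / h) : ℂ) * D t := by
  refine hint.mono (by fun_prop) (ae_of_all _ fun t => ?_)
  rw [norm_mul, norm_mul]
  gcongr
  rw [Complex.norm_real, Complex.norm_real, Real.norm_of_nonneg (Real.exp_pos _).le,
    Real.norm_of_nonneg (Real.exp_pos _).le, Real.exp_le_exp, neg_div, neg_div, neg_le_neg_iff]
  gcongr

theorem integral_exp_neg_div_mul (f : EuclideanSpace ℝ (Fin m) → ℂ) {h : ℝ} (hh : 0 < h) :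
    ∫ t, (Real.exp (-‖t‖ ^ 2 / h) : ℂ) * f t =
      ((h ^ ((m : ℝ) / 2) : ℝ) : ℂ) * gaussMean f (Real.sqrt h) := by
  have hs : 0 < Real.sqrt h := Real.sqrt_pos.2 hh
  have key := Measure.integral_comp_smul (volume : Measure (EuclideanSpace ℝ (Fin m)))
    (fun t => (Real.exp (-‖t‖ ^ 2 / h) : ℂ) * f t) (Real.sqrt h)
  have e1 : ∀ u : EuclideanSpace ℝ (Fin m), -‖Real.sqrt h • u‖ ^ 2 / h = -‖u‖ ^ 2 := by
    intro u
    rw [norm_smul, mul_pow, Real.norm_of_nonneg hs.le, Real.sq_sqrt hh.le]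
    field_simp
  simp only [e1, finrank_euclideanSpace, Fintype.card_fin] at key
  have e2 : h ^ ((m : ℝ) / 2) = Real.sqrt h ^ m := by
    rw [Real.sqrt_eq_rpow, ← Real.rpow_natCast, ← Real.rpow_mul hh.le]
    congr 1; ring
  have hne : ((Real.sqrt h ^ m : ℝ) : ℂ) ≠ 0 := by
    exact_mod_cast (pow_pos hs m).ne'
  rw [gaussMean, key, e2, abs_of_pos (by positivity), Complex.real_smul, ← mul_assoc,
    Complex.ofReal_inv, mul_inv_cancel₀ hne, one_mul]

theorem isBigO_exp_neg_div_rpow (a c : ℝ) (N : ℕ) :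
    (fun h : ℝ => Real.exp (c - 1 / h) / h ^ a) =O[𝓝[>] 0] fun h => h ^ N := by
  have h1 : (fun x : ℝ => Real.exp (-1 * x)) =O[atTop] fun x : ℝ => x ^ (-(a + N)) :=
    (isLittleO_exp_neg_mul_rpow_atTop one_pos _).isBigO
  have h2 := (h1.comp_tendsto tendsto_inv_nhdsGT_zero).const_mul_left (Real.exp c)
  have h3 := h2.mul (Asymptotics.isBigO_refl (fun h : ℝ => h ^ (-a)) (𝓝[>] 0))
  refine (h3.congr' ?_ ?_)
  · filter_upwards [self_mem_nhdsWithin] with h hh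
    have hh : 0 < h := hh
    simp only [Function.comp]
    rw [Real.rpow_neg hh.le, ← Real.exp_add, div_eq_mul_inv]
    congr 2; ring
  · filter_upwards [self_mem_nhdsWithin] with h hh
    have hh : 0 < h := hh
    simp only [Function.comp]
    rw [Real.inv_rpow hh.le, ← Real.rpow_neg hh.le, neg_neg, ← Real.rpow_add hh,
      ← Real.rpow_natCast]
    congr 1; ring

theorem gauss_congr_of_eventuallyEq {f g : smoothAlg m}
    (h : (f : EuclideanSpace ℝ (Fin m) → ℂ) =ᶠ[𝓝 0] g) (C : Fin m → Fin m → ℂ) (k : ℕ) :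
    (smoothJet m).gauss C k f = (smoothJet m).gauss C k g := by
  rw [← sub_eq_zero, ← map_sub]
  refine (smoothJet m).gauss_eq_zero C k (smoothJet_mem_vanish_of_eventuallyEq ?_ _)
  filter_upwards [h] with t ht
  simp [ht]

/-- Laplace's method: the asymptotic expansion of a Gaussian integral as the variance tends to
zero. -/
theorem laplace_expansion (D : smoothAlg m) {h₀ : ℝ} (hh₀ : 0 < h₀)
    (hint : Integrable fun t => (Real.exp (-‖t‖ ^ 2 / h₀) : ℂ) *
      (D : EuclideanSpace ℝ (Fin m) → ℂ) t) (N : ℕ) :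
    (fun h : ℝ => (∫ t, (Real.exp (-‖t‖ ^ 2 / h) : ℂ) * (D : EuclideanSpace ℝ (Fin m) → ℂ) t) /
        (((Real.pi * h) ^ ((m : ℝ) / 2) : ℝ) : ℂ) -
      ∑ k ∈ Finset.range N, (smoothJet m).gauss halfOne k D * (h : ℂ) ^ k)
      =O[𝓝[>] 0] fun h : ℝ => h ^ N := by
  let χ : ContDiffBump (0 : EuclideanSpace ℝ (Fin m)) := ⟨1, 2, one_pos, one_lt_two⟩
  have hχ : ContDiff ℝ ∞ fun t : EuclideanSpace ℝ (Fin m) => (χ t : ℂ) :=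
    Complex.ofRealCLM.contDiff.comp χ.contDiff
  let f : smoothAlg m := ⟨fun t => (χ t : ℂ), hχ⟩ * D
  have hf : ∀ t, (f : EuclideanSpace ℝ (Fin m) → ℂ) t =
      χ t * (D : EuclideanSpace ℝ (Fin m) → ℂ) t := fun t => rfl
  have hsupp : HasCompactSupport (f : EuclideanSpace ℝ (Fin m) → ℂ) := by
    have : HasCompactSupport fun t : EuclideanSpace ℝ (Fin m) => (χ t : ℂ) :=
      χ.hasCompactSupport.comp_left (g := fun x : ℝ => (x : ℂ)) Complex.ofReal_zero
    exact this.mul_right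
  have hfD : (f : EuclideanSpace ℝ (Fin m) → ℂ) =ᶠ[𝓝 0] (D : EuclideanSpace ℝ (Fin m) → ℂ) := by
    filter_upwards [χ.eventuallyEq_one] with t ht
    rw [hf, ht]; simp
  have hgauss : ∀ k, (smoothJet m).gauss halfOne k D = (smoothJet m).gauss halfOne k f :=
    fun k => (gauss_congr_of_eventuallyEq hfD _ k).symm
  obtain ⟨C, hC⟩ := exists_gaussMean_sub_le N f hsupp
  have hDc := (contDiff_coe D).continuous
  have hfc := (contDiff_coe f).continuous
  have hchi01 : ∀ t, 0 ≤ χ t ∧ χ t ≤ 1 := fun t => ⟨χ.nonneg, χ.le_one⟩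
  have hintf : Integrable fun t => (Real.exp (-‖t‖ ^ 2 / h₀) : ℂ) *
      (f : EuclideanSpace ℝ (Fin m) → ℂ) t := by
    refine hint.mono (by fun_prop) (ae_of_all _ fun t => ?_)
    rw [hf, norm_mul, norm_mul, norm_mul]
    gcongr
    rw [Complex.norm_real, Real.norm_of_nonneg (hchi01 t).1]
    exact mul_le_of_le_one_left (norm_nonneg _) (hchi01 t).2
  set B : ℝ := ∫ t, ‖(Real.exp (-‖t‖ ^ 2 / h₀) : ℂ) * (D : EuclideanSpace ℝ (Fin m) → ℂ) t‖
    with hB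
  have htail : ∀ h : ℝ, 0 < h → h ≤ h₀ →
      ‖(∫ t, (Real.exp (-‖t‖ ^ 2 / h) : ℂ) * (D : EuclideanSpace ℝ (Fin m) → ℂ) t) -
        ∫ t, (Real.exp (-‖t‖ ^ 2 / h) : ℂ) * (f : EuclideanSpace ℝ (Fin m) → ℂ) t‖ ≤
      Real.exp (1 / h₀ - 1 / h) * B := by
    intro h hh hle
    rw [← integral_sub (integrable_exp_neg_div_mul hDc hint hh hle)
      (integrable_exp_neg_div_mul hfc hintf hh hle), hB, ← integral_const_mul]
    refine norm_integral_le_of_norm_le (hint.norm.const_mul _) (ae_of_all _ fun t => ?_)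
    have e : (Real.exp (-‖t‖ ^ 2 / h) : ℂ) * (D : EuclideanSpace ℝ (Fin m) → ℂ) t -
        (Real.exp (-‖t‖ ^ 2 / h) : ℂ) * (f : EuclideanSpace ℝ (Fin m) → ℂ) t =
        ((Real.exp (-‖t‖ ^ 2 / h) * (1 - χ t) : ℝ) : ℂ) *
          (D : EuclideanSpace ℝ (Fin m) → ℂ) t := by
      rw [hf]; push_cast; ring
    rw [e, norm_mul, norm_mul, ← mul_assoc, Complex.norm_real, Complex.norm_real,
      Real.norm_of_nonneg (mul_nonneg (Real.exp_pos _).le (by linarith [(hchi01 t).2])),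
      Real.norm_of_nonneg (Real.exp_pos _).le]
    refine mul_le_mul_of_nonneg_right ?_ (norm_nonneg _)
    by_cases ht : ‖t‖ ≤ 1
    · rw [χ.one_of_mem_closedBall (by simpa using ht)]
      simp only [sub_self, mul_zero]
      positivity
    · push Not at ht
      rw [← Real.exp_add]
      refine (mul_le_of_le_one_right (Real.exp_pos _).le (by linarith [(hchi01 t).1])).trans ?_
      rw [Real.exp_le_exp]
      have h3 : 1 / h₀ ≤ 1 / h := one_div_le_one_div_of_le hh hle
      have h4 : (1 : ℝ) ≤ ‖t‖ ^ 2 := by nlinarith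
      have e5 : -‖t‖ ^ 2 / h = -(‖t‖ ^ 2 * (1 / h)) := by ring
      have e6 : -‖t‖ ^ 2 / h₀ = -(‖t‖ ^ 2 * (1 / h₀)) := by ring
      rw [e5, e6]
      nlinarith
  set P : ℝ := Real.pi ^ ((m : ℝ) / 2) with hP
  have hPpos : 0 < P := Real.rpow_pos_of_pos Real.pi_pos _
  have hmain : ∀ h : ℝ, 0 < h →
      ‖(∫ t, (Real.exp (-‖t‖ ^ 2 / h) : ℂ) * (f : EuclideanSpace ℝ (Fin m) → ℂ) t) /
        (((Real.pi * h) ^ ((m : ℝ) / 2) : ℝ) : ℂ) -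
        ∑ k ∈ Finset.range N, (smoothJet m).gauss halfOne k D * (h : ℂ) ^ k‖ ≤ C / P * h ^ N := by
    intro h hh
    have h1 := hC (Real.sqrt h) (Real.sqrt_nonneg _)
    rw [pow_mul, Real.sq_sqrt hh.le] at h1
    have hh' : 0 < h ^ ((m : ℝ) / 2) := Real.rpow_pos_of_pos hh _
    have e : (∫ t, (Real.exp (-‖t‖ ^ 2 / h) : ℂ) * (f : EuclideanSpace ℝ (Fin m) → ℂ) t) /
        (((Real.pi * h) ^ ((m : ℝ) / 2) : ℝ) : ℂ) -
        ∑ k ∈ Finset.range N, (smoothJet m).gauss halfOne k D * (h : ℂ) ^ k =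
        (gaussMean (f : EuclideanSpace ℝ (Fin m) → ℂ) (Real.sqrt h) -
      (P : ℂ) * ∑ k ∈ Finset.range N, (smoothJet m).gauss halfOne k f *
        ((Real.sqrt h : ℝ) : ℂ) ^ (2 * k)) / P := by
      rw [integral_exp_neg_div_mul _ hh, Real.mul_rpow Real.pi_pos.le hh.le, sub_div,
        mul_div_cancel_left₀ _ (by exact_mod_cast hPpos.ne'), Complex.ofReal_mul, mul_comm (_ : ℂ),
        mul_div_mul_right _ _ (by exact_mod_cast hh'.ne')]
      congr 1
      refine Finset.sum_congr rfl fun k _ => ?_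
      have hsq : ((Real.sqrt h : ℝ) : ℂ) ^ 2 = h := by
        rw [← Complex.ofReal_pow, Real.sq_sqrt hh.le]
      rw [hgauss, pow_mul, hsq]
    rw [e, norm_div, Complex.norm_real, Real.norm_of_nonneg hPpos.le, div_mul_eq_mul_div]
    gcongr
  have hO1 : (fun h : ℝ =>
      (∫ t, (Real.exp (-‖t‖ ^ 2 / h) : ℂ) * (f : EuclideanSpace ℝ (Fin m) → ℂ) t) /
        (((Real.pi * h) ^ ((m : ℝ) / 2) : ℝ) : ℂ) -
        ∑ k ∈ Finset.range N, (smoothJet m).gauss halfOne k D * (h : ℂ) ^ k)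
        =O[𝓝[>] 0] fun h : ℝ => h ^ N := by
    refine Asymptotics.IsBigO.of_bound (C / P) ?_
    filter_upwards [self_mem_nhdsWithin] with h hh
    have hh : 0 < h := hh
    rw [Real.norm_of_nonneg (pow_pos hh N).le]
    exact hmain h hh
  have hO2 : (fun h : ℝ =>
      ((∫ t, (Real.exp (-‖t‖ ^ 2 / h) : ℂ) * (D : EuclideanSpace ℝ (Fin m) → ℂ) t) -
        ∫ t, (Real.exp (-‖t‖ ^ 2 / h) : ℂ) * (f : EuclideanSpace ℝ (Fin m) → ℂ) t) /
        (((Real.pi * h) ^ ((m : ℝ) / 2) : ℝ) : ℂ)) =O[𝓝[>] 0] fun h : ℝ => h ^ N := by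
    refine Asymptotics.IsBigO.trans ?_ (isBigO_exp_neg_div_rpow ((m : ℝ) / 2) (1 / h₀) N)
    refine Asymptotics.IsBigO.of_bound (B / P) ?_
    filter_upwards [Ioc_mem_nhdsGT hh₀] with h hh
    have hh' : 0 < h ^ ((m : ℝ) / 2) := Real.rpow_pos_of_pos hh.1 _
    rw [norm_div, Complex.norm_real, Real.mul_rpow Real.pi_pos.le hh.1.le, ← hP,
      Real.norm_of_nonneg (mul_pos hPpos hh').le, Real.norm_of_nonneg (by positivity)]
    calc _ ≤ Real.exp (1 / h₀ - 1 / h) * B / (P * h ^ ((m : ℝ) / 2)) := by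
          gcongr; exact htail h hh.1 hh.2
      _ = _ := by field_simp
  refine (hO1.add hO2).congr_left fun h => ?_
  rw [sub_div]; ring

end Laplace

section RootsOfUnity

variable {m : ℕ} {ζ : ℂ} {A : Type*} [CommRing A] [Algebra ℂ A]

theorem sum_zeta_pow_eq_zero (hζ : IsPrimitiveRoot ζ m) {p : ℕ} (hp : 0 < p) (hpm : p < m) (y : A) :
    ∑ i : Fin m, (algebraMap ℂ A (ζ ^ (i : ℕ)) * y) ^ p = 0 := by
  have hne : ζ ^ p ≠ 1 := hζ.pow_ne_one_of_pos_of_lt hp.ne' hpm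
  have h0 : ∑ i : Fin m, (ζ ^ (i : ℕ)) ^ p = 0 := by
    rw [Fin.sum_univ_eq_sum_range fun i => (ζ ^ i) ^ p]
    have h1 := geom_sum_mul (ζ ^ p) m
    rw [← pow_mul, mul_comm p m, pow_mul, hζ.pow_eq_one, one_pow, sub_self] at h1
    have h2 := (mul_eq_zero.1 h1).resolve_right (sub_ne_zero.2 hne)
    rw [← h2]
    exact Finset.sum_congr rfl fun i _ => by rw [← pow_mul, ← pow_mul, mul_comm]
  simp only [mul_pow, ← map_pow, ← Finset.sum_mul]
  rw [← map_sum, h0, map_zero, zero_mul]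

theorem prod_sub_zeta_mul (hζ : IsPrimitiveRoot ζ m) (hm : 0 < m) (x y : A) :
    ∏ i : Fin m, (x - algebraMap ℂ A (ζ ^ (i : ℕ)) * y) = x ^ m - y ^ m := by
  classical
  let P := MvPolynomial (Fin 2) ℂ
  have hζ' : IsPrimitiveRoot (algebraMap ℂ P ζ) m :=
    hζ.map_of_injective (MvPolynomial.C_injective _ _)
  have key := hζ'.pow_sub_pow_eq_prod_sub_mul (MvPolynomial.X 0 : P) (MvPolynomial.X 1) hm
  have himg : Polynomial.nthRootsFinset m (1 : P) =
      Finset.univ.image fun i : Fin m => algebraMap ℂ P ζ ^ (i : ℕ) := by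
    symm
    refine Finset.eq_of_subset_of_card_le ?_ ?_
    · intro z hz
      obtain ⟨i, -, rfl⟩ := Finset.mem_image.1 hz
      rw [Polynomial.mem_nthRootsFinset hm, ← pow_mul, mul_comm, pow_mul, hζ'.pow_eq_one, one_pow]
    · rw [hζ'.card_nthRootsFinset, Finset.card_image_of_injective, Finset.card_univ,
        Fintype.card_fin]
      intro i j hij
      exact Fin.ext (hζ'.pow_inj i.2 j.2 hij)
  rw [himg, Finset.prod_image] at key
  · have := congrArg (MvPolynomial.aeval ![x, y]) key
    simp only [map_sub, map_pow, map_prod, map_mul, MvPolynomial.aeval_X] at this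
    simp only [Matrix.cons_val_zero, Matrix.cons_val_one] at this
    rw [this]
    refine Finset.prod_congr rfl fun i _ => ?_
    rw [map_pow, AlgHom.commutes]
  · intro i _ j _ hij
    exact Fin.ext (hζ'.pow_inj i.2 j.2 hij)

/-- The inverse of `x - ζ ^ i * y`, up to the factor `x ^ m - y ^ m`. -/
def zetaInv (m : ℕ) (x b : A) : A := ∑ p ∈ Finset.range m, b ^ p * x ^ (m - 1 - p)

theorem sub_mul_zetaInv (hζ : IsPrimitiveRoot ζ m) (x y : A) (i : Fin m) :
    (x - algebraMap ℂ A (ζ ^ (i : ℕ)) * y) * zetaInv m x (algebraMap ℂ A (ζ ^ (i : ℕ)) * y) =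
      x ^ m - y ^ m := by
  have h : (algebraMap ℂ A (ζ ^ (i : ℕ)) * y) ^ m = y ^ m := by
    rw [mul_pow, ← map_pow, ← pow_mul, mul_comm (i : ℕ), pow_mul, hζ.pow_eq_one, one_pow, map_one,
      one_mul]
  have := (Commute.all (algebraMap ℂ A (ζ ^ (i : ℕ)) * y) x).geom_sum₂_mul m
  rw [h] at this
  rw [zetaInv]
  linear_combination -this

theorem sum_zetaInv (hζ : IsPrimitiveRoot ζ m) (hm : 0 < m) (x y : A) :
    ∑ i : Fin m, zetaInv m x (algebraMap ℂ A (ζ ^ (i : ℕ)) * y) = m * x ^ (m - 1) := by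
  simp only [zetaInv]
  rw [Finset.sum_comm, Finset.sum_eq_single_of_mem 0 (Finset.mem_range.2 hm)]
  · simp
  · intro p hp hp0
    rw [← Finset.sum_mul, sum_zeta_pow_eq_zero hζ (Nat.pos_of_ne_zero hp0) (Finset.mem_range.1 hp),
      zero_mul]

end RootsOfUnity

section Hessian

variable {m : ℕ}

theorem det_lgH {x : Fin m → ℂ} (hx : ∀ i, x i ≠ 0) (ℓ : ℂ) :
    (Matrix.of (lgH x ℓ)).det = (∏ i, x i) * (1 - (m : ℂ)⁻¹ * ℓ * ∑ i, (x i)⁻¹) := by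
  have e : Matrix.of (lgH x ℓ) = Matrix.diagonal x *
      (1 + Matrix.replicateCol Unit (fun i => (x i)⁻¹) *
        Matrix.replicateRow Unit fun _ => -((m : ℂ)⁻¹ * ℓ)) := by
    ext i j
    rw [Matrix.diagonal_mul]
    simp only [Matrix.of_apply, lgH, Matrix.add_apply, Matrix.one_apply, Matrix.mul_apply,
      Matrix.replicateCol_apply, Matrix.replicateRow_apply, Finset.univ_unique, Finset.sum_singleton]
    have := hx i
    have h2 : algebraMap ℚ ℂ (m : ℚ)⁻¹ = (m : ℂ)⁻¹ := by simp
    rw [h2]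
    split_ifs <;> field_simp <;> ring
  rw [e, Matrix.det_mul, Matrix.det_diagonal, Matrix.det_one_add_replicateCol_mul_replicateRow]
  congr 1
  simp only [dotProduct]
  rw [← Finset.mul_sum]
  ring

end Hessian

namespace JetAlgebra

variable {ι A R R' : Type*} [DecidableEq ι] [CommRing A] [CommRing R] [Algebra A R]
  [CommRing R'] [Algebra A R'] [Fintype ι] {J : JetAlgebra ι A R} {J' : JetAlgebra ι A R'}
  {Φ : R →ₐ[A] R'} {M : Matrix ι ι R'}

/-- A substitution which brings `S` to the normal form `∑ i, T i ^ 2` diagonalizes its Hessian. -/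
theorem IsSubst.det_sq_mul (h : IsSubst J J' Φ M) {S V : R} {H C : ι → ι → A}
    (hS : Φ S = ∑ i, J'.T i * J'.T i) (hp : J.IsPotential H C S V) :
    J'.ev M.det ^ 2 * (Matrix.of H).det = 2 ^ Fintype.card ι := by
  set N : Matrix ι ι A := M.map J'.ev with hN
  have hdet : J'.ev M.det = N.det := by
    rw [hN]; exact RingHom.map_det (J'.ev : R' →+* A) M
  have h1 : ∀ i j, J'.ev (J'.d i (J'.d j (Φ S))) = ∑ k, ∑ l, N k i * H l k * N l j := by
    intro i j
    rw [h.chain, map_sum, map_sum, Finset.sum_comm]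
    refine Finset.sum_congr rfl fun l _ => ?_
    rw [Derivation.leibniz, h.chain]
    have e1 : J.ev (J.d l S) = 0 := by
      rw [hp.d_eq]
      simp [J.evT, ((J.d_mem_vanish hp.mem l)).2.1]
    have e2 : ∀ k, J.ev (J.d k (J.d l S)) = H l k := by
      intro k
      rw [hp.d_eq, map_add, map_add, (J.d_mem_vanish (J.d_mem_vanish hp.mem l) k).2.1, add_zero]
      simp only [map_sum, Derivation.map_smul, J.dT, map_smul]
      rw [Finset.sum_eq_single k]
      · simp
      · intro b _ hb; simp [hb.symm]
      · simp
    simp only [smul_eq_mul, map_add, map_mul, map_sum, h.ev_map, e1, e2, zero_mul, add_zero,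
      Finset.mul_sum]
    refine Finset.sum_congr rfl fun k _ => ?_
    simp only [hN, Matrix.map_apply]
    ring
  have h2 : ∀ i j, J'.ev (J'.d i (J'.d j (Φ S))) = if i = j then 2 else 0 := by
    intro i j
    rw [hS]
    simp only [map_sum, Derivation.leibniz, J'.dT, smul_eq_mul, map_add, map_mul, J'.evT]
    rw [Finset.sum_eq_single j]
    · rcases eq_or_ne i j with rfl | hij
      · simp; norm_num
      · simp [hij]
    · intro b _ hb
      simp [hb.symm]
    · simp
  have h3 : N.transpose * (Matrix.of H).transpose * N = (2 : A) • 1 := by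
    ext i j
    rw [Matrix.smul_apply, Matrix.one_apply, smul_eq_mul, mul_ite, mul_one, mul_zero, ← h2, h1]
    simp only [Matrix.mul_apply, Matrix.transpose_apply, Matrix.of_apply, Finset.sum_mul]
    rw [Finset.sum_comm]
  have h4 := congrArg Matrix.det h3
  rw [Matrix.det_mul, Matrix.det_mul, Matrix.det_transpose, Matrix.det_transpose, Matrix.det_smul,
    Matrix.det_one, mul_one] at h4
  rw [hdet, ← h4]
  ring

end JetAlgebra

section Thimble

open MvPolynomial

variable {m : ℕ}

/-- The smooth functions on `ℝ^m` substituted for the variables of the jet algebra of the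
potential, along a parametrized cycle with coordinates `g`. -/
noncomputable def cycleValue (g : Fin m → smoothAlg m) : LGVar m → smoothAlg m
  | LGVar.t i => g i
  | LGVar.e i => ⟨fun t => Complex.exp ((g i : EuclideanSpace ℝ (Fin m) → ℂ) t),
      (contDiff_coe (g i)).cexp⟩
  | LGVar.y => ⟨fun t => Complex.exp ((((m : ℂ)⁻¹ • ∑ i, g i : smoothAlg m) :
      EuclideanSpace ℝ (Fin m) → ℂ) t), (contDiff_coe _).cexp⟩

theorem partialDeriv_exp (f : smoothAlg m) (h : ContDiff ℝ ∞ fun t =>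
      Complex.exp ((f : EuclideanSpace ℝ (Fin m) → ℂ) t)) (j : Fin m) :
    partialDeriv j (⟨_, h⟩ : smoothAlg m) = (⟨_, h⟩ : smoothAlg m) * partialDeriv j f := by
  ext t
  have h1 := (differentiable_coe f t).hasFDerivAt.cexp
  have h2 : (partialDeriv j (⟨_, h⟩ : smoothAlg m) : EuclideanSpace ℝ (Fin m) → ℂ) t =
    fderiv ℝ (fun t => Complex.exp ((f : EuclideanSpace ℝ (Fin m) → ℂ) t)) t
      (EuclideanSpace.single j 1) := rfl
  rw [h2, h1.fderiv]
  simp [partialDeriv_apply]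

theorem isSubst_cycle {g : Fin m → smoothAlg m}
    (hg : ∀ i, (g i : EuclideanSpace ℝ (Fin m) → ℂ) 0 = 0) :
    JetAlgebra.IsSubst (lgJet m ℂ) (smoothJet m) (aeval (cycleValue g))
      (Matrix.of fun i j => partialDeriv j (g i)) where
  ev_map f := by
    have : (smoothJet m).ev.comp (aeval (cycleValue g)) = (lgJet m ℂ).ev := by
      refine MvPolynomial.algHom_ext fun v => ?_
      rw [AlgHom.comp_apply, aeval_X, smoothJet_ev]
      cases v with
      | t i => rw [lgJet_ev_t]; exact hg i
      | e i => rw [lgJet_ev_e]; simp [cycleValue, hg]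
      | y =>
        rw [lgJet_ev_y]
        have : (((m : ℂ)⁻¹ • ∑ i, g i : smoothAlg m) : EuclideanSpace ℝ (Fin m) → ℂ) 0 = 0 := by
          rw [← smoothJet_ev, map_smul, map_sum]
          simp [smoothJet_ev, hg]
        simp only [cycleValue, this, Complex.exp_zero]
    exact AlgHom.congr_fun this f
  chain j f := by
    change partialDeriv j _ = _
    induction f using MvPolynomial.induction_on with
    | C a =>
      have h1 : (aeval (cycleValue g)) (C a) = algebraMap ℂ (smoothAlg m) a := by simp
      rw [h1, Derivation.map_algebraMap]
      simp
    | add p q hp hq => simp only [map_add, hp, hq, mul_add, Finset.sum_add_distrib]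
    | mul_X p v hp =>
      have hv : partialDeriv j (cycleValue g v) =
          ∑ i, partialDeriv j (g i) * aeval (cycleValue g) ((lgJet m ℂ).d i (X v)) := by
        cases v with
        | t k =>
          simp only [lgJet_d_t]
          rw [Finset.sum_eq_single k]
          · simp [cycleValue]
          · intro b _ hb; simp [hb]
          · simp
        | e k =>
          simp only [lgJet_d_e]
          rw [Finset.sum_eq_single k]
          · simp only [cycleValue, if_true, aeval_X]
            rw [partialDeriv_exp, mul_comm]
          · intro b _ hb; simp [hb]
          · simp
        | y =>
          simp only [lgJet_d_y, map_smul, aeval_X]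
          simp only [cycleValue]
          rw [partialDeriv_exp, Derivation.map_smul, map_sum, ← Finset.sum_mul, mul_smul_comm,
            mul_smul_comm, mul_comm, map_inv₀, map_natCast]
      rw [map_mul, Derivation.leibniz, hp, aeval_X, hv]
      simp only [Derivation.leibniz, smul_eq_mul, map_add, map_mul, aeval_X, mul_add,
        Finset.sum_add_distrib, Finset.mul_sum, Matrix.of_apply]
      congr 1
      · exact Finset.sum_congr rfl fun i _ => by ring
      · exact Finset.sum_congr rfl fun i _ => by ring
  symm i j l := by
    exact partialDeriv_comm j i (g l)

theorem exp_eq_of_isCritical {lam : Fin m → ℂ} {κ ℓ : ℂ} {s₀ : Fin m → ℂ}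
    (h : HasFDerivAt (lgPotential lam κ) (0 : (Fin m → ℂ) →L[ℂ] ℂ) s₀)
    (hℓ : κ * Complex.exp ((∑ i, s₀ i) / m) = m * ℓ) (i : Fin m) :
    Complex.exp (s₀ i) = ℓ - lam i := by
  have hm : (m : ℂ) ≠ 0 := by exact_mod_cast (Fin.pos i).ne'
  -- restrict to the line through the critical point in the `i`th coordinate direction
  have hline : HasDerivAt (fun w : ℂ => Function.update s₀ i w) (Pi.single i 1) (s₀ i) :=
    hasDerivAt_update s₀ i (s₀ i)
  have h' : HasFDerivAt (lgPotential lam κ) (0 : (Fin m → ℂ) →L[ℂ] ℂ)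
    (Function.update s₀ i (s₀ i)) := by rwa [Function.update_eq_self]
  have h1 := h'.comp_hasDerivAt (s₀ i) hline
  have hcoord : ∀ j, HasDerivAt (fun w : ℂ => Function.update s₀ i w j)
      (if j = i then 1 else 0) (s₀ i) := by
    intro j
    have := (hasDerivAt_pi.1 hline) j
    simpa [Pi.single_apply] using this
  have hsum : HasDerivAt (fun w : ℂ => ∑ j, Function.update s₀ i w j) 1 (s₀ i) := by
    have := HasDerivAt.fun_sum (u := Finset.univ) fun j _ => hcoord j
    simpa using this
  have h2 : HasDerivAt (lgPotential lam κ ∘ fun w : ℂ => Function.update s₀ i w)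
      (∑ j, (Complex.exp (Function.update s₀ i (s₀ i) j) * (if j = i then 1 else 0) +
        lam j * (if j = i then 1 else 0)) -
        κ * (Complex.exp ((∑ j, Function.update s₀ i (s₀ i) j) / m) * (1 / m))) (s₀ i) := by
    refine HasDerivAt.sub (HasDerivAt.fun_sum fun j _ => ?_) ?_
    · exact ((hcoord j).cexp).add ((hcoord j).const_mul _)
    · exact ((hsum.div_const _).cexp).const_mul _
  have h3 := h1.unique h2
  simp only [Function.update_eq_self, mul_ite, mul_one, mul_zero] at h3
  rw [← mul_assoc, hℓ] at h3
  have h4 : (m : ℂ) * ℓ * (1 / m) = ℓ := by field_simp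
  simp only [Finset.sum_add_distrib, Finset.sum_ite_eq', Finset.mem_univ, if_true, h4] at h3
  simp only [zero_apply] at h3
  linear_combination -h3

/-- The inverse Hessian of the potential at the critical point with `x i = ℓ - ζ ^ i * lam`. -/
noncomputable def critC (m : ℕ) (ζ lam ℓ : ℂ) : Fin m → Fin m → ℂ :=
  lgC (fun i => zetaInv m ℓ (ζ ^ (i : ℕ) * lam) / (ℓ ^ m - lam ^ m))
    (ℓ * (ℓ ^ m - lam ^ m) / (m * lam ^ m))

theorem critC_isPotential {ζ lam ℓ : ℂ} (hm : 0 < m) (hζ : IsPrimitiveRoot ζ m) (hlam : lam ≠ 0)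
    (hℓ : ℓ ^ m ≠ lam ^ m) :
    (lgJet m ℂ).IsPotential (lgH (fun i => ℓ - ζ ^ (i : ℕ) * lam) ℓ) (critC m ζ lam ℓ)
      (lgS (fun i => ℓ - ζ ^ (i : ℕ) * lam) ℓ) (lgV (fun i => ℓ - ζ ^ (i : ℕ) * lam) ℓ) := by
  have hne : ℓ ^ m - lam ^ m ≠ 0 := sub_ne_zero.2 hℓ
  have hmc : (m : ℂ) ≠ 0 := by exact_mod_cast hm.ne'
  have hlm : lam ^ m ≠ 0 := pow_ne_zero _ hlam
  refine lgJet_isPotential (fun i => ?_) ?_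
  · have := sub_mul_zetaInv hζ ℓ lam i
    simp only [Algebra.algebraMap_self, RingHom.id_apply] at this
    rw [← mul_div_assoc, this, div_self hne]
  · have := sum_zetaInv hζ hm ℓ lam
    simp only [Algebra.algebraMap_self, RingHom.id_apply] at this
    rw [← Finset.sum_div, this]
    have e : ℓ ^ m = ℓ * ℓ ^ (m - 1) := by rw [← pow_succ', Nat.sub_add_cancel hm]
    field_simp
    rw [e]; ring

/-- The oscillatory integral over a thimble has an asymptotic expansion, with coefficients the sums
over Feynman diagrams at the critical point. -/
theorem thimble_expansion {ζ lam κ ℓ : ℂ} {s₀ : Fin m → ℂ}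
    {γ : EuclideanSpace ℝ (Fin m) → (Fin m → ℂ)} (hm : 0 < m) (hζ : IsPrimitiveRoot ζ m)
    (hlam : lam ≠ 0)
    (hγ : IsLefschetzThimble (lgPotential (fun i : Fin m => ζ ^ (i : ℕ) * lam) κ) s₀ γ)
    (hℓ : κ * Complex.exp ((∑ i, s₀ i) / m) = m * ℓ)
    (hint : ∃ z₀ : ℝ, z₀ < 0 ∧ Integrable
          (oscIntegrand (lgPotential (fun i : Fin m => ζ ^ (i : ℕ) * lam) κ) γ z₀)) :
    ℓ ^ m ≠ lam ^ m ∧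
    (∀ᶠ z : ℝ in 𝓝[<] 0, Integrable
          (oscIntegrand (lgPotential (fun i : Fin m => ζ ^ (i : ℕ) * lam) κ) γ z)) ∧
    ∃ Ψ : ℂ, Ψ ^ 2 * (-lam ^ m) = 1 ∧
      HasOscExpansion m (oscIntegral (lgPotential (fun i : Fin m => ζ ^ (i : ℕ) * lam) κ) γ)
        (lgPotential (fun i : Fin m => ζ ^ (i : ℕ) * lam) κ s₀) Ψ
        fun k => (lgJet m ℂ).feynman (critC m ζ lam ℓ)
          (lgV (fun i => ℓ - ζ ^ (i : ℕ) * lam) ℓ) k 1 := by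
  set W := lgPotential (fun i : Fin m => ζ ^ (i : ℕ) * lam) κ with hW
  set x : Fin m → ℂ := fun i => ℓ - ζ ^ (i : ℕ) * lam with hx
  have hmc : (m : ℂ) ≠ 0 := by exact_mod_cast hm.ne'
  have hex : ∀ i, Complex.exp (s₀ i) = x i := exp_eq_of_isCritical hγ.isCritical hℓ
  have hx0 : ∀ i, x i ≠ 0 := fun i => by rw [← hex]; exact Complex.exp_ne_zero _
  have hprod : ∏ i, x i = ℓ ^ m - lam ^ m := by
    have := prod_sub_zeta_mul hζ hm ℓ lam
    simpa only [Algebra.algebraMap_self, RingHom.id_apply] using this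
  have hℓm : ℓ ^ m - lam ^ m ≠ 0 := by
    rw [← hprod]; exact Finset.prod_ne_zero_iff.2 fun i _ => hx0 i
  have hpot := critC_isPotential hm hζ hlam (sub_ne_zero.1 hℓm)
  have hγs : ∀ i, ContDiff ℝ ∞ fun t => γ t i - s₀ i := fun i =>
    (contDiff_pi.1 hγ.smooth i).sub contDiff_const
  set g : Fin m → smoothAlg m := fun i => ⟨fun t => γ t i - s₀ i, hγs i⟩ with hg
  have hga : ∀ i t, (g i : EuclideanSpace ℝ (Fin m) → ℂ) t = γ t i - s₀ i := fun i t => rfl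
  have hsub := isSubst_cycle (g := g) fun i => by rw [hga, hγ.map_zero, sub_self]
  set M : Matrix (Fin m) (Fin m) (smoothAlg m) := Matrix.of fun i j => partialDeriv j (g i) with hM
  have hsumg : ∀ t, (((m : ℂ)⁻¹ • ∑ i, g i : smoothAlg m) : EuclideanSpace ℝ (Fin m) → ℂ) t =
      (∑ i, γ t i) / m - (∑ i, s₀ i) / m := by
    intro t
    rw [← Subalgebra.coe_val, map_smul, map_sum]
    simp only [Pi.smul_apply, Finset.sum_apply, Subalgebra.coe_val, hga, Finset.sum_sub_distrib,
      smul_eq_mul]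
    field_simp
  have hS : aeval (cycleValue g) (lgS x ℓ) = ∑ i, (smoothJet m).T i * (smoothJet m).T i := by
    ext t
    have e1 : ((∑ i, (smoothJet m).T i * (smoothJet m).T i : smoothAlg m) :
        EuclideanSpace ℝ (Fin m) → ℂ) t = W (γ t) - W s₀ := by
      rw [hγ.height, add_sub_cancel_left, EuclideanSpace.norm_sq_eq, ← Subalgebra.coe_val, map_sum]
      simp only [Finset.sum_apply, Subalgebra.coe_val]
      push_cast
      refine Finset.sum_congr rfl fun i _ => ?_
      change ((smoothJet m).T i : EuclideanSpace ℝ (Fin m) → ℂ) t *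
        ((smoothJet m).T i : EuclideanSpace ℝ (Fin m) → ℂ) t = _
      rw [smoothJet_T, Real.norm_eq_abs, ← Complex.ofReal_pow, sq_abs]
      push_cast; ring
    rw [e1, ← Subalgebra.coe_val]
    simp only [lgS, map_sub, map_sum, map_smul, map_mul, map_natCast, map_one, aeval_X, cycleValue,
      Pi.sub_apply, Finset.sum_apply, Pi.smul_apply, Pi.mul_apply, Subalgebra.coe_val, hga, hsumg]
    simp only [Pi.natCast_apply, Pi.one_apply, smul_eq_mul, hW, lgPotential]
    rw [Complex.exp_sub ((∑ i, γ t i) / m)]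
    have e2 : ∀ i, x i * (Complex.exp (γ t i - s₀ i) - 1 - (γ t i - s₀ i)) =
        Complex.exp (γ t i) + ζ ^ (i : ℕ) * lam * γ t i -
          (Complex.exp (s₀ i) + ζ ^ (i : ℕ) * lam * s₀ i) - ℓ * (γ t i - s₀ i) := by
      intro i
      have : Complex.exp (γ t i - s₀ i) * x i = Complex.exp (γ t i) := by
        rw [← hex, ← Complex.exp_add]; ring_nf
      have h2 : x i = ℓ - ζ ^ (i : ℕ) * lam := rfl
      linear_combination this + hex i - (γ t i - s₀ i) * h2
    simp only [e2, Finset.sum_sub_distrib, ← Finset.mul_sum]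
    have e3 : Complex.exp ((∑ i, s₀ i) / m) ≠ 0 := Complex.exp_ne_zero _
    have e4 : Complex.exp ((∑ i, γ t i) / m) / Complex.exp ((∑ i, s₀ i) / m) * (m * ℓ) =
        κ * Complex.exp ((∑ i, γ t i) / m) := by
      rw [← hℓ]; field_simp
    linear_combination -e4 - hℓ
  set D : smoothAlg m := M.det with hD
  have hDt : ∀ t, (D : EuclideanSpace ℝ (Fin m) → ℂ) t =
      (Matrix.of fun i j : Fin m => fderiv ℝ γ t (EuclideanSpace.single j 1) i).det := by
    intro t
    have h1 : (D : EuclideanSpace ℝ (Fin m) → ℂ) t =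
        ((Pi.evalRingHom (fun _ : EuclideanSpace ℝ (Fin m) => ℂ) t).comp
          (smoothAlg m).val.toRingHom) D := rfl
    rw [h1, hD, RingHom.map_det]
    congr 1
    ext i j
    have h2 : fderiv ℝ (fun t => γ t i - s₀ i) t (EuclideanSpace.single j 1) =
        fderiv ℝ γ t (EuclideanSpace.single j 1) i := by
      rw [fderiv_sub_const]
      have hd : DifferentiableAt ℝ γ t := hγ.smooth.differentiable (by simp) t
      have := (hasFDerivAt_pi'.1 hd.hasFDerivAt i).fderiv
      rw [this]; rfl
    exact h2
  have hosc : ∀ z t, oscIntegrand W γ z t =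
      Complex.exp (W s₀ / z) * ((Real.exp (-‖t‖ ^ 2 / (-z)) : ℂ) *
        (D : EuclideanSpace ℝ (Fin m) → ℂ) t) := by
    intro z t
    rw [oscIntegrand, hDt, hγ.height, add_div, Complex.exp_add, neg_div_neg_eq]
    push_cast
    ring
  obtain ⟨z₀, hz₀, hz₀i⟩ := hint
  have hint0 : Integrable fun t => (Real.exp (-‖t‖ ^ 2 / (-z₀)) : ℂ) *
      (D : EuclideanSpace ℝ (Fin m) → ℂ) t := by
    have := hz₀i.const_mul (Complex.exp (W s₀ / z₀))⁻¹
    refine this.congr (ae_of_all _ fun t => ?_)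
    simp only [hosc]
    rw [inv_mul_cancel_left₀ (Complex.exp_ne_zero _)]
  have hD0 := hsub.det_sq_mul hS hpot
  rw [det_lgH hx0, hprod, Fintype.card_fin] at hD0
  have hdetH : (ℓ ^ m - lam ^ m) * (1 - (m : ℂ)⁻¹ * ℓ * ∑ i, (x i)⁻¹) = -lam ^ m := by
    have h1 : ∀ i : Fin m, (x i)⁻¹ = zetaInv m ℓ (ζ ^ (i : ℕ) * lam) / (ℓ ^ m - lam ^ m) := by
      intro i
      have := sub_mul_zetaInv hζ ℓ lam i
      simp only [Algebra.algebraMap_self, RingHom.id_apply] at this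
      rw [eq_div_iff hℓm, ← this, inv_mul_cancel_left₀ (hx0 i)]
    have h2 := sum_zetaInv hζ hm ℓ lam
    simp only [Algebra.algebraMap_self, RingHom.id_apply] at h2
    simp only [h1]
    rw [← Finset.sum_div, h2]
    have e : ℓ ^ m = ℓ * ℓ ^ (m - 1) := by rw [← pow_succ', Nat.sub_add_cancel hm]
    field_simp
    rw [e]; ring
  rw [hdetH] at hD0
  refine ⟨sub_ne_zero.1 hℓm, ?_, ?_⟩
  · filter_upwards [Ioo_mem_nhdsLT hz₀] with z hz
    have := (integrable_exp_neg_div_mul (contDiff_coe D).continuous hint0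
      (neg_pos.2 hz.2) (neg_le_neg hz.1.le)).const_mul (Complex.exp (W s₀ / z))
    exact this.congr (ae_of_all _ fun t => (hosc z t).symm)
  · set c : ℝ := (2 : ℝ) ^ ((m : ℝ) / 2) with hc
    have hc0 : 0 < c := Real.rpow_pos_of_pos two_pos _
    have hc2 : (c : ℂ) ^ 2 = 2 ^ m := by
      have : c ^ 2 = 2 ^ m := by
        rw [hc, ← Real.rpow_natCast, ← Real.rpow_mul two_pos.le, ← Real.rpow_natCast]
        congr 1; push_cast; ring
      exact_mod_cast this
    have hcc : (c : ℂ) ≠ 0 := by exact_mod_cast hc0.ne'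
    refine ⟨(smoothJet m).ev D / c, ?_, fun N => ?_⟩
    · rw [div_pow, hc2, div_mul_eq_mul_div, hD0, div_self (pow_ne_zero _ two_ne_zero)]
    · have hF := hsub.isOscillatory hS
      have hr : ∀ k, (smoothJet m).gauss halfOne k D = (smoothJet m).ev D *
          (lgJet m ℂ).feynman (critC m ζ lam ℓ) (lgV x ℓ) k 1 := by
        intro k
        have h1 := hF.eq_feynman hpot k 1
        simp only [LinearMap.comp_apply, AlgHom.toLinearMap_apply, map_one,
          LinearMap.mulRight_apply, one_mul, JetAlgebra.gauss_zero] at h1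
        exact h1
      have hneg : Tendsto (fun z : ℝ => -z) (𝓝[<] 0) (𝓝[>] 0) := by
        simpa using tendsto_neg_nhdsLT (a := (0 : ℝ))
      have hL := ((laplace_expansion D (neg_pos.2 hz₀) hint0 N).comp_tendsto hneg).const_mul_left
        ((c : ℂ)⁻¹)
      have hO : (fun z : ℝ => (-z) ^ N) =O[𝓝[<] 0] fun z : ℝ => z ^ N := by
        refine Asymptotics.IsBigO.of_bound 1 (Eventually.of_forall fun z => ?_)
        rw [norm_pow, norm_pow, norm_neg, one_mul]
      refine (hL.trans hO).congr' ?_ EventuallyEq.rfl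
      filter_upwards [self_mem_nhdsWithin] with z hz
      have hz : z < 0 := hz
      have e1 : oscIntegral W γ z = Complex.exp (W s₀ / z) *
          ∫ t, (Real.exp (-‖t‖ ^ 2 / (-z)) : ℂ) * (D : EuclideanSpace ℝ (Fin m) → ℂ) t := by
        rw [oscIntegral, ← integral_const_mul]
        exact integral_congr_ae (ae_of_all _ fun t => hosc z t)
      have e2 : (-2 * Real.pi * z) ^ ((m : ℝ) / 2) = c * (Real.pi * -z) ^ ((m : ℝ) / 2) := by
        rw [hc, ← Real.mul_rpow two_pos.le (mul_nonneg Real.pi_pos.le (by linarith))]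
        congr 1; ring
      have e3 : (((Real.pi * -z) ^ ((m : ℝ) / 2) : ℝ) : ℂ) ≠ 0 := by
        exact_mod_cast (Real.rpow_pos_of_pos (mul_pos Real.pi_pos (by linarith)) _).ne'
      have e4 := Complex.exp_ne_zero (W s₀ / z)
      rw [e1, e2]
      simp only [Function.comp, hr, mul_assoc, ← Finset.mul_sum]
      push_cast
      field_simp

end Thimble

namespace JetAlgebra

section BaseChange

variable {ι A B R R' : Type*} [DecidableEq ι] [Fintype ι] [CommRing A] [CommRing B] [CommRing R]
  [CommRing R'] [Algebra A R] [Algebra B R']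
  {J : JetAlgebra ι A R} {J' : JetAlgebra ι B R'} {φ : A →+* B} {ψ : R →+* R'}

theorem map_lap (hsmul : ∀ a f, ψ (a • f) = φ a • ψ f) (hd : ∀ i f, ψ (J.d i f) = J'.d i (ψ f))
    (C : ι → ι → A) (f : R) : ψ (J.lap C f) = J'.lap (fun i j => φ (C i j)) (ψ f) := by
  simp only [lap_apply, map_sum, hsmul, hd]

theorem map_lap_pow (hsmul : ∀ a f, ψ (a • f) = φ a • ψ f)
    (hd : ∀ i f, ψ (J.d i f) = J'.d i (ψ f)) (C : ι → ι → A) (k : ℕ) (f : R) :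
    ψ ((J.lap C ^ k) f) = (J'.lap (fun i j => φ (C i j)) ^ k) (ψ f) := by
  induction k generalizing f with
  | zero => rfl
  | succ k ih => rw [pow_succ, pow_succ, Module.End.mul_apply, Module.End.mul_apply, ih,
      map_lap hsmul hd]

theorem map_feynman [Algebra ℚ A] [Algebra ℚ B] (hsmul : ∀ a f, ψ (a • f) = φ a • ψ f)
    (hd : ∀ i f, ψ (J.d i f) = J'.d i (ψ f)) (hev : ∀ f, φ (J.ev f) = J'.ev (ψ f))
    (C : ι → ι → A) (V : R) (k : ℕ) (f : R) :
    φ (J.feynman C V k f) = J'.feynman (fun i j => φ (C i j)) (ψ V) k (ψ f) := by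
  have hq : ∀ q : ℚ, φ (algebraMap ℚ A q) = algebraMap ℚ B q := fun q =>
    RingHom.congr_fun (Subsingleton.elim (φ.comp (algebraMap ℚ A)) (algebraMap ℚ B)) q
  simp only [feynman_apply, gauss_apply, map_sum, map_mul, hq, hev, map_lap_pow hsmul hd, map_pow,
    map_neg]

end BaseChange

section Scaling

variable {ι A R : Type*} [DecidableEq ι] [Fintype ι] [CommRing A] [CommRing R] [Algebra A R]
  (J : JetAlgebra ι A R)

theorem lap_smul (c : A) (C : ι → ι → A) : J.lap (fun i j => c * C i j) = c • J.lap C := by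
  ext f
  simp only [lap_apply, LinearMap.smul_apply, Finset.smul_sum, smul_smul]

/-- Multiplying the potential by a unit `u` multiplies the coefficient of `h ^ k` by `u ^ (-k)`. -/
theorem feynman_smul [Algebra ℚ A] {u v : A} (huv : u * v = 1) (C : ι → ι → A) (V : R) (k : ℕ) (f : R) :
    J.feynman (fun i j => v * C i j) (u • V) k f = v ^ k * J.feynman C V k f := by
  simp only [feynman_apply, gauss_apply, Finset.mul_sum, lap_smul]
  refine Finset.sum_congr rfl fun n _ => ?_
  have e : (-(u • V)) ^ n * f = u ^ n • ((-V) ^ n * f) := by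
    rw [← smul_neg, smul_pow, smul_mul_assoc]
  have h1 : v ^ (k + n) * u ^ n = v ^ k := by
    rw [pow_add, mul_assoc, ← mul_pow, mul_comm v u, huv, one_pow, mul_one]
  rw [e, smul_pow, LinearMap.smul_apply, map_smul, map_smul, map_smul, smul_eq_mul, smul_eq_mul,
    ← h1]
  ring

end Scaling

end JetAlgebra

section

variable {m : ℕ} {A B : Type*} [CommRing A] [CommRing B] [Algebra ℚ A] [Algebra ℚ B]

open MvPolynomial

theorem lgJet_map_feynman (φ : A →+* B) (C : Fin m → Fin m → A) (x : Fin m → A) (ℓ : A) (k : ℕ)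
    (f : MvPolynomial (LGVar m) A) :
    φ ((lgJet m A).feynman C (lgV x ℓ) k f) =
      (lgJet m B).feynman (fun i j => φ (C i j)) (lgV (fun i => φ (x i)) (φ ℓ)) k
        (MvPolynomial.map φ f) := by
  have hq : ∀ q : ℚ, φ (algebraMap ℚ A q) = algebraMap ℚ B q := fun q =>
    RingHom.congr_fun (Subsingleton.elim (φ.comp (algebraMap ℚ A)) (algebraMap ℚ B)) q
  have hsmul : ∀ (a : A) (f : MvPolynomial (LGVar m) A),
      MvPolynomial.map φ (a • f) = φ a • MvPolynomial.map φ f := by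
    intro a f
    rw [smul_eq_C_mul, smul_eq_C_mul, map_mul, map_C]
  have hV : MvPolynomial.map φ (lgV x ℓ) = lgV (fun i => φ (x i)) (φ ℓ) := by
    simp only [lgV, lgS, lgH, map_sub, map_sum, hsmul, map_mul, map_X, map_natCast, map_one, hq]
    simp only [apply_ite φ, map_zero]
  rw [JetAlgebra.map_feynman (J' := lgJet m B) (ψ := MvPolynomial.map φ) hsmul ?_ ?_, hV]
  · intro i f
    induction f using MvPolynomial.induction_on with
    | C a => simp [← MvPolynomial.algebraMap_eq]
    | add p q hp hq => simp only [map_add, hp, hq]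
    | mul_X p v hp =>
      have hv : MvPolynomial.map φ ((lgJet m A).d i (X v)) = (lgJet m B).d i (X v) := by
        cases v with
        | t j => simp only [lgJet_d_t]; split_ifs <;> simp
        | e j => simp only [lgJet_d_e]; split_ifs <;> simp
        | y => simp only [lgJet_d_y, hsmul, hq, map_X]
      simp only [Derivation.leibniz, map_add, map_mul, smul_eq_mul, hp, map_X, hv]
  · intro f
    induction f using MvPolynomial.induction_on with
    | C a => simp [← MvPolynomial.algebraMap_eq]
    | add p q hp hq => simp only [map_add, hp, hq]
    | mul_X p v hp =>
      have hv : φ ((lgJet m A).ev (X v)) = (lgJet m B).ev (X v) := by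
        cases v <;> simp [lgJet_ev_t, lgJet_ev_e, lgJet_ev_y]
      simp only [map_mul, map_X, hp, hv]

end

/-- The parameters of the Landau--Ginzburg potential divided by `L_α`: the critical point is
`x i = 1 - ζ ^ i * β`, and `T = β ^ (-m)` is `L ^ m`. -/
structure LGParam (m : ℕ) (A : Type*) [CommRing A] [Algebra ℂ A] where
  ζ : ℂ
  β : A
  T : A
  U : A
  pos : 0 < m
  primitive : IsPrimitiveRoot ζ m
  β_pow_mul : β ^ m * T = 1
  U_mul : U * (T - 1) = 1

namespace LGParam

section

variable {m : ℕ} {A : Type*} [CommRing A] [Algebra ℂ A] (P : LGParam m A)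

/-- The `m`th roots of `T⁻¹`. -/
noncomputable def b (i : Fin m) : A := algebraMap ℂ A (P.ζ ^ (i : ℕ)) * P.β

/-- The coordinates of the critical point. -/
noncomputable def x (i : Fin m) : A := 1 - P.b i

/-- The inverses of the coordinates of the critical point. -/
noncomputable def y (i : Fin m) : A := P.T * P.U * zetaInv m 1 (P.b i)

theorem b_pow_mul (i : Fin m) : P.b i ^ m * P.T = 1 := by
  rw [b, mul_pow, ← map_pow, ← pow_mul, mul_comm (i : ℕ), pow_mul, P.primitive.pow_eq_one, one_pow,
    map_one, one_mul, P.β_pow_mul]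

theorem x_mul_y (i : Fin m) : P.x i * P.y i = 1 := by
  have h := sub_mul_zetaInv P.primitive (1 : A) P.β i
  rw [one_pow] at h
  have h1 := P.β_pow_mul
  have h2 := P.U_mul
  rw [x, y, b]
  linear_combination P.T * P.U * h + P.U * -h1 + h2

theorem sum_y : ∑ i, P.y i = m * (P.T * P.U) := by
  have h := sum_zetaInv P.primitive P.pos (1 : A) P.β
  rw [one_pow, mul_one] at h
  simp only [y, b]
  rw [← Finset.mul_sum, h, mul_comm]

theorem sum_b_pow {p : ℕ} (hp : 0 < p) (hpm : p < m) : ∑ i, P.b i ^ p = 0 :=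
  sum_zeta_pow_eq_zero P.primitive hp hpm P.β

theorem sum_x_pow {l : ℕ} (hl : l < m) : ∑ i, P.x i ^ l = m := by
  have e : ∀ i, P.x i ^ l = ∑ p ∈ Finset.range (l + 1), (-1) ^ p * (l.choose p) * P.b i ^ p := by
    intro i
    rw [x, sub_eq_neg_add, add_pow]
    refine Finset.sum_congr rfl fun p _ => ?_
    rw [one_pow, neg_pow]; ring
  simp only [e]
  rw [Finset.sum_comm, Finset.sum_eq_single_of_mem 0 (by simp)]
  · simp
  · intro p hp hp0
    rw [← Finset.mul_sum, P.sum_b_pow (Nat.pos_of_ne_zero hp0) (by simp at hp; omega), mul_zero]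

/-- The recursion for the power sums of the inverses of the `x i`, which are roots of the polynomial
`T * (1 - x) ^ m - 1` in `x`. -/
theorem sum_y_pow (j : ℕ) (hj : 0 < j) :
    (P.T - 1) * ∑ i, P.y i ^ j =
      -P.T * ∑ c ∈ Finset.range j, (m.choose (c + 1) : A) * (-1) ^ (c + 1) * ∑ i, P.y i ^ (j - (c + 1)) +
      P.T * m * ∑ c ∈ Finset.range (j + 1), (m.choose c : A) * (-1) ^ c := by
  have h1 : ∀ i, ∑ c ∈ Finset.range (m + 1), (m.choose c : A) * (-1) ^ c * P.T * P.x i ^ c = 1 := by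
    intro i
    have : P.b i = -P.x i + 1 := by rw [x]; ring
    conv_rhs => rw [← P.b_pow_mul i, this]
    rw [add_pow, Finset.sum_mul]
    refine Finset.sum_congr rfl fun p _ => ?_
    rw [one_pow, neg_pow]; ring
  -- multiply by `y i ^ j` and split at `c = j`
  have h2 : ∀ i, P.y i ^ j = ∑ c ∈ Finset.range (m + 1 + j), (m.choose c : A) * (-1) ^ c * P.T *
      (P.y i ^ (j - c) * P.x i ^ (c - j)) := by
    intro i
    conv_lhs => rw [← one_mul (P.y i ^ j), ← h1 i, Finset.sum_mul]
    refine (Finset.sum_subset (Finset.range_mono (Nat.le_add_right _ _)) fun c _ hc => ?_).trans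
      (Finset.sum_congr rfl fun c _ => ?_)
    · rw [Nat.choose_eq_zero_of_lt (by simpa using hc)]; simp
    · have hxy := P.x_mul_y i
      rcases le_total c j with h | h
      · obtain ⟨d, rfl⟩ := Nat.exists_eq_add_of_le h
        rw [Nat.add_sub_cancel_left, Nat.sub_eq_zero_of_le h, pow_zero, mul_one]
        have e : P.y i ^ (c + d) * P.x i ^ c = P.y i ^ d := by
          rw [pow_add, mul_right_comm, ← mul_pow, mul_comm (P.y i), hxy, one_pow, one_mul]
        linear_combination (m.choose c) * (-1) ^ c * P.T * e
      · obtain ⟨d, rfl⟩ := Nat.exists_eq_add_of_le h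
        rw [Nat.add_sub_cancel_left, Nat.sub_eq_zero_of_le h, pow_zero, one_mul]
        have e : P.x i ^ (j + d) * P.y i ^ j = P.x i ^ d := by
          rw [pow_add, mul_right_comm, ← mul_pow, hxy, one_pow, one_mul]
        linear_combination (m.choose (j + d)) * (-1) ^ (j + d) * P.T * e
  have h3 : ∑ i, P.y i ^ j = ∑ c ∈ Finset.range (m + 1 + j), (m.choose c : A) * (-1) ^ c * P.T *
      ∑ i, P.y i ^ (j - c) * P.x i ^ (c - j) := by
    rw [Finset.sum_congr rfl fun i _ => h2 i, Finset.sum_comm]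
    simp only [Finset.mul_sum]
  have h4 : ∑ c ∈ Finset.range m, ((m.choose (c + 1 + j)) : A) * (-1) ^ (c + 1 + j) =
      -∑ c ∈ Finset.range (j + 1), (m.choose c : A) * (-1) ^ c := by
    rw [eq_neg_iff_add_eq_zero, add_comm]
    have h5 := Finset.sum_range_add (fun c => ((m.choose c) : A) * (-1) ^ c) (j + 1) m
    have h6 : ∑ c ∈ Finset.range (j + 1 + m), ((m.choose c) : A) * (-1) ^ c = 0 := by
      have h7 := Int.alternating_sum_range_choose_of_ne P.pos.ne'
      have h8 : ∑ c ∈ Finset.range (m + 1), ((m.choose c) : A) * (-1) ^ c = 0 := by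
        have := congrArg (Int.cast : ℤ → A) h7
        push_cast at this
        rw [← this]
        exact Finset.sum_congr rfl fun c _ => mul_comm _ _
      rw [← h8]
      refine (Finset.sum_subset (Finset.range_mono (by omega)) fun c _ hc => ?_).symm
      rw [Nat.choose_eq_zero_of_lt (by simpa using hc)]; simp
    rw [h6] at h5
    rw [h5]
    refine congrArg _ (Finset.sum_congr rfl fun c _ => ?_)
    rw [show c + 1 + j = j + 1 + c by ring]
  rw [show m + 1 + j = j + 1 + m by ring, Finset.sum_range_add, Finset.sum_range_succ'] at h3
  have h9 : ∀ c ∈ Finset.range m, ((m.choose (j + 1 + c)) : A) * (-1) ^ (j + 1 + c) * P.T *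
      ∑ i, P.y i ^ (j - (j + 1 + c)) * P.x i ^ (j + 1 + c - j) =
      P.T * m * ((m.choose (c + 1 + j)) * (-1) ^ (c + 1 + j)) := by
    intro c hc
    have e1 : j - (j + 1 + c) = 0 := by omega
    have e2 : j + 1 + c - j = c + 1 := by omega
    rw [e1, e2, show j + 1 + c = c + 1 + j by ring]
    by_cases hcm : c + 1 < m
    · simp only [pow_zero, one_mul, P.sum_x_pow hcm]; ring
    · rw [Nat.choose_eq_zero_of_lt (by omega)]; simp
  have h10 : ∀ c ∈ Finset.range j, ((m.choose (c + 1)) : A) * (-1) ^ (c + 1) * P.T *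
      ∑ i, P.y i ^ (j - (c + 1)) * P.x i ^ (c + 1 - j) =
      P.T * ((m.choose (c + 1)) * (-1) ^ (c + 1) * ∑ i, P.y i ^ (j - (c + 1))) := by
    intro c hc
    have e2 : c + 1 - j = 0 := by simp at hc; omega
    simp only [e2, pow_zero, mul_one]; ring
  rw [Finset.sum_congr rfl h9, Finset.sum_congr rfl h10, ← Finset.mul_sum, ← Finset.mul_sum, h4]
    at h3
  simp only [Nat.choose_zero_right, Nat.cast_one, pow_zero, one_mul, Nat.sub_zero, Nat.zero_sub,
    mul_one] at h3
  linear_combination -h3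

end

end LGParam

namespace LGParam

open MvPolynomial

section Potential

variable {m : ℕ} {A : Type*} [CommRing A] [Algebra ℂ A] [Algebra ℚ A] (P : LGParam m A)

/-- The inverse of the Hessian. -/
noncomputable def covar : Fin m → Fin m → A :=
  lgC P.y (algebraMap ℚ A (m : ℚ)⁻¹ * (P.T - 1))

theorem inv_mul_natCast (P : LGParam m A) : algebraMap ℚ A (m : ℚ)⁻¹ * (m : A) = 1 :=
  algebraMap_inv_natCast_mul (⟨0, P.pos⟩ : Fin m)

theorem isPotential : (lgJet m A).IsPotential (lgH P.x 1) P.covar (lgS P.x 1) (lgV P.x 1) := by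
  refine lgJet_isPotential P.x_mul_y ?_
  rw [P.sum_y]
  have h := P.inv_mul_natCast
  have h2 := P.U_mul
  linear_combination (P.T - 1) * h - (P.T - 1) * P.T * P.U * h - P.T * h2

/-- The coefficient of `h ^ k` in the normalized asymptotic expansion of `∫ e ^ (-S / h) f`, where
`S` is the potential divided by `L_α`, multiplied by `m ^ k`. -/
noncomputable def expect (k : ℕ) : MvPolynomial (LGVar m) A →ₗ[A] A :=
  (m : A) ^ k • (lgJet m A).feynman P.covar (lgV P.x 1) k

end Potential

section Universality

/-- The derivation of `ℚ[T, E]` with `T ↦ 1` and `E ↦ E`. -/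
noncomputable def expDeriv : Derivation ℚ (MvPolynomial (Fin 2) ℚ) (MvPolynomial (Fin 2) ℚ) :=
  mkDerivation ℚ ![1, X 1]

/-- The value at the origin of a polynomial in `T` and `E = exp T`. -/
noncomputable def expEval : MvPolynomial (Fin 2) ℚ →ₐ[ℚ] ℚ := aeval ![0, 1]

section

variable {m : ℕ} {A : Type*} [CommRing A] [Algebra ℚ A]

/-- A polynomial in `T` and `E = exp T`, as a function of the `i`th coordinate. -/
noncomputable def coordFun (i : Fin m) : MvPolynomial (Fin 2) ℚ →ₐ[ℚ] MvPolynomial (LGVar m) A :=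
  aeval ![X (LGVar.t i), X (LGVar.e i)]

theorem ev_coordFun (i : Fin m) (f : MvPolynomial (Fin 2) ℚ) :
    (lgJet m A).ev (coordFun i f) = algebraMap ℚ A (expEval f) := by
  have : ((lgJet m A).ev.restrictScalars ℚ).comp (coordFun i) =
      (Algebra.ofId ℚ A).comp expEval := by
    refine algHom_ext fun v => ?_
    fin_cases v <;> simp [coordFun, expEval, lgJet_ev_t, lgJet_ev_e]
  exact AlgHom.congr_fun this f

theorem d_coordFun (i j : Fin m) (f : MvPolynomial (Fin 2) ℚ) :
    (lgJet m A).d j (coordFun i f) = if j = i then coordFun i (expDeriv f) else 0 := by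
  induction f using MvPolynomial.induction_on with
  | C a =>
    have h : coordFun i (MvPolynomial.C a) =
        algebraMap ℚ (MvPolynomial (LGVar m) A) a := (coordFun i).commutes a
    have h2 : expDeriv (MvPolynomial.C a) = 0 := expDeriv.map_algebraMap a
    rw [h, h2, map_zero, ite_self, IsScalarTower.algebraMap_apply ℚ A,
      Derivation.map_algebraMap]
  | add p q hp hq =>
    rw [map_add, map_add, hp, hq, map_add, map_add]
    split_ifs <;> simp
  | mul_X p v hp =>
    have hv : (lgJet m A).d j (coordFun i (X v)) = if j = i then coordFun i (expDeriv (X v)) else 0 := by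
      fin_cases v
      · simp [coordFun, expDeriv, lgJet_d_t, mkDerivation_X]
      · simp only [coordFun, expDeriv, mkDerivation_X, aeval_X]
        simp [lgJet_d_e]
    rw [map_mul, Derivation.leibniz, hp, hv, Derivation.leibniz]
    split_ifs <;> simp

end

section

variable {m : ℕ} {A : Type*} [CommRing A] [Algebra ℂ A] (P : LGParam m A)

/-- The weights of the mean values `P.mean a`. -/
noncomputable def weight : ℕ → Fin m → A
  | 0, i => P.x i
  | a + 1, i => P.y i ^ a

theorem weight_mul_y (a : ℕ) (i : Fin m) : P.weight a i * P.y i = P.weight (a + 1) i := by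
  cases a with
  | zero => simp [weight, P.x_mul_y]
  | succ a => simp [weight, pow_succ]

theorem weight_mul_weight_mul_y (a b : ℕ) (i : Fin m) :
    P.weight a i * P.weight b i * P.y i = P.weight (a + b) i := by
  induction a with
  | zero => rw [zero_add, mul_assoc, weight_mul_y, ← weight_mul_y, mul_comm, mul_assoc,
      mul_comm (P.y i), weight, P.x_mul_y, mul_one]
  | succ a ih =>
    rw [← weight_mul_y, add_right_comm, ← weight_mul_y P (a + b), ← ih]
    ring

variable [Algebra ℚ A]

/-- The mean value of the functions `f` of the single coordinates, with weights `x i ^ (1 - a)`. -/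
noncomputable def mean (a : ℕ) (f : MvPolynomial (Fin 2) ℚ) : MvPolynomial (LGVar m) A :=
  algebraMap ℚ A (m : ℚ)⁻¹ • ∑ i, P.weight a i • coordFun i f

/-- The derivative in the direction of the vector `(y i)`. -/
noncomputable def yDeriv : Derivation A (MvPolynomial (LGVar m) A) (MvPolynomial (LGVar m) A) :=
  ∑ i, P.y i • (lgJet m A).d i

theorem yDeriv_apply (f : MvPolynomial (LGVar m) A) :
    P.yDeriv f = ∑ i, P.y i • (lgJet m A).d i f := by
  rw [yDeriv, ← Derivation.coeFnAddMonoidHom_apply, map_sum, Finset.sum_apply]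
  rfl

/-- The Dirichlet form of the diagonal part of the Laplacian. -/
noncomputable def grad (f g : MvPolynomial (LGVar m) A) : MvPolynomial (LGVar m) A :=
  (m : A) • ∑ i, P.y i • ((lgJet m A).d i f * (lgJet m A).d i g)

/-- The diagonal part of the Laplacian. -/
noncomputable def diagLap (f : MvPolynomial (LGVar m) A) : MvPolynomial (LGVar m) A :=
  (m : A) • ∑ i, P.y i • (lgJet m A).d i ((lgJet m A).d i f)

theorem natCast_smul_lap (f : MvPolynomial (LGVar m) A) :
    (m : A) • (lgJet m A).lap P.covar f = P.diagLap f - (P.T - 1) • P.yDeriv (P.yDeriv f) := by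
  have h := P.inv_mul_natCast
  simp only [JetAlgebra.lap_apply, covar, lgC, sub_smul, Finset.sum_sub_distrib, smul_sub, diagLap,
    ite_smul, zero_smul, Finset.sum_ite_eq, Finset.mem_univ, if_true]
  congr 1
  rw [← sub_smul]
  simp only [yDeriv_apply, map_sum, Derivation.map_smul, Finset.smul_sum, smul_smul]
  refine Finset.sum_congr rfl fun i _ => Finset.sum_congr rfl fun j _ => ?_
  rw [(lgJet m A).comm]
  congr 1
  linear_combination (P.T - 1) * P.y i * P.y j * h

theorem d_mean (a : ℕ) (f : MvPolynomial (Fin 2) ℚ) (i : Fin m) :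
    (lgJet m A).d i (P.mean a f) =
      (algebraMap ℚ A (m : ℚ)⁻¹ * P.weight a i) • coordFun i (expDeriv f) := by
  simp only [mean, Derivation.map_smul, map_sum, d_coordFun, smul_ite, smul_zero, Finset.sum_ite_eq,
    Finset.mem_univ, if_true, smul_smul]

theorem yDeriv_mean (a : ℕ) (f : MvPolynomial (Fin 2) ℚ) :
    P.yDeriv (P.mean a f) = P.mean (a + 1) (expDeriv f) := by
  simp only [yDeriv_apply, d_mean]
  simp only [mean, smul_smul, ← P.weight_mul_y, Finset.smul_sum]
  exact Finset.sum_congr rfl fun i _ => by congr 1; ring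

theorem yDeriv_y : P.yDeriv (X LGVar.y) =
    (algebraMap ℚ A (m : ℚ)⁻¹ * ∑ i, P.y i) • X LGVar.y := by
  simp only [yDeriv_apply, lgJet_d_y, smul_smul, ← Finset.sum_smul, ← Finset.sum_mul]
  rw [mul_comm]

theorem grad_y (f : MvPolynomial (LGVar m) A) :
    P.grad (X LGVar.y) f = X LGVar.y * P.yDeriv f := by
  have h := P.inv_mul_natCast
  simp only [grad, yDeriv_apply, lgJet_d_y, Finset.smul_sum, smul_smul, Finset.mul_sum,
    smul_mul_assoc, mul_smul_comm]
  refine Finset.sum_congr rfl fun i _ => ?_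
  congr 1
  linear_combination P.y i * h

theorem grad_mean_mean (a b : ℕ) (f g : MvPolynomial (Fin 2) ℚ) :
    P.grad (P.mean a f) (P.mean b g) = P.mean (a + b) (expDeriv f * expDeriv g) := by
  have h := P.inv_mul_natCast
  simp only [grad, d_mean]
  simp only [mean, Finset.smul_sum, smul_smul, smul_mul_assoc, mul_smul_comm, map_mul,
    ← P.weight_mul_weight_mul_y]
  refine Finset.sum_congr rfl fun i _ => ?_
  congr 1
  linear_combination algebraMap ℚ A (m : ℚ)⁻¹ * P.weight a i * P.weight b i * P.y i * h

theorem diagLap_mean (a : ℕ) (f : MvPolynomial (Fin 2) ℚ) :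
    P.diagLap (P.mean a f) = (m : A) • P.mean (a + 1) (expDeriv (expDeriv f)) := by
  simp only [diagLap, d_mean, Derivation.map_smul, d_coordFun, if_true]
  simp only [mean, Finset.smul_sum, smul_smul, ← P.weight_mul_y]
  exact Finset.sum_congr rfl fun i _ => by congr 1; ring

theorem diagLap_y : P.diagLap (X LGVar.y) =
    (algebraMap ℚ A (m : ℚ)⁻¹ * ∑ i, P.y i) • X LGVar.y := by
  have h := P.inv_mul_natCast
  simp only [diagLap, lgJet_d_y, Derivation.map_smul, smul_smul, ← Finset.sum_smul,
    ← Finset.sum_mul]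
  congr 1
  linear_combination algebraMap ℚ A (m : ℚ)⁻¹ * (∑ i, P.y i) * h

theorem diagLap_mul (f g : MvPolynomial (LGVar m) A) :
    P.diagLap (f * g) = f * P.diagLap g + g * P.diagLap f + 2 * P.grad f g := by
  simp only [diagLap, grad, Derivation.leibniz, map_add, smul_eq_mul, smul_add,
    Finset.sum_add_distrib, Finset.mul_sum, mul_smul_comm, two_mul, Finset.smul_sum]
  have e : ∀ i, (lgJet m A).d i g * (lgJet m A).d i f = (lgJet m A).d i f * (lgJet m A).d i g :=
    fun i => mul_comm _ _
  simp only [e]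
  ring

theorem grad_comm (f g : MvPolynomial (LGVar m) A) : P.grad f g = P.grad g f := by
  simp only [grad, mul_comm]

theorem grad_mul (f g h : MvPolynomial (LGVar m) A) :
    P.grad f (g * h) = g * P.grad f h + h * P.grad f g := by
  simp only [grad, Derivation.leibniz, smul_eq_mul, Finset.mul_sum, mul_smul_comm, mul_add,
    smul_add, Finset.sum_add_distrib]
  congr 1 <;> exact congrArg _ (Finset.sum_congr rfl fun i _ => by congr 1; ring)

theorem ev_mean (a : ℕ) (f : MvPolynomial (Fin 2) ℚ) :
    (lgJet m A).ev (P.mean a f) =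
      algebraMap ℚ A (m : ℚ)⁻¹ * (∑ i, P.weight a i) * algebraMap ℚ A (expEval f) := by
  simp only [mean, map_smul, map_sum, ev_coordFun, smul_eq_mul, ← Finset.sum_mul]
  ring

theorem inv_smul_lgV :
    algebraMap ℚ A (m : ℚ)⁻¹ • lgV P.x 1 =
      P.mean 0 (X 1 - 1 - X 0 - MvPolynomial.C 2⁻¹ * X 0 ^ 2) - (X LGVar.y - 1) + P.mean 1 (X 0) +
        algebraMap ℚ (MvPolynomial (LGVar m) A) 2⁻¹ * P.mean 1 (X 0) ^ 2 := by
  have h := P.inv_mul_natCast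
  have hC : ∀ i : Fin m, coordFun i (MvPolynomial.C (2⁻¹ : ℚ)) =
      algebraMap ℚ (MvPolynomial (LGVar m) A) 2⁻¹ := fun i => (coordFun i).commutes _
  have h2 : ∀ i : Fin m, coordFun (A := A) i (X 0) = X (LGVar.t i) := fun i => by simp [coordFun]
  have h3 : ∀ i : Fin m, coordFun (A := A) i (X 1) = X (LGVar.e i) := fun i => by simp [coordFun]
  have hs : ∀ (q : ℚ) (f : MvPolynomial (LGVar m) A), algebraMap ℚ A q • f =
      algebraMap ℚ (MvPolynomial (LGVar m) A) q * f := fun q f => by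
    rw [Algebra.smul_def, ← IsScalarTower.algebraMap_apply ℚ A]
  have h' : algebraMap ℚ (MvPolynomial (LGVar m) A) (m : ℚ)⁻¹ * (m : MvPolynomial (LGVar m) A) = 1 := by
    have := congrArg (algebraMap A (MvPolynomial (LGVar m) A)) h
    rwa [map_mul, map_natCast, map_one, ← IsScalarTower.algebraMap_apply ℚ A] at this
  simp only [lgV, lgS, lgH, mean, map_sub, map_mul, map_pow, hC, h2, h3, map_one, weight, pow_zero,
    one_smul, mul_one, sub_smul, ite_smul, zero_smul, Finset.sum_sub_distrib, Finset.sum_ite_eq,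
    Finset.mem_univ, if_true, smul_sub, hs, ← Finset.mul_sum]
  have e : ∑ i : Fin m, P.x i • (algebraMap ℚ (MvPolynomial (LGVar m) A) 2⁻¹ * X (LGVar.t i) ^ 2) =
      algebraMap ℚ (MvPolynomial (LGVar m) A) 2⁻¹ *
        ∑ i : Fin m, P.x i • (X (LGVar.t i) * X (LGVar.t i)) := by
    rw [Finset.mul_sum]
    exact Finset.sum_congr rfl fun i _ => by rw [mul_smul_comm, pow_two]
  rw [e, ← Finset.sum_mul]
  linear_combination (-(X LGVar.y - 1)) * h'

end

end Universality

end LGParam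

/-- All instances of the normalized Landau--Ginzburg potential, over all coefficient rings. -/
structure LGInstance where
  m : ℕ
  A : Type
  [commRing : CommRing A]
  [algebraComplex : Algebra ℂ A]
  [algebraRat : Algebra ℚ A]
  P : LGParam m A

attribute [instance] LGInstance.commRing LGInstance.algebraComplex LGInstance.algebraRat

namespace LGInstance

open MvPolynomial LGParam

/-- Families of constants which are given by one polynomial in `m`, `T` and `U`. -/
noncomputable def univ : Subalgebra ℚ (∀ j : LGInstance, j.A) :=
  (aeval ![fun j : LGInstance => (j.m : j.A), fun j => j.P.T, fun j => j.P.U] :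
    MvPolynomial (Fin 3) ℚ →ₐ[ℚ] (∀ j : LGInstance, j.A)).range

theorem mem_univ {u : ∀ j : LGInstance, j.A} :
    u ∈ univ ↔ ∃ N : MvPolynomial (Fin 3) ℚ, ∀ j, u j = aeval ![(j.m : j.A), j.P.T, j.P.U] N := by
  have e : ∀ (j : LGInstance) (N : MvPolynomial (Fin 3) ℚ),
      (aeval ![fun j : LGInstance => (j.m : j.A), fun j => j.P.T, fun j => j.P.U] N :
        ∀ j : LGInstance, j.A) j = aeval ![(j.m : j.A), j.P.T, j.P.U] N := by
    intro j N
    have h : (Pi.evalAlgHom ℚ (fun j : LGInstance => j.A) j).comp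
        (aeval ![fun j : LGInstance => (j.m : j.A), fun j => j.P.T, fun j => j.P.U]) =
        aeval ![(j.m : j.A), j.P.T, j.P.U] := by
      refine algHom_ext fun v => ?_
      fin_cases v <;> simp
    exact AlgHom.congr_fun h N
  constructor
  · rintro ⟨N, rfl⟩
    exact ⟨N, fun j => e j N⟩
  · rintro ⟨N, hN⟩
    exact ⟨N, funext fun j => (e j N).trans (hN j).symm⟩

theorem m_mem_univ : (fun j : LGInstance => (j.m : j.A)) ∈ univ :=
  mem_univ.2 ⟨X 0, fun j => by simp⟩

theorem T_mem_univ : (fun j : LGInstance => j.P.T) ∈ univ :=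
  mem_univ.2 ⟨X 1, fun j => by simp⟩

theorem U_mem_univ : (fun j : LGInstance => j.P.U) ∈ univ :=
  mem_univ.2 ⟨X 2, fun j => by simp⟩

theorem rat_mem_univ (q : ℚ) : (fun j : LGInstance => algebraMap ℚ j.A q) ∈ univ :=
  univ.algebraMap_mem q

theorem choose_mem_univ (c : ℕ) : (fun j : LGInstance => (j.m.choose c : j.A)) ∈ univ := by
  induction c with
  | zero =>
    simp only [Nat.choose_zero_right, Nat.cast_one]
    exact univ.one_mem
  | succ c ih =>
    have h := mul_mem (rat_mem_univ ((c + 1 : ℚ)⁻¹)) (mul_mem ih (sub_mem m_mem_univ (rat_mem_univ c)))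
    convert h using 1
    funext j
    simp only [Pi.mul_apply, Pi.sub_apply, map_natCast]
    have h1 : algebraMap ℚ j.A ((c + 1 : ℚ)⁻¹) * ((c : j.A) + 1) = 1 := by
      have : (c + 1 : ℚ) ≠ 0 := by positivity
      rw [← map_natCast (algebraMap ℚ j.A), ← map_one (algebraMap ℚ j.A), ← map_add, ← map_mul,
        inv_mul_cancel₀ this]
    have h2 : (j.m.choose (c + 1) : j.A) * (c + 1) = j.m.choose c * (j.m - c) := by
      rcases le_or_gt c j.m with h | h
      · have := congrArg (Nat.cast : ℕ → j.A) (Nat.choose_succ_right_eq j.m c)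
        push_cast [Nat.cast_sub h] at this
        exact this
      · rw [Nat.choose_eq_zero_of_lt h, Nat.choose_eq_zero_of_lt (by omega)]; simp
    rw [← h2]
    linear_combination (-(j.m.choose (c + 1) : j.A)) * h1

theorem powMean_mem_univ (a : ℕ) :
    (fun j : LGInstance => algebraMap ℚ j.A (j.m : ℚ)⁻¹ * ∑ i, j.P.y i ^ a) ∈ univ := by
  induction a using Nat.strong_induction_on with
  | _ a ih =>
  rcases Nat.eq_zero_or_pos a with rfl | ha
  · convert univ.one_mem using 1
    funext j
    simp [j.P.inv_mul_natCast]
  have hneg : ∀ c : ℕ, (fun j : LGInstance => (-1 : j.A) ^ c) ∈ univ := fun c =>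
    pow_mem (neg_mem univ.one_mem) c
  have h1 : (∑ c ∈ Finset.range a, fun j : LGInstance =>
      (j.m.choose (c + 1) : j.A) * (-1) ^ (c + 1) *
        (algebraMap ℚ j.A (j.m : ℚ)⁻¹ * ∑ i, j.P.y i ^ (a - (c + 1)))) ∈ univ :=
    sum_mem fun c _ => mul_mem (mul_mem (choose_mem_univ _) (hneg _)) (ih _ (by omega))
  have h2 : (∑ c ∈ Finset.range (a + 1), fun j : LGInstance =>
      (j.m.choose c : j.A) * (-1) ^ c) ∈ univ :=
    sum_mem fun c _ => mul_mem (choose_mem_univ _) (hneg _)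
  have h := mul_mem U_mem_univ (sub_mem (mul_mem T_mem_univ h2) (mul_mem T_mem_univ h1))
  convert h using 1
  funext j
  have h3 := j.P.sum_y_pow a ha
  have h4 := j.P.U_mul
  have h5 := j.P.inv_mul_natCast
  simp only [Pi.mul_apply, Pi.sub_apply, Finset.sum_apply]
  have e : ∑ c ∈ Finset.range a, (j.m.choose (c + 1) : j.A) * (-1) ^ (c + 1) *
      (algebraMap ℚ j.A (j.m : ℚ)⁻¹ * ∑ i, j.P.y i ^ (a - (c + 1))) =
      algebraMap ℚ j.A (j.m : ℚ)⁻¹ * ∑ c ∈ Finset.range a, (j.m.choose (c + 1) : j.A) * (-1) ^ (c + 1) *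
        ∑ i, j.P.y i ^ (a - (c + 1)) := by
    rw [Finset.mul_sum]
    exact Finset.sum_congr rfl fun c _ => by ring
  rw [e]
  linear_combination algebraMap ℚ j.A (j.m : ℚ)⁻¹ * j.P.U * h3 -
    algebraMap ℚ j.A (j.m : ℚ)⁻¹ * (∑ i, j.P.y i ^ a) * h4 +
    j.P.U * j.P.T * (∑ c ∈ Finset.range (a + 1), (j.m.choose c : j.A) * (-1) ^ c) * h5

/-- Families of jets. -/
abbrev Jets : Type 1 := ∀ j : LGInstance, MvPolynomial (LGVar j.m) j.A

/-- The symmetric functions of the coordinates from which the expansion is built. The functions with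
weights `x i` are restricted to those which do not contribute values at the critical point, since
the mean of the `x i` is not universal. -/
inductive Basic : Jets → Prop
  | const (u : ∀ j : LGInstance, j.A) : u ∈ univ → Basic fun j => algebraMap j.A _ (u j)
  | mean_succ (a : ℕ) (f : MvPolynomial (Fin 2) ℚ) : Basic fun j => j.P.mean (a + 1) f
  | mean_zero (f : MvPolynomial (Fin 2) ℚ) : expEval f = 0 → expEval (expDeriv f) = 0 →
      Basic fun j => j.P.mean 0 f
  | y : Basic fun _ => X LGVar.y

/-- The algebra generated by the basic symmetric functions. -/
noncomputable def sym : Subalgebra ℚ Jets := Algebra.adjoin ℚ {f | Basic f}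

theorem Basic.mem_sym {f : Jets} (h : Basic f) : f ∈ sym := Algebra.subset_adjoin h

theorem const_mem_sym {u : ∀ j : LGInstance, j.A} (hu : u ∈ univ) {f : Jets} (hf : f ∈ sym) :
    (fun j => u j • f j) ∈ sym := by
  have := mul_mem (Basic.const u hu).mem_sym hf
  convert this using 1
  funext j
  exact Algebra.smul_def _ _

theorem sym_induction {p : Jets → Prop} (basic : ∀ f, Basic f → p f)
    (add : ∀ f g, p f → p g → p (fun j => f j + g j))
    (mul : ∀ f g, f ∈ sym → g ∈ sym → p f → p g → p (fun j => f j * g j)) {f : Jets} (hf : f ∈ sym) :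
    p f := by
  refine Algebra.adjoin_induction (fun f h => basic f h) (fun r => ?_) (fun f g _ _ => add f g)
    (fun f g hf hg => mul f g hf hg) hf
  have := basic _ (Basic.const _ (rat_mem_univ r))
  convert this using 1
  funext j
  exact IsScalarTower.algebraMap_apply ℚ j.A _ r

theorem yDeriv_mem_sym {f : Jets} (hf : f ∈ sym) : (fun j => j.P.yDeriv (f j)) ∈ sym := by
  refine sym_induction (p := fun f => (fun j => j.P.yDeriv (f j)) ∈ sym) ?_ ?_ ?_ hf
  · rintro f (⟨u, hu⟩ | ⟨a, f⟩ | ⟨f, h1, h2⟩ | _)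
    · simp only [Derivation.map_algebraMap]
      exact sym.zero_mem
    · simp only [yDeriv_mean]
      exact (Basic.mean_succ _ _).mem_sym
    · simp only [yDeriv_mean]
      exact (Basic.mean_succ _ _).mem_sym
    · simp only [yDeriv_y]
      have := powMean_mem_univ 1
      simp only [pow_one] at this
      exact const_mem_sym this Basic.y.mem_sym
  · intro f g hf hg
    simp only [map_add]
    exact add_mem hf hg
  · intro f g hf hg hf' hg'
    simp only [Derivation.leibniz, smul_eq_mul]
    exact add_mem (mul_mem hf hg') (mul_mem hg hf')

theorem grad_mem_sym {f g : Jets} (hf : f ∈ sym) (hg : g ∈ sym) :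
    (fun j => j.P.grad (f j) (g j)) ∈ sym := by
  have hs : ∀ f g : Jets, (fun j => j.P.grad (f j) (g j)) ∈ sym →
      (fun j => j.P.grad (g j) (f j)) ∈ sym := by
    intro f g h
    have e : (fun j : LGInstance => j.P.grad (g j) (f j)) = fun j => j.P.grad (f j) (g j) :=
      funext fun j => grad_comm _ _ _
    rwa [e]
  have h0 : ∀ f g, Basic f → Basic g → (fun j => j.P.grad (f j) (g j)) ∈ sym := by
    have hc : ∀ (u : ∀ j : LGInstance, j.A) (g : Jets),
        (fun j => j.P.grad (algebraMap j.A _ (u j)) (g j)) ∈ sym := by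
      intro u g
      simp only [grad, Derivation.map_algebraMap, zero_mul, smul_zero, Finset.sum_const_zero]
      exact sym.zero_mem
    have hy : ∀ g, Basic g → (fun j => j.P.grad (X LGVar.y) (g j)) ∈ sym := by
      intro g hg
      simp only [grad_y]
      exact mul_mem Basic.y.mem_sym (yDeriv_mem_sym hg.mem_sym)
    rintro f g (⟨u, hu⟩ | ⟨a, f⟩ | ⟨f, h1, h2⟩ | _) hg
    · exact hc u g
    · rcases hg with (⟨u, hu⟩ | ⟨b, g⟩ | ⟨g, h3, h4⟩ | _)
      · exact hs _ _ <| hc u fun j => j.P.mean (a + 1) f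
      · simp only [grad_mean_mean, add_right_comm a 1]
        exact (Basic.mean_succ (a + (b + 1)) _).mem_sym
      · simp only [grad_mean_mean]
        exact (Basic.mean_succ a _).mem_sym
      · exact hs _ _ <| hy _ (Basic.mean_succ a f)
    · rcases hg with (⟨u, hu⟩ | ⟨b, g⟩ | ⟨g, h3, h4⟩ | _)
      · exact hs _ _ <| hc u fun j => j.P.mean 0 f
      · simp only [grad_mean_mean, zero_add]
        exact (Basic.mean_succ b _).mem_sym
      · simp only [grad_mean_mean]
        exact (Basic.mean_zero (expDeriv f * expDeriv g)
          (by simp [h2]) (by simp [Derivation.leibniz, h2, h4])).mem_sym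
      · exact hs _ _ <| hy _ (Basic.mean_zero f h1 h2)
    · exact hy g hg
  have h1 : ∀ f g, Basic f → g ∈ sym → (fun j => j.P.grad (f j) (g j)) ∈ sym := by
    intro f g hf hg
    refine sym_induction (p := fun g => (fun j => j.P.grad (f j) (g j)) ∈ sym)
      (fun g => h0 f g hf) ?_ ?_ hg
    · intro g g' h h'
      have e : ∀ j : LGInstance, j.P.grad (f j) (g j + g' j) =
          j.P.grad (f j) (g j) + j.P.grad (f j) (g' j) := by
        intro j
        simp only [grad, map_add, mul_add, smul_add, Finset.sum_add_distrib]
      simp only [e]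
      exact add_mem h h'
    · intro g g' hg hg' h h'
      simp only [grad_mul]
      exact add_mem (mul_mem hg h') (mul_mem hg' h)
  refine sym_induction (p := fun f => (fun j => j.P.grad (f j) (g j)) ∈ sym)
      (fun f hf => h1 f g hf hg) ?_ ?_ hf
  · intro f f' h h'
    have e : ∀ j : LGInstance, j.P.grad (f j + f' j) (g j) =
        j.P.grad (f j) (g j) + j.P.grad (f' j) (g j) := by
      intro j
      simp only [grad, map_add, add_mul, smul_add, Finset.sum_add_distrib]
    simp only [e]
    exact add_mem h h'
  · intro f f' hf hf' h h'
    have e : ∀ j : LGInstance, j.P.grad (f j * f' j) (g j) =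
        f j * j.P.grad (f' j) (g j) + f' j * j.P.grad (f j) (g j) := by
      intro j
      rw [grad_comm, grad_mul, grad_comm j.P (g j), grad_comm j.P (g j)]
    simp only [e]
    exact add_mem (mul_mem hf h') (mul_mem hf' h)

theorem diagLap_mem_sym {f : Jets} (hf : f ∈ sym) : (fun j => j.P.diagLap (f j)) ∈ sym := by
  refine sym_induction (p := fun f => (fun j => j.P.diagLap (f j)) ∈ sym) ?_ ?_ ?_ hf
  · rintro f (⟨u, hu⟩ | ⟨a, f⟩ | ⟨f, h1, h2⟩ | _)
    · simp only [diagLap, Derivation.map_algebraMap, map_zero, smul_zero, Finset.sum_const_zero]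
      exact sym.zero_mem
    · simp only [diagLap_mean]
      exact const_mem_sym m_mem_univ (Basic.mean_succ _ _).mem_sym
    · simp only [diagLap_mean]
      exact const_mem_sym m_mem_univ (Basic.mean_succ _ _).mem_sym
    · simp only [diagLap_y]
      have := powMean_mem_univ 1
      simp only [pow_one] at this
      exact const_mem_sym this Basic.y.mem_sym
  · intro f g hf hg
    have e : ∀ j : LGInstance, j.P.diagLap (f j + g j) = j.P.diagLap (f j) + j.P.diagLap (g j) := by
      intro j
      simp only [diagLap, map_add, smul_add, Finset.sum_add_distrib]
    simp only [e]
    exact add_mem hf hg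
  · intro f g hf hg hf' hg'
    have h2 : (2 : Jets) ∈ sym := ofNat_mem sym 2
    simp only [diagLap_mul]
    exact add_mem (add_mem (mul_mem hf hg') (mul_mem hg hf'))
      (mul_mem h2 (grad_mem_sym hf hg))

theorem lap_mem_sym {f : Jets} (hf : f ∈ sym) :
    (fun j : LGInstance => ((j.m : j.A) • (lgJet j.m j.A).lap j.P.covar) (f j)) ∈ sym := by
  simp only [LinearMap.smul_apply, natCast_smul_lap]
  exact sub_mem (diagLap_mem_sym hf) (const_mem_sym (sub_mem T_mem_univ univ.one_mem)
    (yDeriv_mem_sym (yDeriv_mem_sym hf)))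

theorem lap_pow_mem_sym {f : Jets} (hf : f ∈ sym) (n : ℕ) :
    (fun j : LGInstance => (((j.m : j.A) • (lgJet j.m j.A).lap j.P.covar) ^ n) (f j)) ∈ sym := by
  induction n with
  | zero => simpa using hf
  | succ n ih => simpa only [pow_succ', Module.End.mul_apply] using lap_mem_sym ih

theorem ev_mem_univ {f : Jets} (hf : f ∈ sym) : (fun j : LGInstance => (lgJet j.m j.A).ev (f j)) ∈ univ := by
  refine sym_induction (p := fun f => (fun j : LGInstance => (lgJet j.m j.A).ev (f j)) ∈ univ) ?_ ?_ ?_ hf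
  · rintro f (⟨u, hu⟩ | ⟨a, f⟩ | ⟨f, h1, h2⟩ | _)
    · simp only [AlgHom.commutes]
      exact hu
    · simp only [ev_mean]
      exact mul_mem (powMean_mem_univ a) (rat_mem_univ (expEval f))
    · simp only [ev_mean, h1, map_zero, mul_zero]
      exact univ.zero_mem
    · simp only [lgJet_ev_y]
      exact univ.one_mem
  · intro f g hf hg
    simp only [map_add]
    exact add_mem hf hg
  · intro f g _ _ hf hg
    simp only [map_mul]
    exact mul_mem hf hg

theorem inv_smul_lgV_mem_sym :
    (fun j : LGInstance => algebraMap ℚ j.A (j.m : ℚ)⁻¹ • lgV j.P.x 1) ∈ sym := by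
  simp only [inv_smul_lgV]
  have h1 := (Basic.mean_succ 0 (X 0)).mem_sym
  refine add_mem (add_mem (sub_mem (Basic.mean_zero _ ?_ ?_).mem_sym
    (sub_mem Basic.y.mem_sym sym.one_mem)) h1) (mul_mem (sym.algebraMap_mem 2⁻¹) (pow_mem h1 2))
  · simp [expEval]
  · have h : expDeriv (MvPolynomial.C (2⁻¹ : ℚ)) = 0 := expDeriv.map_algebraMap _
    simp [Derivation.leibniz, h, pow_two]
    simp [expEval, expDeriv, mkDerivation_X]

/-- The coefficients of the expansion are given by polynomials in `m`, `T` and `U`. -/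
theorem exists_expect_eq (k : ℕ) : ∃ N : MvPolynomial (Fin 3) ℚ, ∀ j : LGInstance,
    j.P.expect k 1 = aeval ![(j.m : j.A), j.P.T, j.P.U] N := by
  rw [← mem_univ]
  have h : ∀ n, (fun j : LGInstance => (lgJet j.m j.A).ev
      ((((j.m : j.A) • (lgJet j.m j.A).lap j.P.covar) ^ (k + n))
        ((-(algebraMap ℚ j.A (j.m : ℚ)⁻¹ • lgV j.P.x 1)) ^ n))) ∈ univ := fun n =>
    ev_mem_univ (lap_pow_mem_sym (pow_mem (neg_mem inv_smul_lgV_mem_sym) n) _)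
  have h2 : (∑ n ∈ Finset.range (2 * k + 1), fun j : LGInstance =>
      algebraMap ℚ j.A ((n.factorial : ℚ)⁻¹) *
      (algebraMap ℚ j.A (((2 : ℚ) ^ (k + n) * (k + n).factorial)⁻¹) * (lgJet j.m j.A).ev
      ((((j.m : j.A) • (lgJet j.m j.A).lap j.P.covar) ^ (k + n))
        ((-(algebraMap ℚ j.A (j.m : ℚ)⁻¹ • lgV j.P.x 1)) ^ n)))) ∈ univ :=
    sum_mem fun n _ => mul_mem (rat_mem_univ _) (mul_mem (rat_mem_univ _) (h n))
  convert h2 using 1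
  funext j
  rw [Finset.sum_apply, expect, LinearMap.smul_apply, JetAlgebra.feynman_apply, Finset.smul_sum]
  refine Finset.sum_congr rfl fun n _ => ?_
  have e : ((algebraMap ℚ j.A (j.m : ℚ)⁻¹) * (j.m : j.A)) ^ n = 1 := by
    rw [j.P.inv_mul_natCast, one_pow]
  rw [JetAlgebra.gauss_apply, mul_one, ← smul_neg, smul_pow, smul_pow, LinearMap.smul_apply,
    map_smul, map_smul, map_smul, smul_eq_mul, smul_eq_mul, smul_eq_mul, pow_add (j.m : j.A)]
  rw [mul_pow] at e
  linear_combination (-(j.m : j.A) ^ k * algebraMap ℚ j.A ((n.factorial : ℚ)⁻¹) *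
    (algebraMap ℚ j.A (((2 : ℚ) ^ (k + n) * (k + n).factorial)⁻¹) * (lgJet j.m j.A).ev
      (((lgJet j.m j.A).lap j.P.covar ^ (k + n)) ((-lgV j.P.x 1) ^ n)))) * e

end LGInstance

namespace MvPolynomial

variable {σ A : Type*} [CommRing A] [Algebra ℚ A] (δ : Derivation ℚ A A)

/-- A derivation acting on the coefficients of a polynomial. -/
noncomputable def mapDeriv : MvPolynomial σ A →+ MvPolynomial σ A where
  toFun f := AddMonoidAlgebra.map δ.toLinearMap.toAddMonoidHom f
  map_zero' := by ext d; simp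
  map_add' f g := by
    refine MvPolynomial.ext _ _ fun d => ?_
    rw [coeff_add, coeff_addMonoidAlgebraMap, coeff_addMonoidAlgebraMap, coeff_addMonoidAlgebraMap,
      coeff_add, map_add]

theorem coeff_mapDeriv (f : MvPolynomial σ A) (d : σ →₀ ℕ) :
    (mapDeriv δ f).coeff d = δ (f.coeff d) := coeff_addMonoidAlgebraMap _ _ _

theorem mapDeriv_mul (f g : MvPolynomial σ A) :
    mapDeriv δ (f * g) = mapDeriv δ f * g + f * mapDeriv δ g := by
  classical
  refine MvPolynomial.ext _ _ fun d => ?_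
  rw [coeff_mapDeriv, coeff_add, coeff_mul, coeff_mul, coeff_mul, map_sum, ← Finset.sum_add_distrib]
  refine Finset.sum_congr rfl fun p _ => ?_
  rw [Derivation.leibniz, coeff_mapDeriv, coeff_mapDeriv, smul_eq_mul, smul_eq_mul]
  ring

theorem mapDeriv_C (a : A) : mapDeriv δ (C a : MvPolynomial σ A) = C (δ a) := by
  classical
  refine MvPolynomial.ext _ _ fun d => ?_
  rw [coeff_mapDeriv, coeff_C, coeff_C]
  split_ifs <;> simp

theorem mapDeriv_X (v : σ) : mapDeriv δ (X v : MvPolynomial σ A) = 0 := by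
  classical
  refine MvPolynomial.ext _ _ fun d => ?_
  rw [coeff_mapDeriv, coeff_X]
  split_ifs <;> simp

theorem mapDeriv_smul (a : A) (f : MvPolynomial σ A) :
    mapDeriv δ (a • f) = δ a • f + a • mapDeriv δ f := by
  simp only [smul_eq_C_mul, mapDeriv_mul, mapDeriv_C]

theorem mapDeriv_one : mapDeriv δ (1 : MvPolynomial σ A) = 0 := by
  rw [← C_1, mapDeriv_C, Derivation.map_one_eq_zero, C_0]

end MvPolynomial

namespace JetAlgebra

variable {ι A R : Type*} [DecidableEq ι] [CommRing A] [CommRing R] [Algebra A R]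
  [Algebra ℚ A] {J : JetAlgebra ι A R} {H C : ι → ι → A} {S V : R}

theorem map_mem_vanish {δ : Derivation ℚ A A} {D : R →+ R} (hd : ∀ i f, D (J.d i f) = J.d i (D f))
    (hev : ∀ f, J.ev (D f) = δ (J.ev f)) {n : ℕ} {f : R} (hf : f ∈ J.vanish n) :
    D f ∈ J.vanish n := by
  induction n generalizing f with
  | zero => exact J.mem_vanish_zero _
  | succ n ih =>
    rw [mem_vanish_succ] at hf ⊢
    exact ⟨ih hf.1, by rw [hev, hf.2.1, map_zero], fun i => by rw [← hd]; exact ih (hf.2.2 i)⟩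

variable [Fintype ι]

theorem IsPotential.mem_vanish_two (h : J.IsPotential H C S V) : S ∈ J.vanish 2 := by
  have e : S = algebraMap ℚ A 2⁻¹ • (2 * S) := by
    rw [two_mul, ← two_smul A S, smul_smul, ← map_ofNat (algebraMap ℚ A) 2, ← map_mul,
      inv_mul_cancel₀ two_ne_zero, map_one, one_smul]
  rw [e, h.two_mul_eq]
  refine J.smul_mem_vanish _ (add_mem (sum_mem fun i _ => sum_mem fun j _ =>
    J.smul_mem_vanish _ (J.mul_mem_vanish (J.T_mem_vanish i) (J.T_mem_vanish j))) ?_)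
  exact Ideal.mul_mem_left _ _ (J.vanish_anti (by norm_num) h.mem)

/-- Differentiation of the expansion with respect to parameters of the potential. The derivative
corrected by the multiplication by the derivative of the potential is again oscillatory, so it is
a multiple of the expansion. -/
theorem IsPotential.deriv_feynman (h : J.IsPotential H C S V) {δ : Derivation ℚ A A} {D : R →+ R}
    (hmul : ∀ f g, D (f * g) = D f * g + f * D g) (hsmul : ∀ a f, D (a • f) = δ a • f + a • D f)
    (hone : D 1 = 0) (hd : ∀ i f, D (J.d i f) = J.d i (D f)) (hev : ∀ f, J.ev (D f) = δ (J.ev f))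
    (k : ℕ) : δ (J.feynman C V k 1) = J.feynman C V 1 (D S) * J.feynman C V k 1 -
      J.feynman C V (k + 1) (D S) := by
  have hE := h.isOscillatory_feynman
  let F : ℕ → R →ₗ[A] A := fun k =>
    { toFun := fun f => δ (J.feynman C V k f) - J.feynman C V k (D f) +
        J.feynman C V (k + 1) (D S * f)
      map_add' := fun f g => by simp only [map_add, mul_add]; ring
      map_smul' := fun a f => by
        simp only [hsmul, map_add, map_smul, mul_smul_comm, smul_eq_mul, Derivation.leibniz,
          RingHom.id_apply]
        ring }
  have hF : ∀ k f, F k f = δ (J.feynman C V k f) - J.feynman C V k (D f) +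
        J.feynman C V (k + 1) (D S * f) := fun _ _ => rfl
  have hosc : J.IsOscillatory S F := by
    refine ⟨fun k i f => ?_, fun k => ?_, fun k f hf => ?_⟩
    · have e1 := hE.ibp k i (D f)
      have e2 := hE.ibp (k + 1) i (D S * f)
      have e3 : D S * (J.d i S * f) = J.d i S * (D S * f) := by ring
      rw [hF, hF, hE.ibp, hmul, map_add, e1, hd, hd, e3, e2, Derivation.leibniz, map_add,
        smul_eq_mul, smul_eq_mul, mul_comm f]
      ring
    · have e1 := h.feynman_mul k 1
      have e2 := h.feynman_mul (k + 1) (D S)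
      rw [mul_one] at e1
      have e3 := congrArg δ e1
      have e5 : δ (2 : A) = 0 := by simpa using δ.map_natCast 2
      have e6 : δ (2 * k + Fintype.card ι : A) = 0 := by
        have := δ.map_natCast (2 * k + Fintype.card ι)
        push_cast at this
        exact this
      rw [Derivation.leibniz, Derivation.leibniz, e5, e6] at e3
      simp only [smul_eq_mul, mul_zero, add_zero] at e3
      rw [hF, hF, hone, map_zero, mul_one, mul_comm (D S) S]
      push_cast at e2
      linear_combination e3 + e2
    · rw [hF, hE.vanish k f hf, hE.vanish k _ (map_mem_vanish hd hev hf), hE.vanish (k + 1)]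
      · simp
      · refine J.vanish_anti ?_ (J.mul_mem_vanish (map_mem_vanish hd hev h.mem_vanish_two) hf)
        omega
  have := hosc.eq_feynman h k 1
  have h0 : δ (J.ev 1) = 0 := by rw [map_one, Derivation.map_one_eq_zero]
  rw [hF, hF 0, hone, map_zero, map_zero, feynman_zero_apply, h0, mul_one, zero_add] at this
  linear_combination this

end JetAlgebra

namespace LGParam

open MvPolynomial

variable {m : ℕ} {A : Type*} [CommRing A] [Algebra ℂ A] [Algebra ℚ A] (P : LGParam m A)

theorem isOscillatory : (lgJet m A).IsOscillatory (lgS P.x 1)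
    ((lgJet m A).feynman P.covar (lgV P.x 1)) := P.isPotential.isOscillatory_feynman

theorem d_lgS (i : Fin m) : (lgJet m A).d i (lgS P.x 1) =
    P.x i • X (LGVar.e i) - X LGVar.y + algebraMap A _ (P.b i) := by
  have : P.b i = 1 - P.x i := by rw [x]; ring
  rw [lgJet_d_lgS, one_smul, smul_sub, this, map_sub, map_one, Algebra.smul_def, Algebra.smul_def]
  ring

theorem expect_succ (k : ℕ) (i : Fin m) (f : MvPolynomial (LGVar m) A) :
    P.expect (k + 1) ((P.x i • X (LGVar.e i) - X LGVar.y + algebraMap A _ (P.b i)) * f) =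
      m * P.expect k ((lgJet m A).d i f) := by
  have h := P.isOscillatory.ibp k i f
  rw [P.d_lgS] at h
  rw [expect, expect, LinearMap.smul_apply, LinearMap.smul_apply, h, smul_eq_mul, smul_eq_mul]
  ring

theorem expect_zero (f : MvPolynomial (LGVar m) A) : P.expect 0 f = (lgJet m A).ev f := by
  rw [expect, pow_zero, one_smul, JetAlgebra.feynman_zero_apply]

theorem expect_vanish {k : ℕ} {f : MvPolynomial (LGVar m) A}
    (hf : f ∈ (lgJet m A).vanish (2 * k + 1)) : P.expect k f = 0 := by
  rw [expect, LinearMap.smul_apply, P.isOscillatory.vanish k f hf, smul_zero]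

/-- Differentiation with respect to the parameter `β`. -/
theorem deriv_expect {δ : Derivation ℚ A A} (hδ : δ P.β = -P.β)
    (hζ : ∀ z : ℂ, δ (algebraMap ℂ A z) = 0) (k : ℕ) :
    δ (P.expect k 1) = (k + P.U * P.expect 1 (X LGVar.y - 1)) * P.expect k 1 -
      P.U * P.expect (k + 1) (X LGVar.y - 1) := by
  have hb : ∀ i, δ (P.x i) = 1 - P.x i := fun i => by
    rw [x, map_sub, Derivation.map_one_eq_zero, b, Derivation.leibniz, hζ, hδ]
    simp
  have hS : mapDeriv δ (lgS P.x 1) = ∑ i, X (LGVar.e i) - (m : MvPolynomial (LGVar m) A) *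
      X LGVar.y - lgS P.x 1 := by
    have h1 : ∀ n : ℕ, mapDeriv δ (n : MvPolynomial (LGVar m) A) = 0 := fun n => by
      have := mapDeriv_C (σ := LGVar m) δ n
      rwa [map_natCast, Derivation.map_natCast, map_zero] at this
    simp only [lgS, map_sub, map_sum, mapDeriv_smul, hb, mapDeriv_X, mapDeriv_one, mapDeriv_mul, h1,
      sub_smul, one_smul, Finset.sum_sub_distrib, sub_zero, smul_zero,
      Finset.sum_const_zero, mul_zero, zero_mul, add_zero]
    simp
    ring
  have he : ∀ k, P.expect (k + 1) (∑ i, X (LGVar.e i) - (m : MvPolynomial (LGVar m) A) *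
      X LGVar.y) = m * P.U * P.expect (k + 1) (X LGVar.y - 1) := by
    intro k
    have h1 : ∀ i, P.expect (k + 1) (X (LGVar.e i)) =
        P.y i * P.expect (k + 1) (X LGVar.y - 1) + P.expect (k + 1) 1 := by
      intro i
      have h2 := P.expect_succ k i 1
      have e : P.b i = 1 - P.x i := by rw [x]; ring
      rw [Derivation.map_one_eq_zero, map_zero, mul_zero, mul_one, e, map_add, map_sub,
        Algebra.algebraMap_eq_smul_one, map_smul, map_smul, smul_eq_mul, smul_eq_mul] at h2
      rw [map_sub]
      linear_combination P.y i * h2 + (P.expect (k + 1) 1 - P.expect (k + 1) (X (LGVar.e i))) * P.x_mul_y i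
    have h3 : ((m : MvPolynomial (LGVar m) A) * X LGVar.y) = (m : A) • X LGVar.y := by
      rw [Algebra.smul_def, map_natCast]
    rw [map_sub, map_sum, Finset.sum_congr rfl fun i _ => h1 i, Finset.sum_add_distrib,
      ← Finset.sum_mul, P.sum_y, h3, map_smul, map_sub, smul_eq_mul]
    simp only [Finset.sum_const, Finset.card_univ, Fintype.card_fin, nsmul_eq_mul]
    linear_combination (m : A) * (P.expect (k + 1) (X LGVar.y) - P.expect (k + 1) 1) * P.U_mul
  have hd : ∀ i f, mapDeriv δ ((lgJet m A).d i f) = (lgJet m A).d i (mapDeriv δ f) := by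
    intro i f
    induction f using MvPolynomial.induction_on with
    | C a =>
      rw [mapDeriv_C]
      simp only [← MvPolynomial.algebraMap_eq, Derivation.map_algebraMap]
      exact map_zero _
    | add p q hp hq => simp only [map_add, hp, hq]
    | mul_X p v hp =>
      have hv : mapDeriv δ ((lgJet m A).d i (X v)) = 0 := by
        cases v with
        | t j => rw [lgJet_d_t]; split_ifs <;> simp [mapDeriv_one]
        | e j => rw [lgJet_d_e]; split_ifs <;> simp [mapDeriv_X]
        | y => rw [lgJet_d_y, mapDeriv_smul, mapDeriv_X, Derivation.map_algebraMap]; simp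
      simp only [Derivation.leibniz, map_add, smul_eq_mul, mapDeriv_mul, hp, hv, mapDeriv_X,
        mul_zero, add_zero]
      ring
  have hev : ∀ f, (lgJet m A).ev (mapDeriv δ f) = δ ((lgJet m A).ev f) := by
    intro f
    induction f using MvPolynomial.induction_on with
    | C a =>
      rw [mapDeriv_C, ← MvPolynomial.algebraMap_eq, AlgHom.commutes, AlgHom.commutes]
      rfl
    | add p q hp hq => simp only [map_add, hp, hq]
    | mul_X p v hp =>
      have hv : δ ((lgJet m A).ev (X v)) = 0 := by
        cases v <;> simp [lgJet_ev_t, lgJet_ev_e, lgJet_ev_y]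
      simp only [mapDeriv_mul, map_mul, hp, mapDeriv_X, Derivation.leibniz, hv, mul_zero,
        smul_eq_mul, zero_add, add_zero]
      ring
  have h := P.isPotential.deriv_feynman (δ := δ) (mapDeriv_mul δ) (mapDeriv_smul δ)
    (mapDeriv_one δ) hd hev k
  rw [hS, map_sub _ (_ - _), map_sub _ (_ - _)] at h
  have h1 := he k
  have h2 := he 0
  have h3 := P.isOscillatory.euler k
  have h4 := P.isOscillatory.euler 0
  have h5 : (lgJet m A).feynman P.covar (lgV P.x 1) 0 1 = 1 := by
    rw [JetAlgebra.feynman_zero_apply, map_one]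
  have hm : ∀ n : ℕ, δ ((m : A) ^ n) = 0 := fun n => by
    rw [← Nat.cast_pow, Derivation.map_natCast]
  have h6 : ∀ a b : A, 2 * a = 2 * b → a = b := by
    intro a b hab
    have := JetAlgebra.eq_zero_of_natCast_mul (A := A) (n := 2) (a := a - b) two_ne_zero
      (by push_cast; linear_combination hab)
    exact sub_eq_zero.1 this
  rw [h5] at h4
  simp only [expect, LinearMap.smul_apply, smul_eq_mul, Derivation.leibniz, hm, mul_zero, add_zero,
    Fintype.card_fin, zero_add, Nat.cast_zero, pow_one] at h1 h2 h3 h4 ⊢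
  have h7 : ∀ a b : A, (m : A) * a = m * b → a = b := by
    intro a b hab
    linear_combination algebraMap ℚ A (m : ℚ)⁻¹ * hab - (a - b) * P.inv_mul_natCast
  have h1' := h7 ((m : A) ^ k * (lgJet m A).feynman P.covar (lgV P.x 1) (k + 1)
      (∑ i, X (LGVar.e i) - (m : MvPolynomial (LGVar m) A) * X LGVar.y))
    (P.U * (m : A) ^ (k + 1) * (lgJet m A).feynman P.covar (lgV P.x 1) (k + 1) (X LGVar.y - 1))
    (by linear_combination h1)
  have h2' := h7 _ _ (h2.trans (mul_assoc _ _ _))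
  refine h6 _ _ ?_
  linear_combination 2 * (m : A) ^ k * h + 2 * (m : A) ^ k *
    (lgJet m A).feynman P.covar (lgV P.x 1) k 1 * h2' - 2 * h1' -
    (m : A) ^ k * (lgJet m A).feynman P.covar (lgV P.x 1) k 1 * h4 + (m : A) ^ k * h3

end LGParam

section ShiftOperator

open Polynomial

variable {K : Type*} [CommRing K]

/-- The operator `X + h * X * d/dX` on power series in `h` with coefficients in `K[X]`. -/
noncomputable def eulerOp : (ℕ → K[X]) →ₗ[K] (ℕ → K[X]) where
  toFun F j := X * F j + match j with
    | 0 => 0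
    | j + 1 => X * derivative (F j)
  map_add' F G := by
    funext j
    cases j <;> simp [mul_add]
    ring
  map_smul' c F := by
    funext j
    cases j <;> simp

theorem eulerOp_zero (F : ℕ → K[X]) : eulerOp F 0 = X * F 0 := add_zero _

theorem eulerOp_succ (F : ℕ → K[X]) (j : ℕ) :
    eulerOp F (j + 1) = X * F (j + 1) + X * derivative (F j) := rfl

/-- The coefficient of `h ^ j` in the operator `(X + h * X * d/dX) ^ m`. -/
noncomputable def eulerCoeff (m j : ℕ) (g : K[X]) : K[X] := (eulerOp ^ m) (Pi.single 0 g) j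

theorem eulerCoeff_zero (m : ℕ) (g : K[X]) : eulerCoeff m 0 g = X ^ m * g := by
  induction m with
  | zero => simp [eulerCoeff]
  | succ m ih =>
    rw [eulerCoeff, pow_succ', Module.End.mul_apply, eulerOp_zero, ← eulerCoeff, ih]
    ring

theorem eulerCoeff_one (m : ℕ) (g : K[X]) : eulerCoeff m 1 g =
    (m : K[X]) * X ^ m * derivative g + (m.choose 2 : K[X]) * X ^ (m - 1) * g := by
  induction m with
  | zero => simp [eulerCoeff]
  | succ m ih =>
    rw [eulerCoeff, pow_succ', Module.End.mul_apply, eulerOp_succ, ← eulerCoeff, ← eulerCoeff, ih,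
      eulerCoeff_zero, Nat.choose_succ_succ, Nat.choose_one_right, derivative_mul, derivative_X_pow]
    have e : (X : K[X]) * ((m.choose 2 : K[X]) * X ^ (m - 1)) = (m.choose 2 : K[X]) * X ^ m := by
      cases m with
      | zero => simp
      | succ m => rw [Nat.add_sub_cancel]; ring
    have e' : (X : K[X]) * ((m : K[X]) * X ^ (m - 1)) = (m : K[X]) * X ^ m := by
      cases m with
      | zero => simp
      | succ m => rw [Nat.add_sub_cancel]; ring
    rw [Nat.add_sub_cancel]
    push_cast
    simp only [map_natCast]
    linear_combination g * e + g * e'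

theorem eulerCoeff_map {K' : Type*} [CommRing K'] (φ : K →+* K') (m j : ℕ) (g : K[X]) :
    (eulerCoeff m j g).map φ = eulerCoeff m j (g.map φ) := by
  induction m generalizing j with
  | zero =>
    simp only [eulerCoeff, pow_zero, Module.End.one_apply]
    cases j <;> simp
  | succ m ih =>
    simp only [eulerCoeff] at ih
    cases j with
    | zero => simp only [eulerCoeff, pow_succ', Module.End.mul_apply, eulerOp_zero,
        Polynomial.map_mul, ih, map_X]
    | succ j => simp only [eulerCoeff, pow_succ', Module.End.mul_apply, eulerOp_succ,
        Polynomial.map_add, Polynomial.map_mul, ih, map_X, ← derivative_map]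

end ShiftOperator

namespace LGParam

open MvPolynomial

theorem d_prod_e {m : ℕ} {A : Type*} [CommRing A] [Algebra ℚ A] (s : Finset (Fin m)) (i : Fin m) :
    (lgJet m A).d i (∏ j ∈ s, X (LGVar.e j)) = if i ∈ s then ∏ j ∈ s, X (LGVar.e j) else 0 := by
  induction s using Finset.induction_on with
  | empty => simp
  | insert j s hj ih =>
    rw [Finset.prod_insert hj, Derivation.leibniz, ih, lgJet_d_e, smul_eq_mul, smul_eq_mul]
    by_cases h1 : i = j
    · subst h1
      simp [hj]
      ring
    · by_cases h2 : i ∈ s <;> simp [h1, h2]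

section

variable {m : ℕ} {A : Type*} [CommRing A] [Algebra ℂ A] (P : LGParam m A)

theorem prod_x : P.T * ∏ i, P.x i = P.T - 1 := by
  have h := prod_sub_zeta_mul P.primitive P.pos (1 : A) P.β
  simp only [x, b]
  rw [h]
  linear_combination -P.β_pow_mul

theorem prod_X_sub_C_b : ∏ i, (Polynomial.X - Polynomial.C (P.b i)) =
    Polynomial.X ^ m - Polynomial.C (P.β ^ m) := by
  have h := prod_sub_zeta_mul P.primitive P.pos (Polynomial.X : A[X]) (Polynomial.C P.β)
  rw [Polynomial.C_pow, ← h]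
  refine Finset.prod_congr rfl fun i _ => ?_
  rw [b, Polynomial.C_mul]
  rfl

variable [Algebra ℚ A]

theorem natCast_mul_inv_smul (P : LGParam m A) (f : MvPolynomial (LGVar m) A) :
    (m : MvPolynomial (LGVar m) A) * (algebraMap ℚ A (m : ℚ)⁻¹ • f) = f := by
  rw [mul_smul_comm, ← nsmul_eq_mul, ← Nat.cast_smul_eq_nsmul A, smul_smul, P.inv_mul_natCast,
    one_smul]

theorem prod_e_sub_mem_vanish (P : LGParam m A) (n : ℕ) :
    ∏ j, X (LGVar.e j) - X LGVar.y ^ m ∈ (lgJet m A).vanish n := by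
  induction n with
  | zero => exact (lgJet m A).mem_vanish_zero _
  | succ n ih =>
    refine (lgJet m A).mem_vanish_of ?_ fun i => ?_
    · simp [lgJet_ev_e, lgJet_ev_y]
    · have h : (lgJet m A).d i (X LGVar.y ^ m) = X LGVar.y ^ m := by
        obtain ⟨l, rfl⟩ : ∃ l, m = l + 1 := ⟨m - 1, by have := P.pos; omega⟩
        rw [Derivation.leibniz_pow, lgJet_d_y, Nat.add_sub_cancel, smul_eq_mul, nsmul_eq_mul,
          mul_left_comm, P.natCast_mul_inv_smul, pow_succ]
      rw [map_sub, d_prod_e, if_pos (Finset.mem_univ i), h]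
      exact ih

theorem d_aeval_y (P : LGParam m A) (i : Fin m) (g : A[X]) :
    (m : MvPolynomial (LGVar m) A) * (lgJet m A).d i (Polynomial.aeval (X LGVar.y) g) =
      Polynomial.aeval (X LGVar.y) (Polynomial.X * Polynomial.derivative g) := by
  have h : (lgJet m A).d i (Polynomial.aeval (X LGVar.y) g) =
      Polynomial.aeval (X LGVar.y) (Polynomial.derivative g) * (lgJet m A).d i (X LGVar.y) := by
    rw [Derivation.map_aeval]
    rfl
  rw [h, lgJet_d_y, mul_left_comm, P.natCast_mul_inv_smul, map_mul, Polynomial.aeval_X, mul_comm]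

/-- The coefficient of `h ^ k` in the expansion of `f` times a power series in `h` with coefficients
in `A[Y]`. -/
noncomputable def hExpect (k : ℕ) (f : MvPolynomial (LGVar m) A) (F : ℕ → A[X]) : A :=
  ∑ j ∈ Finset.range (k + 1), P.expect (k - j) (f * Polynomial.aeval (X LGVar.y) (F j))

theorem hExpect_eulerOp (k : ℕ) {s : Finset (Fin m)} {i : Fin m} (hi : i ∉ s) (F : ℕ → A[X]) :
    P.x i * P.hExpect k (∏ j ∈ insert i s, X (LGVar.e j)) F =
      P.hExpect k (∏ j ∈ s, X (LGVar.e j)) (eulerOp F - P.b i • F) := by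
  set es := ∏ j ∈ s, (X (LGVar.e j) : MvPolynomial (LGVar m) A) with hes
  have h0 : (lgJet m A).d i es = 0 := by rw [hes, d_prod_e, if_neg hi]
  rw [Finset.prod_insert hi]
  have h1 : P.expect 0 ((P.x i • X (LGVar.e i) - X LGVar.y + algebraMap A _ (P.b i)) *
      (es * Polynomial.aeval (X LGVar.y) (F k))) = 0 := by
    rw [expect_zero, map_mul, ← d_lgS, lgJet_d_lgS]
    simp [lgJet_ev_e, lgJet_ev_y]
  have h2 : ∑ j ∈ Finset.range (k + 1), P.expect (k - j)
      ((P.x i • X (LGVar.e i) - X LGVar.y + algebraMap A _ (P.b i)) *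
        (es * Polynomial.aeval (X LGVar.y) (F j))) =
      ∑ j ∈ Finset.range k, P.expect (k - (j + 1)) (es * Polynomial.aeval (X LGVar.y)
        (Polynomial.X * Polynomial.derivative (F j))) := by
    rw [Finset.sum_range_succ, Nat.sub_self, h1, add_zero]
    refine Finset.sum_congr rfl fun j hj => ?_
    have e : k - j = k - (j + 1) + 1 := by rw [Finset.mem_range] at hj; omega
    rw [e, P.expect_succ, Derivation.leibniz, h0, smul_zero, add_zero, ← P.d_aeval_y i,
      smul_eq_mul, mul_left_comm, ← nsmul_eq_mul, ← nsmul_eq_mul, map_nsmul]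
  have h3 : ∀ j, P.expect (k - j) ((P.x i • X (LGVar.e i) - X LGVar.y + algebraMap A _ (P.b i)) *
        (es * Polynomial.aeval (X LGVar.y) (F j))) =
      P.x i * P.expect (k - j) (X (LGVar.e i) * es * Polynomial.aeval (X LGVar.y) (F j)) -
      P.expect (k - j) (es * Polynomial.aeval (X LGVar.y) (Polynomial.X * F j - P.b i • F j)) := by
    intro j
    rw [← smul_eq_mul (P.x i), ← map_smul, ← map_sub]
    congr 1
    rw [map_sub, map_mul, Polynomial.aeval_X, map_smul, Algebra.smul_def, Algebra.smul_def,
      Algebra.smul_def]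
    ring
  simp only [h3, Finset.sum_sub_distrib, ← Finset.mul_sum] at h2
  rw [hExpect, hExpect, Finset.sum_range_succ' (fun j => P.expect (k - j) (es *
    Polynomial.aeval (X LGVar.y) ((eulerOp F - P.b i • F) j)))]
  rw [Finset.sum_range_succ' (fun j => P.expect (k - j) (es *
    Polynomial.aeval (X LGVar.y) (Polynomial.X * F j - P.b i • F j)))] at h2
  have h4 : ∀ j, P.expect (k - (j + 1)) (es * Polynomial.aeval (X LGVar.y)
      ((eulerOp F - P.b i • F) (j + 1))) =
      P.expect (k - (j + 1)) (es * Polynomial.aeval (X LGVar.y)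
        (Polynomial.X * F (j + 1) - P.b i • F (j + 1))) +
      P.expect (k - (j + 1)) (es * Polynomial.aeval (X LGVar.y)
        (Polynomial.X * Polynomial.derivative (F j))) := by
    intro j
    rw [← map_add, ← mul_add, ← map_add, Pi.sub_apply, Pi.smul_apply, eulerOp_succ]
    congr 3
    ring
  rw [Finset.sum_congr rfl fun j _ => h4 j, Finset.sum_add_distrib]
  simp only [Pi.sub_apply, Pi.smul_apply, eulerOp_zero]
  linear_combination h2

theorem prod_x_mul_hExpect (k : ℕ) (s : Finset (Fin m)) (F : ℕ → A[X]) :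
    (∏ i ∈ s, P.x i) * P.hExpect k (∏ j ∈ s, X (LGVar.e j)) F =
      P.hExpect k 1 (Polynomial.aeval (eulerOp : Module.End A (ℕ → A[X]))
        (∏ i ∈ s, (Polynomial.X - Polynomial.C (P.b i))) F) := by
  induction s using Finset.induction_on generalizing F with
  | empty => simp
  | insert i s hi ih =>
    have e : (eulerOp F - P.b i • F) = Polynomial.aeval (eulerOp : Module.End A (ℕ → A[X]))
        (Polynomial.X - Polynomial.C (P.b i)) F := by
      simp [Algebra.algebraMap_eq_smul_one]
    rw [Finset.prod_insert hi, mul_right_comm, P.hExpect_eulerOp k hi, mul_comm, ih, e,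
      Finset.prod_insert hi, mul_comm (Polynomial.X - _), map_mul]
    rfl

/-- The Picard--Fuchs relation: up to terms of higher order in `h`, the function `Y ^ m` takes the
value `1`. -/
theorem expect_pow_sub_one_mul (k : ℕ) (g : A[X]) :
    P.expect k (Polynomial.aeval (X LGVar.y) ((Polynomial.X ^ m - 1) * g)) =
      -P.T * ∑ j ∈ Finset.range k, P.expect (k - (j + 1))
        (Polynomial.aeval (X LGVar.y) (eulerCoeff m (j + 1) g)) := by
  have h := P.prod_x_mul_hExpect k Finset.univ (Pi.single 0 g)
  rw [P.prod_X_sub_C_b] at h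
  have h1 : P.hExpect k (∏ j, X (LGVar.e j)) (Pi.single 0 g) =
      P.expect k (Polynomial.aeval (X LGVar.y) (Polynomial.X ^ m * g)) := by
    rw [hExpect, Finset.sum_eq_single_of_mem 0 (by simp)]
    · rw [Nat.sub_zero, Pi.single_eq_same, ← sub_eq_zero, ← map_sub, map_mul, map_pow,
        Polynomial.aeval_X, ← sub_mul]
      exact P.expect_vanish (Ideal.mul_mem_right _ _ (P.prod_e_sub_mem_vanish _))
    · intro j _ hj
      rw [Pi.single_eq_of_ne hj]; simp
  have h2 : P.hExpect k 1 (Polynomial.aeval (eulerOp : Module.End A (ℕ → A[X]))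
        (Polynomial.X ^ m - Polynomial.C (P.β ^ m)) (Pi.single 0 g)) =
      ∑ j ∈ Finset.range k, P.expect (k - (j + 1))
        (Polynomial.aeval (X LGVar.y) (eulerCoeff m (j + 1) g)) +
      P.expect k (Polynomial.aeval (X LGVar.y) (Polynomial.X ^ m * g)) -
      P.β ^ m * P.expect k (Polynomial.aeval (X LGVar.y) g) := by
    have e : Polynomial.aeval (eulerOp : Module.End A (ℕ → A[X]))
        (Polynomial.X ^ m - Polynomial.C (P.β ^ m)) (Pi.single 0 g) = fun j =>
        eulerCoeff m j g - P.β ^ m • (Pi.single 0 g : ℕ → A[X]) j := by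
      funext j
      rw [map_sub, map_pow, Polynomial.aeval_X, Polynomial.aeval_C, Algebra.algebraMap_eq_smul_one]
      rfl
    rw [e, hExpect, Finset.sum_range_succ']
    simp only [one_mul, Pi.single_eq_same, Pi.single_eq_of_ne (Nat.succ_ne_zero _), smul_zero,
      sub_zero, eulerCoeff_zero, Nat.sub_zero, map_sub, map_smul, smul_eq_mul]
    ring
  rw [h1, h2] at h
  have e : (Polynomial.X ^ m - 1) * g = Polynomial.X ^ m * g - g := by ring
  rw [e, map_sub, map_sub]
  linear_combination P.expect k (Polynomial.aeval (X LGVar.y) (Polynomial.X ^ m * g)) * P.prod_x -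
    P.T * h + P.expect k (Polynomial.aeval (X LGVar.y) g) * P.β_pow_mul

theorem expect_pow_sub_one_mul_rat (k : ℕ) (g : ℚ[X]) :
    P.expect k (Polynomial.aeval (X LGVar.y) ((Polynomial.X ^ m - 1) * g)) =
      -P.T * ∑ j ∈ Finset.range k, P.expect (k - (j + 1))
        (Polynomial.aeval (X LGVar.y) (eulerCoeff m (j + 1) g)) := by
  have h := P.expect_pow_sub_one_mul k (g.map (algebraMap ℚ A))
  have e : (Polynomial.X ^ m - 1) * g.map (algebraMap ℚ A) =
      ((Polynomial.X ^ m - 1) * g).map (algebraMap ℚ A) := by simp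
  simp only [e, ← eulerCoeff_map, Polynomial.aeval_map_algebraMap] at h
  exact h

theorem expect_eq_zero_of_dvd {k : ℕ} {f : ℚ[X]} (hf : (Polynomial.X - 1) ^ (2 * k + 1) ∣ f) :
    P.expect k (Polynomial.aeval (X LGVar.y) f) = 0 := by
  obtain ⟨g, rfl⟩ := hf
  rw [map_mul, map_pow, map_sub, Polynomial.aeval_X, map_one]
  refine P.expect_vanish (Ideal.mul_mem_right _ _ ?_)
  have h : (X LGVar.y - 1 : MvPolynomial (LGVar m) A) ∈ (lgJet m A).vanish 1 :=
    (lgJet m A).mem_vanish_one.2 (by simp [lgJet_ev_y])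
  simpa using (lgJet m A).pow_mem_vanish h (2 * k + 1)

end

end LGParam

section Poles

open Polynomial

/-- A solution of the differential equation which is regular away from `1` is a polynomial. -/
theorem exists_eq_pow_mul_of_ode {m k : ℕ} (hm : 0 < m) {Q : ℚ[X]} (hQ : Q.natDegree ≤ k + 1) (s : ℕ) :
    ∀ N : ℚ[X], (X - 1) * ((m : ℚ[X]) * X * derivative N - (k : ℚ[X]) * N) -
      (s : ℚ[X]) * (m : ℚ[X]) * X * N = -(X - 1) ^ s * Q →
    ∃ R : ℚ[X], R.natDegree ≤ k ∧ N = (X - 1) ^ s * R := by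
  have hm' : (m : ℚ) ≠ 0 := by exact_mod_cast hm.ne'
  induction s with
  | zero =>
    intro N hN
    refine ⟨N, ?_, by simp⟩
    by_contra! hd
    obtain ⟨d, hd'⟩ : ∃ d, N.natDegree = d + 1 := ⟨N.natDegree - 1, by omega⟩
    have hN0 : N.coeff (d + 1) ≠ 0 := by
      rw [← hd']
      exact leadingCoeff_ne_zero.2 (by rintro rfl; simp at hd')
    have h1 : N.coeff (d + 2) = 0 := coeff_eq_zero_of_natDegree_lt (by omega)
    have h2 : Q.coeff (d + 2) = 0 := coeff_eq_zero_of_natDegree_lt (by omega)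
    have h3 := congrArg (fun f => f.coeff (d + 2)) hN
    have e : (X - 1) * ((m : ℚ[X]) * X * derivative N - (k : ℚ[X]) * N) -
        ((0 : ℕ) : ℚ[X]) * (m : ℚ[X]) * X * N = X * (C (m : ℚ) * (X * derivative N) - C (k : ℚ) * N) -
        (C (m : ℚ) * (X * derivative N) - C (k : ℚ) * N) := by
      simp only [map_natCast]
      push_cast
      ring
    rw [e] at h3
    simp only [pow_zero, neg_one_mul, coeff_neg, h2, coeff_sub, coeff_X_mul, coeff_C_mul,
      coeff_derivative, h1] at h3
    have h4 : ((m : ℚ) * (d + 1) - k) * N.coeff (d + 1) = 0 := by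
      push_cast at h3
      linear_combination h3
    rcases mul_eq_zero.1 h4 with h | h
    · have h5 : k < m * (d + 1) := by nlinarith
      have h6 : (k : ℚ) < m * (d + 1) := by exact_mod_cast h5
      linarith
    · exact hN0 h
  | succ s ih =>
    intro N hN
    have h1 : N.eval 1 = 0 := by
      have := congrArg (eval 1) hN
      simp only [eval_sub, eval_mul, eval_X, eval_one, sub_self, zero_mul, eval_natCast, eval_neg,
        eval_pow, ne_eq, Nat.add_eq_zero_iff, one_ne_zero, and_false, not_false_eq_true, zero_pow,
        neg_zero, zero_sub, mul_one, neg_eq_zero, mul_eq_zero, hm', or_false] at this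
      rcases this with h | h
      · exact absurd h (by positivity)
      · exact h
    obtain ⟨N', rfl⟩ := dvd_iff_isRoot.2 (show IsRoot N 1 from h1)
    have h2 : (X - C (1 : ℚ)) ≠ 0 := X_sub_C_ne_zero 1
    rw [C_1] at h2 hN ⊢
    obtain ⟨R, hR, rfl⟩ := ih N' (by
      refine mul_left_cancel₀ h2 ?_
      rw [derivative_mul, derivative_sub, derivative_X, derivative_one] at hN
      push_cast at hN
      linear_combination hN)
    exact ⟨R, hR, by ring⟩

theorem exists_eq_add_pow_sub_one_mul {m : ℕ} (hm : 0 < m) (f : ℚ[X]) (N : ℕ) :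
    ∃ g r : ℚ[X], f = C (f.eval 1) + ((X ^ m - 1) * g + (X - 1) ^ N * r) := by
  have hm' : (m : ℚ) ≠ 0 := by exact_mod_cast hm.ne'
  obtain ⟨q, hq⟩ : (X - 1 : ℚ[X]) ∣ X ^ m - 1 := by
    simpa using sub_dvd_pow_sub_pow (X : ℚ[X]) 1 m
  have hq1 : q.eval 1 = m := by
    have := congrArg (fun f => (derivative f).eval 1) hq
    simpa [derivative_mul, derivative_X_pow] using this.symm
  obtain ⟨q', hq'⟩ : (X - C 1 : ℚ[X]) ∣ q - C (m : ℚ) := dvd_iff_isRoot.2 (by simp [hq1])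
  have hco : IsCoprime q (X - 1) := by
    refine ⟨C (m : ℚ)⁻¹, -C (m : ℚ)⁻¹ * q', ?_⟩
    have e : C (m : ℚ)⁻¹ * C (m : ℚ) = 1 := by rw [← C_mul, inv_mul_cancel₀ hm', C_1]
    rw [C_1] at hq'
    linear_combination C (m : ℚ)⁻¹ * hq' + e
  obtain ⟨a, b, hab⟩ := hco.pow_right (n := N)
  obtain ⟨h, hh⟩ : (X - C 1 : ℚ[X]) ∣ f - C (f.eval 1) := dvd_iff_isRoot.2 (by simp)
  rw [C_1] at hh
  refine ⟨a * h, b * h * (X - 1), ?_⟩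
  rw [hq]
  linear_combination hh - (X - 1) * h * hab

theorem eval_one_eulerCoeff_one {m N : ℕ} (hm : 0 < m) (hN : 3 ≤ N) {g r : ℚ[X]}
    (h : (X - 1 : ℚ[X]) = (X ^ m - 1) * g + (X - 1) ^ N * r) : (eulerCoeff m 1 g).eval 1 = 0 := by
  have hm' : (m : ℚ) ≠ 0 := by exact_mod_cast hm.ne'
  obtain ⟨N, rfl⟩ := Nat.exists_eq_add_of_le' hN
  have h1 := congrArg (fun f => (derivative (derivative f)).eval 1) h
  simp [derivative_mul, derivative_pow] at h1
  have h3 : ((m - 1 : ℕ) : ℚ) = m - 1 := by push_cast [Nat.cast_sub (Nat.one_le_of_lt hm)]; rfl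
  have h4 : (m.choose 2 : ℚ) = m * (m - 1) / 2 := Nat.cast_choose_two ℚ m
  rw [eulerCoeff_one]
  simp [h4]
  rw [h3] at h1
  linear_combination -h1 / 2

end Poles

namespace LGParam

section Generic

open PowerSeries

theorem deriv_T {m : ℕ} {A : Type*} [CommRing A] [Algebra ℂ A] [Algebra ℚ A] (P : LGParam m A)
    {δ : Derivation ℚ A A} (hδ : δ P.β = -P.β) : δ P.T = m * P.T := by
  have h := congrArg δ P.β_pow_mul
  rw [Derivation.leibniz, Derivation.leibniz_pow, hδ, Derivation.map_one_eq_zero] at h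
  obtain ⟨l, rfl⟩ : ∃ l, m = l + 1 := ⟨m - 1, by have := P.pos; omega⟩
  simp only [smul_eq_mul, nsmul_eq_mul, Nat.add_sub_cancel] at h
  have h2 := P.β_pow_mul
  linear_combination P.T * h - (δ P.T - (l + 1 : ℕ) * P.T) * h2

/-- The parameter of the generic instance, a power series with constant coefficient `2`. -/
noncomputable def genericβ : ℂ⟦X⟧ := PowerSeries.C 2 + X

theorem genericβ_mul_inv : genericβ * genericβ⁻¹ = 1 :=
  PowerSeries.mul_inv_cancel _ (by simp [genericβ])

/-- An instance in which `T` is transcendental and can be differentiated. -/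
noncomputable def generic {m : ℕ} (hm : 0 < m) : LGParam m ℂ⟦X⟧ where
  ζ := Complex.exp (2 * Real.pi * Complex.I / m)
  β := genericβ
  T := genericβ⁻¹ ^ m
  U := (genericβ⁻¹ ^ m - 1)⁻¹
  pos := hm
  primitive := Complex.isPrimitiveRoot_exp m hm.ne'
  β_pow_mul := by rw [← mul_pow, genericβ_mul_inv, one_pow]
  U_mul := by
    refine PowerSeries.inv_mul_cancel _ ?_
    rw [map_sub, map_pow, PowerSeries.constantCoeff_inv]
    have h : constantCoeff genericβ = 2 := by simp [genericβ]
    rw [h, map_one, sub_ne_zero]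
    intro h2
    have h3 := congrArg norm h2
    rw [norm_pow, norm_inv, norm_one, Complex.norm_ofNat] at h3
    have : ((2 : ℝ)⁻¹) ^ m < 1 := pow_lt_one₀ (by norm_num) (by norm_num) hm.ne'
    linarith

/-- Differentiation with respect to the parameter of the generic instance. -/
noncomputable def genericDeriv : Derivation ℚ ℂ⟦X⟧ ℂ⟦X⟧ :=
  (-genericβ • PowerSeries.derivative ℂ).restrictScalars ℚ

theorem genericDeriv_apply (f : ℂ⟦X⟧) :
    genericDeriv f = -genericβ * PowerSeries.derivative ℂ f := rfl

theorem genericDeriv_β : genericDeriv genericβ = -genericβ := by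
  rw [genericDeriv_apply, genericβ, map_add, derivative_C, derivative_X, zero_add, mul_one]

theorem genericDeriv_algebraMap (z : ℂ) : genericDeriv (algebraMap ℂ ℂ⟦X⟧ z) = 0 := by
  rw [genericDeriv_apply, Derivation.map_algebraMap, mul_zero]

theorem generic_injective {m : ℕ} (hm : 0 < m) {p q : ℚ[X]}
    (h : Polynomial.aeval (generic hm).T p = Polynomial.aeval (generic hm).T q) : p = q := by
  have hT : (generic hm).T ≠ 0 := by
    intro h0
    have := (generic hm).β_pow_mul
    rw [h0, mul_zero] at this
    exact zero_ne_one this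
  have key : ∀ (n : ℕ) (p : ℚ[X]), p.natDegree ≤ n → Polynomial.aeval (generic hm).T p = 0 → p = 0 := by
    intro n
    induction n with
    | zero =>
      intro p hp h
      rw [Polynomial.eq_C_of_natDegree_le_zero hp, Polynomial.aeval_C] at h
      rw [Polynomial.eq_C_of_natDegree_le_zero hp]
      have := (map_eq_zero_iff _ (algebraMap ℚ ℂ⟦X⟧).injective).1 h
      rw [this, map_zero]
    | succ n ih =>
      intro p hp h
      have h1 := congrArg genericDeriv h
      rw [Derivation.map_aeval, map_zero, (generic hm).deriv_T genericDeriv_β, smul_eq_mul] at h1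
      have hm' : (m : ℂ⟦X⟧) ≠ 0 := by
        rw [← map_natCast (algebraMap ℚ ℂ⟦X⟧), Ne, map_eq_zero_iff _ (algebraMap ℚ ℂ⟦X⟧).injective]
        exact_mod_cast hm.ne'
      have h2 := (mul_eq_zero.1 h1).resolve_right (mul_ne_zero hm' hT)
      have h3 := ih _ ((Polynomial.natDegree_derivative_le p).trans (by omega)) h2
      have h4 : p.natDegree = 0 := Polynomial.derivative_eq_zero.1 h3
      rw [Polynomial.eq_C_of_natDegree_le_zero h4.le, Polynomial.aeval_C] at h
      rw [Polynomial.eq_C_of_natDegree_le_zero h4.le]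
      have := (map_eq_zero_iff _ (algebraMap ℚ ℂ⟦X⟧).injective).1 h
      rw [this, map_zero]
  rw [← sub_eq_zero]
  exact key _ _ le_rfl (by rw [map_sub, h, sub_self])

end Generic

end LGParam

/-- The coefficients of the expansion, multiplied by a power of `T - 1`, are polynomials in `m` and
`T`. -/
theorem LGInstance.exists_pow_mul_expect_eq (k : ℕ) : ∃ (s : ℕ) (N : ℚ[X][X]), ∀ j : LGInstance,
    (j.P.T - 1) ^ s * j.P.expect k 1 =
      Polynomial.aeval j.P.T (N.map (Polynomial.evalRingHom (j.m : ℚ))) := by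
  obtain ⟨N, hN⟩ := LGInstance.exists_expect_eq k
  simp only [hN]
  clear hN
  induction N using MvPolynomial.induction_on with
  | C a => exact ⟨0, Polynomial.C (Polynomial.C a), fun j => by simp⟩
  | add p q hp hq =>
    obtain ⟨s, N, h⟩ := hp
    obtain ⟨s', N', h'⟩ := hq
    refine ⟨s + s', (Polynomial.X - 1) ^ s' * N + (Polynomial.X - 1) ^ s * N', fun j => ?_⟩
    have h1 := h j
    have h2 := h' j
    simp only [map_add, Polynomial.map_add, Polynomial.map_mul, Polynomial.map_pow,
      Polynomial.map_sub, Polynomial.map_X, Polynomial.map_one, map_mul, map_pow, map_sub,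
      Polynomial.aeval_X, map_one, ← h1, ← h2]
    ring
  | mul_X p v hp =>
    obtain ⟨s, N, h⟩ := hp
    fin_cases v
    · refine ⟨s, N * Polynomial.C Polynomial.X, fun j => ?_⟩
      have h1 := h j
      rw [Polynomial.map_mul, Polynomial.map_C, map_mul, map_mul, ← h1]
      simp
      ring
    · refine ⟨s, N * Polynomial.X, fun j => ?_⟩
      have h1 := h j
      rw [Polynomial.map_mul, Polynomial.map_X, map_mul, map_mul, ← h1]
      simp
      ring
    · refine ⟨s + 1, N, fun j => ?_⟩
      have h1 := h j
      have h2 := j.P.U_mul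
      rw [map_mul, ← h1]
      simp
      rw [pow_succ]
      linear_combination (j.P.T - 1) ^ s * MvPolynomial.aeval ![(j.m : j.A), j.P.T, j.P.U] p * h2

namespace LGParam

open Polynomial

/-- The `k`-th coefficient of the expansion of `f` is a polynomial of degree at most `d` in `T`. -/
def IsPoly (m k d : ℕ) (f : ℚ[X]) : Prop :=
  ∃ Q : ℚ[X], Q.natDegree ≤ d ∧ ∀ (A : Type) [CommRing A] [Algebra ℂ A] [Algebra ℚ A] (P : LGParam m A),
    P.expect k (aeval (MvPolynomial.X LGVar.y) f) = aeval P.T Q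

variable {m k d : ℕ}

theorem IsPoly.add {f g : ℚ[X]} (hf : IsPoly m k d f) (hg : IsPoly m k d g) :
    IsPoly m k d (f + g) := by
  obtain ⟨Q, h1, h2⟩ := hf
  obtain ⟨Q', h1', h2'⟩ := hg
  exact ⟨Q + Q', (natDegree_add_le _ _).trans (max_le h1 h1'), fun A _ _ _ P => by
    rw [map_add, map_add, map_add, h2, h2']⟩

theorem isPoly_pow_sub_one_mul {g : ℚ[X]} (hk : ∀ j < k, ∃ d', d' + 1 ≤ d ∧
    IsPoly m (k - (j + 1)) d' (eulerCoeff m (j + 1) g)) : IsPoly m k d ((X ^ m - 1) * g) := by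
  choose! d' h1 Q h2 h3 using hk
  refine ⟨-X * ∑ j ∈ Finset.range k, Q j, ?_, fun A _ _ _ P => ?_⟩
  · rw [neg_mul, natDegree_neg, Finset.mul_sum]
    refine natDegree_sum_le_of_forall_le _ _ fun j hj => ?_
    rw [Finset.mem_range] at hj
    refine natDegree_mul_le.trans ?_
    have := h1 j hj
    have := h2 j hj
    rw [natDegree_X]
    omega
  · rw [P.expect_pow_sub_one_mul_rat, map_mul, map_neg, aeval_X, map_sum]
    congr 1
    exact Finset.sum_congr rfl fun j hj => h3 j (Finset.mem_range.1 hj) A P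

theorem isPoly_of_dvd {f : ℚ[X]} (h : (X - 1) ^ (2 * k + 1) ∣ f) : IsPoly m k d f :=
  ⟨0, by simp, fun A _ _ _ P => by rw [P.expect_eq_zero_of_dvd h, map_zero]⟩

/-- The function `X - 1` vanishes at the critical point, and its expansion starts two orders later
than expected. -/
theorem exists_isPoly_X_sub_one (hm : 0 < m) (hk : ∀ j < k, ∀ f, IsPoly m j j f) :
    ∃ Q : ℚ[X], Q.natDegree ≤ k + 1 ∧ ∀ (A : Type) [CommRing A] [Algebra ℂ A] [Algebra ℚ A]
      (P : LGParam m A), P.expect (k + 1) (MvPolynomial.X LGVar.y - 1) = aeval P.T Q ∧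
        P.expect 1 (MvPolynomial.X LGVar.y - 1) = 0 := by
  have main : ∀ f : ℚ[X], f.eval 1 = 0 → IsPoly m k k f := by
    intro f hf
    obtain ⟨g, r, h⟩ := exists_eq_add_pow_sub_one_mul hm f (2 * k + 1)
    rw [hf, C_0, zero_add] at h
    rw [h]
    exact (isPoly_pow_sub_one_mul fun j hj => ⟨k - (j + 1), by omega, hk _ (by omega) _⟩).add
      (isPoly_of_dvd ⟨r, rfl⟩)
  obtain ⟨g, r, h⟩ := exists_eq_add_pow_sub_one_mul hm (X - 1) (2 * (k + 1) + 1)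
  have e : (X - 1 : ℚ[X]).eval 1 = 0 := by simp
  rw [e, C_0, zero_add] at h
  have h1 : IsPoly m (k + 1) (k + 1) (X - 1) := by
    rw [h]
    refine (isPoly_pow_sub_one_mul fun j hj => ?_).add (isPoly_of_dvd ⟨r, rfl⟩)
    rcases Nat.eq_zero_or_pos j with rfl | hj0
    · exact ⟨k, le_rfl, main _ (eval_one_eulerCoeff_one hm (by omega) h)⟩
    · exact ⟨k + 1 - (j + 1), by omega, hk _ (by omega) _⟩
  obtain ⟨Q, hQ, hQ'⟩ := h1
  refine ⟨Q, hQ, fun A _ _ _ P => ⟨?_, ?_⟩⟩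
  · rw [← hQ']; simp
  · obtain ⟨g, r, h⟩ := exists_eq_add_pow_sub_one_mul hm (X - 1) (2 * 1 + 1)
    rw [e, C_0, zero_add] at h
    have e2 : (MvPolynomial.X LGVar.y - 1 : MvPolynomial (LGVar m) A) =
        aeval (MvPolynomial.X LGVar.y) ((X ^ m - 1) * g + (X - 1) ^ (2 * 1 + 1) * r) := by
      rw [← h]; simp
    rw [e2, map_add, map_add, P.expect_eq_zero_of_dvd ⟨r, rfl⟩, P.expect_pow_sub_one_mul_rat,
      Finset.sum_range_one, Nat.sub_self, expect_zero]
    have e3 : ∀ f : ℚ[X], (lgJet m A).ev (aeval (MvPolynomial.X LGVar.y) f) =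
        algebraMap ℚ A (f.eval 1) := by
      intro f
      have : ((lgJet m A).ev.restrictScalars ℚ).comp (aeval (MvPolynomial.X LGVar.y)) =
          (Algebra.ofId ℚ A).comp (aeval (1 : ℚ)) := by
        refine algHom_ext ?_
        simp [lgJet_ev_y]
      have := AlgHom.congr_fun this f
      simpa [← coe_aeval_eq_eval] using this
    rw [e3, eval_one_eulerCoeff_one hm (by omega) h]
    simp

theorem exists_expect_one (hm : 0 < m) (hk : ∀ j < k, ∀ f, IsPoly m j j f) : IsPoly m k k 1 := by
  obtain ⟨Q, hQ, hw⟩ := exists_isPoly_X_sub_one hm hk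
  obtain ⟨s, N, hN⟩ := LGInstance.exists_pow_mul_expect_eq k
  set N' := N.map (evalRingHom (m : ℚ)) with hN'
  have hode : (X - 1) * ((m : ℚ[X]) * X * derivative N' - (k : ℚ[X]) * N') -
      (s : ℚ[X]) * (m : ℚ[X]) * X * N' = -(X - 1) ^ s * Q := by
    refine generic_injective hm ?_
    set P := generic hm with hP
    have h1 := hN ⟨m, _, P⟩
    have h2 := hw _ P
    have h3 := P.deriv_expect (δ := genericDeriv) genericDeriv_β genericDeriv_algebraMap k
    have h4 := P.deriv_T (δ := genericDeriv) genericDeriv_β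
    have h5 := congrArg genericDeriv h1
    rw [Derivation.map_aeval, h4, Derivation.leibniz, Derivation.leibniz_pow, map_sub,
      Derivation.map_one_eq_zero, h4] at h5
    rw [h2.1, h2.2] at h3
    have h6 := P.U_mul
    dsimp only at h1 h5
    rw [← hN'] at h1 h5
    simp only [map_sub, map_mul, map_neg, map_pow, aeval_X, map_one, map_natCast, ← h1]
    simp only [smul_eq_mul, nsmul_eq_mul, sub_zero] at h5
    have h7 : (s : PowerSeries ℂ) * (P.T - 1) ^ (s - 1) * (P.T - 1) = s * (P.T - 1) ^ s := by
      cases s with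
      | zero => simp
      | succ s => rw [Nat.add_sub_cancel]; ring
    linear_combination -(P.T - 1) * h5 + (P.T - 1) ^ s * (P.T - 1) * h3 - (P.T - 1) ^ s * aeval P.T Q * h6
      + P.expect k 1 * m * P.T * h7
  obtain ⟨R, hR, hR'⟩ := exists_eq_pow_mul_of_ode hm hQ s N' hode
  refine ⟨R, hR, fun A _ _ _ P => ?_⟩
  have h1 := hN ⟨m, _, P⟩
  dsimp only at h1
  rw [← hN', hR', map_mul, map_pow, map_sub, aeval_X, map_one (aeval P.T)] at h1
  have h2 : P.U ^ s * (P.T - 1) ^ s = 1 := by rw [← mul_pow, P.U_mul, one_pow]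
  rw [map_one]
  linear_combination P.U ^ s * h1 - (P.expect k 1 - aeval P.T R) * h2

/-- The coefficients of the expansions of polynomials in `Y` are polynomials in `T`. -/
theorem isPoly (hm : 0 < m) (k : ℕ) (f : ℚ[X]) : IsPoly m k k f := by
  induction k using Nat.strong_induction_on generalizing f with
  | _ k ih =>
  obtain ⟨g, r, h⟩ := exists_eq_add_pow_sub_one_mul hm f (2 * k + 1)
  rw [h]
  refine .add ?_ (.add (isPoly_pow_sub_one_mul fun j hj => ⟨k - (j + 1), by omega, ih _ (by omega) _⟩)
    (isPoly_of_dvd ⟨r, rfl⟩))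
  obtain ⟨Q, hQ, hQ'⟩ := exists_expect_one hm ih
  refine ⟨C (f.eval 1) * Q, (natDegree_C_mul_le _ _).trans hQ, fun A _ _ _ P => ?_⟩
  have h1 := hQ' A P
  rw [map_one] at h1
  rw [map_mul, aeval_C, aeval_C, IsScalarTower.algebraMap_apply ℚ A (MvPolynomial (LGVar m) A),
    Algebra.algebraMap_eq_smul_one (R := A), map_smul, h1, smul_eq_mul]

end LGParam

section Rescaling

variable {m : ℕ} {A : Type*} [CommRing A] [Algebra ℚ A]

theorem lgH_smul (x : Fin m → A) (ℓ : A) (i j : Fin m) :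
    lgH (fun i => ℓ * x i) ℓ i j = ℓ * lgH x 1 i j := by
  rw [lgH, lgH]
  split_ifs <;> ring

theorem lgV_smul (x : Fin m → A) (ℓ : A) : lgV (fun i => ℓ * x i) ℓ = ℓ • lgV x 1 := by
  simp only [lgV, lgS, lgH_smul, smul_sub, Finset.smul_sum, smul_smul, one_smul]
  congr 1
  refine Finset.sum_congr rfl fun i _ => Finset.sum_congr rfl fun j _ => ?_
  congr 1
  ring

/-- The coefficients of the expansion for the potential with values `x i = ℓ - ζ ^ i * ℓ * β` at the
critical point, in terms of those for the potential divided by `ℓ`. -/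
theorem LGParam.pow_mul_feynman [Algebra ℂ A] (P : LGParam m A) {ℓ v : A} (hv : ℓ * v = 1)
    {C : Fin m → Fin m → A} (hC : ∀ i j, ∑ l, lgH (fun i => ℓ * P.x i) ℓ i l * C l j =
      if i = j then 1 else 0) (k : ℕ) :
    (m : A) ^ k * (ℓ ^ k * (lgJet m A).feynman C (lgV (fun i => ℓ * P.x i) ℓ) k 1) =
      P.expect k 1 := by
  have h : C = fun i j => v * P.covar i j := by
    have h1 : Matrix.of (lgH (fun i => ℓ * P.x i) ℓ) * Matrix.of C = 1 := by
      ext i j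
      simp [Matrix.mul_apply, hC, Matrix.one_apply]
    have h2 : Matrix.of (lgH (fun i => ℓ * P.x i) ℓ) * Matrix.of (fun i j => v * P.covar i j) = 1 := by
      ext i j
      have e : ∀ l, ℓ * lgH P.x 1 i l * (v * P.covar l j) = lgH P.x 1 i l * P.covar l j := fun l => by
        linear_combination lgH P.x 1 i l * P.covar l j * hv
      simp [Matrix.mul_apply, lgH_smul, e, P.isPotential.inv, Matrix.one_apply]
    have h3 := mul_eq_one_comm.1 h1
    have h4 : Matrix.of C = Matrix.of (fun i j => v * P.covar i j) := by
      rw [← mul_one (Matrix.of C), ← h2, ← mul_assoc, h3, one_mul]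
    exact Matrix.of.injective h4
  rw [h, lgV_smul, JetAlgebra.feynman_smul _ hv, expect, LinearMap.smul_apply, smul_eq_mul,
    ← mul_assoc (ℓ ^ k), ← mul_pow ℓ, hv, one_pow, one_mul]

end Rescaling

namespace LGParam

open Polynomial

section ExpectPoly

variable {m : ℕ} (hm : 0 < m)

/-- The polynomial in `T` which is the `k`-th coefficient of the expansion of `f`. -/
noncomputable def expectPoly (k : ℕ) (f : ℚ[X]) : ℚ[X] := (isPoly hm k f).choose

theorem natDegree_expectPoly_le (k : ℕ) (f : ℚ[X]) : (expectPoly hm k f).natDegree ≤ k :=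
  (isPoly hm k f).choose_spec.1

theorem expect_aeval {A : Type} [CommRing A] [Algebra ℂ A] [Algebra ℚ A] (P : LGParam m A) (k : ℕ)
    (f : ℚ[X]) :
    P.expect k (aeval (MvPolynomial.X LGVar.y) f) = aeval P.T (expectPoly hm k f) :=
  (isPoly hm k f).choose_spec.2 A P

theorem expect_one {A : Type} [CommRing A] [Algebra ℂ A] [Algebra ℚ A] (P : LGParam m A) (k : ℕ) :
    P.expect k 1 = aeval P.T (expectPoly hm k 1) := by
  have h := expect_aeval hm P k 1
  rwa [map_one] at h

theorem expectPoly_add (k : ℕ) (f g : ℚ[X]) :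
    expectPoly hm k (f + g) = expectPoly hm k f + expectPoly hm k g := by
  refine generic_injective hm ?_
  simp only [map_add, ← expect_aeval hm]

theorem expectPoly_smul (k : ℕ) (c : ℚ) (f : ℚ[X]) :
    expectPoly hm k (c • f) = c • expectPoly hm k f := by
  refine generic_injective hm ?_
  rw [map_smul, ← expect_aeval hm, ← expect_aeval hm, map_smul, ← algebraMap_smul (PowerSeries ℂ) c,
    map_smul, algebraMap_smul]

theorem expectPoly_pow_sub_one_mul (k : ℕ) (g : ℚ[X]) :
    expectPoly hm k ((X ^ m - 1) * g) =
      -X * ∑ j ∈ Finset.range k, expectPoly hm (k - (j + 1)) (eulerCoeff m (j + 1) g) := by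
  refine generic_injective hm ?_
  rw [← expect_aeval hm, expect_pow_sub_one_mul_rat, map_mul, map_neg, aeval_X, map_sum]
  congr 1
  exact Finset.sum_congr rfl fun j _ => expect_aeval hm _ _ _

theorem expectPoly_eq_zero_of_dvd {k : ℕ} {f : ℚ[X]} (hf : (X - 1) ^ (2 * k + 1) ∣ f) :
    expectPoly hm k f = 0 := by
  refine generic_injective hm ?_
  rw [← expect_aeval hm, expect_eq_zero_of_dvd _ hf, map_zero]

theorem expectPoly_X_sub_one (k : ℕ) :
    expectPoly hm (k + 1) (X - 1) = -((X - 1) * ((m : ℚ[X]) * X *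
      derivative (expectPoly hm k 1) - (k : ℚ[X]) * expectPoly hm k 1)) := by
  refine generic_injective hm ?_
  set P := generic hm with hP
  have h3 := P.deriv_expect (δ := genericDeriv) genericDeriv_β genericDeriv_algebraMap k
  have h4 := P.deriv_T (δ := genericDeriv) genericDeriv_β
  obtain ⟨Q, -, hQ⟩ := exists_isPoly_X_sub_one (k := 0) hm (by simp)
  have h6 := P.U_mul
  have h7 : P.expect (k + 1) (MvPolynomial.X LGVar.y - 1) =
      aeval P.T (expectPoly hm (k + 1) (X - 1)) := by
    rw [← expect_aeval hm]; simp
  rw [(hQ _ P).2, h7, expect_one hm P, Derivation.map_aeval, h4] at h3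
  simp only [map_neg, map_sub, map_mul, aeval_X, map_one (aeval P.T), map_natCast]
  simp only [smul_eq_mul] at h3
  linear_combination (P.T - 1) * h3 - aeval P.T (expectPoly hm (k + 1) (X - 1)) * h6

/-- The coefficient of `T ^ k` in `expectPoly k f`. -/
noncomputable def expectTop (k : ℕ) : ℚ[X] →ₗ[ℚ] ℚ where
  toFun f := (expectPoly hm k f).coeff k
  map_add' f g := by rw [expectPoly_add, coeff_add]
  map_smul' c f := by rw [expectPoly_smul, coeff_smul, RingHom.id_apply]

theorem expectTop_apply (k : ℕ) (f : ℚ[X]) : expectTop hm k f = (expectPoly hm k f).coeff k := rfl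

theorem expectTop_pow_sub_one_mul (k : ℕ) (g : ℚ[X]) :
    expectTop hm (k + 1) ((X ^ m - 1) * g) = -expectTop hm k (eulerCoeff m 1 g) := by
  rw [expectTop_apply, expectTop_apply, expectPoly_pow_sub_one_mul, neg_mul, coeff_neg, coeff_X_mul,
    finsetSum_coeff, Finset.sum_eq_single_of_mem 0 (by simp)]
  · simp
  · intro j _ hj
    refine coeff_eq_zero_of_natDegree_lt ((natDegree_expectPoly_le hm _ _).trans_lt ?_)
    have := Finset.mem_range.1 ‹_›
    omega

theorem expectTop_eq_zero_of_dvd {k : ℕ} {f : ℚ[X]} (hf : (X - 1) ^ (2 * k + 1) ∣ f) :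
    expectTop hm k f = 0 := by
  rw [expectTop_apply, expectPoly_eq_zero_of_dvd hm hf, coeff_zero]

theorem expectTop_X_sub_one (k : ℕ) :
    expectTop hm (k + 1) (X - 1) = -((m - 1) * k * expectTop hm k 1) := by
  have h1 : (expectPoly hm k 1).coeff (k + 1) = 0 :=
    coeff_eq_zero_of_natDegree_lt ((natDegree_expectPoly_le hm k 1).trans_lt (by omega))
  have e : (X - 1) * ((m : ℚ[X]) * X * derivative (expectPoly hm k 1) - (k : ℚ[X]) * expectPoly hm k 1)
    = X * (C (m : ℚ) * (X * derivative (expectPoly hm k 1)) - C (k : ℚ) * expectPoly hm k 1) -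
      (C (m : ℚ) * (X * derivative (expectPoly hm k 1)) - C (k : ℚ) * expectPoly hm k 1) := by
    simp only [map_natCast]
    ring
  rw [expectTop_apply, expectTop_apply, expectPoly_X_sub_one, e]
  simp only [coeff_neg, coeff_sub, coeff_X_mul, coeff_C_mul, coeff_derivative, h1]
  cases k with
  | zero => simp
  | succ k =>
    simp only [coeff_X_mul, coeff_derivative]
    push_cast
    ring

theorem expectPoly_zero (f : ℚ[X]) : expectPoly hm 0 f = C (f.eval 1) := by
  refine generic_injective hm ?_
  rw [← expect_aeval hm, aeval_C, expect_zero]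
  have : ((lgJet m (PowerSeries ℂ)).ev.restrictScalars ℚ).comp (aeval (MvPolynomial.X LGVar.y)) =
      (Algebra.ofId ℚ (PowerSeries ℂ)).comp (aeval (1 : ℚ)) := by
    refine algHom_ext ?_
    simp [lgJet_ev_y]
  have := AlgHom.congr_fun this f
  simpa [← coe_aeval_eq_eval] using this

theorem expectTop_zero (f : ℚ[X]) : expectTop hm 0 f = f.eval 1 := by
  rw [expectTop_apply, expectPoly_zero, coeff_C_zero]

end ExpectPoly

/-- The coefficients of the expansion are polynomials in `m` and `T`, uniformly in `m`. -/
theorem exists_map_eq_expectPoly (k : ℕ) : ∃ N : ℚ[X][X], ∀ {m : ℕ} (hm : 0 < m),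
    N.map (evalRingHom (m : ℚ)) = expectPoly hm k 1 := by
  obtain ⟨s, N, hN⟩ := LGInstance.exists_pow_mul_expect_eq k
  have hmon : ((X - C 1 : ℚ[X][X]) ^ s).Monic := (monic_X_sub_C 1).pow s
  refine ⟨N /ₘ (X - C 1) ^ s, fun {m} hm => ?_⟩
  have h : N.map (evalRingHom (m : ℚ)) = (X - C 1) ^ s * expectPoly hm k 1 := by
    refine generic_injective hm ?_
    have := hN ⟨m, _, generic hm⟩
    dsimp only at this
    rw [← this, map_mul, expect_one hm, map_pow, map_sub, aeval_X, aeval_C, map_one (algebraMap ℚ _)]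
  rw [map_divByMonic _ hmon, h, Polynomial.map_pow, Polynomial.map_sub, map_X, map_C, map_one (evalRingHom _),
    mul_divByMonic_cancel_left _ ((monic_X_sub_C 1).pow s)]

end LGParam

namespace LGParam

open PowerSeries

/-- The critical point with `x i = ℓ - ζ ^ i` is nondegenerate at `ℓ = 0`, so that the coefficients
`r k` of the expansion are power series in `ℓ = L`. -/
theorem X_pow_dvd_expectPoly_comp {m : ℕ} (hm : 0 < m) (k : ℕ) :
    (Polynomial.X ^ k : ℚ[X]) ∣ (expectPoly hm k 1).comp (Polynomial.X ^ m) := by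
  set B := ℂ⟦X⟧ with hB
  set F := FractionRing B with hF
  set ζ : ℂ := Complex.exp (2 * Real.pi * Complex.I / m) with hζ'
  have hζ : IsPrimitiveRoot ζ m := Complex.isPrimitiveRoot_exp m hm.ne'
  set D : B := (X : B) ^ m - 1 with hD
  have hD1 : D * D⁻¹ = 1 := by
    refine PowerSeries.mul_inv_cancel _ ?_
    rw [hD, map_sub, map_pow, constantCoeff_X, zero_pow hm.ne', map_one]
    norm_num
  set x : Fin m → B := fun i => X - algebraMap ℂ B (ζ ^ (i : ℕ)) * 1 with hx
  set y : Fin m → B := fun i => D⁻¹ * zetaInv m X (algebraMap ℂ B (ζ ^ (i : ℕ)) * 1) with hy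
  have hxy : ∀ i, x i * y i = 1 := by
    intro i
    have := sub_mul_zetaInv hζ (X : B) 1 i
    rw [one_pow] at this
    rw [hx, hy]
    linear_combination D⁻¹ * this + hD1
  have hpot := lgJet_isPotential (ℓ := (X : B)) (c := algebraMap ℚ B (m : ℚ)⁻¹ * (X * D)) hxy (by
    have h1 := sum_zetaInv hζ hm (X : B) 1
    have h2 := algebraMap_inv_natCast_mul (A := B) (⟨0, hm⟩ : Fin m)
    have h3 : (X : B) ^ m = X * X ^ (m - 1) := by rw [← pow_succ', Nat.sub_add_cancel hm]
    rw [hy, ← Finset.mul_sum, h1]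
    rw [h3] at hD
    linear_combination X * D * h2 - X ^ 2 * X ^ (m - 1) * D * D⁻¹ * h2 - X * X * X ^ (m - 1) * hD1 + X * hD)
  set C := lgC y (algebraMap ℚ B (m : ℚ)⁻¹ * (X * D)) with hC
  set r := (lgJet m B).feynman C (lgV x X) k 1 with hr
  set φ : B →+* F := algebraMap B F with hφ
  have hinj : Function.Injective φ := IsFractionRing.injective B F
  have hX : φ X ≠ 0 := by
    rw [Ne, map_eq_zero_iff _ hinj]
    exact X_ne_zero
  have hDF : φ D ≠ 0 := by
    intro h
    have := congrArg φ hD1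
    rw [map_mul, h, zero_mul, map_one] at this
    exact zero_ne_one this
  let P : LGParam m F :=
    { ζ := ζ
      β := (φ X)⁻¹
      T := (φ X) ^ m
      U := (φ D)⁻¹
      pos := hm
      primitive := hζ
      β_pow_mul := by rw [← mul_pow, inv_mul_cancel₀ hX, one_pow]
      U_mul := by
        have e : φ X ^ m - 1 = φ D := by rw [hD, map_sub, map_pow, map_one]
        rw [e]
        exact inv_mul_cancel₀ hDF }
  have hz : ∀ z : ℂ, algebraMap ℂ F z = φ (algebraMap ℂ B z) := fun z =>
    IsScalarTower.algebraMap_apply ℂ B F z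
  have hPx : ∀ i, φ X * P.x i = φ (x i) := by
    intro i
    rw [LGParam.x, LGParam.b, hz, hx]
    simp only [mul_one, map_sub]
    change φ X * (1 - φ (algebraMap ℂ B (ζ ^ (i : ℕ))) * (φ X)⁻¹) = _
    rw [mul_sub, mul_one, mul_left_comm, mul_inv_cancel₀ hX, mul_one]
  have hq : ∀ q : ℚ, φ (algebraMap ℚ B q) = algebraMap ℚ F q := fun q =>
    (IsScalarTower.algebraMap_apply ℚ B F q).symm
  have h := P.pow_mul_feynman (mul_inv_cancel₀ hX) (C := fun i j => φ (C i j)) (fun i j => by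
    have h1 := congrArg φ (hpot.inv i j)
    rw [map_sum] at h1
    have h2 : ∀ l, lgH (fun i => φ X * P.x i) (φ X) i l = φ (lgH x X i l) := by
      intro l
      simp only [lgH, hPx, map_sub, map_mul, hq]
      split_ifs <;> simp
    simp only [h2, ← map_mul]
    rw [h1]
    split_ifs <;> simp) k
  simp only [hPx] at h
  have h1 := lgJet_map_feynman φ C x X k 1
  rw [map_one (MvPolynomial.map φ)] at h1
  rw [← h1, expect_one hm, ← map_natCast φ, ← map_pow, ← map_pow, ← map_mul, ← map_mul, ← hr] at h
  have h2 : Polynomial.aeval P.T (expectPoly hm k 1) =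
      φ ((((expectPoly hm k 1).comp (Polynomial.X ^ m)).map (algebraMap ℚ ℂ) : ℂ[X]) : ℂ⟦X⟧) := by
    have e : ∀ f : ℚ[X], Polynomial.aeval P.T f =
        φ (((f.comp (Polynomial.X ^ m)).map (algebraMap ℚ ℂ) : ℂ[X]) : ℂ⟦X⟧) := by
      intro f
      induction f using Polynomial.induction_on' with
      | add p q hp hq => simp only [map_add, hp, hq, Polynomial.add_comp, Polynomial.map_add, Polynomial.coe_add]
      | monomial n a =>
        rw [Polynomial.aeval_monomial, Polynomial.monomial_comp, Polynomial.map_mul, Polynomial.map_C, Polynomial.coe_mul, map_mul,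
          Polynomial.map_pow, Polynomial.map_pow, Polynomial.map_X, Polynomial.coe_pow, Polynomial.coe_pow, Polynomial.coe_X,
          Polynomial.coe_C, map_pow, map_pow, ← hq, RingHom.congr_fun (Subsingleton.elim
            (algebraMap ℚ B) ((PowerSeries.C (R := ℂ)).comp (algebraMap ℚ ℂ))) a]
        rfl
    exact e _
  rw [h2] at h
  have h3 := hinj h
  rw [Polynomial.X_pow_dvd_iff]
  intro d hd
  have h4 : PowerSeries.coeff d ((m : B) ^ k * (X ^ k * r)) = 0 := by
    rw [mul_left_comm]
    exact (X_pow_dvd_iff.1 (dvd_mul_right _ _)) d hd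
  rw [h3, Polynomial.coeff_coe, Polynomial.coeff_map] at h4
  exact (map_eq_zero_iff _ (algebraMap ℚ ℂ).injective).1 h4

end LGParam

section Characterisation

open Polynomial

variable {m : ℕ} (hm : 0 < m)

/-- The relations satisfied by the leading coefficients `LGParam.expectTop` determine them up to
their value at `k = 0`. -/
theorem LGParam.apply_one_eq_expectTop_smul {K : Type*} [Field K] [CharZero K] (h1 : m ≠ 1)
    (σ : ℕ → ℚ[X] →ₗ[ℚ] K) (h0 : ∀ f : ℚ[X], f.eval 1 = 0 → σ 0 f = 0)
    (hmul : ∀ k g, σ (k + 1) ((X ^ m - 1) * g) = -σ k (eulerCoeff m 1 g))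
    (hdvd : ∀ k f, (X - 1) ^ (2 * k + 1) ∣ f → σ k f = 0)
    (hX : ∀ k, σ (k + 1) (X - 1) = -((m - 1) * k * σ k 1)) (k : ℕ) :
    σ k 1 = LGParam.expectTop hm k 1 • σ 0 1 := by
  have hm' : (m : ℚ) ≠ 0 := by exact_mod_cast hm.ne'
  have hm1 : (m : K) - 1 ≠ 0 := by
    rw [sub_ne_zero]
    exact_mod_cast h1
  suffices h : ∀ f, σ k f = LGParam.expectTop hm k f • σ 0 1 from h 1
  induction k with
  | zero =>
    intro f
    have h := h0 (f - Polynomial.C (f.eval 1)) (by simp)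
    rw [map_sub, sub_eq_zero, ← mul_one (Polynomial.C _), ← smul_eq_C_mul, map_smul] at h
    rw [h, LGParam.expectTop_zero]
  | succ k ih =>
    have step : ∀ j, (∀ f, σ j f = LGParam.expectTop hm j f • σ 0 1) → ∀ f : ℚ[X], f.eval 1 = 0 →
        σ (j + 1) f = LGParam.expectTop hm (j + 1) f • σ 0 1 := by
      intro j hj f hf
      obtain ⟨g, r, h⟩ := exists_eq_add_pow_sub_one_mul hm f (2 * (j + 1) + 1)
      rw [hf, C_0, zero_add] at h
      rw [h, map_add, map_add, hmul, hdvd _ _ ⟨r, rfl⟩, LGParam.expectTop_pow_sub_one_mul,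
        LGParam.expectTop_eq_zero_of_dvd hm ⟨r, rfl⟩, hj, add_zero, add_zero, neg_smul]
    have key : σ (k + 1) 1 = LGParam.expectTop hm (k + 1) 1 • σ 0 1 := by
      obtain ⟨g, r, h⟩ := exists_eq_add_pow_sub_one_mul hm (X - 1) (2 * (k + 2) + 1)
      have e : (X - 1 : ℚ[X]).eval 1 = 0 := by simp
      rw [e, C_0, zero_add] at h
      have hg : (eulerCoeff m 1 g).eval 1 = 0 := by
        have d1 := congrArg (fun f => (derivative f).eval 1) h
        have d2 := congrArg (fun f => (derivative (derivative f)).eval 1) h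
        have q : (X - 1 : ℚ[X]) ^ (2 * (k + 2) + 1) * r = (X - 1) ^ 3 * ((X - 1) ^ (2 * (k + 1)) * r) := by
          ring
        rw [q] at d1 d2
        have hc : ((m.choose 2 : ℕ) : ℚ) = m * (m - 1) / 2 := Nat.cast_choose_two ℚ m
        simp [derivative_pow] at d1 d2
        rw [eulerCoeff_one]
        simp
        have hm2 : ((m - 1 : ℕ) : ℚ) = m - 1 := by
          rw [Nat.cast_sub hm, Nat.cast_one]
        rw [hm2] at d2
        rw [hc]
        have d3 : (m : ℚ) * ((m - 1) * eval 1 g + 2 * eval 1 (derivative g)) = 0 := by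
          linear_combination -d2
        have d4 := (mul_eq_zero.1 d3).resolve_left hm'
        linear_combination (m / 2 : ℚ) * d4
      have s1 := hX (k + 1)
      have s2 := LGParam.expectTop_X_sub_one hm (k + 1)
      have hE : σ (k + 2) (X - 1) = LGParam.expectTop hm (k + 2) (X - 1) • σ 0 1 := by
        rw [h, map_add, map_add, hmul, hdvd _ _ ⟨r, rfl⟩, LGParam.expectTop_pow_sub_one_mul,
          LGParam.expectTop_eq_zero_of_dvd hm ⟨r, rfl⟩, step k ih _ hg, add_zero, add_zero,
          neg_smul]
      rw [s1, s2, neg_smul, neg_inj, Algebra.smul_def] at hE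
      have hk : ((k + 1 : ℕ) : K) ≠ 0 := by exact_mod_cast k.succ_ne_zero
      refine mul_left_cancel₀ (mul_ne_zero hm1 hk) (hE.trans ?_)
      rw [Algebra.smul_def]
      simp
      ring
    intro f
    have h := step k ih (f - Polynomial.C (f.eval 1)) (by simp)
    rw [← mul_one (Polynomial.C _), ← smul_eq_C_mul, map_sub, map_sub, map_smul, map_smul, key,
      sub_smul, smul_assoc] at h
    exact sub_left_inj.1 h

/-- The values at `1` of functionals obeying the integration by parts rule `hD` for the measure
`x ^ (-n / 2) dx / x`, with a large parameter dual to `x + y / n - (n + 1) / n`. -/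
theorem LGParam.prod_mul_apply_one {K A : Type*} [Field K] [CharZero K] [CommRing A] [Algebra ℚ A]
    {n : ℕ} (hn : 1 ≤ n) {x y : A} (hxy : x ^ n * y = 1) (ρ : ℕ → A →ₗ[ℚ] K)
    (hD : ∀ k (p : ℚ[X]), ρ k (x * aeval x (derivative p) - (n / 2 : ℚ) • aeval x p) =
      ((2 * k + 1) / 2 : ℚ) • ρ (k + 1) (aeval x p * (x - y)))
    (hP : ∀ k, (n : ℚ) • ρ k 1 = ρ (k + 1) ((n + 1 : ℚ) • aeval x (X - 1 : ℚ[X]) - (x - y)))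
    (hV : ∀ k (f : ℚ[X]), (X - 1) ^ (2 * k + 1) ∣ f → ρ k (aeval x f) = 0) (k : ℕ) :
    (∏ j ∈ Finset.range k, (-((n + 1) * (2 * j + 1) / 2) : ℚ)) • ρ k 1 =
      LGParam.expectTop n.succ_pos k 1 • ρ 0 1 := by
  let N : ℕ → ℚ := fun k => ∏ j ∈ Finset.range k, (-((n + 1) * (2 * j + 1) / 2) : ℚ)
  have hN : ∀ k, N (k + 1) = N k * -((n + 1) * (2 * k + 1) / 2) := fun k => by
    simp only [N, Finset.prod_range_succ]
  let σ : ℕ → ℚ[X] →ₗ[ℚ] K := fun k => N k • (ρ k ∘ₗ (aeval x).toLinearMap)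
  have hσ : ∀ k f, σ k f = N k • ρ k (aeval x f) := fun _ _ => rfl
  have key := LGParam.apply_one_eq_expectTop_smul n.succ_pos (by omega) σ
    (fun f hf => by
      rw [hσ, hV 0 f (by simpa using dvd_iff_isRoot.2 hf), smul_zero]) ?_
    (fun k f hf => by rw [hσ, hV k f hf, smul_zero]) ?_ k
  · simpa only [hσ, map_one, N, Finset.prod_range_zero, one_smul] using key
  · intro k g
    have e1 : aeval x ((X ^ (n + 1) - 1) * g) = aeval x (X ^ n * g) * (x - y) := by
      simp only [map_mul, map_pow, map_sub, aeval_X, map_one]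
      linear_combination (aeval x g) * hxy
    have e2 : aeval x (eulerCoeff (n + 1) 1 g) = (n + 1 : ℚ) •
        (x * aeval x (derivative (X ^ n * g)) - (n / 2 : ℚ) • aeval x (X ^ n * g)) := by
      have hc : (((n + 1).choose 2 : ℕ) : ℚ[X]) = ((n : ℚ[X]) + 1) * C (n / 2 : ℚ) := by
        rw [← map_natCast C, Nat.cast_choose_two, ← map_natCast C, ← C_1, ← C_add, ← C_mul]
        push_cast
        ring_nf
      have hp : (X : ℚ[X]) * X ^ (n - 1) = X ^ n := by rw [← pow_succ', Nat.sub_add_cancel hn]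
      have e : eulerCoeff (n + 1) 1 g = (n + 1 : ℚ) •
          (X * derivative (X ^ n * g) - (n / 2 : ℚ) • (X ^ n * g)) := by
        have h2 : (n : ℚ[X]) = C (n / 2 : ℚ) * 2 := by
          rw [← map_natCast C, ← map_ofNat C, ← C_mul, div_mul_cancel₀ _ two_ne_zero]
        rw [eulerCoeff_one, hc]
        simp only [smul_eq_C_mul, derivative_mul, derivative_X_pow, C_add, C_1, map_natCast,
          Nat.add_sub_cancel]
        push_cast
        linear_combination -((n : ℚ[X]) + 1) * n * g * hp - ((n : ℚ[X]) + 1) * X ^ n * g * h2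
      rw [e, map_smul, map_sub, map_smul, map_mul, aeval_X]
    rw [hσ, hσ, hN, e1, e2, map_smul, hD]
    simp only [smul_smul]
    rw [← neg_smul]
    congr 1
    ring
  · intro k
    have h := hD k 1
    simp only [derivative_one, map_zero, mul_zero, zero_sub, map_one, one_mul, map_neg, map_smul] at h
    have h2 := hP k
    rw [map_sub, map_smul] at h2
    rw [hσ, hσ, hN, map_one]
    simp only [Algebra.smul_def, map_mul, map_neg, map_div₀, map_add, map_natCast, map_one, map_ofNat] at h h2 ⊢
    push_cast
    linear_combination (algebraMap ℚ K (N k) * (2 * k + 1) / 2) * h2 + algebraMap ℚ K (N k) * h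

end Characterisation

section Rectangle

open Complex Set

/-- The boundary of the rectangle `[-T, T] × [-β, β]`. -/
def rectBdry (T β : ℝ) : Set ℂ :=
  {τ | (|τ.re| ≤ T ∧ |τ.im| = β) ∨ (|τ.re| = T ∧ |τ.im| ≤ β)}

/-- The integral over the positively oriented boundary of the rectangle `[-T, T] × [-β, β]`. -/
noncomputable def rectInt (T β : ℝ) (f : ℂ → ℂ) : ℂ :=
  (∫ x in (-T)..T, f (x - β * I)) - (∫ x in (-T)..T, f (x + β * I)) +
    I * (∫ y in (-β)..β, f (T + y * I)) - I * ∫ y in (-β)..β, f (-T + y * I)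

variable {T β : ℝ} {f g : ℂ → ℂ}

theorem rectBdry_bot (hT : 0 ≤ T) (hβ : 0 ≤ β) {x : ℝ} (hx : x ∈ uIcc (-T) T) :
    (x - β * I : ℂ) ∈ rectBdry T β := by
  rw [uIcc_of_le (by linarith)] at hx
  left
  simpa [abs_of_nonneg hβ, abs_le] using hx

theorem rectBdry_top (hT : 0 ≤ T) (hβ : 0 ≤ β) {x : ℝ} (hx : x ∈ uIcc (-T) T) :
    (x + β * I : ℂ) ∈ rectBdry T β := by
  rw [uIcc_of_le (by linarith)] at hx
  left
  simpa [abs_of_nonneg hβ, abs_le] using hx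

theorem rectBdry_right (hT : 0 ≤ T) (hβ : 0 ≤ β) {y : ℝ} (hy : y ∈ uIcc (-β) β) :
    (T + y * I : ℂ) ∈ rectBdry T β := by
  rw [uIcc_of_le (by linarith)] at hy
  right
  simpa [abs_of_nonneg hT, abs_le] using hy

theorem rectBdry_left (hT : 0 ≤ T) (hβ : 0 ≤ β) {y : ℝ} (hy : y ∈ uIcc (-β) β) :
    (-T + y * I : ℂ) ∈ rectBdry T β := by
  rw [uIcc_of_le (by linarith)] at hy
  right
  simpa [abs_of_nonneg hT, abs_le] using hy

theorem ContinuousOn.rect_integrable (hT : 0 ≤ T) (hβ : 0 ≤ β) (hf : ContinuousOn f (rectBdry T β)) :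
    IntervalIntegrable (fun x : ℝ => f (x - β * I)) volume (-T) T ∧
    IntervalIntegrable (fun x : ℝ => f (x + β * I)) volume (-T) T ∧
    IntervalIntegrable (fun y : ℝ => f (T + y * I)) volume (-β) β ∧
    IntervalIntegrable (fun y : ℝ => f (-T + y * I)) volume (-β) β := by
  refine ⟨?_, ?_, ?_, ?_⟩ <;> refine ContinuousOn.intervalIntegrable (hf.comp (by fun_prop) ?_)
  exacts [fun x hx => rectBdry_bot hT hβ hx, fun x hx => rectBdry_top hT hβ hx,
    fun x hx => rectBdry_right hT hβ hx, fun x hx => rectBdry_left hT hβ hx]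

theorem rectInt_add (hT : 0 ≤ T) (hβ : 0 ≤ β) (hf : ContinuousOn f (rectBdry T β))
    (hg : ContinuousOn g (rectBdry T β)) :
    rectInt T β (fun τ => f τ + g τ) = rectInt T β f + rectInt T β g := by
  obtain ⟨f1, f2, f3, f4⟩ := hf.rect_integrable hT hβ
  obtain ⟨g1, g2, g3, g4⟩ := hg.rect_integrable hT hβ
  simp only [rectInt, intervalIntegral.integral_add f1 g1, intervalIntegral.integral_add f2 g2,
    intervalIntegral.integral_add f3 g3, intervalIntegral.integral_add f4 g4]
  ring

theorem rectInt_const_mul (c : ℂ) (f : ℂ → ℂ) :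
    rectInt T β (fun τ => c * f τ) = c * rectInt T β f := by
  simp only [rectInt, intervalIntegral.integral_const_mul]
  ring

theorem rectInt_congr (hT : 0 ≤ T) (hβ : 0 ≤ β) (h : EqOn f g (rectBdry T β)) :
    rectInt T β f = rectInt T β g := by
  simp only [rectInt]
  rw [intervalIntegral.integral_congr fun x hx => h (rectBdry_bot hT hβ hx),
    intervalIntegral.integral_congr fun x hx => h (rectBdry_top hT hβ hx),
    intervalIntegral.integral_congr fun x hx => h (rectBdry_right hT hβ hx),
    intervalIntegral.integral_congr fun x hx => h (rectBdry_left hT hβ hx)]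

theorem rectInt_eq_zero_of_differentiableOn (hT : 0 ≤ T) (hβ : 0 ≤ β)
    (hf : DifferentiableOn ℂ f {τ | |τ.re| ≤ T ∧ |τ.im| ≤ β}) : rectInt T β f = 0 := by
  have h := integral_boundary_rect_eq_zero_of_differentiableOn f (-T - β * I) (T + β * I)
    (hf.mono fun τ hτ => by
      rw [mem_reProdIm] at hτ
      simp [uIcc_of_le (show -T ≤ T by linarith), uIcc_of_le (show -β ≤ β by linarith)] at hτ
      exact ⟨abs_le.2 hτ.1, abs_le.2 hτ.2⟩)
  simp at h
  simpa [rectInt, sub_eq_add_neg] using h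

theorem rectInt_eq_zero_of_hasDerivAt {F : ℂ → ℂ} (hT : 0 ≤ T) (hβ : 0 ≤ β)
    (hF : ∀ τ ∈ rectBdry T β, HasDerivAt F (f τ) τ) (hf : ContinuousOn f (rectBdry T β)) :
    rectInt T β f = 0 := by
  obtain ⟨f1, f2, f3, f4⟩ := hf.rect_integrable hT hβ
  have e1 := intervalIntegral.integral_eq_sub_of_hasDerivAt (f := fun x : ℝ => F (x - β * I))
    (fun x hx => by
      simpa [Function.comp_def] using (hF _ (rectBdry_bot hT hβ hx)).comp_of_eq x
        ((hasDerivAt_id (x : ℂ)).comp_ofReal.sub_const (β * I)) rfl) f1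
  have e2 := intervalIntegral.integral_eq_sub_of_hasDerivAt (f := fun x : ℝ => F (x + β * I))
    (fun x hx => by
      simpa [Function.comp_def] using (hF _ (rectBdry_top hT hβ hx)).comp_of_eq x
        ((hasDerivAt_id (x : ℂ)).comp_ofReal.add_const (β * I)) rfl) f2
  have e3 := intervalIntegral.integral_eq_sub_of_hasDerivAt (f := fun y : ℝ => F (T + y * I))
    (fun x hx => by
      simpa [Function.comp_def] using (hF _ (rectBdry_right hT hβ hx)).comp_of_eq x
        (((hasDerivAt_id (x : ℂ)).comp_ofReal.mul_const I).const_add (T : ℂ)) rfl) (f3.mul_const I)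
  have e4 := intervalIntegral.integral_eq_sub_of_hasDerivAt (f := fun y : ℝ => F (-T + y * I))
    (fun x hx => by
      simpa [Function.comp_def] using (hF _ (rectBdry_left hT hβ hx)).comp_of_eq x
        (((hasDerivAt_id (x : ℂ)).comp_ofReal.mul_const I).const_add (-T : ℂ)) rfl) (f4.mul_const I)
  rw [intervalIntegral.integral_mul_const] at e3 e4
  simp only [rectInt, e1, e2]
  rw [mul_comm I, mul_comm I, e3, e4]
  push_cast
  ring_nf

theorem rectInt_inv_sub {w : ℂ} (hT : |w.re| < T) (hβ : |w.im| < β) :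
    rectInt T β (fun τ => (τ - w)⁻¹) = 2 * Real.pi * I := by
  obtain ⟨r1, r2⟩ := abs_lt.1 hT
  obtain ⟨i1, i2⟩ := abs_lt.1 hβ
  have F : ∀ {τ : ℂ}, τ - w ∈ slitPlane → HasDerivAt (fun τ => log (τ - w)) (τ - w)⁻¹ τ :=
    fun {τ} h => by simpa using ((hasDerivAt_id τ).sub_const w).clog h
  have G : ∀ {τ : ℂ}, -(τ - w) ∈ slitPlane →
      HasDerivAt (fun τ => log (-(τ - w))) (τ - w)⁻¹ τ := fun {τ} h => by
    have := ((hasDerivAt_id τ).sub_const w).neg.clog h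
    have e0 : (τ - w)⁻¹ = -1 / -(τ - w) := by rw [neg_div_neg_eq, one_div]
    rw [e0]
    exact this
  have c : ∀ {γ : ℝ → ℂ} {a b : ℝ}, Continuous γ → (∀ x, γ x ≠ w) →
      IntervalIntegrable (fun x => (γ x - w)⁻¹) volume a b := fun {γ a b} hγ h => by
    refine Continuous.intervalIntegrable ?_ _ _
    exact (hγ.sub continuous_const).inv₀ fun x => sub_ne_zero.2 (h x)
  have nb : ∀ x : ℝ, (x - β * I : ℂ) ≠ w := fun x h => by
    have := congrArg im h
    simp at this
    linarith
  have nt : ∀ x : ℝ, (x + β * I : ℂ) ≠ w := fun x h => by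
    have := congrArg im h
    simp at this
    linarith
  have nr : ∀ y : ℝ, (T + y * I : ℂ) ≠ w := fun x h => by
    have := congrArg re h
    simp at this
    linarith
  have nl : ∀ y : ℝ, (-T + y * I : ℂ) ≠ w := fun x h => by
    have := congrArg re h
    simp at this
    linarith
  have e1 := intervalIntegral.integral_eq_sub_of_hasDerivAt (a := -T) (b := T)
    (f := fun x : ℝ => log (x - β * I - w)) (fun x _ => by
      simpa [Function.comp_def] using (F (τ := x - β * I) (Or.inr (by simp; linarith))).comp_of_eq x
        ((hasDerivAt_id (x : ℂ)).comp_ofReal.sub_const (β * I)) rfl) (c (by fun_prop) nb)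
  have e2 := intervalIntegral.integral_eq_sub_of_hasDerivAt (a := -T) (b := T)
    (f := fun x : ℝ => log (x + β * I - w)) (fun x _ => by
      simpa [Function.comp_def] using (F (τ := x + β * I) (Or.inr (by simp; linarith))).comp_of_eq x
        ((hasDerivAt_id (x : ℂ)).comp_ofReal.add_const (β * I)) rfl) (c (by fun_prop) nt)
  have e3 := intervalIntegral.integral_eq_sub_of_hasDerivAt (a := -β) (b := β)
    (f := fun y : ℝ => log (T + y * I - w)) (fun x _ => by
      simpa [Function.comp_def] using (F (τ := T + x * I) (Or.inl (by simp; linarith))).comp_of_eq x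
        (((hasDerivAt_id (x : ℂ)).comp_ofReal.mul_const I).const_add (T : ℂ)) rfl)
    ((c (by fun_prop) nr).mul_const I)
  have e4 := intervalIntegral.integral_eq_sub_of_hasDerivAt (a := -β) (b := β)
    (f := fun y : ℝ => log (-(-T + y * I - w))) (fun x _ => by
      simpa [Function.comp_def] using (G (τ := -T + x * I) (Or.inl (by simp; linarith))).comp_of_eq x
        (((hasDerivAt_id (x : ℂ)).comp_ofReal.mul_const I).const_add (-T : ℂ)) rfl)
    ((c (by fun_prop) nl).mul_const I)
  rw [intervalIntegral.integral_mul_const] at e3 e4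
  have l1 : log (-(-T + β * I - w)) = log (-T + β * I - w) - Real.pi * I := by
    have h : 0 < (-T + β * I - w : ℂ).im := by simp; linarith
    rw [log, log, norm_neg, arg_neg_eq_arg_sub_pi_of_im_pos h]
    push_cast
    ring
  have l2 : log (-(-T + (-β : ℝ) * I - w)) = log (-T + (-β : ℝ) * I - w) + Real.pi * I := by
    have h : (-T + (-β : ℝ) * I - w : ℂ).im < 0 := by simp; linarith
    rw [log, log, norm_neg, arg_neg_eq_arg_add_pi_of_im_neg h]
    push_cast
    ring
  rw [l1, l2] at e4
  simp only [rectInt, e1, e2]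
  rw [mul_comm I, mul_comm I, e3, e4]
  push_cast
  ring_nf

/-- The residue formula for a simple pole inside a rectangle. -/
theorem rectInt_mul_inv_sub {U : Set ℂ} (hU : IsOpen U)
    (hR : {τ : ℂ | |τ.re| ≤ T ∧ |τ.im| ≤ β} ⊆ U) (hf : DifferentiableOn ℂ f U) {w : ℂ}
    (hT : |w.re| < T) (hβ : |w.im| < β) :
    rectInt T β (fun τ => f τ * (τ - w)⁻¹) = 2 * Real.pi * I * f w := by
  have hT0 : 0 ≤ T := (abs_nonneg _).trans hT.le
  have hβ0 : 0 ≤ β := (abs_nonneg _).trans hβ.le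
  have hw : w ∈ U := hR ⟨hT.le, hβ.le⟩
  have hd := (differentiableOn_dslope (hU.mem_nhds hw)).2 hf
  have hbd : rectBdry T β ⊆ {τ : ℂ | |τ.re| ≤ T ∧ |τ.im| ≤ β} := by
    rintro τ (h | h)
    exacts [⟨h.1, h.2.le⟩, ⟨h.1.le, h.2⟩]
  have hne : ∀ τ ∈ rectBdry T β, τ - w ≠ 0 := by
    rintro τ hτ h
    rw [sub_eq_zero] at h
    subst h
    rcases hτ with h | h
    exacts [hβ.ne h.2, hT.ne h.1]
  have e : rectInt T β (fun τ => f τ * (τ - w)⁻¹) =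
      rectInt T β (fun τ => f w * (τ - w)⁻¹ + dslope f w τ) := by
    refine rectInt_congr hT0 hβ0 fun τ hτ => ?_
    have h := hne τ hτ
    change f τ * (τ - w)⁻¹ = f w * (τ - w)⁻¹ + dslope f w τ
    rw [dslope_of_ne _ (sub_ne_zero.1 h), slope_def_field]
    field_simp
    ring
  rw [e, rectInt_add hT0 hβ0, rectInt_const_mul, rectInt_inv_sub hT hβ,
    rectInt_eq_zero_of_differentiableOn hT0 hβ0 (hd.mono hR)]
  · ring
  · exact continuousOn_const.mul (ContinuousOn.inv₀ (by fun_prop) hne)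
  · exact hd.continuousOn.mono (hbd.trans hR)

end Rectangle

section Strip

open Complex Set

/-- The function `e ^ τ + e ^ (-n τ) / n - (n + 1) / n`, which vanishes to second order at `0`. -/
noncomputable def coniPot (n : ℕ) (τ : ℂ) : ℂ :=
  exp τ + exp (-(n * τ)) / n - (n + 1) / n

/-- The restriction of `coniPot` to the real line. -/
noncomputable def coniPotReal (n : ℕ) (x : ℝ) : ℝ :=
  Real.exp x + Real.exp (-(n * x)) / n - (n + 1) / n

/-- The strip around the real line in which `coniPot` takes values in `[0, ∞)` only on the line. -/
def coniStrip (n : ℕ) : Set ℂ := {τ | |τ.im| < 2 * Real.pi / n}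

variable {n : ℕ}

theorem coniPot_ofReal (x : ℝ) : coniPot n x = coniPotReal n x := by
  simp [coniPot, coniPotReal]

theorem coniPot_conj (τ : ℂ) : coniPot n (starRingEnd ℂ τ) = starRingEnd ℂ (coniPot n τ) := by
  simp [coniPot, ← exp_conj]

theorem coniPot_zero (hn : 0 < n) : coniPot n 0 = 0 := by
  have : (n : ℂ) ≠ 0 := by exact_mod_cast hn.ne'
  simp [coniPot]
  field_simp
  ring

theorem hasDerivAt_coniPot (hn : 0 < n) (τ : ℂ) :
    HasDerivAt (coniPot n) (exp τ - exp (-(n * τ))) τ := by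
  have hn' : (n : ℂ) ≠ 0 := by exact_mod_cast hn.ne'
  have h1 : HasDerivAt (fun τ : ℂ => exp (-(n * τ))) (exp (-(n * τ)) * -(n * 1)) τ :=
    (((hasDerivAt_id τ).const_mul (n : ℂ)).neg).cexp
  have h := ((hasDerivAt_exp τ).add (h1.div_const (n : ℂ))).sub_const ((n + 1) / n : ℂ)
  have e : exp τ - exp (-(n * τ)) = exp τ + exp (-(n * τ)) * -(n * 1) / n := by
    field_simp
    ring
  rw [e]
  exact h

theorem differentiable_coniPot (hn : 0 < n) : Differentiable ℂ (coniPot n) :=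
  fun τ => (hasDerivAt_coniPot hn τ).differentiableAt

theorem hasDerivAt_coniPotReal (hn : 0 < n) (x : ℝ) :
    HasDerivAt (coniPotReal n) (Real.exp x - Real.exp (-(n * x))) x := by
  have hn' : (n : ℝ) ≠ 0 := by exact_mod_cast hn.ne'
  have h1 : HasDerivAt (fun x : ℝ => Real.exp (-(n * x))) (Real.exp (-(n * x)) * -(n * 1)) x :=
    (((hasDerivAt_id x).const_mul (n : ℝ)).neg).exp
  have h := ((Real.hasDerivAt_exp x).add (h1.div_const (n : ℝ))).sub_const ((n + 1) / n : ℝ)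
  have e : Real.exp x - Real.exp (-(n * x)) =
      Real.exp x + Real.exp (-(n * x)) * -(n * 1) / n := by
    field_simp
    ring
  rw [e]
  exact h

theorem strictMonoOn_coniPotReal (hn : 0 < n) : StrictMonoOn (coniPotReal n) (Ici 0) := by
  have hn' : (0 : ℝ) < n := by exact_mod_cast hn
  refine strictMonoOn_of_deriv_pos (convex_Ici 0)
    (fun x _ => (hasDerivAt_coniPotReal hn x).continuousAt.continuousWithinAt) fun x hx => ?_
  rw [interior_Ici] at hx
  rw [(hasDerivAt_coniPotReal hn x).deriv, sub_pos, Real.exp_lt_exp]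
  have := mul_pos hn' (mem_Ioi.1 hx)
  have := mem_Ioi.1 hx
  linarith

theorem strictAntiOn_coniPotReal (hn : 0 < n) : StrictAntiOn (coniPotReal n) (Iic 0) := by
  have hn' : (0 : ℝ) < n := by exact_mod_cast hn
  refine strictAntiOn_of_deriv_neg (convex_Iic 0)
    (fun x _ => (hasDerivAt_coniPotReal hn x).continuousAt.continuousWithinAt) fun x hx => ?_
  rw [interior_Iic] at hx
  rw [(hasDerivAt_coniPotReal hn x).deriv, sub_neg, Real.exp_lt_exp]
  have := mul_neg_of_pos_of_neg hn' (mem_Iio.1 hx)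
  have := mem_Iio.1 hx
  linarith

theorem coniPotReal_zero (hn : 0 < n) : coniPotReal n 0 = 0 := by
  have := coniPot_zero hn
  rw [← ofReal_zero, coniPot_ofReal] at this
  exact_mod_cast this

theorem coniPotReal_pos (hn : 0 < n) {x : ℝ} (hx : x ≠ 0) : 0 < coniPotReal n x := by
  rw [← coniPotReal_zero hn]
  rcases lt_or_gt_of_ne hx with h | h
  · exact strictAntiOn_coniPotReal hn h.le (mem_Iic.2 le_rfl) h
  · exact strictMonoOn_coniPotReal hn (mem_Ici.2 le_rfl) h.le h

theorem coniPotReal_nonneg (hn : 0 < n) (x : ℝ) : 0 ≤ coniPotReal n x := by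
  rcases eq_or_ne x 0 with rfl | hx
  · rw [coniPotReal_zero hn]
  · exact (coniPotReal_pos hn hx).le

/-- The function `sin t / t` is decreasing on `(0, π)`. -/
theorem mul_sin_lt_mul_sin {a b : ℝ} (ha : 0 < a) (hab : a < b) (hb : b ≤ Real.pi) :
    a * Real.sin b < b * Real.sin a := by
  have h1 : 0 < 1 - a / b := by rw [sub_pos, div_lt_one (ha.trans hab)]; exact hab
  have h := strictConcaveOn_sin_Icc.2 (⟨le_rfl, Real.pi_pos.le⟩ : (0 : ℝ) ∈ Icc 0 Real.pi)
    (⟨(ha.trans hab).le, hb⟩ : b ∈ Icc 0 Real.pi) (ha.trans hab).ne h1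
    (div_pos ha (ha.trans hab)) (by ring)
  simp only [smul_eq_mul, Real.sin_zero, mul_zero, zero_add] at h
  have hb0 := ha.trans hab
  rw [div_mul_cancel₀ _ hb0.ne', div_mul_eq_mul_div, div_lt_iff₀ hb0] at h
  linarith

theorem coniPot_re_neg_of_im_eq_zero (hn : 2 ≤ n) {τ : ℂ} (h0 : 0 < τ.im)
    (h1 : τ.im < 2 * Real.pi / n) (him : (coniPot n τ).im = 0) : (coniPot n τ).re < 0 := by
  have hn0 : (0 : ℝ) < n := by exact_mod_cast (by omega : 0 < n)
  have hn2 : (2 : ℝ) ≤ n := by exact_mod_cast hn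
  set x := τ.re with hx
  set b := τ.im with hb
  have hpi := Real.pi_pos
  rw [lt_div_iff₀ hn0] at h1
  have hbpi : b < Real.pi := by nlinarith
  have hsin : 0 < Real.sin b := Real.sin_pos_of_pos_of_lt_pi h0 hbpi
  have eim : (coniPot n τ).im = Real.exp x * Real.sin b - Real.exp (-(n * x)) * Real.sin (n * b) / n := by
    have e2 : (exp (-(n * τ)) / n).im = (exp (-(n * τ))).im / n := by
      rw [← ofReal_natCast, div_ofReal_im]
    have e3 : ((n + 1 : ℂ) / n).im = 0 := by
      rw [← ofReal_natCast, div_ofReal_im]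
      simp
    rw [coniPot, sub_im, add_im, e2, e3, exp_im, exp_im]
    simp [← hx, ← hb]
    ring
  have ere : (coniPot n τ).re =
      Real.exp x * Real.cos b + Real.exp (-(n * x)) * Real.cos (n * b) / n - (n + 1) / n := by
    have e2 : (exp (-(n * τ)) / n).re = (exp (-(n * τ))).re / n := by
      rw [← ofReal_natCast, div_ofReal_re]
    have e3 : ((n + 1 : ℂ) / n).re = (n + 1) / n := by
      rw [← ofReal_natCast, div_ofReal_re]
      simp
    rw [coniPot, sub_re, add_re, e2, e3, exp_re, exp_re]
    simp [← hx, ← hb]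
  rw [eim, sub_eq_zero] at him
  have hE := Real.exp_pos x
  have hF := Real.exp_pos (-(n * x))
  -- the imaginary part can only vanish for `n b < π`
  have hsn : 0 < Real.sin (n * b) := by
    have h : 0 < Real.exp (-(n * x)) * Real.sin (n * b) / n := him ▸ mul_pos hE hsin
    rw [div_pos_iff_of_pos_right hn0] at h
    exact (mul_pos_iff_of_pos_left hF).1 h
  have hnb : n * b < Real.pi := by
    by_contra h
    push Not at h
    have := Real.sin_nonpos_of_nonpos_of_neg_pi_le (x := n * b - 2 * Real.pi) (by linarith)
      (by linarith)
    rw [Real.sin_sub_two_pi] at this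
    linarith
  -- on the curve where it vanishes the real part is explicit
  have key : Real.exp (-(n * x)) / n = Real.exp x * Real.sin b / Real.sin (n * b) := by
    field_simp at him ⊢
    linarith
  have ere2 : (coniPot n τ).re = Real.exp x * Real.sin ((n + 1) * b) / Real.sin (n * b) -
      (n + 1) / n := by
    have : Real.exp (-(n * x)) * Real.cos (n * b) / n =
      Real.exp x * Real.sin b / Real.sin (n * b) * Real.cos (n * b) := by rw [← key]; ring
    rw [ere, this, add_mul, one_mul, Real.sin_add]
    field_simp
  rw [ere2, sub_neg]
  have hw : (0 : ℝ) < (n + 1) / n := by positivity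
  rcases le_or_gt Real.pi ((n + 1) * b) with h | h
  · have : Real.sin ((n + 1) * b) ≤ 0 := by
      have := Real.sin_nonpos_of_nonpos_of_neg_pi_le (x := (n + 1) * b - 2 * Real.pi)
        (by nlinarith) (by linarith)
      rwa [Real.sin_sub_two_pi] at this
    refine lt_of_le_of_lt ?_ hw
    exact div_nonpos_of_nonpos_of_nonneg (mul_nonpos_of_nonneg_of_nonpos hE.le this) hsn.le
  · have hnb0 : 0 < n * b := mul_pos hn0 h0
    have s1 : Real.sin (n * b) < n * Real.sin b := by
      have := mul_sin_lt_mul_sin h0 (b := n * b) (by nlinarith) hnb.le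
      have h2 : b * Real.sin (n * b) < b * (n * Real.sin b) := by linarith
      exact lt_of_mul_lt_mul_left h2 h0.le
    have s2 : n * Real.sin ((n + 1) * b) < (n + 1) * Real.sin (n * b) := by
      have := mul_sin_lt_mul_sin hnb0 (b := (n + 1) * b) (by nlinarith) h.le
      have h2 : b * (n * Real.sin ((n + 1) * b)) < b * ((n + 1) * Real.sin (n * b)) := by linarith
      exact lt_of_mul_lt_mul_left h2 h0.le
    have hx0 : x < 0 := by
      by_contra hx0
      push Not at hx0
      have h3 : Real.exp (-(n * x)) ≤ Real.exp x := by
        rw [Real.exp_le_exp]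
        have := mul_nonneg hn0.le hx0
        linarith
      have h4 : Real.exp x * Real.sin b * n ≤ Real.exp x * Real.sin (n * b) := by
        rw [him, div_mul_cancel₀ _ hn0.ne']
        exact mul_le_mul_of_nonneg_right h3 hsn.le
      nlinarith
    have he1 : Real.exp x < 1 := by
      rw [← Real.exp_zero]
      exact Real.exp_lt_exp.2 hx0
    have hs1 : 0 < Real.sin ((n + 1) * b) :=
      Real.sin_pos_of_pos_of_lt_pi (by positivity) h
    rw [div_lt_div_iff₀ hsn hn0]
    have := mul_lt_mul_of_pos_right he1 (mul_pos hs1 hn0)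
    linarith

theorem mem_coniStrip {τ : ℂ} : τ ∈ coniStrip n ↔ |τ.im| < 2 * Real.pi / n := Iff.rfl

theorem isOpen_coniStrip : IsOpen (coniStrip n) :=
  isOpen_lt (by fun_prop) continuous_const

theorem convex_coniStrip : Convex ℝ (coniStrip n) := by
  have : coniStrip n = imLm ⁻¹' Ioo (-(2 * Real.pi / n)) (2 * Real.pi / n) := by
    ext τ
    simp [coniStrip, abs_lt]
  rw [this]
  exact (convex_Ioo _ _).linear_preimage _

theorem ofReal_mem_coniStrip (hn : 0 < n) (x : ℝ) : (x : ℂ) ∈ coniStrip n := by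
  have : (0 : ℝ) < n := by exact_mod_cast hn
  rw [mem_coniStrip, ofReal_im, abs_zero]
  have := Real.pi_pos
  positivity

/-- In the strip, `coniPot` takes values in `[0, ∞)` only on the real line. -/
theorem im_eq_zero_of_coniPot_eq (hn : 2 ≤ n) {τ : ℂ} (hτ : τ ∈ coniStrip n) {r : ℝ} (hr : 0 ≤ r)
    (h : coniPot n τ = r) : τ.im = 0 := by
  obtain ⟨h1, h2⟩ := abs_lt.1 (mem_coniStrip.1 hτ)
  rcases lt_trichotomy τ.im 0 with h0 | h0 | h0
  · have h' : coniPot n (starRingEnd ℂ τ) = r := by rw [coniPot_conj, h, conj_ofReal]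
    have := coniPot_re_neg_of_im_eq_zero hn (τ := starRingEnd ℂ τ) (by simpa using h0)
      (by simp; linarith) (by simp [h'])
    rw [h', ofReal_re] at this
    linarith
  · exact h0
  · have := coniPot_re_neg_of_im_eq_zero hn h0 h2 (by simp [h])
    rw [h, ofReal_re] at this
    linarith

end Strip

section Root

open Complex Set

/-- A continuous square root of a holomorphic function without zeros is holomorphic. -/
theorem hasDerivAt_of_sq_eq {U : Set ℂ} (hU : IsOpen U) {g G : ℂ → ℂ} {G' a : ℂ} (ha : a ∈ U)
    (hg : ContinuousOn g U) (hG : HasDerivAt G G' a) (h : ∀ τ ∈ U, g τ ^ 2 = G τ) (h0 : g a ≠ 0) :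
    HasDerivAt g (G' / (2 * g a)) a := by
  have hga : ContinuousAt g a := hg.continuousAt (hU.mem_nhds ha)
  rw [hasDerivAt_iff_tendsto_slope] at hG ⊢
  have h2 : Tendsto (fun y => g y + g a) (𝓝[≠] a) (𝓝 (2 * g a)) := by
    rw [two_mul]
    exact (hga.tendsto.add_const _).mono_left nhdsWithin_le_nhds
  have h3 : (2 * g a) ≠ 0 := mul_ne_zero two_ne_zero h0
  refine (hG.div h2 h3).congr' ?_
  filter_upwards [h2.eventually_ne h3, nhdsWithin_le_nhds (hU.mem_nhds ha)] with y hy hyU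
  rw [Pi.div_apply, slope_def_field, slope_def_field, ← h y hyU, ← h a ha, div_div, sq_sub_sq,
    mul_comm (y - a), mul_div_mul_left _ _ hy]

variable {n : ℕ}

/-- A holomorphic square root `τ ↦ τ * g τ` of `coniPot` on the strip, increasing along the real
line. -/
structure ConiRoot (n : ℕ) where
  /-- the root divided by the variable -/
  g : ℂ → ℂ
  diffOn : DifferentiableOn ℂ g (coniStrip n)
  ne_zero : ∀ τ ∈ coniStrip n, g τ ≠ 0
  sq : ∀ τ ∈ coniStrip n, (τ * g τ) ^ 2 = coniPot n τ
  map_zero : g 0 = √((n + 1) / 2)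

theorem exists_coniPot_eq_sq_mul (hn : 0 < n) : ∃ G : ℂ → ℂ, Differentiable ℂ G ∧
    (∀ τ, coniPot n τ = τ ^ 2 * G τ) ∧ G 0 = (n + 1) / 2 := by
  have hd := differentiable_coniPot hn
  have d1 : Differentiable ℂ (dslope (coniPot n) 0) := by
    rw [← differentiableOn_univ] at hd ⊢
    exact (differentiableOn_dslope univ_mem).2 hd
  have d2 : Differentiable ℂ (dslope (dslope (coniPot n) 0) 0) := by
    rw [← differentiableOn_univ] at d1 ⊢
    exact (differentiableOn_dslope univ_mem).2 d1
  have e0 : dslope (coniPot n) 0 0 = 0 := by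
    rw [dslope_same, (hasDerivAt_coniPot hn 0).deriv]
    simp
  have e : ∀ τ, coniPot n τ = τ ^ 2 * dslope (dslope (coniPot n) 0) 0 τ := fun τ => by
    have h1 := sub_smul_dslope (coniPot n) 0 τ
    have h2 := sub_smul_dslope (dslope (coniPot n) 0) 0 τ
    rw [coniPot_zero hn] at h1
    rw [e0] at h2
    simp only [sub_zero, smul_eq_mul] at h1 h2
    rw [sq, mul_assoc, h2, h1]
  refine ⟨_, d2, e, ?_⟩
  set G := dslope (dslope (coniPot n) 0) 0 with hG
  have hK : ∀ τ, exp τ - exp (-(n * τ)) = τ * (2 * G τ + τ * deriv G τ) := fun τ => by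
    have h := ((hasDerivAt_pow 2 τ).mul (d2 τ).hasDerivAt)
    have h' : HasDerivAt (coniPot n) _ τ := h.congr_of_eventuallyEq (Eventually.of_forall e)
    rw [(hasDerivAt_coniPot hn τ).unique h']
    simp
    ring
  have h1 : HasDerivAt (fun τ : ℂ => exp τ - exp (-(n * τ))) (1 + n) 0 := by
    have h1 : HasDerivAt (fun τ : ℂ => exp (-(n * τ))) (exp (-(n * (0 : ℂ))) * -(n * 1)) 0 :=
      (((hasDerivAt_id (0 : ℂ)).const_mul (n : ℂ)).neg).cexp
    have h2 := (hasDerivAt_exp 0).sub h1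
    have e : (1 + n : ℂ) = exp 0 - exp (-(n * 0)) * -(n * 1) := by simp
    rw [e]
    exact h2
  have h2 : HasDerivAt (fun τ : ℂ => τ * (2 * G τ + τ * deriv G τ)) (2 * G 0) 0 := by
    have dG : Differentiable ℂ (deriv G) := d2.deriv
    have h3 := (hasDerivAt_id (0 : ℂ)).mul ((((d2 0).const_mul (2 : ℂ)).add
      ((differentiableAt_id).mul (dG 0))).hasDerivAt)
    refine h3.congr_deriv ?_
    simp
  have h3 := (h1.congr_of_eventuallyEq (Eventually.of_forall fun τ => (hK τ).symm)).unique h2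
  linear_combination -h3 / 2

theorem exists_coniRoot (hn : 2 ≤ n) : Nonempty (ConiRoot n) := by
  obtain ⟨G, hG, h, hG0⟩ := exists_coniPot_eq_sq_mul (n := n) (by omega)
  have hpos : (0 : ℝ) < (n + 1) / 2 := by positivity
  have hne : ∀ τ ∈ coniStrip n, G τ ≠ 0 := fun τ hτ h0 => by
    rcases eq_or_ne τ 0 with rfl | hτ0
    · rw [h0] at hG0
      have : (((n + 1) / 2 : ℝ) : ℂ) = 0 := by rw [hG0]; push_cast; rfl
      exact hpos.ne' (by exact_mod_cast this)
    · have h1 : coniPot n τ = (0 : ℝ) := by rw [h, h0]; simp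
      have h2 := im_eq_zero_of_coniPot_eq hn hτ le_rfl h1
      have h3 : τ = τ.re := by apply Complex.ext <;> simp [h2]
      rw [h3, coniPot_ofReal] at h1
      refine (coniPotReal_pos (n := n) (by omega) (x := τ.re) ?_).ne' (by exact_mod_cast h1)
      intro h4
      rw [h4, ofReal_zero] at h3
      exact hτ0 h3
  have hsc : IsSimplyConnected (coniStrip n) := by
    have := (convex_coniStrip (n := n)).contractibleSpace
      ⟨0, by simpa using ofReal_mem_coniStrip (n := n) (by omega) 0⟩
    exact inferInstanceAs (SimplyConnectedSpace (coniStrip n))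
  obtain ⟨f, hfc, hf⟩ := exists_continuousOn_pow_eq hsc isOpen_coniStrip
    hG.continuous.continuousOn (fun ⟨τ, hτ, h0⟩ => hne τ hτ h0) two_ne_zero
  have h0s : (0 : ℂ) ∈ coniStrip n := by
    simpa using ofReal_mem_coniStrip (n := n) (by omega) 0
  have hs : f 0 ^ 2 = ((√((n + 1) / 2) : ℝ) : ℂ) ^ 2 := by
    rw [hf, hG0, ← ofReal_pow, Real.sq_sqrt hpos.le]
    push_cast
    rfl
  have main : ∀ f : ℂ → ℂ, ContinuousOn f (coniStrip n) → (∀ τ, f τ ^ 2 = G τ) →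
      f 0 = ((√((n + 1) / 2) : ℝ) : ℂ) → Nonempty (ConiRoot n) := fun f hfc hf hf0 => by
    have hfne : ∀ τ ∈ coniStrip n, f τ ≠ 0 := fun τ hτ h0 => hne τ hτ (by rw [← hf, h0]; simp)
    exact ⟨⟨f, fun τ hτ => (hasDerivAt_of_sq_eq isOpen_coniStrip hτ hfc (hG τ).hasDerivAt
      (fun τ _ => hf τ) (hfne τ hτ)).differentiableAt.differentiableWithinAt, hfne,
      fun τ hτ => by rw [mul_pow, hf, h], hf0⟩⟩
  rcases sq_eq_sq_iff_eq_or_eq_neg.1 hs with h1 | h1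
  · exact main f hfc hf h1
  · exact main (fun τ => -f τ) hfc.neg (fun τ => by rw [neg_sq, hf]) (by rw [h1, neg_neg])

namespace ConiRoot

variable (R : ConiRoot n)

/-- The holomorphic square root of `coniPot`. -/
def s (τ : ℂ) : ℂ := τ * R.g τ

theorem s_sq {τ : ℂ} (hτ : τ ∈ coniStrip n) : R.s τ ^ 2 = coniPot n τ := R.sq τ hτ

theorem differentiableOn_s : DifferentiableOn ℂ R.s (coniStrip n) :=
  differentiableOn_id.mul R.diffOn

theorem differentiableAt_s {τ : ℂ} (hτ : τ ∈ coniStrip n) : DifferentiableAt ℂ R.s τ :=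
  R.differentiableOn_s.differentiableAt (isOpen_coniStrip.mem_nhds hτ)

theorem s_eq_zero_iff {τ : ℂ} (hτ : τ ∈ coniStrip n) : R.s τ = 0 ↔ τ = 0 := by
  rw [s, mul_eq_zero, or_iff_left (R.ne_zero τ hτ)]

theorem two_mul_s_mul_deriv (hn : 0 < n) {τ : ℂ} (hτ : τ ∈ coniStrip n) :
    2 * R.s τ * deriv R.s τ = exp τ - exp (-(n * τ)) := by
  have h := (R.differentiableAt_s hτ).hasDerivAt.pow 2
  have h' : HasDerivAt (coniPot n) _ τ := h.congr_of_eventuallyEq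
    (by filter_upwards [isOpen_coniStrip.mem_nhds hτ] with y hy using (R.s_sq hy).symm)
  rw [(hasDerivAt_coniPot hn τ).unique h']
  simp

theorem deriv_s_zero (hn : 0 < n) : deriv R.s 0 = R.g 0 := by
  have h0 : (0 : ℂ) ∈ coniStrip n := by
    simpa using ofReal_mem_coniStrip (n := n) hn 0
  have := (hasDerivAt_id (0 : ℂ)).mul
    (R.diffOn.differentiableAt (isOpen_coniStrip.mem_nhds h0)).hasDerivAt
  have h : deriv R.s 0 = _ := this.deriv
  rw [h]
  simp

theorem exists_g_ofReal (hn : 0 < n) (x : ℝ) : ∃ r : ℝ, 0 < r ∧ R.g x = r := by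
  have him : ∀ x : ℝ, (R.g x).im = 0 := fun x => by
    rcases eq_or_ne x 0 with rfl | hx
    · rw [ofReal_zero, R.map_zero, ofReal_im]
    have h := R.sq x (ofReal_mem_coniStrip hn x)
    rw [coniPot_ofReal, mul_pow, ← ofReal_pow] at h
    have h1 := congrArg im h
    have h2 := congrArg re h
    have h3 := coniPotReal_pos hn hx
    rw [re_ofReal_mul, pow_two (R.g x), mul_re, ofReal_re] at h2
    rw [im_ofReal_mul, pow_two (R.g x), mul_im, ofReal_im] at h1
    have hx2 : 0 < x ^ 2 := by positivity
    have h4 := (mul_eq_zero.1 h1).resolve_left hx2.ne'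
    have h5 : (R.g x).re * (R.g x).im = 0 := by linarith
    rcases mul_eq_zero.1 h5 with h6 | h6
    · rw [h6] at h2
      nlinarith [sq_nonneg (x * (R.g x).im)]
    · exact h6
  have hre : ∀ x : ℝ, R.g x = (R.g x).re := fun x => by
    apply Complex.ext <;> simp [him]
  refine ⟨(R.g x).re, ?_, hre x⟩
  by_contra hneg
  push Not at hneg
  have hc : Continuous fun x : ℝ => (R.g x).re := by
    refine continuous_re.comp (R.diffOn.continuousOn.comp_continuous continuous_ofReal
      (ofReal_mem_coniStrip hn))
  have h0 : 0 ≤ (R.g (0 : ℝ)).re := by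
    rw [ofReal_zero, R.map_zero, ofReal_re]
    positivity
  obtain ⟨y, hy⟩ := mem_range_of_exists_le_of_exists_ge hc ⟨x, hneg⟩ ⟨0, h0⟩
  refine R.ne_zero y (ofReal_mem_coniStrip hn y) ?_
  have hy' : (R.g y).re = 0 := hy
  rw [hre, hy', ofReal_zero]

/-- The restriction of the root to the real line. -/
def sr (x : ℝ) : ℝ := (R.s x).re

theorem s_ofReal (hn : 0 < n) (x : ℝ) : R.s x = R.sr x := by
  obtain ⟨r, -, h⟩ := R.exists_g_ofReal hn x
  rw [sr, s, h, ← ofReal_mul, ofReal_re]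

theorem sr_sq (hn : 0 < n) (x : ℝ) : R.sr x ^ 2 = coniPotReal n x := by
  have h := R.s_sq (ofReal_mem_coniStrip hn x)
  rw [R.s_ofReal hn, coniPot_ofReal] at h
  exact_mod_cast h

theorem exists_sr_eq_mul (hn : 0 < n) (x : ℝ) : ∃ r : ℝ, 0 < r ∧ R.sr x = x * r := by
  obtain ⟨r, h0, h⟩ := R.exists_g_ofReal hn x
  exact ⟨r, h0, by rw [sr, s, h, ← ofReal_mul, ofReal_re]⟩

theorem exists_deriv_s_ofReal (hn : 0 < n) (x : ℝ) : ∃ r : ℝ, 0 < r ∧ deriv R.s x = r := by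
  rcases eq_or_ne x 0 with rfl | hx
  · rw [ofReal_zero, R.deriv_s_zero hn, R.map_zero]
    exact ⟨_, by positivity, rfl⟩
  have h := R.two_mul_s_mul_deriv hn (ofReal_mem_coniStrip hn x)
  obtain ⟨r, hr, hs⟩ := R.exists_sr_eq_mul hn x
  have hs0 : R.sr x ≠ 0 := by
    rw [hs]
    exact mul_ne_zero hx hr.ne'
  have hn' : (0 : ℝ) < n := by exact_mod_cast hn
  refine ⟨(Real.exp x - Real.exp (-(n * x))) / (2 * R.sr x), ?_, ?_⟩
  · rcases lt_or_gt_of_ne hx with hx | hx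
    · refine div_pos_of_neg_of_neg ?_ ?_
      · rw [sub_neg, Real.exp_lt_exp]
        nlinarith
      · rw [hs]
        nlinarith
    · refine div_pos ?_ ?_
      · rw [sub_pos, Real.exp_lt_exp]
        nlinarith
      · rw [hs]
        positivity
  · rw [R.s_ofReal hn] at h
    have h2 : (2 * R.sr x : ℂ) ≠ 0 := by exact_mod_cast mul_ne_zero two_ne_zero hs0
    push_cast
    rw [eq_div_iff h2, ← h]
    ring

theorem hasDerivAt_sr (hn : 0 < n) (x : ℝ) : HasDerivAt R.sr (deriv R.s x).re x :=
  (R.differentiableAt_s (ofReal_mem_coniStrip hn x)).hasDerivAt.real_of_complex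

theorem deriv_s_re_pos (hn : 0 < n) (x : ℝ) : 0 < (deriv R.s x).re := by
  obtain ⟨r, h0, h⟩ := R.exists_deriv_s_ofReal hn x
  rwa [h, ofReal_re]

theorem strictMono_sr (hn : 0 < n) : StrictMono R.sr :=
  strictMono_of_deriv_pos fun x => by
    rw [(R.hasDerivAt_sr hn x).deriv]
    exact R.deriv_s_re_pos hn x

theorem eq_of_s_eq (hn : 2 ≤ n) {τ : ℂ} (hτ : τ ∈ coniStrip n) {x : ℝ} (h : R.s τ = R.sr x) :
    τ = x := by
  have h1 := R.s_sq hτ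
  rw [h, ← ofReal_pow] at h1
  have h2 := im_eq_zero_of_coniPot_eq hn hτ (sq_nonneg _) h1.symm
  have h3 : τ = τ.re := by apply Complex.ext <;> simp [h2]
  rw [h3, R.s_ofReal (by omega)] at h
  rw [h3, (R.strictMono_sr (by omega)).injective (ofReal_injective h)]

/-- The root lies in the upper half plane on the upper half of the strip. -/
theorem s_im_pos (hn : 2 ≤ n) {τ : ℂ} (h0 : 0 < τ.im) (h1 : τ.im < 2 * Real.pi / n) :
    0 < (R.s τ).im := by
  have hn0 : 0 < n := by omega
  set V : Set ℂ := imLm ⁻¹' Ioo 0 (2 * Real.pi / n) with hV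
  have hVs : V ⊆ coniStrip n := fun τ hτ => by
    have h : 0 < τ.im ∧ τ.im < 2 * Real.pi / n := hτ
    rw [mem_coniStrip, abs_of_pos h.1]
    exact h.2
  have hVc : IsPreconnected V := ((convex_Ioo _ _).linear_preimage imLm).isPreconnected
  have hne : ∀ τ ∈ V, (R.s τ).im ≠ 0 := fun τ hτ h => by
    have h2 := R.s_sq (hVs hτ)
    have h3 : R.s τ = (R.s τ).re := by apply Complex.ext <;> simp [h]
    rw [h3, ← ofReal_pow] at h2
    have h4 := im_eq_zero_of_coniPot_eq hn (hVs hτ) (sq_nonneg _) h2.symm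
    have h5 : 0 < τ.im := hτ.1
    exact h5.ne' h4
  by_contra hneg
  push Not at hneg
  have hpi : 0 < 2 * Real.pi / n := by
    have : (0 : ℝ) < n := by exact_mod_cast hn0
    have := Real.pi_pos
    positivity
  -- near the origin the root is close to a positive multiple of the variable
  obtain ⟨y, hy, hy0⟩ : ∃ y ∈ V, 0 ≤ (R.s y).im := by
    have hc : ContinuousAt (fun t : ℝ => (R.g (t * I)).re) 0 := by
      have : ContinuousAt R.g ((0 : ℝ) * I) := by
        rw [ofReal_zero, zero_mul]
        refine R.diffOn.continuousOn.continuousAt (isOpen_coniStrip.mem_nhds ?_)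
        simpa using ofReal_mem_coniStrip (n := n) hn0 0
      exact continuous_re.continuousAt.comp
        (ContinuousAt.comp (f := fun t : ℝ => (t * I : ℂ)) (x := 0) this (by fun_prop))
    have hpos : 0 < (R.g ((0 : ℝ) * I)).re := by
      rw [ofReal_zero, zero_mul, R.map_zero, ofReal_re]
      positivity
    have h2 := (hc.eventually (lt_mem_nhds hpos)).filter_mono (nhdsWithin_le_nhds (s := Ioi 0))
    obtain ⟨t, ht, ht2⟩ := (h2.and (Ioo_mem_nhdsGT hpi)).exists
    refine ⟨t * I, ?_, ?_⟩
    · change (t * I : ℂ).im ∈ Ioo 0 (2 * Real.pi / n)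
      simpa using ht2
    · have : (R.s (t * I)).im = t * (R.g (t * I)).re := by simp [s]
      rw [this]
      exact mul_nonneg ht2.1.le ht.le
  have hc : ContinuousOn (fun τ => (R.s τ).im) V :=
    continuous_im.comp_continuousOn (R.differentiableOn_s.continuousOn.mono hVs)
  have hτV : τ ∈ V := ⟨h0, h1⟩
  obtain ⟨w, hw, hw0⟩ := hVc.intermediate_value hτV hy hc ⟨hneg, hy0⟩
  exact hne w hw hw0

end ConiRoot
end Root

namespace ConiRoot

open Complex Set

variable {n : ℕ} (R : ConiRoot n) {T β : ℝ}

/-- The integral of `φ(τ) e ^ (-n τ / 2) s(τ) ^ (-2 k - 1)` over the boundary of a rectangle. -/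
noncomputable def period (T β : ℝ) (k : ℕ) (φ : ℂ → ℂ) : ℂ :=
  rectInt T β fun τ => φ τ * exp (-(n * τ) / 2) * (R.s τ)⁻¹ ^ (2 * k + 1)

theorem rect_subset (hβ : β < 2 * Real.pi / n) :
    {τ : ℂ | |τ.re| ≤ T ∧ |τ.im| ≤ β} ⊆ coniStrip n :=
  fun _ h => lt_of_le_of_lt h.2 hβ

theorem rectBdry_subset (T : ℝ) (hβ : β < 2 * Real.pi / n) : rectBdry T β ⊆ coniStrip n := by
  rintro τ (h | h)
  exacts [mem_coniStrip.2 (h.2.trans_lt hβ), mem_coniStrip.2 (h.2.trans_lt hβ)]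

theorem ne_zero_of_mem_rectBdry (hT : 0 < T) (hβ : 0 < β) {τ : ℂ} (hτ : τ ∈ rectBdry T β) :
    τ ≠ 0 := by
  rintro rfl
  rcases hτ with h | h
  · exact hβ.ne (by simpa using h.2)
  · exact hT.ne (by simpa using h.1)

variable (hT : 0 < T) (hβ0 : 0 < β) (hβ : β < 2 * Real.pi / n)

theorem continuousOn_inv_s (hT : 0 < T) (hβ0 : 0 < β) (hβ : β < 2 * Real.pi / n) :
    ContinuousOn (fun τ => (R.s τ)⁻¹) (rectBdry T β) :=
  (R.differentiableOn_s.continuousOn.mono (rectBdry_subset T hβ)).inv₀ fun _ hτ =>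
    (R.s_eq_zero_iff (rectBdry_subset T hβ hτ)).not.2 (ne_zero_of_mem_rectBdry hT hβ0 hτ)

theorem continuousOn_period (hT : 0 < T) (hβ0 : 0 < β) (hβ : β < 2 * Real.pi / n) {φ : ℂ → ℂ}
    (hφ : Continuous φ) (k : ℕ) :
    ContinuousOn (fun τ => φ τ * exp (-(n * τ) / 2) * (R.s τ)⁻¹ ^ (2 * k + 1)) (rectBdry T β) :=
  ((hφ.mul (by fun_prop)).continuousOn).mul ((R.continuousOn_inv_s hT hβ0 hβ).pow _)

theorem period_add (hT : 0 < T) (hβ0 : 0 < β) (hβ : β < 2 * Real.pi / n) {φ ψ : ℂ → ℂ}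
    (hφ : Continuous φ) (hψ : Continuous ψ) (k : ℕ) :
    R.period T β k (fun τ => φ τ + ψ τ) = R.period T β k φ + R.period T β k ψ := by
  rw [period, period, period, ← rectInt_add hT.le hβ0.le (R.continuousOn_period hT hβ0 hβ hφ k)
    (R.continuousOn_period hT hβ0 hβ hψ k)]
  simp only [add_mul]

theorem period_const_mul (c : ℂ) (φ : ℂ → ℂ) (k : ℕ) :
    R.period T β k (fun τ => c * φ τ) = c * R.period T β k φ := by
  rw [period, period, ← rectInt_const_mul]
  simp only [mul_assoc]

/-- The integral of the derivative of `p(e ^ τ) e ^ (-n τ / 2) s(τ) ^ (-2 k - 1)` vanishes. -/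
theorem period_derivative (hn : 0 < n) (hT : 0 < T) (hβ0 : 0 < β) (hβ : β < 2 * Real.pi / n)
    (p : ℚ[X]) (k : ℕ) :
    R.period T β k (fun τ => exp τ * Polynomial.aeval (exp τ) (Polynomial.derivative p) -
        n / 2 * Polynomial.aeval (exp τ) p) =
      (2 * k + 1) / 2 * R.period T β (k + 1)
        (fun τ => Polynomial.aeval (exp τ) p * (exp τ - exp (-(n * τ)))) := by
  have cp : ∀ p : ℚ[X], Continuous fun τ => Polynomial.aeval (exp τ) p := fun p =>
    (Polynomial.continuous_aeval p).comp continuous_exp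
  have f1 : Continuous fun τ => exp τ * Polynomial.aeval (exp τ) (Polynomial.derivative p) -
      n / 2 * Polynomial.aeval (exp τ) p :=
    (continuous_exp.mul (cp _)).sub (continuous_const.mul (cp p))
  have f2 : Continuous fun τ => (-((2 * k + 1) / 2) : ℂ) * (Polynomial.aeval (exp τ) p *
      (exp τ - exp (-(n * τ)))) :=
    continuous_const.mul ((cp p).mul (by fun_prop))
  have c1 := R.continuousOn_period hT hβ0 hβ f1 k
  have c2 := R.continuousOn_period hT hβ0 hβ f2 (k + 1)
  have h := rectInt_eq_zero_of_hasDerivAt hT.le hβ0.le (F := fun τ => Polynomial.aeval (exp τ) p *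
    exp (-(n * τ) / 2) * (R.s τ)⁻¹ ^ (2 * k + 1)) (fun τ hτ => ?_) (c1.add c2)
  · have h2 := rectInt_add hT.le hβ0.le c1 c2
    have h3 : rectInt T β _ + rectInt T β _ = 0 := h2.symm.trans h
    have h4 := R.period_const_mul (T := T) (β := β) (-((2 * k + 1) / 2) : ℂ)
      (fun τ => Polynomial.aeval (exp τ) p * (exp τ - exp (-(n * τ)))) (k + 1)
    rw [← sub_eq_zero, sub_eq_add_neg, ← neg_mul, ← h4]
    exact h3
  · have hτU := rectBdry_subset T hβ hτ
    have hs : R.s τ ≠ 0 := (R.s_eq_zero_iff hτU).not.2 (ne_zero_of_mem_rectBdry hT hβ0 hτ)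
    have d1 := (p.hasDerivAt_aeval (exp τ)).comp τ (hasDerivAt_exp τ)
    have d2 : HasDerivAt (fun τ : ℂ => exp (-(n * τ) / 2)) (exp (-(n * τ) / 2) * (-(n * 1) / 2)) τ :=
      ((((hasDerivAt_id τ).const_mul (n : ℂ)).neg).div_const 2).cexp
    have d3 := ((R.differentiableAt_s hτU).hasDerivAt.inv hs).pow (2 * k + 1)
    refine ((d1.mul d2).mul d3).congr_deriv ?_
    have e := R.two_mul_s_mul_deriv hn hτU
    have e2 : deriv R.s τ = (exp τ - exp (-(n * τ))) * (R.s τ)⁻¹ / 2 := by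
      rw [← e]
      field_simp
    simp only [Pi.add_apply, Pi.mul_apply, Pi.pow_apply, Pi.inv_apply, Function.comp_apply, e2,
      Nat.add_sub_cancel]
    push_cast
    have e3 : ∀ x : ℂ, -x / R.s τ ^ 2 = -x * (R.s τ)⁻¹ ^ 2 := fun x => by
      rw [inv_pow, div_eq_mul_inv]
    rw [e3]
    ring

/-- Integrands with a zero of high enough order at the origin have vanishing integral. -/
theorem period_eq_zero_of_dvd (hT : 0 < T) (hβ0 : 0 < β) (hβ : β < 2 * Real.pi / n) {k : ℕ}
    {f : ℚ[X]} (hf : (Polynomial.X - 1) ^ (2 * k + 1) ∣ f) :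
    R.period T β k (fun τ => Polynomial.aeval (exp τ) f) = 0 := by
  obtain ⟨r, rfl⟩ := hf
  have hd : Differentiable ℂ (dslope exp 0) := by
    have := differentiable_exp (𝕜 := ℂ)
    rw [← differentiableOn_univ] at this ⊢
    exact (differentiableOn_dslope univ_mem).2 this
  have hp : Differentiable ℂ fun τ => Polynomial.aeval (exp τ) r :=
    (Polynomial.differentiable_aeval r).comp differentiable_exp
  have hH : DifferentiableOn ℂ (fun τ => Polynomial.aeval (exp τ) r * exp (-(n * τ) / 2) *
      (dslope exp 0 τ * (R.g τ)⁻¹) ^ (2 * k + 1)) {τ | |τ.re| ≤ T ∧ |τ.im| ≤ β} := by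
    have h1 : DifferentiableOn ℂ (fun τ => (R.g τ)⁻¹) (coniStrip n) := R.diffOn.inv R.ne_zero
    have h2 : Differentiable ℂ fun τ : ℂ => exp (-(n * τ) / 2) := by fun_prop
    exact ((hp.mul h2).differentiableOn).mul
      ((hd.differentiableOn.mul (h1.mono (rect_subset hβ))).pow _)
  rw [period, ← rectInt_eq_zero_of_differentiableOn hT.le hβ0.le hH]
  refine rectInt_congr hT.le hβ0.le fun τ hτ => ?_
  have h0 := ne_zero_of_mem_rectBdry hT hβ0 hτ
  have h1 := sub_smul_dslope exp 0 τ
  simp only [sub_zero, smul_eq_mul, exp_zero] at h1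
  simp only [map_mul, map_pow, map_sub, Polynomial.aeval_X, map_one, ← h1, s, mul_inv, mul_pow]
  have h2 : τ ^ (2 * k + 1) * τ⁻¹ ^ (2 * k + 1) = 1 := by
    rw [← mul_pow, mul_inv_cancel₀ h0, one_pow]
  linear_combination (Polynomial.aeval (exp τ) r * exp (-(n * τ) / 2) *
    dslope exp 0 τ ^ (2 * k + 1) * (R.g τ)⁻¹ ^ (2 * k + 1)) * h2

theorem period_zero_one (hT : 0 < T) (hβ0 : 0 < β) (hβ : β < 2 * Real.pi / n) :
    R.period T β 0 (fun _ => 1) = 2 * Real.pi * I * (√((n + 1) / 2) : ℝ)⁻¹ := by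
  have h1 : DifferentiableOn ℂ (fun τ => exp (-(n * τ) / 2) * (R.g τ)⁻¹) (coniStrip n) :=
    DifferentiableOn.mul (by fun_prop) (R.diffOn.inv R.ne_zero)
  have h2 := rectInt_mul_inv_sub isOpen_coniStrip (rect_subset (T := T) hβ) h1 (w := 0)
    (by simpa) (by simpa)
  rw [R.map_zero] at h2
  simp only [mul_zero, neg_zero, zero_div, exp_zero, one_mul, sub_zero] at h2
  rw [ofReal_inv, ← h2, period]
  congr 1
  ext τ
  simp [s]
  ring

/-- The values of the leading coefficients `LGParam.expectTop` at `1` are periods. -/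
theorem period_one (hn : 2 ≤ n) (hT : 0 < T) (hβ0 : 0 < β) (hβ : β < 2 * Real.pi / n) (k : ℕ) :
    (∏ j ∈ Finset.range k, (-((n + 1) * (2 * j + 1) / 2) : ℂ)) * R.period T β k (fun _ => 1) =
      (LGParam.expectTop n.succ_pos k 1 : ℂ) * (2 * Real.pi * I * (√((n + 1) / 2) : ℝ)⁻¹) := by
  have hn0 : 0 < n := by omega
  have hn' : (n : ℂ) ≠ 0 := by exact_mod_cast hn0.ne'
  let x : C(ℂ, ℂ) := ⟨exp, continuous_exp⟩
  let y : C(ℂ, ℂ) := ⟨fun τ => exp (-(n * τ)), by fun_prop⟩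
  have hx : ∀ (p : ℚ[X]) τ, Polynomial.aeval x p τ = Polynomial.aeval (exp τ) p := fun p τ =>
    (Polynomial.aeval_algHom_apply (ContinuousMap.evalAlgHom ℚ ℂ τ) x p).symm
  have hxy : x ^ n * y = 1 := by
    ext τ
    change exp τ ^ n * exp (-(n * τ)) = 1
    rw [← exp_nat_mul, ← exp_add, add_neg_cancel, exp_zero]
  let ρ : ℕ → C(ℂ, ℂ) →ₗ[ℚ] ℂ := fun k =>
    { toFun := fun f => R.period T β k f
      map_add' := fun f g => R.period_add hT hβ0 hβ f.continuous g.continuous k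
      map_smul' := fun c f => by
        rw [RingHom.id_apply, Algebra.smul_def, ← R.period_const_mul]
        congr 1 }
  have hρ : ∀ k f, ρ k f = R.period T β k f := fun _ _ => rfl
  have key := LGParam.prod_mul_apply_one (by omega) hxy ρ ?_ ?_ ?_ k
  · have h1 : ∀ k, ρ k 1 = R.period T β k fun _ => 1 := fun _ => rfl
    rw [h1, h1, R.period_zero_one hT hβ0 hβ, Algebra.smul_def, Algebra.smul_def, map_prod] at key
    simpa using key
  · intro k p
    have e : ⇑(x * Polynomial.aeval x (Polynomial.derivative p) - (n / 2 : ℚ) • Polynomial.aeval x p) =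
        fun τ => exp τ * Polynomial.aeval (exp τ) (Polynomial.derivative p) -
          n / 2 * Polynomial.aeval (exp τ) p := by
      ext τ
      simp [x, hx, Algebra.smul_def]
    rw [hρ, hρ, e, R.period_derivative hn0 hT hβ0 hβ p k, Algebra.smul_def]
    congr 1
    · simp
    · congr 1
      ext τ
      simp [x, y, hx]
  · intro k
    rw [Algebra.smul_def, hρ, hρ, map_natCast, period, period, ← rectInt_const_mul]
    refine rectInt_congr hT.le hβ0.le fun τ hτ => ?_
    have hτU := rectBdry_subset T hβ hτ
    have hs : R.s τ ≠ 0 := (R.s_eq_zero_iff hτU).not.2 (ne_zero_of_mem_rectBdry hT hβ0 hτ)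
    have h := R.s_sq hτU
    have h3 : R.s τ ^ 2 * (R.s τ)⁻¹ ^ 2 = 1 := by rw [← mul_pow, mul_inv_cancel₀ hs, one_pow]
    have h4 : ((n + 1 : ℚ) • Polynomial.aeval x (Polynomial.X - 1 : ℚ[X]) - (x - y)) τ =
        n * R.s τ ^ 2 := by
      rw [h, coniPot]
      simp [x, y, Algebra.smul_def]
      field_simp
      ring
    simp only [h4, ContinuousMap.one_apply]
    rw [show 2 * (k + 1) + 1 = (2 * k + 1) + 2 by ring, pow_add]
    linear_combination -(n * exp (-(n * τ) / 2) * (R.s τ)⁻¹ ^ (2 * k + 1)) * h3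
  · intro k f hf
    rw [hρ, ← R.period_eq_zero_of_dvd hT hβ0 hβ hf]
    congr 1
    ext τ
    exact hx f τ

end ConiRoot

section Line

open Complex Set

variable {n : ℕ}

/-- Half of the height at which the shifted line runs through the next critical point. -/
noncomputable def coniAngle (n : ℕ) : ℝ := Real.pi / (n + 1)

/-- The distance from `0` to the critical values nearest to it. -/
noncomputable def coniDist (n : ℕ) : ℝ := 2 * ((n + 1) / n) * Real.sin (coniAngle n)

/-- The complex number `Δ` for which `coniPot` takes the value `e ^ (2 i α) (Δ + coniPot x)` at
`x + 2 i α`. -/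
noncomputable def coniGap (n : ℕ) : ℂ := coniDist n * I * exp (-(coniAngle n * I))

theorem coniAngle_pos : 0 < coniAngle n := div_pos Real.pi_pos (by positivity)

theorem coniAngle_le (hn : 2 ≤ n) : coniAngle n ≤ Real.pi / 3 := by
  have : (2 : ℝ) ≤ n := by exact_mod_cast hn
  exact div_le_div_of_nonneg_left Real.pi_pos.le (by norm_num) (by linarith)

theorem sin_coniAngle_pos (hn : 2 ≤ n) : 0 < Real.sin (coniAngle n) :=
  Real.sin_pos_of_pos_of_lt_pi coniAngle_pos (by linarith [coniAngle_le hn, Real.pi_pos])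

theorem cos_coniAngle_pos (hn : 2 ≤ n) : 0 < Real.cos (coniAngle n) :=
  Real.cos_pos_of_mem_Ioo ⟨by linarith [coniAngle_pos (n := n), Real.pi_pos],
    by linarith [coniAngle_le hn, Real.pi_pos]⟩

theorem coniDist_pos (hn : 2 ≤ n) : 0 < coniDist n := by
  have : (0 : ℝ) < n := by exact_mod_cast (by omega : 0 < n)
  have := sin_coniAngle_pos hn
  rw [coniDist]
  positivity

theorem two_mul_coniAngle_lt (hn : 0 < n) : 2 * coniAngle n < 2 * Real.pi / n := by
  have : (0 : ℝ) < n := by exact_mod_cast hn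
  rw [coniAngle, mul_div_assoc]
  exact mul_lt_mul_of_pos_left (div_lt_div_of_pos_left Real.pi_pos this (by linarith)) two_pos

theorem succ_mul_coniAngle : (n + 1) * coniAngle n = Real.pi := by
  rw [coniAngle]
  field_simp

theorem exp_mul_coniGap : exp (coniAngle n * I) * coniGap n = coniDist n * I := by
  rw [coniGap, mul_left_comm, ← exp_add, add_neg_cancel, exp_zero, mul_one]

theorem coniGap_eq :
    coniGap n = (n + 1) / n * (1 - exp (-(2 * coniAngle n * I))) := by
  have h1 : exp (-(2 * coniAngle n * I)) = exp (-(coniAngle n * I)) * exp (-(coniAngle n * I)) := by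
    rw [← exp_add]
    ring_nf
  have h2 : exp (coniAngle n * I) * exp (-(coniAngle n * I)) = 1 := by
    rw [← exp_add, add_neg_cancel, exp_zero]
  rw [coniGap, coniDist, h1]
  push_cast
  rw [Complex.sin, neg_mul]
  linear_combination ((n + 1) / n : ℂ) * h2 * (-I ^ 2) -
    ((n + 1) / n : ℂ) * (1 - exp (-(coniAngle n * I)) ^ 2) * I_sq

theorem coniPot_add_mul_I (hn : 0 < n) (x : ℝ) : coniPot n (x + (2 * coniAngle n : ℝ) * I) =
    exp (2 * coniAngle n * I) * (coniGap n + coniPotReal n x) := by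
  have h1 : exp (-(n * (x + (2 * coniAngle n : ℝ) * I))) =
      exp (-(n * x)) * exp (2 * coniAngle n * I) := by
    have e : -(n * (x + (2 * coniAngle n : ℝ) * I) : ℂ) =
        -(n * x) + 2 * coniAngle n * I - 2 * Real.pi * I := by
      rw [← succ_mul_coniAngle (n := n)]
      push_cast
      ring
    rw [e, exp_sub, exp_two_pi_mul_I, div_one, exp_add]
  have h2 : exp (2 * coniAngle n * I) * exp (-(2 * coniAngle n * I)) = 1 := by
    rw [← exp_add, add_neg_cancel, exp_zero]
  rw [coniPot, h1, exp_add, coniGap_eq, coniPotReal]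
  push_cast
  linear_combination ((n + 1) / n : ℂ) * h2

theorem exp_neg_div_two_add_mul_I (x : ℝ) :
    exp (-(n * (x + (2 * coniAngle n : ℝ) * I)) / 2) =
      -exp (coniAngle n * I) * Real.exp (-(n * x) / 2) := by
  have e : -(n * (x + (2 * coniAngle n : ℝ) * I) : ℂ) / 2 =
      coniAngle n * I - Real.pi * I + (-(n * x) / 2 : ℝ) := by
    rw [← succ_mul_coniAngle (n := n)]
    push_cast
    ring
  rw [e, exp_add, exp_sub, exp_pi_mul_I, ofReal_exp]
  ring

theorem sq_add_sq_le_norm_coniGap_add (hn : 2 ≤ n) {t : ℝ} (ht : 0 ≤ t) :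
    coniDist n ^ 2 + t ^ 2 ≤ ‖coniGap n + t‖ ^ 2 := by
  have hd := coniDist_pos hn
  have hs := sin_coniAngle_pos hn
  have h1 : (coniGap n).re = coniDist n * Real.sin (coniAngle n) := by
    have e : exp (-(coniAngle n * I)) = exp ((-coniAngle n : ℝ) * I) := by push_cast; ring_nf
    rw [coniGap, e, mul_assoc, re_ofReal_mul, I_mul_re, exp_ofReal_mul_I_im, Real.sin_neg, neg_neg]
  have h2 : (coniGap n).im = coniDist n * Real.cos (coniAngle n) := by
    have e : exp (-(coniAngle n * I)) = exp ((-coniAngle n : ℝ) * I) := by push_cast; ring_nf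
    rw [coniGap, e, mul_assoc, im_ofReal_mul, I_mul_im, exp_ofReal_mul_I_re, Real.cos_neg]
  rw [← normSq_eq_norm_sq, normSq_apply]
  simp only [add_re, add_im, ofReal_re, ofReal_im, add_zero, h1, h2]
  have := Real.sin_sq_add_cos_sq (coniAngle n)
  have h3 : 0 ≤ coniDist n * Real.sin (coniAngle n) * t := by positivity
  nlinarith

theorem coniDist_le_norm (hn : 2 ≤ n) {t : ℝ} (ht : 0 ≤ t) : coniDist n ≤ ‖coniGap n + t‖ := by
  refine le_of_sq_le_sq ?_ (norm_nonneg _)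
  have := sq_add_sq_le_norm_coniGap_add hn ht
  nlinarith

/-- The shifted line is mapped at distance at least `coniDist n` from the positive real axis. -/
theorem coniDist_le_norm_sub (hn : 2 ≤ n) (x : ℝ) {t : ℝ} (ht : 0 ≤ t) :
    coniDist n ≤ ‖coniPot n (x + (2 * coniAngle n : ℝ) * I) - t‖ := by
  have hs := sin_coniAngle_pos hn
  have hx := coniPotReal_nonneg (n := n) (by omega) x
  have e1 : exp (2 * coniAngle n * I) = exp (coniAngle n * I) * exp (coniAngle n * I) := by
    rw [← exp_add]
    ring_nf
  have h1 : exp (coniAngle n * I) * exp (-(coniAngle n * I)) = 1 := by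
    rw [← exp_add, add_neg_cancel, exp_zero]
  have e2 : exp (-(coniAngle n * I)) * (coniPot n (x + (2 * coniAngle n : ℝ) * I) - t) =
      coniDist n * I + (coniPotReal n x : ℝ) * exp (coniAngle n * I) -
        (t : ℝ) * exp ((-coniAngle n : ℝ) * I) := by
    rw [coniPot_add_mul_I (by omega), e1, ← exp_mul_coniGap]
    push_cast
    rw [neg_mul]
    linear_combination exp (coniAngle n * I) * (coniGap n + coniPotReal n x) * h1
  have e3 : ‖exp (-(coniAngle n * I))‖ = 1 := by
    have : exp (-(coniAngle n * I)) = exp ((-coniAngle n : ℝ) * I) := by push_cast; ring_nf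
    rw [this, norm_exp_ofReal_mul_I]
  have e4 := norm_mul (exp (-(coniAngle n * I)))
    (coniPot n (x + (2 * coniAngle n : ℝ) * I) - t)
  rw [e3, one_mul, e2] at e4
  rw [← e4]
  refine le_trans ?_ (abs_im_le_norm _)
  refine le_trans ?_ (le_abs_self _)
  rw [sub_im, add_im, im_ofReal_mul, im_ofReal_mul, im_ofReal_mul,
    exp_ofReal_mul_I_im, exp_ofReal_mul_I_im, Real.sin_neg, I_im]
  have h2 := mul_nonneg hx hs.le
  have h3 := mul_nonneg ht hs.le
  linarith

theorem norm_coniPot_add_mul_I (hn : 0 < n) (x : ℝ) :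
    ‖coniPot n (x + (2 * coniAngle n : ℝ) * I)‖ = ‖coniGap n + coniPotReal n x‖ := by
  have : exp (2 * coniAngle n * I) = exp ((2 * coniAngle n : ℝ) * I) := by push_cast; ring_nf
  rw [coniPot_add_mul_I hn, norm_mul, this, norm_exp_ofReal_mul_I, one_mul]

theorem coniPot_sub_mul_I (x y : ℝ) :
    coniPot n (x - y * I) = starRingEnd ℂ (coniPot n (x + y * I)) := by
  rw [← coniPot_conj]
  simp [sub_eq_add_neg]

/-- The function `coniPot` dominates the square of `e ^ (-n x / 2) - 1`. -/
theorem sq_le_mul_coniPotReal (hn : 0 < n) (x : ℝ) :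
    (Real.exp (-(n * x) / 2) - 1) ^ 2 ≤ n * coniPotReal n x := by
  have hn' : (0 : ℝ) < n := by exact_mod_cast hn
  have h1 : Real.exp (-(n * x)) = Real.exp (-(n * x) / 2) ^ 2 := by
    rw [← Real.exp_nat_mul]
    ring_nf
  have h2 := mul_le_mul_of_nonneg_left (Real.add_one_le_exp (x)) hn'.le
  have h3 := Real.add_one_le_exp (-(n * x) / 2)
  have h4 : n * coniPotReal n x = n * Real.exp x + Real.exp (-(n * x) / 2) ^ 2 - (n + 1) := by
    rw [coniPotReal, h1]
    field_simp
  rw [h4]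
  linarith

end Line

section Bounds

open Complex Set

/-- The antiderivative of `(a + v ^ 4 / b ^ 2) ^ (-5 / 4)`. -/
theorem hasDerivAt_div_rpow {a b : ℝ} (ha : 0 < a) (v : ℝ) :
    HasDerivAt (fun v => v / (a * (a + v ^ 4 / b ^ 2) ^ (1 / 4 : ℝ)))
      ((a + v ^ 4 / b ^ 2) ^ (-(5 / 4) : ℝ)) v := by
  have hA : 0 < a + v ^ 4 / b ^ 2 := by positivity
  have h1 : HasDerivAt (fun v : ℝ => a + v ^ 4 / b ^ 2) (4 * v ^ 3 / b ^ 2) v := by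
    simpa using ((hasDerivAt_pow 4 v).div_const (b ^ 2)).const_add a
  have h2 := (h1.rpow_const (p := (1 / 4 : ℝ)) (Or.inl hA.ne')).const_mul a
  have h3 := (hasDerivAt_id v).div h2 (by positivity)
  refine h3.congr_deriv ?_
  set A := a + v ^ 4 / b ^ 2 with hAdef
  have e1 : A ^ (1 / 4 - 1 : ℝ) = A ^ (1 / 4 : ℝ) / A := by
    rw [Real.rpow_sub hA, Real.rpow_one]
  have e2 : A ^ (-(5 / 4) : ℝ) = A ^ (1 / 4 : ℝ) / (A * (A ^ (1 / 4 : ℝ)) ^ 2) := by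
    rw [← Real.rpow_natCast (A ^ (1 / 4 : ℝ)), ← Real.rpow_mul hA.le, eq_div_iff (by positivity)]
    nth_rewrite 2 [← Real.rpow_one A]
    rw [← Real.rpow_add hA, ← Real.rpow_add hA]
    norm_num
  have e3 : 0 < A ^ (1 / 4 : ℝ) := by positivity
  rw [e1, e2]
  have e4 : v ^ 4 / b ^ 2 = A - a := by rw [hAdef]; ring
  simp only [id]
  have e5 : v * (a * (4 * v ^ 3 / b ^ 2 * (1 / 4) * (A ^ (1 / 4 : ℝ) / A))) =
      a * (A ^ (1 / 4 : ℝ) / A) * (v ^ 4 / b ^ 2) := by ring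
  rw [e5, e4]
  field_simp
  ring

theorem abs_div_rpow_le {a b : ℝ} (ha : 0 < a) (hb : 0 < b) (v : ℝ) :
    |v / (a * (a + v ^ 4 / b ^ 2) ^ (1 / 4 : ℝ))| ≤ √b / a := by
  have hA : 0 < a + v ^ 4 / b ^ 2 := by positivity
  have h1 : |v| / √b ≤ (a + v ^ 4 / b ^ 2) ^ (1 / 4 : ℝ) := by
    have h : (|v| / √b) ^ 4 ≤ a + v ^ 4 / b ^ 2 := by
      have : √b ^ 4 = b ^ 2 := by rw [show 4 = 2 * 2 from rfl, pow_mul, Real.sq_sqrt hb.le]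
      rw [div_pow, this, Even.pow_abs ⟨2, rfl⟩]
      linarith
    calc |v| / √b = ((|v| / √b) ^ 4) ^ (1 / 4 : ℝ) := by
          rw [← Real.rpow_natCast, ← Real.rpow_mul (by positivity)]
          norm_num
      _ ≤ _ := Real.rpow_le_rpow (by positivity) h (by norm_num)
  have hs : 0 < √b := Real.sqrt_pos.2 hb
  have hp : 0 < (a + v ^ 4 / b ^ 2) ^ (1 / 4 : ℝ) := by positivity
  rw [abs_div, abs_of_pos (show 0 < a * (a + v ^ 4 / b ^ 2) ^ (1 / 4 : ℝ) by positivity),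
    div_le_div_iff₀ (by positivity) ha]
  rw [div_le_iff₀ hs] at h1
  nlinarith

theorem norm_rectInt_le {T β ε B : ℝ} {f : ℂ → ℂ} {b : ℝ → ℝ} (hT : 0 ≤ T) (hβ : 0 ≤ β)
    (hbi : IntervalIntegrable b volume (-T) T) (hB : ∫ x in (-T)..T, b x ≤ B)
    (h1 : ∀ x : ℝ, ‖f (x - β * I)‖ ≤ b x) (h2 : ∀ x : ℝ, ‖f (x + β * I)‖ ≤ b x)
    (h3 : ∀ y ∈ Icc (-β) β, ‖f (T + y * I)‖ ≤ ε) (h4 : ∀ y ∈ Icc (-β) β, ‖f (-T + y * I)‖ ≤ ε) :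
    ‖rectInt T β f‖ ≤ 2 * B + 4 * β * ε := by
  have hT' : -T ≤ T := by linarith
  have hβ' : -β ≤ β := by linarith
  have i1 := intervalIntegral.norm_integral_le_of_norm_le hT'
    (Eventually.of_forall fun x _ => h1 x) hbi
  have i2 := intervalIntegral.norm_integral_le_of_norm_le hT'
    (Eventually.of_forall fun x _ => h2 x) hbi
  have m : ∀ {y}, y ∈ uIoc (-β) β → y ∈ Icc (-β) β := fun {y} hy => by
    rw [uIoc_of_le hβ'] at hy
    exact Ioc_subset_Icc_self hy
  have i3 := intervalIntegral.norm_integral_le_of_norm_le_const fun y hy => h3 y (m hy)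
  have i4 := intervalIntegral.norm_integral_le_of_norm_le_const fun y hy => h4 y (m hy)
  have hβ2 : |β - -β| = 2 * β := by
    rw [abs_of_nonneg (by linarith)]
    ring
  rw [hβ2] at i3 i4
  rw [rectInt]
  refine (norm_sub_le _ _).trans ?_
  rw [norm_mul, norm_I, one_mul]
  refine (add_le_add ((norm_add_le _ _).trans (add_le_add (norm_sub_le _ _) le_rfl)) le_rfl).trans ?_
  rw [norm_mul, norm_I, one_mul]
  linarith

variable {n : ℕ}

/-- Lower bounds for `coniPot` far from the origin. -/
theorem le_norm_coniPot (hn : 2 ≤ n) {T : ℝ} (hT : 6 ≤ T) {τ : ℂ} (h : |τ.re| = T) :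
    T ≤ ‖coniPot n τ‖ ∧ ‖exp (-(n * τ) / 2)‖ ^ 2 ≤ 2 * n * ‖coniPot n τ‖ := by
  have hn2 : (2 : ℝ) ≤ n := by exact_mod_cast hn
  have hn0 : (0 : ℝ) < n := by linarith
  have ew : ‖exp (-(n * τ) / 2)‖ ^ 2 = Real.exp (-(n * τ.re)) := by
    rw [norm_exp, ← Real.exp_nat_mul]
    congr 1
    simp
    ring
  have sqe : ∀ y : ℝ, 0 ≤ y → (1 + y / 2) ^ 2 ≤ Real.exp y := fun y hy => by
    have h1 : Real.exp y = Real.exp (y / 2) ^ 2 := by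
      rw [← Real.exp_nat_mul]
      ring_nf
    rw [h1]
    have := Real.add_one_le_exp (y / 2)
    exact pow_le_pow_left₀ (by positivity) (by linarith) 2
  have e1 : ‖exp τ‖ = Real.exp τ.re := norm_exp τ
  have e2 : ‖exp (-(n * τ)) / n‖ = Real.exp (-(n * τ.re)) / n := by
    rw [norm_div, norm_exp, Complex.norm_natCast]
    simp
  have e3 : ‖((n + 1) / n : ℂ)‖ ≤ 2 := by
    have : ((n + 1) / n : ℂ) = ((n + 1) / n : ℝ) := by push_cast; ring
    rw [this, Complex.norm_real, Real.norm_of_nonneg (by positivity), div_le_iff₀ hn0]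
    linarith
  rcases (abs_eq (by linarith)).1 h with hx | hx
  · have hb : Real.exp T - 1 - 2 ≤ ‖coniPot n τ‖ := by
      have k1 : Real.exp (-(n * T)) / n ≤ 1 := by
        rw [div_le_one hn0]
        refine le_trans ?_ (show (1 : ℝ) ≤ n by linarith)
        rw [Real.exp_le_one_iff]
        have : 0 ≤ n * T := by positivity
        linarith
      rw [hx] at e1 e2
      have k2 := norm_sub_le (coniPot n τ + (n + 1) / n) ((n + 1) / n : ℂ)
      have k3 := norm_sub_norm_le (exp τ) (-(exp (-(n * τ)) / n) + ((n + 1) / n : ℂ))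
      have k4 := norm_add_le (-(exp (-(n * τ)) / n)) ((n + 1) / n : ℂ)
      rw [norm_neg, e2] at k4
      have k5 : exp τ - (-(exp (-(n * τ)) / n) + ((n + 1) / n : ℂ)) = coniPot n τ := by
        rw [coniPot]
        ring
      rw [k5, e1] at k3
      linarith
    have hs := sqe T (by linarith)
    have h6 : T ≤ ‖coniPot n τ‖ := by nlinarith
    refine ⟨h6, ?_⟩
    rw [ew, hx]
    have : Real.exp (-(n * T)) ≤ 1 := by
      rw [Real.exp_le_one_iff]
      have : 0 ≤ n * T := by positivity
      linarith
    nlinarith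
  · have hneg : -(n * τ.re) = n * T := by rw [hx]; ring
    rw [hneg] at e2 ew
    have hb : Real.exp (n * T) / n - 3 ≤ ‖coniPot n τ‖ := by
      have k1 : Real.exp (-T) ≤ 1 := by
        rw [Real.exp_le_one_iff]
        linarith
      rw [hx] at e1
      have k3 := norm_sub_norm_le (exp (-(n * τ)) / n) (-exp τ + ((n + 1) / n : ℂ))
      have k4 := norm_add_le (-exp τ) ((n + 1) / n : ℂ)
      rw [norm_neg, e1] at k4
      have k5 : exp (-(n * τ)) / n - (-exp τ + ((n + 1) / n : ℂ)) = coniPot n τ := by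
        rw [coniPot]
        ring
      rw [k5, e2] at k3
      linarith
    have hs := sqe (n * T) (by positivity)
    have hs2 : T + 6 ≤ Real.exp (n * T) / n := by
      rw [le_div_iff₀ hn0]
      have h2 : 12 ≤ n * T := by nlinarith
      nlinarith [mul_nonneg (by linarith : (0 : ℝ) ≤ n * T - 12) (by positivity : 0 ≤ n * T)]
    refine ⟨by linarith, ?_⟩
    rw [ew]
    have : Real.exp (n * T) = n * (Real.exp (n * T) / n) := by field_simp
    rw [this]
    nlinarith

namespace ConiRoot

variable (R : ConiRoot n)

theorem norm_s_sq {τ : ℂ} (hτ : τ ∈ coniStrip n) : ‖R.s τ‖ ^ 2 = ‖coniPot n τ‖ := by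
  rw [← norm_pow, R.s_sq hτ]

theorem side_le (hn : 2 ≤ n) {T : ℝ} (hT : 6 ≤ T) {τ : ℂ} (hτ : τ ∈ coniStrip n) (h : |τ.re| = T)
    {J : ℕ} (hJ : 3 ≤ J) : ‖exp (-(n * τ) / 2)‖ * ‖R.s τ‖⁻¹ ^ J ≤ √(2 * n) / T := by
  obtain ⟨h1, h2⟩ := le_norm_coniPot hn hT h
  rw [← R.norm_s_sq hτ] at h1 h2
  have hs1 : 1 ≤ ‖R.s τ‖ := by
    by_contra hc
    push Not at hc
    have := norm_nonneg (R.s τ)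
    nlinarith
  have hs0 : 0 < ‖R.s τ‖ := by linarith
  have h3 : ‖exp (-(n * τ) / 2)‖ ≤ √(2 * n) * ‖R.s τ‖ := by
    refine le_of_sq_le_sq ?_ (by positivity)
    rw [mul_pow, Real.sq_sqrt (by positivity)]
    exact h2
  have h4 : ‖R.s τ‖⁻¹ ^ J ≤ ‖R.s τ‖⁻¹ ^ 3 :=
    pow_le_pow_of_le_one (by positivity) (inv_le_one_of_one_le₀ hs1) hJ
  calc _ ≤ √(2 * n) * ‖R.s τ‖ * ‖R.s τ‖⁻¹ ^ 3 := by gcongr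
    _ = √(2 * n) / ‖R.s τ‖ ^ 2 := by field_simp
    _ ≤ _ := by gcongr

theorem line_mem (hn : 0 < n) (x : ℝ) :
    (x + (2 * coniAngle n : ℝ) * I : ℂ) ∈ coniStrip n ∧
    (x - (2 * coniAngle n : ℝ) * I : ℂ) ∈ coniStrip n := by
  have h := two_mul_coniAngle_lt hn
  have h0 := coniAngle_pos (n := n)
  constructor <;> rw [mem_coniStrip]
  · simpa [abs_of_pos h0] using h
  · simpa [abs_of_pos h0] using h

/-- The root on the two shifted lines has the same absolute value. -/
theorem norm_s_line (hn : 0 < n) (x : ℝ) :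
    ‖R.s (x + (2 * coniAngle n : ℝ) * I)‖ ^ 2 = ‖coniGap n + coniPotReal n x‖ ∧
    ‖R.s (x - (2 * coniAngle n : ℝ) * I)‖ ^ 2 = ‖coniGap n + coniPotReal n x‖ := by
  rw [R.norm_s_sq (line_mem hn x).1, R.norm_s_sq (line_mem hn x).2, coniPot_sub_mul_I,
    norm_conj, norm_coniPot_add_mul_I hn]
  exact ⟨rfl, rfl⟩

/-- The weight of the line integrals. -/
noncomputable def lineWeight (n : ℕ) (J : ℕ) (x : ℝ) : ℝ :=
  Real.exp (-(n * x) / 2) * (√‖coniGap n + coniPotReal n x‖)⁻¹ ^ J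

theorem continuous_coniPotReal (hn : 0 < n) : Continuous (coniPotReal n) :=
  continuous_iff_continuousAt.2 fun x => (hasDerivAt_coniPotReal hn x).continuousAt

theorem continuous_lineWeight (hn : 2 ≤ n) (J : ℕ) : Continuous (lineWeight n J) := by
  have h1 := continuous_coniPotReal (n := n) (by omega)
  refine (by fun_prop : Continuous fun x : ℝ => Real.exp (-(n * x) / 2)).mul
    (Continuous.pow (Continuous.inv₀ (by fun_prop) fun x => ?_) _)
  exact (Real.sqrt_pos.2 ((coniDist_pos hn).trans_le
    (coniDist_le_norm hn (coniPotReal_nonneg (n := n) (by omega) x)))).ne'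

theorem lineWeight_nonneg (J : ℕ) (x : ℝ) : 0 ≤ lineWeight n J x := by
  rw [lineWeight]
  positivity

theorem norm_line_le (hn : 2 ≤ n) (J : ℕ) (x : ℝ) :
    ‖exp (-(n * (x + (2 * coniAngle n : ℝ) * I)) / 2) *
      (R.s (x + (2 * coniAngle n : ℝ) * I))⁻¹ ^ J‖ = lineWeight n J x ∧
    ‖exp (-(n * (x - (2 * coniAngle n : ℝ) * I)) / 2) *
      (R.s (x - (2 * coniAngle n : ℝ) * I))⁻¹ ^ J‖ = lineWeight n J x := by
  obtain ⟨h1, h2⟩ := R.norm_s_line (by omega) x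
  have e1 : ‖exp (-(n * (x + (2 * coniAngle n : ℝ) * I)) / 2)‖ = Real.exp (-(n * x) / 2) := by
    rw [norm_exp]
    simp
  have e2 : ‖exp (-(n * (x - (2 * coniAngle n : ℝ) * I)) / 2)‖ = Real.exp (-(n * x) / 2) := by
    rw [norm_exp]
    simp
  have h3 := (pow_left_inj₀ (norm_nonneg _) (norm_nonneg _) two_ne_zero).1 (h2.trans h1.symm)
  rw [norm_mul, norm_mul, e1, e2, norm_pow, norm_pow, norm_inv, norm_inv, lineWeight, h3, ← h1,
    Real.sqrt_sq (norm_nonneg _)]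
  exact ⟨rfl, rfl⟩

theorem integral_lineWeight_five_le (hn : 2 ≤ n) {T : ℝ} (hT : 0 ≤ T) :
    ∫ x in (-T)..T, lineWeight n 5 x ≤ 4 / (√n * coniDist n ^ 2) := by
  have hn0 : (0 : ℝ) < n := by exact_mod_cast (by omega : 0 < n)
  have hd := coniDist_pos hn
  set d := coniDist n with hd_def
  let F : ℝ → ℝ := fun v => v / (d ^ 2 * (d ^ 2 + v ^ 4 / (n : ℝ) ^ 2) ^ (1 / 4 : ℝ))
  let G : ℝ → ℝ := fun v => (d ^ 2 + v ^ 4 / (n : ℝ) ^ 2) ^ (-(5 / 4) : ℝ)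
  let z : ℝ → ℝ := fun x => Real.exp (-(n * x) / 2)
  have hz : ∀ x, HasDerivAt (fun x => z x - 1) (z x * (-(n * 1) / 2)) x := fun x =>
    (((((hasDerivAt_id x).const_mul (n : ℝ)).neg).div_const 2).exp).sub_const 1
  have hΦ : ∀ x, HasDerivAt (fun x => -(2 / n) * F (z x - 1)) (z x * G (z x - 1)) x := fun x => by
    refine (((hasDerivAt_div_rpow (b := n) (pow_pos hd 2) (z x - 1)).comp x (hz x)).const_mul
      (-(2 / n) : ℝ)).congr_deriv ?_
    simp only [G]
    field_simp
  have hGc : Continuous fun x => z x * G (z x - 1) := by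
    have hzc : Continuous z := by fun_prop
    refine hzc.mul (Continuous.rpow_const (by fun_prop) fun x => Or.inl ?_)
    have := pow_pos hd 2
    positivity
  have hle : ∀ x, lineWeight n 5 x ≤ z x * G (z x - 1) := fun x => by
    have hX := coniPotReal_nonneg (n := n) (by omega) x
    set N := ‖coniGap n + coniPotReal n x‖ with hN
    have h1 := sq_add_sq_le_norm_coniGap_add hn hX
    have hNpos : 0 < N := hd.trans_le (coniDist_le_norm hn hX)
    have h2 : d ^ 2 + (z x - 1) ^ 4 / (n : ℝ) ^ 2 ≤ N ^ 2 := by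
      refine le_trans ?_ h1
      have h3 := sq_le_mul_coniPotReal (n := n) (by omega) x
      have h4 : (z x - 1) ^ 2 / n ≤ coniPotReal n x := by
        rw [div_le_iff₀ hn0]
        linarith
      have h5 := pow_le_pow_left₀ (by positivity) h4 2
      have h6 : (z x - 1) ^ 4 / (n : ℝ) ^ 2 = ((z x - 1) ^ 2 / n) ^ 2 := by ring
      rw [h6]
      linarith
    have h7 : (√N)⁻¹ ^ 5 = (N ^ 2) ^ (-(5 / 4) : ℝ) := by
      rw [Real.sqrt_eq_rpow, ← Real.rpow_neg hNpos.le, ← Real.rpow_natCast, ← Real.rpow_natCast,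
        ← Real.rpow_mul hNpos.le, ← Real.rpow_mul hNpos.le]
      norm_num
    rw [lineWeight, ← hN, h7]
    refine mul_le_mul_of_nonneg_left ?_ (Real.exp_pos _).le
    exact Real.rpow_le_rpow_of_nonpos (by have := pow_pos hd 2; positivity) h2 (by norm_num)
  have hT' : -T ≤ T := by linarith
  refine (intervalIntegral.integral_mono_on hT' ((continuous_lineWeight hn 5).intervalIntegrable _ _)
    (hGc.intervalIntegrable _ _) fun x _ => hle x).trans ?_
  rw [intervalIntegral.integral_eq_sub_of_hasDerivAt (fun x _ => hΦ x)
    (hGc.intervalIntegrable _ _)]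
  have b1 := abs_le.1 (abs_div_rpow_le (b := n) (pow_pos hd 2) hn0 (z T - 1))
  have b2 := abs_le.1 (abs_div_rpow_le (b := n) (pow_pos hd 2) hn0 (z (-T) - 1))
  have e : 4 / (√n * d ^ 2) = 2 / n * (√n / d ^ 2) + 2 / n * (√n / d ^ 2) := by
    have : √(n : ℝ) * √n = n := Real.mul_self_sqrt hn0.le
    have hs : 0 < √(n : ℝ) := Real.sqrt_pos.2 hn0
    field_simp
    nlinarith
  rw [e]
  have h2n : (0 : ℝ) < 2 / n := by positivity
  have c1 := mul_le_mul_of_nonneg_left b1.1 h2n.le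
  have c2 := mul_le_mul_of_nonneg_left b2.2 h2n.le
  simp only [F]
  linarith

theorem lineWeight_le (hn : 2 ≤ n) (j : ℕ) (x : ℝ) :
    lineWeight n (2 * j + 5) x ≤ (coniDist n ^ j)⁻¹ * lineWeight n 5 x := by
  have hd := coniDist_pos hn
  have h1 := coniDist_le_norm hn (coniPotReal_nonneg (n := n) (by omega) x)
  set N := ‖coniGap n + coniPotReal n x‖ with hN
  have h2 : (√N)⁻¹ ^ (2 * j + 5) = (N ^ j)⁻¹ * (√N)⁻¹ ^ 5 := by
    rw [pow_add, pow_mul, inv_pow, Real.sq_sqrt (norm_nonneg _), inv_pow]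
  rw [lineWeight, lineWeight, ← hN, h2, mul_left_comm]
  gcongr

theorem integral_lineWeight_le (hn : 2 ≤ n) (j : ℕ) {T : ℝ} (hT : 0 ≤ T) :
    ∫ x in (-T)..T, lineWeight n (2 * j + 5) x ≤ 4 / (√n * coniDist n ^ (j + 2)) := by
  have hd := coniDist_pos hn
  have hT' : -T ≤ T := by linarith
  refine (intervalIntegral.integral_mono_on hT' ((continuous_lineWeight hn _).intervalIntegrable _ _)
    (((continuous_lineWeight hn 5).intervalIntegrable _ _).const_mul _)
    fun x _ => lineWeight_le hn j x).trans ?_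
  rw [intervalIntegral.integral_const_mul]
  refine (mul_le_mul_of_nonneg_left (integral_lineWeight_five_le hn hT) (by positivity)).trans
    (le_of_eq ?_)
  rw [pow_add]
  field_simp

end ConiRoot

end Bounds

section Fold

open Complex Set

/-- The principal square root of `δ + v ^ 2`. -/
noncomputable def foldRoot (δ : ℂ) (v : ℝ) : ℂ := (δ + (v : ℂ) ^ 2) ^ (2⁻¹ : ℂ)

/-- The integral `∫ v ^ (2 j) (δ + v ^ 2) ^ (-k - 1 / 2)`. -/
noncomputable def foldInt (δ : ℂ) (j k : ℕ) : ℂ :=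
  ∫ v : ℝ, (v : ℂ) ^ (2 * j) * (foldRoot δ v)⁻¹ ^ (2 * k + 1)

variable {δ : ℂ}

theorem fold_re_pos (hre : 0 < δ.re) (v : ℝ) : 0 < (δ + (v : ℂ) ^ 2).re := by
  rw [← ofReal_pow, add_re, ofReal_re]
  positivity

theorem foldRoot_sq (v : ℝ) : foldRoot δ v ^ 2 = δ + (v : ℂ) ^ 2 := by
  rw [foldRoot, ← cpow_nat_mul]
  simp

theorem foldRoot_ne_zero (hre : 0 < δ.re) (v : ℝ) : foldRoot δ v ≠ 0 := fun h => by
  have h1 := foldRoot_sq (δ := δ) v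
  have h2 := fold_re_pos hre v
  rw [← h1, h] at h2
  simp at h2

theorem fold_mul_inv (hre : 0 < δ.re) (v : ℝ) :
    (δ + (v : ℂ) ^ 2) * (foldRoot δ v)⁻¹ ^ 2 = 1 := by
  rw [← foldRoot_sq, inv_pow, mul_inv_cancel₀ (pow_ne_zero 2 (foldRoot_ne_zero hre v))]

theorem foldRoot_eq {w : ℂ} (hw : 0 < w.re) {v : ℝ} (h : w ^ 2 = δ + (v : ℂ) ^ 2) :
    foldRoot δ v = w := by
  rw [foldRoot, ← h, sq_cpow_two_inv hw]

theorem foldRoot_neg (v : ℝ) : foldRoot δ (-v) = foldRoot δ v := by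
  rw [foldRoot, foldRoot, ofReal_neg, neg_sq]

theorem hasDerivAt_foldRoot (hre : 0 < δ.re) (v : ℝ) :
    HasDerivAt (foldRoot δ) (v * (foldRoot δ v)⁻¹) v := by
  have h1 : HasDerivAt (fun z : ℂ => δ + z ^ 2) (2 * (v : ℂ)) (v : ℂ) := by
    simpa using (hasDerivAt_pow 2 (v : ℂ)).const_add δ
  have h2 := (h1.cpow_const (c := (2⁻¹ : ℂ)) (Or.inl (fold_re_pos hre v))).comp_ofReal
  refine h2.congr_deriv ?_
  have h0 : δ + (v : ℂ) ^ 2 ≠ 0 := by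
    rw [← foldRoot_sq]
    exact pow_ne_zero 2 (foldRoot_ne_zero hre v)
  rw [cpow_sub _ _ h0, cpow_one]
  change 2⁻¹ * (foldRoot δ v / (δ + (v : ℂ) ^ 2)) * (2 * v) = _
  have := foldRoot_ne_zero hre v
  rw [← foldRoot_sq]
  field_simp

theorem continuous_foldRoot (hre : 0 < δ.re) : Continuous (foldRoot δ) :=
  continuous_iff_continuousAt.2 fun v => (hasDerivAt_foldRoot hre v).continuousAt

theorem one_add_pow_le_norm_foldRoot (hδ : ‖δ‖ = 1) (hre : 0 < δ.re) (v : ℝ) :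
    1 + v ^ 4 ≤ ‖foldRoot δ v‖ ^ 4 := by
  have h1 : ‖foldRoot δ v‖ ^ 4 = ‖δ + (v : ℂ) ^ 2‖ ^ 2 := by
    rw [← foldRoot_sq, norm_pow]
    ring
  have h2 : δ.re * δ.re + δ.im * δ.im = 1 := by
    rw [← normSq_apply, normSq_eq_norm_sq, hδ, one_pow]
  rw [h1, ← normSq_eq_norm_sq, normSq_apply, ← ofReal_pow, add_re, add_im, ofReal_re, ofReal_im]
  nlinarith [mul_nonneg hre.le (sq_nonneg v)]

theorem one_le_norm_foldRoot (hδ : ‖δ‖ = 1) (hre : 0 < δ.re) (v : ℝ) : 1 ≤ ‖foldRoot δ v‖ := by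
  have h := one_add_pow_le_norm_foldRoot hδ hre v
  refine le_of_pow_le_pow_left₀ (n := 4) (by norm_num) (norm_nonneg _) ?_
  nlinarith [pow_nonneg (sq_nonneg v) 2]

theorem abs_le_norm_foldRoot (hδ : ‖δ‖ = 1) (hre : 0 < δ.re) (v : ℝ) : |v| ≤ ‖foldRoot δ v‖ := by
  have h := one_add_pow_le_norm_foldRoot hδ hre v
  refine le_of_pow_le_pow_left₀ (n := 4) (by norm_num) (norm_nonneg _) ?_
  have : |v| ^ 4 = v ^ 4 := Even.pow_abs ⟨2, rfl⟩ v
  linarith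

/-- Monomials divided by a sufficiently high power of the root are `O(v ^ (-2))`. -/
theorem norm_fold_le (hδ : ‖δ‖ = 1) (hre : 0 < δ.re) {i l : ℕ} (h : i + 2 ≤ l) (v : ℝ) :
    ‖(v : ℂ) ^ i * (foldRoot δ v)⁻¹ ^ l‖ ≤ 2 * (1 + v ^ 2)⁻¹ := by
  set N := ‖foldRoot δ v‖ with hN
  have h1 : 1 ≤ N := one_le_norm_foldRoot hδ hre v
  have h2 : 1 + v ^ 2 ≤ 2 * N ^ 2 := by
    have h := one_add_pow_le_norm_foldRoot hδ hre v
    refine le_of_pow_le_pow_left₀ (n := 2) (by norm_num) (by positivity) ?_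
    nlinarith [sq_nonneg (v ^ 2 - 1)]
  have h3 : |v| ^ i * N⁻¹ ^ l ≤ N⁻¹ ^ 2 := by
    obtain ⟨c, rfl⟩ := Nat.exists_eq_add_of_le h
    calc |v| ^ i * N⁻¹ ^ (i + 2 + c) ≤ N ^ i * N⁻¹ ^ (i + 2) := by
          refine mul_le_mul (pow_le_pow_left₀ (abs_nonneg v) (abs_le_norm_foldRoot hδ hre v) i)
            (pow_le_pow_of_le_one (by positivity) (inv_le_one_of_one_le₀ h1) (by omega))
            (by positivity) (by positivity)
      _ = _ := by rw [pow_add, inv_pow, ← mul_assoc, mul_inv_cancel₀ (by positivity), one_mul]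
  rw [norm_mul, norm_pow, norm_pow, norm_inv, Complex.norm_real, Real.norm_eq_abs]
  refine h3.trans ?_
  rw [inv_pow, ← div_eq_mul_inv, inv_eq_one_div, div_le_div_iff₀ (by positivity) (by positivity)]
  linarith

theorem continuous_fold (hre : 0 < δ.re) (i l : ℕ) :
    Continuous fun v : ℝ => (v : ℂ) ^ i * (foldRoot δ v)⁻¹ ^ l :=
  (by fun_prop : Continuous fun v : ℝ => (v : ℂ) ^ i).mul
    (((continuous_foldRoot hre).inv₀ (foldRoot_ne_zero hre)).pow l)

theorem integrable_fold (hδ : ‖δ‖ = 1) (hre : 0 < δ.re) {i l : ℕ} (h : i + 2 ≤ l) :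
    Integrable fun v : ℝ => (v : ℂ) ^ i * (foldRoot δ v)⁻¹ ^ l :=
  (integrable_inv_one_add_sq.const_mul 2).mono' (continuous_fold hre i l).aestronglyMeasurable
    (Eventually.of_forall fun v => norm_fold_le hδ hre h v)

theorem tendsto_fold (hδ : ‖δ‖ = 1) (hre : 0 < δ.re) {i l : ℕ} (h : i + 2 ≤ l) :
    Tendsto (fun v : ℝ => (v : ℂ) ^ i * (foldRoot δ v)⁻¹ ^ l) atTop (𝓝 0) ∧
    Tendsto (fun v : ℝ => (v : ℂ) ^ i * (foldRoot δ v)⁻¹ ^ l) atBot (𝓝 0) := by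
  have key : ∀ l : Filter ℝ, Tendsto (fun v : ℝ => v ^ 2) l atTop →
      Tendsto (fun v : ℝ => 2 * (1 + v ^ 2)⁻¹) l (𝓝 0) := fun l hl => by
    simpa using (tendsto_inv_atTop_zero.comp (tendsto_atTop_add_const_left _ 1 hl)).const_mul 2
  exact ⟨squeeze_zero_norm (norm_fold_le hδ hre h) (key _ (tendsto_pow_atTop two_ne_zero)),
    squeeze_zero_norm (norm_fold_le hδ hre h)
      (key _ (by simpa [Function.comp_def] using
        (tendsto_pow_atTop (α := ℝ) two_ne_zero).comp tendsto_neg_atBot_atTop))⟩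

theorem hasDerivAt_fold (hre : 0 < δ.re) (i l : ℕ) (v : ℝ) :
    HasDerivAt (fun v : ℝ => (v : ℂ) ^ (i + 1) * (foldRoot δ v)⁻¹ ^ l)
      ((i + 1 : ℕ) * ((v : ℂ) ^ i * (foldRoot δ v)⁻¹ ^ l) -
        l * ((v : ℂ) ^ (i + 2) * (foldRoot δ v)⁻¹ ^ (l + 2))) v := by
  have h0 := foldRoot_ne_zero hre v
  have h1 := (hasDerivAt_pow (i + 1) (v : ℂ)).comp_ofReal
  have h2 := ((hasDerivAt_foldRoot hre v).inv h0).pow l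
  refine (h1.mul h2).congr_deriv ?_
  rcases l with - | l
  · simp
  · simp only [Nat.add_sub_cancel, Pi.inv_apply, Pi.pow_apply]
    rw [div_eq_mul_inv, ← inv_pow]
    ring

/-- Integration by parts, first form. -/
theorem foldInt_succ_right (hδ : ‖δ‖ = 1) (hre : 0 < δ.re) (k : ℕ) :
    (2 * k + 2 : ℂ) * foldInt δ 0 (k + 1) = (2 * k + 3) * δ * foldInt δ 0 (k + 2) := by
  have e : ∀ v : ℝ, ((0 + 1 : ℕ) : ℂ) * ((v : ℂ) ^ 0 * (foldRoot δ v)⁻¹ ^ (2 * k + 3)) -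
        (2 * k + 3 : ℕ) * ((v : ℂ) ^ (0 + 2) * (foldRoot δ v)⁻¹ ^ (2 * k + 3 + 2)) =
      (2 * k + 3) * δ * ((v : ℂ) ^ (2 * 0) * (foldRoot δ v)⁻¹ ^ (2 * (k + 2) + 1)) -
        (2 * k + 2) * ((v : ℂ) ^ (2 * 0) * (foldRoot δ v)⁻¹ ^ (2 * (k + 1) + 1)) := fun v => by
    have h0 := fold_mul_inv hre v
    push_cast
    linear_combination (-(2 * k + 3) * (foldRoot δ v)⁻¹ ^ (2 * k + 3)) * h0
  have hi1 := (integrable_fold (i := 2 * 0) (l := 2 * (k + 2) + 1) hδ hre (by omega)).const_mul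
    ((2 * k + 3) * δ)
  have hi2 := (integrable_fold (i := 2 * 0) (l := 2 * (k + 1) + 1) hδ hre (by omega)).const_mul
    (2 * k + 2 : ℂ)
  have ht := tendsto_fold (i := 0 + 1) (l := 2 * k + 3) hδ hre (by omega)
  have h := integral_of_hasDerivAt_of_tendsto (fun v => hasDerivAt_fold hre 0 (2 * k + 3) v)
    ((hi1.sub hi2).congr (Eventually.of_forall fun v => (e v).symm)) ht.2 ht.1
  simp only [e] at h
  rw [integral_sub hi1 hi2, integral_const_mul, integral_const_mul, sub_zero, sub_eq_zero] at h
  exact h.symm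

/-- Integration by parts, second form. -/
theorem foldInt_succ_left (hδ : ‖δ‖ = 1) (hre : 0 < δ.re) {j k : ℕ} (h : j + 2 ≤ k) :
    (2 * (k - 1 - j) : ℂ) * foldInt δ (j + 1) k = (2 * j + 1) * δ * foldInt δ j k := by
  obtain ⟨c, rfl⟩ := Nat.exists_eq_add_of_le h
  have e : ∀ v : ℝ, ((2 * j + 1 : ℕ) : ℂ) *
        ((v : ℂ) ^ (2 * j) * (foldRoot δ v)⁻¹ ^ (2 * (j + c) + 3)) -
        (2 * (j + c) + 3 : ℕ) * ((v : ℂ) ^ (2 * j + 2) *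
          (foldRoot δ v)⁻¹ ^ (2 * (j + c) + 3 + 2)) =
      (2 * j + 1) * δ * ((v : ℂ) ^ (2 * j) * (foldRoot δ v)⁻¹ ^ (2 * (j + 2 + c) + 1)) -
        (2 * (c + 1)) * ((v : ℂ) ^ (2 * (j + 1)) *
          (foldRoot δ v)⁻¹ ^ (2 * (j + 2 + c) + 1)) := fun v => by
    have h0 := fold_mul_inv hre v
    push_cast
    linear_combination
      (-(2 * j + 1) * (v : ℂ) ^ (2 * j) * (foldRoot δ v)⁻¹ ^ (2 * (j + c) + 3)) * h0
  have hi1 := (integrable_fold (i := 2 * j) (l := 2 * (j + 2 + c) + 1) hδ hre (by omega)).const_mul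
    ((2 * j + 1) * δ)
  have hi2 := (integrable_fold (i := 2 * (j + 1)) (l := 2 * (j + 2 + c) + 1) hδ hre
    (by omega)).const_mul (2 * (c + 1) : ℂ)
  have ht := tendsto_fold (i := 2 * j + 1) (l := 2 * (j + c) + 3) hδ hre (by omega)
  have h := integral_of_hasDerivAt_of_tendsto (fun v => hasDerivAt_fold hre (2 * j)
    (2 * (j + c) + 3) v)
    ((hi1.sub hi2).congr (Eventually.of_forall fun v => (e v).symm)) ht.2 ht.1
  simp only [e] at h
  rw [integral_sub hi1 hi2, integral_const_mul, integral_const_mul, sub_zero, sub_eq_zero] at h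
  rw [foldInt, foldInt, h]
  push_cast
  ring

theorem foldInt_zero_one (hδ : ‖δ‖ = 1) (hre : 0 < δ.re) : δ * foldInt δ 0 1 = 2 := by
  have e : ∀ v : ℝ, ((0 + 1 : ℕ) : ℂ) * ((v : ℂ) ^ 0 * (foldRoot δ v)⁻¹ ^ 1) -
        (1 : ℕ) * ((v : ℂ) ^ (0 + 2) * (foldRoot δ v)⁻¹ ^ (1 + 2)) =
      δ * ((v : ℂ) ^ (2 * 0) * (foldRoot δ v)⁻¹ ^ (2 * 1 + 1)) := fun v => by
    have h0 := fold_mul_inv hre v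
    push_cast
    linear_combination (-(foldRoot δ v)⁻¹) * h0
  have ht : Tendsto (fun v : ℝ => (v : ℂ) ^ (0 + 1) * (foldRoot δ v)⁻¹ ^ 1) atTop (𝓝 1) := by
    have h1 : Tendsto (fun v : ℝ => (1 - δ * (δ + (v : ℂ) ^ 2)⁻¹) ^ (2⁻¹ : ℂ)) atTop (𝓝 1) := by
      have h2 : Tendsto (fun v : ℝ => 1 - δ * (δ + (v : ℂ) ^ 2)⁻¹) atTop (𝓝 1) := by
        have h3 := (tendsto_fold (i := 0) (l := 2) hδ hre (by omega)).1
        have h4 := (h3.const_mul δ).const_sub 1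
        rw [mul_zero, sub_zero] at h4
        refine h4.congr fun v => ?_
        rw [pow_zero, one_mul, inv_pow, foldRoot_sq]
      have h5 : ContinuousAt (fun z : ℂ => z ^ (2⁻¹ : ℂ)) 1 :=
        continuousAt_cpow_const (by simp)
      simpa [Function.comp_def] using h5.tendsto.comp h2
    refine h1.congr' ?_
    filter_upwards [eventually_gt_atTop 0] with v hv
    have h0 := foldRoot_ne_zero hre v
    have hr : 0 ≤ (foldRoot δ v).re := by
      rw [foldRoot, cpow_inv_two_re]
      positivity
    have hr2 : 0 < (foldRoot δ v).re := by
      refine lt_of_le_of_ne hr fun hz => ?_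
      have := fold_re_pos hre v
      rw [← foldRoot_sq, pow_two, mul_re, ← hz] at this
      nlinarith
    have e1 : 1 - δ * (δ + (v : ℂ) ^ 2)⁻¹ = ((v : ℂ) * (foldRoot δ v)⁻¹) ^ 2 := by
      rw [← foldRoot_sq]
      have hd : δ = foldRoot δ v ^ 2 - (v : ℂ) ^ 2 := by rw [foldRoot_sq]; ring
      nth_rewrite 1 [hd]
      field_simp
      ring
    rw [e1, sq_cpow_two_inv, zero_add, pow_one, pow_one]
    rw [re_ofReal_mul, inv_re]
    have := normSq_pos.2 h0
    positivity
  have ht2 : Tendsto (fun v : ℝ => (v : ℂ) ^ (0 + 1) * (foldRoot δ v)⁻¹ ^ 1) atBot (𝓝 (-1)) := by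
    refine (ht.comp tendsto_neg_atBot_atTop).neg.congr fun v => ?_
    simp [foldRoot_neg]
  have hi := (integrable_fold (i := 2 * 0) (l := 2 * 1 + 1) hδ hre (by omega)).const_mul δ
  have h := integral_of_hasDerivAt_of_tendsto (fun v => hasDerivAt_fold hre 0 1 v)
    (hi.congr (Eventually.of_forall fun v => (e v).symm)) ht2 ht
  simp only [e] at h
  rw [integral_const_mul] at h
  rw [foldInt, h]
  norm_num

/-- The value of `δ ^ (k + 1) * foldInt δ 0 (k + 1)`. -/
noncomputable def foldConst : ℕ → ℝ
  | 0 => 2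
  | k + 1 => (2 * k + 2) / (2 * k + 3) * foldConst k

theorem foldConst_pos (k : ℕ) : 0 < foldConst k := by
  induction k with
  | zero => norm_num [foldConst]
  | succ k ih => rw [foldConst]; positivity

theorem le_foldConst_sq (k : ℕ) : 8 / 3 ≤ foldConst (k + 1) ^ 2 * (k + 3 / 2) := by
  induction k with
  | zero => norm_num [foldConst]
  | succ k ih =>
    rw [foldConst]
    refine ih.trans ?_
    rw [mul_pow, mul_comm (((_ : ℝ) / _) ^ 2), mul_assoc]
    refine mul_le_mul_of_nonneg_left ?_ (sq_nonneg (foldConst (k + 1)))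
    push_cast
    rw [div_pow, div_mul_eq_mul_div, le_div_iff₀ (by positivity)]
    have hk : (0 : ℝ) ≤ k := Nat.cast_nonneg k
    nlinarith

theorem foldInt_zero (hδ : ‖δ‖ = 1) (hre : 0 < δ.re) (k : ℕ) :
    δ ^ (k + 1) * foldInt δ 0 (k + 1) = foldConst k := by
  induction k with
  | zero =>
    rw [zero_add, pow_one, foldInt_zero_one hδ hre]
    norm_num [foldConst]
  | succ k ih =>
    have h := foldInt_succ_right hδ hre k
    have h3 : (2 * k + 3 : ℂ) ≠ 0 := by exact_mod_cast (by omega : 2 * k + 3 ≠ 0)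
    rw [foldConst]
    push_cast
    rw [← ih, div_mul_eq_mul_div, eq_div_iff h3, pow_succ δ (k + 1)]
    linear_combination -δ ^ (k + 1) * h

/-- The ratio of `foldInt δ j k` and `δ ^ j * foldInt δ 0 k`. -/
noncomputable def foldRatio (k j : ℕ) : ℝ := ∏ i ∈ Finset.range j, (2 * i + 1) / (2 * (k - 1 - i))

theorem foldInt_eq (hδ : ‖δ‖ = 1) (hre : 0 < δ.re) {j k : ℕ} (h : j + 1 ≤ k) :
    foldInt δ j k = δ ^ j * foldRatio k j * foldInt δ 0 k := by
  induction j with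
  | zero => simp [foldRatio]
  | succ j ih =>
    have h1 := foldInt_succ_left hδ hre (j := j) (k := k) (by omega)
    obtain ⟨c, rfl⟩ := Nat.exists_eq_add_of_le h
    have h2 : (c + 1 : ℂ) ≠ 0 := by exact_mod_cast c.succ_ne_zero
    have e1 : (2 * ((j + 1 + 1 + c : ℕ) - 1 - j) : ℂ) = 2 * (c + 1) := by push_cast; ring
    have e2 : (2 * ((j + 1 + 1 + c : ℕ) - 1 - j) : ℝ) = 2 * (c + 1) := by push_cast; ring
    rw [e1, ih (by omega)] at h1
    rw [foldRatio, Finset.prod_range_succ, ← foldRatio, e2]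
    push_cast
    field_simp
    linear_combination h1

end Fold

section FoldEstimate

open Complex Set

theorem integral_Ioi_pow_mul_rpow {c : ℝ} (hc : c < -1) :
    IntegrableOn (fun v : ℝ => v ^ 3 * (1 + v ^ 4) ^ c) (Ioi 0) ∧
      ∫ v in Ioi (0 : ℝ), v ^ 3 * (1 + v ^ 4) ^ c = -(1 / (4 * (c + 1))) := by
  have hpos : ∀ v : ℝ, 0 < 1 + v ^ 4 := fun v => by positivity
  have h1 : ∀ v ∈ Ici (0 : ℝ), HasDerivAt (fun v : ℝ => (1 + v ^ 4) ^ (c + 1) / (4 * (c + 1)))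
      (v ^ 3 * (1 + v ^ 4) ^ c) v := fun v _ => by
    have h := (((hasDerivAt_pow 4 v).const_add 1).rpow_const (p := c + 1)
      (Or.inl (hpos v).ne')).div_const (4 * (c + 1))
    refine h.congr_deriv ?_
    have : c + 1 ≠ 0 := by linarith
    rw [add_sub_cancel_right]
    push_cast
    field_simp
  have h2 : Tendsto (fun v : ℝ => (1 + v ^ 4) ^ (c + 1) / (4 * (c + 1))) atTop (𝓝 0) := by
    have h3 : Tendsto (fun v : ℝ => 1 + v ^ 4) atTop atTop :=
      tendsto_atTop_add_const_left _ 1 (tendsto_pow_atTop (by norm_num))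
    have h4 := (tendsto_rpow_neg_atTop (y := -(c + 1)) (by linarith)).comp h3
    simpa [Function.comp_def] using h4.div_const (4 * (c + 1))
  have h3 : ∀ v ∈ Ioi (0 : ℝ), 0 ≤ v ^ 3 * (1 + v ^ 4) ^ c := fun v hv => by
    have : (0 : ℝ) < v := hv
    have := hpos v
    positivity
  refine ⟨integrableOn_Ioi_deriv_of_nonneg' h1 h3 h2, ?_⟩
  rw [integral_Ioi_of_hasDerivAt_of_nonneg' h1 h3 h2]
  simp

/-- A bound for `v ^ 12 (1 + v ^ 4) ^ (-p)` with an elementary integral. -/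
noncomputable def foldTail (p v : ℝ) : ℝ :=
  (3 / 5 * v ^ 11 + 125 / 256 * v ^ 15) * (1 + v ^ 4) ^ (-p)

/-- The integral of `foldTail p |v|`. -/
noncomputable def foldTailInt (p : ℝ) : ℝ :=
  3 / 5 / ((p - 1) * (p - 2) * (p - 3)) +
    375 / 256 / ((p - 1) * (p - 2) * (p - 3) * (p - 4))

theorem pow_mul_rpow_le_foldTail (p v : ℝ) :
    v ^ 12 * (1 + v ^ 4) ^ (-p) ≤ foldTail p |v| := by
  have h4 : |v| ^ 4 = v ^ 4 := Even.pow_abs ⟨2, rfl⟩ v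
  have h12 : |v| ^ 12 = v ^ 12 := Even.pow_abs ⟨6, rfl⟩ v
  rw [foldTail, h4, ← h12]
  refine mul_le_mul_of_nonneg_right ?_ (by positivity)
  -- the inequality `t ≤ 3 / 4 + t ^ 4 / 4` at `t = 5 |v| / 4`
  have h : |v| ≤ 3 / 5 + 125 / 256 * |v| ^ 4 := by
    nlinarith [sq_nonneg (5 / 4 * |v| - 1), sq_nonneg ((5 / 4 * |v|) ^ 2 - 1)]
  calc |v| ^ 12 = |v| ^ 11 * |v| := by ring
    _ ≤ |v| ^ 11 * (3 / 5 + 125 / 256 * |v| ^ 4) := by gcongr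
    _ = _ := by ring

theorem integral_foldTail {p : ℝ} (hp : 4 < p) :
    Integrable (fun v => foldTail p |v|) ∧ ∫ v, foldTail p |v| = foldTailInt p := by
  have hpos : ∀ v : ℝ, 0 < 1 + v ^ 4 := fun v => by positivity
  obtain ⟨i0, e0⟩ := integral_Ioi_pow_mul_rpow (c := -p) (by linarith)
  obtain ⟨i1, e1⟩ := integral_Ioi_pow_mul_rpow (c := 1 - p) (by linarith)
  obtain ⟨i2, e2⟩ := integral_Ioi_pow_mul_rpow (c := 2 - p) (by linarith)
  obtain ⟨i3, e3⟩ := integral_Ioi_pow_mul_rpow (c := 3 - p) (by linarith)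
  have hsplit : ∀ v : ℝ, foldTail p v = 125 / 256 * (v ^ 3 * (1 + v ^ 4) ^ (3 - p)) +
      (3 / 5 - 375 / 256) * (v ^ 3 * (1 + v ^ 4) ^ (2 - p)) +
      (375 / 256 - 6 / 5) * (v ^ 3 * (1 + v ^ 4) ^ (1 - p)) +
      (3 / 5 - 125 / 256) * (v ^ 3 * (1 + v ^ 4) ^ (-p)) := fun v => by
    have r : ∀ i : ℕ, (1 + v ^ 4) ^ ((i : ℝ) - p) = (1 + v ^ 4) ^ i * (1 + v ^ 4) ^ (-p) :=
      fun i => by rw [sub_eq_add_neg, Real.rpow_add (hpos v), Real.rpow_natCast]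
    have r1 := r 1
    have r2 := r 2
    have r3 := r 3
    push_cast at r1 r2 r3
    rw [r1, r2, r3, foldTail]
    ring
  have key : ∀ (a b c d : ℝ) {f g h u : ℝ → ℝ}, IntegrableOn f (Ioi 0) → IntegrableOn g (Ioi 0) →
      IntegrableOn h (Ioi 0) → IntegrableOn u (Ioi 0) →
      ∫ v in Ioi (0 : ℝ), (a * f v + b * g v + c * h v + d * u v) =
        a * (∫ v in Ioi (0 : ℝ), f v) + b * (∫ v in Ioi (0 : ℝ), g v) +
        c * (∫ v in Ioi (0 : ℝ), h v) + d * (∫ v in Ioi (0 : ℝ), u v) :=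
    fun a b c d {f g h u} hf hg hh hu => by
      have s1 : IntegrableOn (fun v => a * f v + b * g v) (Ioi 0) :=
        (hf.const_mul a).add (hg.const_mul b)
      have s2 : IntegrableOn (fun v => a * f v + b * g v + c * h v) (Ioi 0) :=
        s1.add (hh.const_mul c)
      rw [integral_add s2 (hu.const_mul d), integral_add s1 (hh.const_mul c),
        integral_add (hf.const_mul a) (hg.const_mul b)]
      simp only [integral_const_mul]
  have hI : ∫ v, foldTail p |v| = foldTailInt p := by
    rw [integral_comp_abs (f := foldTail p)]
    simp only [hsplit]
    rw [key _ _ _ _ i3 i2 i1 i0, e0, e1, e2, e3, foldTailInt]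
    have h1 : p - 1 ≠ 0 := by linarith
    have h2 : p - 2 ≠ 0 := by linarith
    have h3 : p - 3 ≠ 0 := by linarith
    have h4 : p - 4 ≠ 0 := by linarith
    rw [show -p + 1 = -(p - 1) by ring, show 1 - p + 1 = -(p - 2) by ring,
      show 2 - p + 1 = -(p - 3) by ring, show 3 - p + 1 = -(p - 4) by ring]
    field_simp
    ring
  refine ⟨Integrable.of_integral_ne_zero ?_, hI⟩
  have h1 : 0 < p - 1 := by linarith
  have h2 : 0 < p - 2 := by linarith
  have h3 : 0 < p - 3 := by linarith
  have h4 : 0 < p - 4 := by linarith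
  rw [hI, foldTailInt]
  positivity

/-- The relative error of the two-term approximation of the integrals over the shifted line. -/
noncomputable def foldErr (k : ℕ) : ℝ :=
  ∑ j ∈ Finset.Ico 2 6, foldRatio k j + foldTailInt ((2 * k + 1) / 4) / foldConst (k - 1)

theorem norm_integral_sub_le {δ : ℂ} (hδ : ‖δ‖ = 1) (hre : 0 < δ.re) {κ : ℝ} {c : ℕ → ℝ}
    {H : ℝ → ℂ} {k : ℕ} (hk : 8 ≤ k) (c0 : c 0 = 1) (hc : ∀ j ∈ Finset.Ico 2 6, |c j| ≤ κ)
    (hH : ∀ v : ℝ, ‖H v - ∑ j ∈ Finset.range 6, (c j : ℂ) * (v : ℂ) ^ (2 * j)‖ ≤ κ * v ^ 12)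
    (hi : Integrable fun v : ℝ => H v * (foldRoot δ v)⁻¹ ^ (2 * k + 1)) :
    ‖foldInt δ 0 k‖ = foldConst (k - 1) ∧
    ‖(∫ v : ℝ, H v * (foldRoot δ v)⁻¹ ^ (2 * k + 1)) -
      foldInt δ 0 k * (1 + c 1 * δ * foldRatio k 1)‖ ≤ ‖foldInt δ 0 k‖ * (κ * foldErr k) := by
  have hB := foldConst_pos (k - 1)
  have hnorm : ‖foldInt δ 0 k‖ = foldConst (k - 1) := by
    have h := congrArg norm (foldInt_zero hδ hre (k - 1))
    rw [Nat.sub_add_cancel (by omega), norm_mul, norm_pow, hδ, one_pow, one_mul,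
      Complex.norm_real, Real.norm_of_nonneg hB.le] at h
    exact h
  refine ⟨hnorm, ?_⟩
  have hj : ∀ j ∈ Finset.range 6, Integrable fun v : ℝ =>
      (c j : ℂ) * ((v : ℂ) ^ (2 * j) * (foldRoot δ v)⁻¹ ^ (2 * k + 1)) := fun j hj =>
    (integrable_fold hδ hre (by have := Finset.mem_range.1 hj; omega)).const_mul _
  have hS := integrable_finsetSum _ hj
  have e1 : ∫ v : ℝ, H v * (foldRoot δ v)⁻¹ ^ (2 * k + 1) =
      ∑ j ∈ Finset.range 6, (c j : ℂ) * foldInt δ j k +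
      ∫ v : ℝ, (H v - ∑ j ∈ Finset.range 6, (c j : ℂ) * (v : ℂ) ^ (2 * j)) *
        (foldRoot δ v)⁻¹ ^ (2 * k + 1) := by
    have h : ∀ v : ℝ, (H v - ∑ j ∈ Finset.range 6, (c j : ℂ) * (v : ℂ) ^ (2 * j)) *
        (foldRoot δ v)⁻¹ ^ (2 * k + 1) = H v * (foldRoot δ v)⁻¹ ^ (2 * k + 1) -
        ∑ j ∈ Finset.range 6, (c j : ℂ) * ((v : ℂ) ^ (2 * j) * (foldRoot δ v)⁻¹ ^ (2 * k + 1)) :=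
      fun v => by rw [sub_mul, Finset.sum_mul]; simp only [mul_assoc]
    simp only [h]
    rw [integral_sub hi hS, integral_finsetSum _ hj]
    simp only [integral_const_mul]
    simp only [foldInt]
    ring
  set p : ℝ := (2 * k + 1) / 4 with hp
  have hk' : (8 : ℝ) ≤ k := by exact_mod_cast hk
  obtain ⟨t1, t2⟩ := integral_foldTail (p := p) (by rw [hp]; linarith)
  have hκ : 0 ≤ κ := (abs_nonneg _).trans (hc 2 (by simp))
  have e2 : ‖∫ v : ℝ, (H v - ∑ j ∈ Finset.range 6, (c j : ℂ) * (v : ℂ) ^ (2 * j)) *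
        (foldRoot δ v)⁻¹ ^ (2 * k + 1)‖ ≤ κ * foldTailInt p := by
    rw [← t2, ← integral_const_mul]
    refine norm_integral_le_of_norm_le (t1.const_mul κ) (Eventually.of_forall fun v => ?_)
    refine le_trans ?_ (mul_le_mul_of_nonneg_left (pow_mul_rpow_le_foldTail p v) hκ)
    have h1 := one_le_norm_foldRoot hδ hre v
    have h2 : ‖(foldRoot δ v)⁻¹ ^ (2 * k + 1)‖ ≤ (1 + v ^ 4) ^ (-p) := by
      rw [inv_pow, norm_inv, norm_pow, Real.rpow_neg (by positivity)]
      refine inv_anti₀ (by positivity) ?_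
      refine (Real.rpow_le_rpow (by positivity) (one_add_pow_le_norm_foldRoot hδ hre v)
        (by rw [hp]; positivity)).trans (le_of_eq ?_)
      rw [← Real.rpow_natCast, ← Real.rpow_mul (norm_nonneg _), ← Real.rpow_natCast]
      congr 1
      rw [hp]
      push_cast
      ring
    rw [norm_mul, ← mul_assoc]
    exact mul_le_mul (hH v) h2 (norm_nonneg _) (by positivity)
  have e3 : ∀ j ∈ Finset.range 6, (c j : ℂ) * foldInt δ j k =
      foldInt δ 0 k * (c j * δ ^ j * foldRatio k j) := fun j hj => by
    rw [foldInt_eq hδ hre (by have := Finset.mem_range.1 hj; omega)]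
    ring
  have e4 : (∫ v : ℝ, H v * (foldRoot δ v)⁻¹ ^ (2 * k + 1)) -
      foldInt δ 0 k * (1 + c 1 * δ * foldRatio k 1) =
      foldInt δ 0 k * (∑ j ∈ Finset.Ico 2 6, c j * δ ^ j * foldRatio k j) +
      ∫ v : ℝ, (H v - ∑ j ∈ Finset.range 6, (c j : ℂ) * (v : ℂ) ^ (2 * j)) *
        (foldRoot δ v)⁻¹ ^ (2 * k + 1) := by
    rw [e1, Finset.sum_congr rfl e3, ← Finset.mul_sum, ← Finset.sum_range_add_sum_Ico _
      (show 2 ≤ 6 by norm_num), Finset.sum_range_succ, Finset.sum_range_one, c0]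
    simp only [foldRatio, Finset.range_zero, Finset.prod_empty]
    push_cast
    ring
  rw [e4]
  refine (norm_add_le _ _).trans ?_
  rw [norm_mul, foldErr, mul_add, mul_add]
  refine add_le_add (mul_le_mul_of_nonneg_left ?_ (norm_nonneg _)) (e2.trans (le_of_eq ?_))
  · refine (norm_sum_le _ _).trans ?_
    rw [Finset.mul_sum]
    refine Finset.sum_le_sum fun j hj => ?_
    have hr : 0 ≤ foldRatio k j := Finset.prod_nonneg fun i hi => by
      have h1 := Finset.mem_range.1 hi
      have h2 := Finset.mem_Ico.1 hj
      have h3 : (i : ℝ) ≤ 5 := by exact_mod_cast (by omega : i ≤ 5)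
      have h4 : (0 : ℝ) ≤ k - 1 - i := by linarith
      positivity
    rw [norm_mul, norm_mul, norm_pow, hδ, one_pow, mul_one, Complex.norm_real, Complex.norm_real,
      Real.norm_eq_abs, Real.norm_of_nonneg hr]
    exact mul_le_mul_of_nonneg_right (hc j hj) hr
  · rw [hnorm, ← hp]
    field_simp

/-- An upper bound for `(k - 1) * foldErr k` that is monotone in `k`. -/
theorem mul_foldErr_le {k K : ℕ} (hK : 8 ≤ K) (hk : K ≤ k) : ((k : ℝ) - 1) * foldErr k ≤
    3 / 4 / ((K : ℝ) - 2) + 15 / 8 / (((K : ℝ) - 2) * (K - 3)) +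
    105 / 16 / (((K : ℝ) - 2) * (K - 3) * (K - 4)) +
    945 / 32 / (((K : ℝ) - 2) * (K - 3) * (K - 4) * (K - 5)) +
    7655 / 100000 * ((2 + 2 / (2 * K - 3)) * (2 + 76 / (2 * K - 7)) *
      (12 / 5 / (2 * K - 11) + 375 / 16 / ((2 * K - 11) * (2 * K - 15)))) := by
  have hK' : (8 : ℝ) ≤ K := by exact_mod_cast hK
  have hx : (K : ℝ) ≤ k := by exact_mod_cast hk
  set x : ℝ := (k : ℝ) with hxdef
  have h1 : (∑ j ∈ Finset.Ico 2 6, foldRatio k j) * (x - 1) =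
      3 / 4 / (x - 2) + 15 / 8 / ((x - 2) * (x - 3)) +
      105 / 16 / ((x - 2) * (x - 3) * (x - 4)) +
      945 / 32 / ((x - 2) * (x - 3) * (x - 4) * (x - 5)) := by
    simp only [foldRatio, Finset.sum_Ico_succ_top (show 2 ≤ 5 by norm_num),
      Finset.sum_Ico_succ_top (show 2 ≤ 4 by norm_num),
      Finset.sum_Ico_succ_top (show 2 ≤ 3 by norm_num),
      Finset.sum_Ico_succ_top (show 2 ≤ 2 by norm_num), Finset.Ico_self, Finset.sum_empty,
      Finset.prod_range_succ, Finset.prod_range_zero, ← hxdef]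
    have a1 : x - 1 ≠ 0 := by linarith
    have a2 : x - 2 ≠ 0 := by linarith
    have a3 : x - 3 ≠ 0 := by linarith
    have a4 : x - 4 ≠ 0 := by linarith
    have a5 : x - 5 ≠ 0 := by linarith
    push_cast
    rw [show x - 1 - 1 = x - 2 by ring, show x - 1 - 2 = x - 3 by ring,
      show x - 1 - 3 = x - 4 by ring, show x - 1 - 4 = x - 5 by ring, sub_zero]
    field_simp
    ring
  have hB := foldConst_pos (k - 1)
  have h2 : 1 / foldConst (k - 1) ≤ 7655 / 100000 * (x + 31 / 2) := by
    have h3 := le_foldConst_sq (k - 2)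
    rw [show k - 2 + 1 = k - 1 by omega, Nat.cast_sub (by omega), ← hxdef] at h3
    push_cast at h3
    rw [div_le_iff₀ hB]
    -- the arithmetic-geometric mean inequality for `x - 1 / 2` and `16`
    have h4 : 64 * (x - 1 / 2) ≤ (x + 31 / 2) ^ 2 := by nlinarith [sq_nonneg (x - 33 / 2)]
    refine le_of_sq_le_sq ?_ (by positivity)
    rw [mul_pow, mul_pow]
    nlinarith [mul_le_mul_of_nonneg_left h4 (sq_nonneg (foldConst (k - 1)))]
  have h3 : (x - 1) * (foldTailInt ((2 * x + 1) / 4) * (x + 31 / 2)) =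
      (2 + 2 / (2 * x - 3)) * (2 + 76 / (2 * x - 7)) *
      (12 / 5 / (2 * x - 11) + 375 / 16 / ((2 * x - 11) * (2 * x - 15))) := by
    have a1 : 2 * x - 3 ≠ 0 := by linarith
    have a2 : 2 * x - 7 ≠ 0 := by linarith
    have a3 : 2 * x - 11 ≠ 0 := by linarith
    have a4 : 2 * x - 15 ≠ 0 := by linarith
    have g1 : 2 + 2 / (2 * x - 3) = 4 * (x - 1) / (2 * x - 3) := by
      rw [eq_div_iff a1, add_mul, div_mul_cancel₀ _ a1]
      ring
    have g2 : 2 + 76 / (2 * x - 7) = 4 * (x + 31 / 2) / (2 * x - 7) := by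
      rw [eq_div_iff a2, add_mul, div_mul_cancel₀ _ a2]
      ring
    have key : ∀ a b c d : ℝ, a ≠ 0 → b ≠ 0 → c ≠ 0 → d ≠ 0 →
        (x - 1) * ((3 / 5 / (a / 4 * (b / 4) * (c / 4)) +
          375 / 256 / (a / 4 * (b / 4) * (c / 4) * (d / 4))) * (x + 31 / 2)) =
        4 * (x - 1) / a * (4 * (x + 31 / 2) / b) * (12 / 5 / c + 375 / 16 / (c * d)) :=
      fun a b c d ha hb hc hd => by
        field_simp
        ring
    rw [foldTailInt, show (2 * x + 1) / 4 - 1 = (2 * x - 3) / 4 by ring,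
      show (2 * x + 1) / 4 - 2 = (2 * x - 7) / 4 by ring,
      show (2 * x + 1) / 4 - 3 = (2 * x - 11) / 4 by ring,
      show (2 * x + 1) / 4 - 4 = (2 * x - 15) / 4 by ring, g1, g2]
    exact key _ _ _ _ a1 a2 a3 a4
  have hT : 0 ≤ foldTailInt ((2 * x + 1) / 4) := by
    have a1 : 0 < (2 * x + 1) / 4 - 1 := by linarith
    have a2 : 0 < (2 * x + 1) / 4 - 2 := by linarith
    have a3 : 0 < (2 * x + 1) / 4 - 3 := by linarith
    have a4 : 0 < (2 * x + 1) / 4 - 4 := by linarith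
    rw [foldTailInt]
    positivity
  have h4 : (x - 1) * (foldTailInt ((2 * x + 1) / 4) / foldConst (k - 1)) ≤
      7655 / 100000 * ((x - 1) * (foldTailInt ((2 * x + 1) / 4) * (x + 31 / 2))) := by
    have := mul_le_mul_of_nonneg_left h2
      (mul_nonneg (by linarith : 0 ≤ x - 1) hT)
    calc _ = (x - 1) * foldTailInt ((2 * x + 1) / 4) * (1 / foldConst (k - 1)) := by ring
      _ ≤ _ := this
      _ = _ := by ring
  rw [h3] at h4
  rw [foldErr, mul_add, mul_comm (x - 1), h1]
  have b2 : 0 < (K : ℝ) - 2 := by linarith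
  have b3 : 0 < (K : ℝ) - 3 := by linarith
  have b4 : 0 < (K : ℝ) - 4 := by linarith
  have b5 : 0 < (K : ℝ) - 5 := by linarith
  have c1 : 0 < 2 * (K : ℝ) - 3 := by linarith
  have c2 : 0 < 2 * (K : ℝ) - 7 := by linarith
  have c3 : 0 < 2 * (K : ℝ) - 11 := by linarith
  have c4 : 0 < 2 * (K : ℝ) - 15 := by linarith
  have d2 : 0 < x - 2 := by linarith
  have d3 : 0 < x - 3 := by linarith
  have d4 : 0 < x - 4 := by linarith
  have d5 : 0 < x - 5 := by linarith
  have f1 : 0 < 2 * x - 3 := by linarith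
  have f2 : 0 < 2 * x - 7 := by linarith
  have f3 : 0 < 2 * x - 11 := by linarith
  have f4 : 0 < 2 * x - 15 := by linarith
  refine (add_le_add le_rfl h4).trans ?_
  gcongr

end FoldEstimate

section Dispersion

open Complex Set

variable {n : ℕ}

/-- The even Taylor coefficients of `e ^ (-n τ / 2) dτ / ds` with respect to the root `s`; up to
an explicit nonzero factor they are the numbers `LGParam.expectTop` at `1`. -/
noncomputable def coniCoeff (n k : ℕ) : ℝ :=
  (LGParam.expectTop n.succ_pos k 1 : ℝ) /
    (√((n + 1) / 2) * ∏ j ∈ Finset.range k, (-((n + 1) * (2 * j + 1) / 2) : ℝ))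

theorem le_of_le_add_div {a b c : ℝ} (T₀ : ℝ) (h : ∀ T, T₀ ≤ T → a ≤ b + c * (√(2 * n) / T)) :
    a ≤ b := by
  have h1 : Tendsto (fun T : ℝ => b + c * (√(2 * n) / T)) atTop (𝓝 (b + c * 0)) :=
    ((tendsto_const_nhds.div_atTop tendsto_id).const_mul c).const_add b
  rw [mul_zero, add_zero] at h1
  exact ge_of_tendsto h1 (eventually_atTop.2 ⟨T₀, h⟩)

theorem prod_coniCoeff_ne_zero (n k : ℕ) :
    ∏ j ∈ Finset.range k, (-((n + 1) * (2 * j + 1) / 2) : ℝ) ≠ 0 :=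
  Finset.prod_ne_zero_iff.2 fun j _ => by
    have : (0 : ℝ) < (n + 1) * (2 * j + 1) / 2 := by positivity
    linarith

namespace ConiRoot

variable (R : ConiRoot n)

theorem period_one_eq (hn : 2 ≤ n) {T : ℝ} (hT : 0 < T) (k : ℕ) :
    R.period T (2 * coniAngle n) k (fun _ => 1) = 2 * Real.pi * I * coniCoeff n k := by
  have h := R.period_one hn hT (by have := coniAngle_pos (n := n); positivity)
    (two_mul_coniAngle_lt (by omega)) k
  have h1 : (∏ j ∈ Finset.range k, (-((n + 1) * (2 * j + 1) / 2) : ℂ)) ≠ 0 := by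
    have h2 := ofReal_ne_zero.2 (prod_coniCoeff_ne_zero n k)
    push_cast at h2
    exact h2
  have h3 : ((√((n + 1) / 2) : ℝ) : ℂ) ≠ 0 :=
    ofReal_ne_zero.2 (Real.sqrt_pos.2 (by positivity)).ne'
  rw [coniCoeff]
  push_cast
  rw [← mul_right_inj' h1, h]
  push_cast
  field_simp

theorem norm_rectInt_line_le (hn : 2 ≤ n) {T C : ℝ} (hT : 6 ≤ T) (j : ℕ) {f : ℂ → ℂ}
    (h1 : ∀ x : ℝ, ‖f (x - (2 * coniAngle n : ℝ) * I)‖ ≤ C * lineWeight n (2 * j + 5) x)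
    (h2 : ∀ x : ℝ, ‖f (x + (2 * coniAngle n : ℝ) * I)‖ ≤ C * lineWeight n (2 * j + 5) x)
    (h3 : ∀ τ ∈ coniStrip n, |τ.re| = T → ‖f τ‖ ≤ ‖exp (-(n * τ) / 2)‖ * ‖R.s τ‖⁻¹ ^ 3)
    (hC : 0 ≤ C) :
    ‖rectInt T (2 * coniAngle n) f‖ ≤ 8 * C / (√n * coniDist n ^ (j + 2)) +
      8 * coniAngle n * (√(2 * n) / T) := by
  have ha := coniAngle_pos (n := n)
  have hmem : ∀ y ∈ Icc (-(2 * coniAngle n)) (2 * coniAngle n), ∀ t : ℝ,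
      (t + y * I : ℂ) ∈ coniStrip n := fun y hy t => by
    rw [mem_coniStrip]
    have : |y| ≤ 2 * coniAngle n := abs_le.2 hy
    simpa using this.trans_lt (two_mul_coniAngle_lt (by omega))
  have hT0 : |T| = T := abs_of_pos (by linarith)
  have h := norm_rectInt_le (T := T) (β := 2 * coniAngle n) (f := f)
    (b := fun x => C * lineWeight n (2 * j + 5) x) (B := C * (4 / (√n * coniDist n ^ (j + 2))))
    (ε := √(2 * n) / T) (by linarith) (by positivity)
    (((continuous_lineWeight hn _).intervalIntegrable _ _).const_mul C)
    (by
      rw [intervalIntegral.integral_const_mul]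
      exact mul_le_mul_of_nonneg_left (integral_lineWeight_le hn j (by linarith)) hC)
    h1 h2
    (fun y hy => (h3 _ (hmem y hy T) (by simpa using hT0)).trans
      (R.side_le hn hT (hmem y hy T) (by simpa using hT0) le_rfl))
    (fun y hy => by
      have h4 := hmem y hy (-T)
      rw [ofReal_neg] at h4
      exact (h3 _ h4 (by simpa using hT0)).trans (R.side_le hn hT h4 (by simpa using hT0) le_rfl))
  refine h.trans (le_of_eq ?_)
  ring

theorem one_le_norm_s (hn : 2 ≤ n) {T : ℝ} (hT : 6 ≤ T) {τ : ℂ} (hτ : τ ∈ coniStrip n)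
    (h : |τ.re| = T) : T ≤ ‖R.s τ‖ ^ 2 ∧ ‖R.s τ‖⁻¹ ≤ 1 := by
  have h1 := (le_norm_coniPot hn hT h).1
  rw [← R.norm_s_sq hτ] at h1
  refine ⟨h1, inv_le_one_of_one_le₀ ?_⟩
  by_contra hc
  push Not at hc
  have := norm_nonneg (R.s τ)
  nlinarith

theorem abs_coniCoeff_le (R : ConiRoot n) (hn : 2 ≤ n) (j : ℕ) :
    |coniCoeff n (j + 2)| ≤ 4 / (Real.pi * √n * coniDist n ^ (j + 2)) := by
  have hpi := Real.pi_pos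
  have h : 2 * Real.pi * |coniCoeff n (j + 2)| ≤ 8 * 1 / (√n * coniDist n ^ (j + 2)) := by
    refine le_of_le_add_div (n := n) (c := 8 * coniAngle n) 6 fun T hT => ?_
    have h1 := R.norm_rectInt_line_le hn hT j (C := 1)
      (f := fun τ => 1 * exp (-(n * τ) / 2) * (R.s τ)⁻¹ ^ (2 * (j + 2) + 1))
      (fun x => by
        rw [one_mul, one_mul]
        exact (R.norm_line_le hn (2 * j + 5) x).2.le)
      (fun x => by
        rw [one_mul, one_mul]
        exact (R.norm_line_le hn (2 * j + 5) x).1.le)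
      (fun τ hτ h => by
        rw [one_mul, norm_mul, norm_pow, norm_inv]
        refine mul_le_mul_of_nonneg_left ?_ (norm_nonneg _)
        exact pow_le_pow_of_le_one (by positivity) (R.one_le_norm_s hn hT hτ h).2 (by omega))
      zero_le_one
    refine le_trans (le_of_eq ?_) h1
    change _ = ‖R.period T (2 * coniAngle n) (j + 2) (fun _ => 1)‖
    rw [R.period_one_eq hn (by linarith)]
    simp [abs_of_pos hpi]
  have hs : 0 < √(n : ℝ) := Real.sqrt_pos.2 (by exact_mod_cast (by omega : 0 < n))
  have hd := coniDist_pos hn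
  calc |coniCoeff n (j + 2)| = (2 * Real.pi * |coniCoeff n (j + 2)|) / (2 * Real.pi) := by
        field_simp
    _ ≤ 8 * 1 / (√n * coniDist n ^ (j + 2)) / (2 * Real.pi) := by gcongr
    _ = _ := by
        field_simp
        norm_num

/-- The Cauchy integral for the local inverse of the root. -/
theorem rectInt_mul_inv_s_sub (hn : 2 ≤ n) {T x : ℝ} (hx : |x| < T) :
    rectInt T (2 * coniAngle n) (fun τ => exp (-(n * τ) / 2) * (R.s τ - R.sr x)⁻¹) =
      2 * Real.pi * I * ((Real.exp (-(n * x) / 2) / (deriv R.s x).re : ℝ) : ℂ) := by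
  have ha := coniAngle_pos (n := n)
  have hxU := ofReal_mem_coniStrip (n := n) (by omega) x
  have hs := R.s_ofReal (by omega) x
  have hd : DifferentiableOn ℂ (dslope R.s x) (coniStrip n) :=
    (differentiableOn_dslope (isOpen_coniStrip.mem_nhds hxU)).2 R.differentiableOn_s
  have e : ∀ τ, R.s τ - R.sr x = dslope R.s x τ * (τ - x) := fun τ => by
    rw [mul_comm, ← smul_eq_mul, sub_smul_dslope, hs]
  obtain ⟨r, hr, hr'⟩ := R.exists_deriv_s_ofReal (by omega) x
  have h0 : ∀ τ ∈ coniStrip n, dslope R.s x τ ≠ 0 := fun τ hτ h => by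
    have h1 : R.s τ = R.sr x := by
      rw [← sub_eq_zero, e, h, zero_mul]
    rw [R.eq_of_s_eq hn hτ h1, dslope_same, hr', ofReal_eq_zero] at h
    exact hr.ne' h
  have h := rectInt_mul_inv_sub isOpen_coniStrip
    (rect_subset (T := T) (two_mul_coniAngle_lt (by omega)))
    (f := fun τ => exp (-(n * τ) / 2) * (dslope R.s x τ)⁻¹)
    (DifferentiableOn.mul (by fun_prop) (hd.inv h0)) (w := x) (by simpa) (by simpa)
  rw [dslope_same, hr'] at h
  simp only [e, mul_inv, ← mul_assoc] at h ⊢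
  rw [h, hr', ofReal_re]
  push_cast
  ring

theorem s_ne_of_mem_rectBdry (hn : 2 ≤ n) {T x : ℝ} (hx : |x| < T) {τ : ℂ}
    (hτ : τ ∈ rectBdry T (2 * coniAngle n)) : R.s τ - R.sr x ≠ 0 := fun h => by
  have ha := coniAngle_pos (n := n)
  have h1 := R.eq_of_s_eq hn (rectBdry_subset T (two_mul_coniAngle_lt (by omega)) hτ)
    (sub_eq_zero.1 h)
  rw [h1] at hτ
  rcases hτ with h | h
  · exact (by positivity : 2 * coniAngle n ≠ 0) (by simpa using h.2.symm)
  · exact hx.ne (by simpa using h.1)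

/-- The even part of `e ^ (-n τ / 2) dτ / ds` as a function of the root is close to a polynomial,
on the whole real line. -/
theorem abs_even_sub_le (hn : 2 ≤ n) {x y : ℝ} (hxy : R.sr y = -R.sr x) :
    |(Real.exp (-(n * x) / 2) / (deriv R.s x).re + Real.exp (-(n * y) / 2) / (deriv R.s y).re) / 2 -
      ∑ j ∈ Finset.range 6, coniCoeff n j * R.sr x ^ (2 * j)| ≤
      4 / (Real.pi * √n * coniDist n ^ 6) * R.sr x ^ 12 := by
  have hpi := Real.pi_pos
  have hdist := coniDist_pos hn
  have ha := coniAngle_pos (n := n)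
  have hβ := two_mul_coniAngle_lt (n := n) (by omega)
  set σ : ℝ := R.sr x with hσ
  set D := (Real.exp (-(n * x) / 2) / (deriv R.s x).re +
    Real.exp (-(n * y) / 2) / (deriv R.s y).re) / 2 -
      ∑ j ∈ Finset.range 6, coniCoeff n j * σ ^ (2 * j) with hD
  let f : ℂ → ℂ := fun τ => exp (-(n * τ) / 2) * (R.s τ)⁻¹ ^ 11 * (R.s τ ^ 2 - (σ : ℂ) ^ 2)⁻¹
  have key : ∀ T, |x| < T → |y| < T → 0 < T →
      2 * Real.pi * I * D = (σ : ℂ) ^ 12 * rectInt T (2 * coniAngle n) f := fun T hx hy hT => by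
    have h1 := R.rectInt_mul_inv_s_sub hn hx
    have h2 := R.rectInt_mul_inv_s_sub hn hy
    have hsc : ContinuousOn R.s (rectBdry T (2 * coniAngle n)) :=
      R.differentiableOn_s.continuousOn.mono (rectBdry_subset T hβ)
    have c1 : ContinuousOn (fun τ => exp (-(n * τ) / 2) * (R.s τ - σ)⁻¹)
        (rectBdry T (2 * coniAngle n)) :=
      ContinuousOn.mul (by fun_prop) ((hsc.sub continuousOn_const).inv₀ fun τ hτ =>
        R.s_ne_of_mem_rectBdry hn hx hτ)
    have c2 : ContinuousOn (fun τ => exp (-(n * τ) / 2) * (R.s τ - R.sr y)⁻¹)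
        (rectBdry T (2 * coniAngle n)) :=
      ContinuousOn.mul (by fun_prop) ((hsc.sub continuousOn_const).inv₀ fun τ hτ =>
        R.s_ne_of_mem_rectBdry hn hy hτ)
    have c3 : ∀ j, ContinuousOn (fun τ => 1 * exp (-(n * τ) / 2) * (R.s τ)⁻¹ ^ (2 * j + 1))
        (rectBdry T (2 * coniAngle n)) := fun j =>
      R.continuousOn_period hT (by positivity) hβ (φ := fun _ => 1) continuous_const j
    have cf : ContinuousOn f (rectBdry T (2 * coniAngle n)) :=
      (ContinuousOn.mul (by fun_prop)
        ((R.continuousOn_inv_s hT (by positivity) hβ).pow _)).mul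
        (((hsc.pow 2).sub continuousOn_const).inv₀ fun τ hτ => by
          have e1 := R.s_ne_of_mem_rectBdry hn hx hτ
          have e2 := R.s_ne_of_mem_rectBdry hn hy hτ
          rw [hxy, ofReal_neg, sub_neg_eq_add] at e2
          change R.s τ ^ 2 - (σ : ℂ) ^ 2 ≠ 0
          rw [sq_sub_sq]
          exact mul_ne_zero e2 e1)
    have hsum : ∀ N : ℕ, ContinuousOn (fun τ => ∑ j ∈ Finset.range N, (σ : ℂ) ^ (2 * j) *
        (1 * exp (-(n * τ) / 2) * (R.s τ)⁻¹ ^ (2 * j + 1))) (rectBdry T (2 * coniAngle n)) ∧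
        rectInt T (2 * coniAngle n) (fun τ => ∑ j ∈ Finset.range N, (σ : ℂ) ^ (2 * j) *
        (1 * exp (-(n * τ) / 2) * (R.s τ)⁻¹ ^ (2 * j + 1))) =
        ∑ j ∈ Finset.range N, (σ : ℂ) ^ (2 * j) * (2 * Real.pi * I * coniCoeff n j) := fun N => by
      induction N with
      | zero => exact ⟨by simpa using continuousOn_const, by simp [rectInt]⟩
      | succ N ih =>
        simp only [Finset.sum_range_succ]
        have c4 : ContinuousOn (fun τ => (σ : ℂ) ^ (2 * N) *
            (1 * exp (-(n * τ) / 2) * (R.s τ)⁻¹ ^ (2 * N + 1))) (rectBdry T (2 * coniAngle n)) :=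
          continuousOn_const.mul (c3 N)
        refine ⟨ih.1.add c4, ?_⟩
        rw [rectInt_add hT.le (by positivity) ih.1 c4, ih.2,
          rectInt_const_mul, ← R.period_one_eq hn hT]
        rfl
    have e : rectInt T (2 * coniAngle n) (fun τ => exp (-(n * τ) / 2) * (R.s τ - σ)⁻¹ +
        exp (-(n * τ) / 2) * (R.s τ - R.sr y)⁻¹) = rectInt T (2 * coniAngle n) (fun τ =>
        2 * (∑ j ∈ Finset.range 6, (σ : ℂ) ^ (2 * j) *
        (1 * exp (-(n * τ) / 2) * (R.s τ)⁻¹ ^ (2 * j + 1))) + 2 * (σ : ℂ) ^ 12 * f τ) := by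
      refine rectInt_congr hT.le (by positivity) fun τ hτ => ?_
      have e1 := R.s_ne_of_mem_rectBdry hn hx hτ
      have e2 := R.s_ne_of_mem_rectBdry hn hy hτ
      have e3 : R.s τ ≠ 0 := (R.s_eq_zero_iff (rectBdry_subset T hβ hτ)).not.2
        (ne_zero_of_mem_rectBdry hT (by positivity) hτ)
      rw [hxy, ofReal_neg, sub_neg_eq_add] at e2
      simp only [f, hxy, ofReal_neg, sub_neg_eq_add, sq_sub_sq, ← hσ, Finset.sum_range_succ,
        Finset.sum_range_zero, inv_pow] at e1 ⊢
      field_simp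
      ring
    have c5 : ContinuousOn (fun τ => 2 * ∑ j ∈ Finset.range 6, (σ : ℂ) ^ (2 * j) *
        (1 * exp (-(n * τ) / 2) * (R.s τ)⁻¹ ^ (2 * j + 1))) (rectBdry T (2 * coniAngle n)) :=
      continuousOn_const.mul (hsum 6).1
    have c6 : ContinuousOn (fun τ => 2 * (σ : ℂ) ^ 12 * f τ) (rectBdry T (2 * coniAngle n)) :=
      continuousOn_const.mul cf
    rw [rectInt_add hT.le (by positivity) c1 c2, h1, h2,
      rectInt_add hT.le (by positivity) c5 c6, rectInt_const_mul, rectInt_const_mul, (hsum 6).2] at e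
    rw [hD]
    have e4 : ∑ j ∈ Finset.range 6, (σ : ℂ) ^ (2 * j) * (2 * Real.pi * I * coniCoeff n j) =
        2 * Real.pi * I * ((∑ j ∈ Finset.range 6, coniCoeff n j * σ ^ (2 * j) : ℝ) : ℂ) := by
      rw [ofReal_sum, Finset.mul_sum]
      exact Finset.sum_congr rfl fun j _ => by push_cast; ring
    rw [e4] at e
    rw [ofReal_sub, ofReal_div, ofReal_add, ofReal_ofNat]
    linear_combination e / 2
  have h : 2 * Real.pi * |D| ≤ σ ^ 12 * (8 * (coniDist n)⁻¹ / (√n * coniDist n ^ (3 + 2))) := by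
    refine le_of_le_add_div (n := n) (c := σ ^ 12 * (8 * coniAngle n))
      (max 6 (max (|x| + 1) (max (|y| + 1) (σ ^ 2 + 1)))) fun T hT => ?_
    obtain ⟨hT6, hT⟩ := max_le_iff.1 hT
    obtain ⟨hTx, hT⟩ := max_le_iff.1 hT
    obtain ⟨hTy, hTσ⟩ := max_le_iff.1 hT
    have h1 := R.norm_rectInt_line_le hn hT6 3 (C := (coniDist n)⁻¹) (f := f)
      (fun x => by
        have h2 := (R.norm_line_le hn 11 x).2
        have h3 := coniDist_le_norm_sub hn x (sq_nonneg σ)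
        rw [norm_mul, h2, norm_inv, mul_comm, R.s_sq (line_mem (by omega) x).2, coniPot_sub_mul_I,
          ← norm_conj, map_sub, conj_conj, map_pow, conj_ofReal, ← ofReal_pow]
        exact mul_le_mul_of_nonneg_right (inv_anti₀ hdist h3) (lineWeight_nonneg _ _))
      (fun x => by
        have h2 := (R.norm_line_le hn 11 x).1
        have h3 := coniDist_le_norm_sub hn x (sq_nonneg σ)
        rw [norm_mul, h2, norm_inv, mul_comm, R.s_sq (line_mem (by omega) x).1, ← ofReal_pow]
        exact mul_le_mul_of_nonneg_right (inv_anti₀ hdist h3) (lineWeight_nonneg _ _))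
      (fun τ hτ h => by
        obtain ⟨h2, h3⟩ := R.one_le_norm_s hn hT6 hτ h
        have h4 : 1 ≤ ‖R.s τ ^ 2 - (σ : ℂ) ^ 2‖ := by
          have h5 := norm_sub_norm_le (R.s τ ^ 2) ((σ : ℂ) ^ 2)
          rw [norm_pow, norm_pow, Complex.norm_real, Real.norm_eq_abs, sq_abs] at h5
          linarith
        rw [norm_mul, norm_mul, norm_inv, norm_pow, norm_inv]
        calc ‖exp (-(n * τ) / 2)‖ * ‖R.s τ‖⁻¹ ^ 11 * ‖R.s τ ^ 2 - (σ : ℂ) ^ 2‖⁻¹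
            ≤ ‖exp (-(n * τ) / 2)‖ * ‖R.s τ‖⁻¹ ^ 11 * 1 := by
              gcongr
              exact inv_le_one_of_one_le₀ h4
          _ ≤ _ := by
              rw [mul_one]
              exact mul_le_mul_of_nonneg_left (pow_le_pow_of_le_one (by positivity) h3 (by omega))
                (norm_nonneg _))
      (by positivity)
    have h2 := congrArg norm (key T (by linarith) (by linarith) (by linarith))
    have h3 : ‖(2 * Real.pi * I : ℂ)‖ = 2 * Real.pi := by simp [abs_of_pos hpi]
    rw [norm_mul _ (D : ℂ), h3, norm_mul, norm_pow, Complex.norm_real, Complex.norm_real,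
      Real.norm_eq_abs, Real.norm_eq_abs, Even.pow_abs ⟨6, rfl⟩] at h2
    rw [h2, mul_assoc, ← mul_add]
    exact mul_le_mul_of_nonneg_left h1 (Even.pow_nonneg ⟨6, rfl⟩ σ)
  have hs : 0 < √(n : ℝ) := Real.sqrt_pos.2 (by exact_mod_cast (by omega : 0 < n))
  calc |D| = (2 * Real.pi * |D|) / (2 * Real.pi) := by field_simp
    _ ≤ σ ^ 12 * (8 * (coniDist n)⁻¹ / (√n * coniDist n ^ (3 + 2))) / (2 * Real.pi) := by gcongr
    _ = _ := by
        field_simp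
        ring

end ConiRoot

end Dispersion

section LineIntegral

open Complex Set

variable {n : ℕ}

/-- The direction of `coniGap`. -/
noncomputable def coniDir (n : ℕ) : ℂ := I * exp (-(coniAngle n * I))

theorem coniDir_eq : coniDir n = Real.sin (coniAngle n) + Real.cos (coniAngle n) * I := by
  have : exp (-(coniAngle n * I)) = exp ((-coniAngle n : ℝ) * I) := by push_cast; ring_nf
  rw [coniDir, this, exp_mul_I, ← ofReal_cos, ← ofReal_sin, Real.cos_neg, Real.sin_neg]
  push_cast
  linear_combination -(sin (coniAngle n)) * I_sq

theorem coniDir_re : (coniDir n).re = Real.sin (coniAngle n) := by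
  rw [coniDir_eq, add_re, ofReal_re, re_ofReal_mul, I_re, mul_zero, add_zero]

theorem coniDir_im : (coniDir n).im = Real.cos (coniAngle n) := by
  rw [coniDir_eq, add_im, ofReal_im, im_ofReal_mul, I_im, mul_one, zero_add]

theorem norm_coniDir : ‖coniDir n‖ = 1 := by
  have : exp (-(coniAngle n * I)) = exp ((-coniAngle n : ℝ) * I) := by push_cast; ring_nf
  rw [coniDir, this, norm_mul, norm_exp_ofReal_mul_I, norm_I, one_mul]

namespace ConiRoot

variable (R : ConiRoot n)

theorem s_im_pos' (hn : 2 ≤ n) (x : ℝ) : 0 < (R.s (x + (2 * coniAngle n : ℝ) * I)).im :=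
  R.s_im_pos hn (by simpa using coniAngle_pos) (by simpa using two_mul_coniAngle_lt (by omega))

/-- The complex conjugate of a root. -/
noncomputable def conj : ConiRoot n where
  g := fun τ => starRingEnd ℂ (R.g (starRingEnd ℂ τ))
  diffOn := fun τ hτ => by
    have h : starRingEnd ℂ τ ∈ coniStrip n := by
      rw [mem_coniStrip, conj_im, abs_neg]
      exact hτ
    have h1 := (R.diffOn.differentiableAt (isOpen_coniStrip.mem_nhds h)).conj_conj
    rw [conj_conj] at h1
    exact h1.differentiableWithinAt
  ne_zero := fun τ hτ h => by
    have h' : starRingEnd ℂ τ ∈ coniStrip n := by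
      rw [mem_coniStrip, conj_im, abs_neg]
      exact hτ
    exact R.ne_zero _ h' ((map_eq_zero _).1 h)
  sq := fun τ hτ => by
    have h' : starRingEnd ℂ τ ∈ coniStrip n := by
      rw [mem_coniStrip, conj_im, abs_neg]
      exact hτ
    have h1 := congrArg (starRingEnd ℂ) (R.sq _ h')
    rw [map_pow, map_mul, conj_conj, ← coniPot_conj, conj_conj] at h1
    exact h1
  map_zero := by rw [_root_.map_zero, R.map_zero, conj_ofReal]

theorem s_line_conj (hn : 2 ≤ n) (x : ℝ) : R.s (x - (2 * coniAngle n : ℝ) * I) =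
    starRingEnd ℂ (R.s (x + (2 * coniAngle n : ℝ) * I)) := by
  have e : R.conj.s (x + (2 * coniAngle n : ℝ) * I) =
      starRingEnd ℂ (R.s (x - (2 * coniAngle n : ℝ) * I)) := by
    simp [s, conj, sub_eq_add_neg, map_ofNat]
  have h1 := R.conj.s_im_pos' hn x
  have h2 := R.s_im_pos' hn x
  have h3 := R.s_sq (line_mem (by omega) x).1
  rw [← R.conj.s_sq (line_mem (by omega) x).1, sq_eq_sq_iff_eq_or_eq_neg] at h3
  rcases h3 with h3 | h3
  · rw [h3, e, conj_conj]
  · rw [h3, neg_im] at h2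
    linarith

/-- The root on the shifted line. -/
theorem s_line (hn : 2 ≤ n) (x : ℝ) : R.s (x + (2 * coniAngle n : ℝ) * I) =
    exp (coniAngle n * I) * √(coniDist n) *
      foldRoot (coniDir n) (R.sr x / √(coniDist n)) := by
  have hd := coniDist_pos hn
  have he : 0 < √(coniDist n) := Real.sqrt_pos.2 hd
  have he0 : ((√(coniDist n) : ℝ) : ℂ) ≠ 0 := ofReal_ne_zero.2 he.ne'
  have he2 : ((√(coniDist n) : ℝ) : ℂ) ^ 2 = coniDist n := by
    rw [← ofReal_pow, Real.sq_sqrt hd.le]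
  have hE : exp (coniAngle n * I) ≠ 0 := exp_ne_zero _
  obtain ⟨q, hq⟩ : ∃ q, R.s (x + (2 * coniAngle n : ℝ) * I) =
      exp (coniAngle n * I) * √(coniDist n) * q :=
    ⟨_, (mul_div_cancel₀ _ (mul_ne_zero hE he0)).symm⟩
  have h1 : q ^ 2 = coniDir n + ((R.sr x / √(coniDist n) : ℝ) : ℂ) ^ 2 := by
    have h := R.s_sq (line_mem (n := n) (by omega) x).1
    have h2 : exp (2 * coniAngle n * I) = exp (coniAngle n * I) ^ 2 := by
      rw [← exp_nat_mul]
      ring_nf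
    rw [coniPot_add_mul_I (by omega), hq, mul_pow, mul_pow, h2, mul_assoc, he2,
      mul_right_inj' (pow_ne_zero 2 hE)] at h
    have h3 : (coniPotReal n x : ℂ) = (R.sr x : ℂ) ^ 2 := by
      rw [← ofReal_pow, R.sr_sq (by omega)]
    have hd0 : (coniDist n : ℂ) ≠ 0 := ofReal_ne_zero.2 hd.ne'
    rw [h3, coniGap, mul_assoc, ← coniDir] at h
    rw [ofReal_div, div_pow, he2, ← mul_right_inj' hd0, h]
    field_simp
  have hs := R.s_im_pos' hn x
  have hsin := sin_coniAngle_pos hn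
  have hcos := cos_coniAngle_pos hn
  have h2 : 0 < Real.cos (coniAngle n) * q.im + Real.sin (coniAngle n) * q.re := by
    rw [hq, mul_right_comm, mul_comm _ ((√(coniDist n) : ℝ) : ℂ), im_ofReal_mul, mul_im,
      exp_ofReal_mul_I_re, exp_ofReal_mul_I_im] at hs
    exact pos_of_mul_pos_right hs he.le
  have h3 : 2 * (q.re * q.im) = Real.cos (coniAngle n) := by
    have h := congrArg im h1
    rw [pow_two, mul_im, add_im, coniDir_im, ← ofReal_pow, ofReal_im, add_zero] at h
    linarith
  have hre : 0 < q.re := by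
    by_contra hc
    push Not at hc
    have h4 : 0 < q.im := by nlinarith
    nlinarith
  rw [hq, foldRoot_eq hre h1]

/-- The integrand on the shifted line, without constant factors. -/
noncomputable def lineFun (k : ℕ) (x : ℝ) : ℂ :=
  Real.exp (-(n * x) / 2) * (foldRoot (coniDir n) (R.sr x / √(coniDist n)))⁻¹ ^ (2 * k + 1)

theorem line_eq (hn : 2 ≤ n) (k : ℕ) (x : ℝ) :
    1 * exp (-(n * (x + (2 * coniAngle n : ℝ) * I)) / 2) *
      (R.s (x + (2 * coniAngle n : ℝ) * I))⁻¹ ^ (2 * k + 1) =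
    -(exp (-(2 * k * coniAngle n * I)) * (√(coniDist n) : ℝ)⁻¹ ^ (2 * k + 1)) * R.lineFun k x := by
  have h : exp (coniAngle n * I) * (exp (coniAngle n * I))⁻¹ ^ (2 * k + 1) =
      exp (-(2 * k * coniAngle n * I)) := by
    rw [← exp_neg, ← exp_nat_mul, ← exp_add]
    congr 1
    push_cast
    ring
  rw [exp_neg_div_two_add_mul_I, R.s_line hn, lineFun, mul_inv, mul_inv, mul_pow, mul_pow, ← h]
  push_cast
  ring

theorem continuous_lineFun (hn : 2 ≤ n) (k : ℕ) : Continuous (R.lineFun k) := by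
  have hre : 0 < (coniDir n).re := by rw [coniDir_re]; exact sin_coniAngle_pos hn
  have h1 : Continuous R.sr := continuous_iff_continuousAt.2 fun x =>
    (R.hasDerivAt_sr (by omega) x).continuousAt
  refine Continuous.mul (by fun_prop) ((Continuous.inv₀ ?_ fun x => foldRoot_ne_zero hre _).pow _)
  exact (continuous_foldRoot hre).comp (h1.div_const _)

theorem integrable_lineFun (hn : 2 ≤ n) (j : ℕ) : Integrable (R.lineFun (j + 2)) := by
  have hd := coniDist_pos hn
  have he : 0 < √(coniDist n) := Real.sqrt_pos.2 hd
  have hc := R.continuous_lineFun hn (j + 2)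
  have hnorm : ∀ x, ‖R.lineFun (j + 2) x‖ =
      √(coniDist n) ^ (2 * j + 5) * lineWeight n (2 * j + 5) x := fun x => by
    have h1 := (R.norm_line_le hn (2 * (j + 2) + 1) x).1
    have h2 := congrArg norm (R.line_eq hn (j + 2) x)
    have h3 : exp (-(2 * (j + 2 : ℕ) * coniAngle n * I)) =
        exp ((-(2 * (j + 2 : ℕ) * coniAngle n) : ℝ) * I) := by push_cast; ring_nf
    rw [one_mul, h1, show 2 * (j + 2) + 1 = 2 * j + 5 by ring, norm_mul, norm_neg,
      norm_mul, h3, norm_exp_ofReal_mul_I, one_mul, norm_pow, Complex.norm_real, norm_inv,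
      Real.norm_of_nonneg he.le] at h2
    rw [h2, ← mul_assoc, ← mul_pow, mul_inv_cancel₀ he.ne', one_pow, one_mul]
  refine integrable_of_intervalIntegral_norm_bounded
    (√(coniDist n) ^ (2 * j + 5) * (4 / (√n * coniDist n ^ (j + 2))))
    (a := fun T : ℝ => -T) (b := fun T => T) (l := atTop)
    (fun T => hc.integrableOn_Ioc) tendsto_neg_atTop_atBot tendsto_id ?_
  filter_upwards [eventually_ge_atTop 0] with T hT
  simp only [hnorm]
  rw [intervalIntegral.integral_const_mul]
  exact mul_le_mul_of_nonneg_left (integral_lineWeight_le hn j hT) (by positivity)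

/-- The coefficients as integrals over the shifted line. -/
theorem pi_mul_coniCoeff (hn : 2 ≤ n) (j : ℕ) : Real.pi * coniCoeff n (j + 2) =
    (√(coniDist n))⁻¹ ^ (2 * (j + 2) + 1) *
      (exp (-(2 * (j + 2 : ℕ) * coniAngle n * I)) * ∫ x, R.lineFun (j + 2) x).im := by
  set k := j + 2 with hk
  have ha := coniAngle_pos (n := n)
  let f : ℂ → ℂ := fun τ => 1 * exp (-(n * τ) / 2) * (R.s τ)⁻¹ ^ (2 * k + 1)
  set c : ℂ := -(exp (-(2 * k * coniAngle n * I)) * (√(coniDist n) : ℝ)⁻¹ ^ (2 * k + 1)) with hc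
  have htop : ∀ x : ℝ, f (x + (2 * coniAngle n : ℝ) * I) = c * R.lineFun k x := R.line_eq hn k
  have hbot : ∀ x : ℝ, f (x - (2 * coniAngle n : ℝ) * I) =
      starRingEnd ℂ (c * R.lineFun k x) := fun x => by
    rw [← htop]
    simp only [f, one_mul]
    rw [R.s_line_conj hn, map_mul, map_pow, map_inv₀, ← exp_conj]
    congr 3
    simp [sub_eq_add_neg, map_ofNat]
  set t : ℂ := ∫ x, c * R.lineFun k x with ht
  have hi := (R.integrable_lineFun hn j).const_mul c
  have l1 : Tendsto (fun T : ℝ => ∫ x in (-T)..T, f (x + (2 * coniAngle n : ℝ) * I)) atTop (𝓝 t) := by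
    simp only [htop]
    exact intervalIntegral_tendsto_integral hi tendsto_neg_atTop_atBot tendsto_id
  have l2 : Tendsto (fun T : ℝ => ∫ x in (-T)..T, f (x - (2 * coniAngle n : ℝ) * I)) atTop
      (𝓝 (starRingEnd ℂ t)) := by
    simp only [hbot]
    rw [ht, ← integral_conj]
    exact intervalIntegral_tendsto_integral ((conjLIE.toContinuousLinearEquiv :
      ℂ →L[ℝ] ℂ).integrable_comp hi) tendsto_neg_atTop_atBot tendsto_id
  have hside : ∀ y ∈ Icc (-(2 * coniAngle n)) (2 * coniAngle n), ∀ t : ℝ, 6 ≤ |t| →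
      ‖f (t + y * I)‖ ≤ √(2 * n) / |t| := fun y hy t ht => by
    have hm : (t + y * I : ℂ) ∈ coniStrip n := by
      rw [mem_coniStrip]
      have : |y| ≤ 2 * coniAngle n := abs_le.2 hy
      simpa using this.trans_lt (two_mul_coniAngle_lt (by omega))
    have := R.side_le hn ht hm (by simp) (J := 2 * k + 1) (by omega)
    simp only [f, one_mul]
    rwa [norm_mul, norm_pow, norm_inv]
  have hz : Tendsto (fun T : ℝ => √(2 * n) / T * |2 * coniAngle n - -(2 * coniAngle n)|)
      atTop (𝓝 0) := by
    simpa using (tendsto_const_nhds.div_atTop tendsto_id).mul_const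
      (|2 * coniAngle n - -(2 * coniAngle n)|)
  have hab : -(2 * coniAngle n) ≤ 2 * coniAngle n := by linarith
  have l3 : Tendsto (fun T : ℝ => ∫ y in (-(2 * coniAngle n))..(2 * coniAngle n), f (T + y * I))
      atTop (𝓝 0) := by
    refine squeeze_zero_norm' ?_ hz
    filter_upwards [eventually_ge_atTop 6] with T hT
    refine intervalIntegral.norm_integral_le_of_norm_le_const fun y hy => ?_
    rw [uIoc_of_le hab] at hy
    have h0 : |T| = T := abs_of_pos (by linarith)
    simpa only [h0] using hside y (Ioc_subset_Icc_self hy) T (by rwa [h0])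
  have l4 : Tendsto (fun T : ℝ => ∫ y in (-(2 * coniAngle n))..(2 * coniAngle n), f (-T + y * I))
      atTop (𝓝 0) := by
    refine squeeze_zero_norm' ?_ hz
    filter_upwards [eventually_ge_atTop 6] with T hT
    refine intervalIntegral.norm_integral_le_of_norm_le_const fun y hy => ?_
    rw [uIoc_of_le hab] at hy
    have h0 : |-T| = T := by rw [abs_neg, abs_of_pos (by linarith)]
    simpa only [h0, ofReal_neg] using hside y (Ioc_subset_Icc_self hy) (-T) (by rwa [h0])
  have l5 := ((l2.sub l1).add (l3.const_mul I)).sub (l4.const_mul I)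
  have l6 : Tendsto (fun T : ℝ => rectInt T (2 * coniAngle n) f) atTop
      (𝓝 (2 * Real.pi * I * coniCoeff n k)) := by
    refine tendsto_const_nhds.congr' ?_
    filter_upwards [eventually_gt_atTop 0] with T hT
    exact (R.period_one_eq hn hT k).symm
  have h := congrArg im (tendsto_nhds_unique l6 l5)
  have e1 : (2 * Real.pi * I * coniCoeff n k : ℂ) = ((2 * Real.pi * coniCoeff n k : ℝ) : ℂ) * I := by
    push_cast
    ring
  rw [e1, im_ofReal_mul, I_im, mul_one] at h
  simp only [mul_zero, add_zero, sub_zero, sub_im, conj_im] at h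
  have e2 : t = -((((√(coniDist n))⁻¹ ^ (2 * k + 1) : ℝ) : ℂ) *
      (exp (-(2 * k * coniAngle n * I)) * ∫ x, R.lineFun k x)) := by
    rw [ht, integral_const_mul, hc]
    push_cast
    ring
  have e3 := congrArg im e2
  rw [neg_im, im_ofReal_mul] at e3
  linarith

end ConiRoot

end LineIntegral

section NonVanishing

open Complex Set

variable {n : ℕ}

namespace ConiRoot

variable (R : ConiRoot n)

theorem surjective_sr (hn : 0 < n) : Function.Surjective R.sr := fun c => by
  have hc : Continuous R.sr := continuous_iff_continuousAt.2 fun x =>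
    (R.hasDerivAt_sr hn x).continuousAt
  have hn' : (1 : ℝ) ≤ n := by exact_mod_cast hn
  have h2 : ((n : ℝ) + 1) / n ≤ 2 := by
    rw [div_le_iff₀ (by linarith)]
    linarith
  have h0 : R.sr 0 = 0 := by simp [sr, s]
  refine mem_range_of_exists_le_of_exists_ge hc ⟨-(c ^ 2 + 2), ?_⟩ ⟨c ^ 2 + 2, ?_⟩
  · have h1 := R.sr_sq hn (-(c ^ 2 + 2))
    have h3 : R.sr (-(c ^ 2 + 2)) < 0 := h0 ▸ R.strictMono_sr hn (by nlinarith)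
    have h4 : c ^ 2 + 2 ≤ Real.exp (-(n * -(c ^ 2 + 2))) / n := by
      rw [le_div_iff₀ (by linarith)]
      linarith [Real.add_one_le_exp (-(n * -(c ^ 2 + 2)))]
    have h5 := Real.exp_pos (-(c ^ 2 + 2))
    rw [coniPotReal] at h1
    nlinarith
  · have h1 := R.sr_sq hn (c ^ 2 + 2)
    have h3 : 0 < R.sr (c ^ 2 + 2) := h0 ▸ R.strictMono_sr hn (by nlinarith)
    have h4 := Real.add_one_le_exp (c ^ 2 + 2)
    have h5 : 0 < Real.exp (-(n * (c ^ 2 + 2))) / n := by positivity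
    rw [coniPotReal] at h1
    nlinarith

/-- The integral over the shifted line with the root as variable. -/
theorem exists_integral_lineFun_eq (hn : 2 ≤ n) (j : ℕ) : ∃ H : ℝ → ℝ,
    (Integrable fun v : ℝ => (H v : ℂ) * (foldRoot (coniDir n) v)⁻¹ ^ (2 * (j + 2) + 1)) ∧
    ∫ x, R.lineFun (j + 2) x = (√(coniDist n) : ℝ) *
      ∫ v : ℝ, (H v : ℂ) * (foldRoot (coniDir n) v)⁻¹ ^ (2 * (j + 2) + 1) ∧
    ∀ v : ℝ, |H v - ∑ i ∈ Finset.range 6, coniCoeff n i * coniDist n ^ i * v ^ (2 * i)| ≤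
      4 / (Real.pi * √n) * v ^ 12 := by
  have hd := coniDist_pos hn
  set e : ℝ := √(coniDist n) with he
  have he0 : 0 < e := Real.sqrt_pos.2 hd
  have he2 : e ^ 2 = coniDist n := Real.sq_sqrt hd.le
  have hD := fun x => R.deriv_s_re_pos (n := n) (by omega) x
  let h : ℝ → ℝ := fun x => Real.exp (-(n * x) / 2) / (deriv R.s x).re
  let V : ℝ → ℝ := fun x => R.sr x / e
  have hVi : Function.Injective V := fun x y hxy =>
    (R.strictMono_sr (by omega)).injective ((div_left_inj' he0.ne').1 hxy)
  choose X hX using R.surjective_sr (n := n) (by omega)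
  have hXV : ∀ x, X (e * V x) = x := fun x => (R.strictMono_sr (by omega)).injective (by
    rw [hX]
    exact mul_div_cancel₀ _ he0.ne')
  let r : ℝ → ℂ := fun v => (foldRoot (coniDir n) v)⁻¹ ^ (2 * (j + 2) + 1)
  let K : ℝ → ℂ := fun v => (h (X (e * v)) : ℂ) * r v
  have hV' : ∀ x ∈ (univ : Set ℝ), HasDerivWithinAt V ((deriv R.s x).re / e) univ x := fun x _ =>
    ((R.hasDerivAt_sr (by omega) x).div_const e).hasDerivWithinAt
  have hsurj : V '' univ = univ := by
    rw [image_univ]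
    exact Function.Surjective.range_eq fun v => ⟨X (e * v), by
      simp only [V, hX, mul_div_cancel_left₀ _ he0.ne']⟩
  have hKV : ∀ x : ℝ, |(deriv R.s x).re / e| • K (V x) = (e : ℂ)⁻¹ * R.lineFun (j + 2) x := fun x => by
    have h1 : ((deriv R.s x).re : ℂ) ≠ 0 := ofReal_ne_zero.2 (hD x).ne'
    rw [abs_of_pos (div_pos (hD x) he0), real_smul]
    simp only [K, hXV, h, r, V, lineFun, ← he]
    push_cast
    field_simp
  have hKi : Integrable K := by
    have h1 := (integrableOn_image_iff_integrableOn_abs_deriv_smul MeasurableSet.univ hV'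
      (hVi.injOn) K).2
    rw [hsurj, integrableOn_univ, integrableOn_univ] at h1
    simp only [hKV] at h1
    exact h1 ((R.integrable_lineFun hn j).const_mul _)
  have hKint : ∫ v, K v = (e : ℂ)⁻¹ * ∫ x, R.lineFun (j + 2) x := by
    have h1 := integral_image_eq_integral_abs_deriv_smul MeasurableSet.univ hV' (hVi.injOn) K
    rw [hsurj, setIntegral_univ, setIntegral_univ] at h1
    simp only [hKV] at h1
    rw [h1, integral_const_mul]
  have hsplit : ∀ v : ℝ, (((h (X (e * v)) + h (X (e * -v))) / 2 : ℝ) : ℂ) * r v =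
      2⁻¹ * (K v + K (-v)) := fun v => by
    simp only [K, r, foldRoot_neg]
    push_cast
    ring
  have hs := hKi.add hKi.comp_neg
  refine ⟨fun v => (h (X (e * v)) + h (X (e * -v))) / 2, ?_, ?_, fun v => ?_⟩
  · exact (hs.const_mul 2⁻¹).congr (Eventually.of_forall fun v => (hsplit v).symm)
  · have e1 : ∫ v : ℝ, (((h (X (e * v)) + h (X (e * -v))) / 2 : ℝ) : ℂ) * r v = ∫ v, K v := by
      simp only [hsplit]
      rw [integral_const_mul, integral_add hKi hKi.comp_neg, integral_neg_eq_self]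
      ring
    have hec : (e : ℂ) ≠ 0 := ofReal_ne_zero.2 he0.ne'
    change _ = (e : ℂ) * ∫ v : ℝ, (((h (X (e * v)) + h (X (e * -v))) / 2 : ℝ) : ℂ) * r v
    rw [e1, hKint, mul_inv_cancel_left₀ hec]
  · have h1 := R.abs_even_sub_le hn (x := X (e * v)) (y := X (e * -v)) (by rw [hX, hX]; ring)
    rw [hX] at h1
    have h2 : ∀ i, coniCoeff n i * (e * v) ^ (2 * i) =
        coniCoeff n i * coniDist n ^ i * v ^ (2 * i) := fun i => by
      rw [mul_pow, pow_mul e, he2, mul_assoc]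
    simp only [h2] at h1
    refine h1.trans (le_of_eq ?_)
    rw [mul_pow, show e ^ 12 = (e ^ 2) ^ 6 by ring, he2]
    field_simp

/-- The value of a coefficient, up to a positive factor, in terms of a complex number that is
known with a small relative error. -/
theorem exists_coniCoeff_eq (R : ConiRoot n) (hn : 2 ≤ n) {k : ℕ} (hk : 8 ≤ k) : ∃ Z : ℂ, ∃ r : ℝ, r ≠ 0 ∧
    coniCoeff n k = r * (exp ((-(k * (Real.pi / 2 + coniAngle n)) : ℝ) * I) * Z).im ∧
    ‖Z - (1 + (coniCoeff n 1 * coniDist n / coniCoeff n 0 : ℝ) * coniDir n * foldRatio k 1)‖ ≤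
      4 * √((n + 1) / 2) / (Real.pi * √n) * foldErr k := by
  obtain ⟨j, rfl⟩ := Nat.exists_eq_add_of_le' (show 2 ≤ k by omega)
  have hpi := Real.pi_pos
  have hd := coniDist_pos hn
  have he0 : 0 < √(coniDist n) := Real.sqrt_pos.2 hd
  have hn0 : (0 : ℝ) < n := by exact_mod_cast (by omega : 0 < n)
  have hsn : 0 < √(n : ℝ) := Real.sqrt_pos.2 hn0
  have hs : 0 < √(((n : ℝ) + 1) / 2) := Real.sqrt_pos.2 (by positivity)
  have hre : 0 < (coniDir n).re := by rw [coniDir_re]; exact sin_coniAngle_pos hn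
  have c0 : coniCoeff n 0 = (√(((n : ℝ) + 1) / 2))⁻¹ := by
    rw [coniCoeff, LGParam.expectTop_zero]
    simp
  have hc0 : 0 < coniCoeff n 0 := by rw [c0]; positivity
  obtain ⟨H, hi, hint, hH⟩ := R.exists_integral_lineFun_eq hn j
  set κ : ℝ := 4 * √((n + 1) / 2) / (Real.pi * √n) with hκ
  have hκ' : 4 / (Real.pi * √n) / coniCoeff n 0 = κ := by
    rw [c0, hκ]
    field_simp
  have hmain := norm_integral_sub_le (δ := coniDir n) norm_coniDir hre (κ := κ)
    (c := fun i => coniCoeff n i * coniDist n ^ i / coniCoeff n 0)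
    (H := fun v => ((H v / coniCoeff n 0 : ℝ) : ℂ)) hk (by simp [hc0.ne'])
    (fun i hi => by
      obtain ⟨i, rfl⟩ := Nat.exists_eq_add_of_le' (Finset.mem_Ico.1 hi).1
      have h1 := R.abs_coniCoeff_le hn i
      rw [abs_div, abs_mul, abs_of_pos hc0, abs_of_pos (pow_pos hd _), ← hκ']
      gcongr
      calc |coniCoeff n (i + 2)| * coniDist n ^ (i + 2)
          ≤ 4 / (Real.pi * √n * coniDist n ^ (i + 2)) * coniDist n ^ (i + 2) := by gcongr
        _ = _ := by field_simp)
    (fun v => by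
      have e1 : ((H v / coniCoeff n 0 : ℝ) : ℂ) - ∑ i ∈ Finset.range 6,
          ((coniCoeff n i * coniDist n ^ i / coniCoeff n 0 : ℝ) : ℂ) * (v : ℂ) ^ (2 * i) =
          (((H v - ∑ i ∈ Finset.range 6, coniCoeff n i * coniDist n ^ i * v ^ (2 * i)) /
            coniCoeff n 0 : ℝ) : ℂ) := by
        push_cast
        rw [sub_div, Finset.sum_div]
        congr 1
        exact Finset.sum_congr rfl fun i _ => by ring
      rw [e1, Complex.norm_real, Real.norm_eq_abs, abs_div, abs_of_pos hc0, ← hκ',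
        div_mul_eq_mul_div]
      exact div_le_div_of_nonneg_right (hH v) hc0.le)
    (by
      refine (hi.const_mul (coniCoeff n 0 : ℂ)⁻¹).congr (Eventually.of_forall fun v => ?_)
      push_cast
      ring)
  obtain ⟨hnorm, hmain⟩ := hmain
  have hB := foldConst_pos (j + 2 - 1)
  set J := foldInt (coniDir n) 0 (j + 2) with hJ
  have hJ0 : J ≠ 0 := norm_pos_iff.1 (by rw [hnorm]; exact hB)
  set Y := ∫ v : ℝ, ((H v / coniCoeff n 0 : ℝ) : ℂ) *
    (foldRoot (coniDir n) v)⁻¹ ^ (2 * (j + 2) + 1) with hY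
  refine ⟨Y / J, Real.pi⁻¹ * ((√(coniDist n))⁻¹ ^ (2 * (j + 2) + 1) * √(coniDist n) *
    coniCoeff n 0 * foldConst (j + 1)), ?_, ?_, ?_⟩
  · have := foldConst_pos (j + 1)
    positivity
  · have h1 := R.pi_mul_coniCoeff hn j
    have hc : (coniCoeff n 0 : ℂ) ≠ 0 := ofReal_ne_zero.2 hc0.ne'
    have h2 : ∫ v : ℝ, (H v : ℂ) * (foldRoot (coniDir n) v)⁻¹ ^ (2 * (j + 2) + 1) =
        coniCoeff n 0 * Y := by
      rw [hY, ← integral_const_mul]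
      congr 1
      funext v
      push_cast
      field_simp
    have h3 := foldInt_zero (norm_coniDir (n := n)) hre (j + 1)
    have h4 : exp (-(2 * (j + 2 : ℕ) * coniAngle n * I)) * J =
        foldConst (j + 1) * exp ((-((j + 2 : ℕ) * (Real.pi / 2 + coniAngle n)) : ℝ) * I) := by
      rw [← h3, ← hJ]
      have h5 : coniDir n = exp (Real.pi / 2 * I - coniAngle n * I) := by
        rw [coniDir, sub_eq_add_neg, exp_add, exp_pi_div_two_mul_I]
      have h6 : coniDir n ^ (j + 2) *
          exp ((-((j + 2 : ℕ) * (Real.pi / 2 + coniAngle n)) : ℝ) * I) =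
          exp (-(2 * (j + 2 : ℕ) * coniAngle n * I)) := by
        rw [h5, ← exp_nat_mul, ← exp_add]
        congr 1
        push_cast
        ring
      rw [← h6]
      ring
    have h7 : exp (-(2 * (j + 2 : ℕ) * coniAngle n * I)) * ∫ x, R.lineFun (j + 2) x =
        ((√(coniDist n) * coniCoeff n 0 * foldConst (j + 1) : ℝ) : ℂ) *
        (exp ((-((j + 2 : ℕ) * (Real.pi / 2 + coniAngle n)) : ℝ) * I) * (Y / J)) := by
      rw [hint, h2]
      have h8 : Y = J * (Y / J) := (mul_div_cancel₀ _ hJ0).symm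
      nth_rewrite 1 [h8]
      push_cast at h4 ⊢
      linear_combination (√(coniDist n) : ℝ) * (coniCoeff n 0 : ℂ) * (Y / J) * h4
    rw [h7, im_ofReal_mul] at h1
    rw [eq_comm, mul_assoc, inv_mul_eq_iff_eq_mul₀ hpi.ne', h1]
    ring
  · have e1 : Y / J - (1 + (coniCoeff n 1 * coniDist n / coniCoeff n 0 : ℝ) * coniDir n *
        foldRatio (j + 2) 1) = (Y - J * (1 + (coniCoeff n 1 * coniDist n ^ 1 / coniCoeff n 0 : ℝ) *
        coniDir n * foldRatio (j + 2) 1)) / J := by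
      rw [pow_one]
      field_simp
    rw [e1, norm_div, div_le_iff₀ (norm_pos_iff.2 hJ0), mul_comm _ ‖J‖]
    exact hmain

end ConiRoot

/-- A number with small negative argument does not become real after a rotation by a multiple of
`π / (2 m)` of the special form occurring for the coefficients. -/
theorem im_exp_mul_ne_zero {Z : ℂ} {m k : ℕ} (hm : 0 < m) (him : Z.im < 0)
    (hre : 0 < Z.re) (h : -Z.im < Real.pi / (4 * k + 2) * Z.re) :
    (exp ((-(k * (Real.pi / 2 + Real.pi / m)) : ℝ) * I) * Z).im ≠ 0 := fun h0 => by
  have hpi := Real.pi_pos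
  have hm' : (0 : ℝ) < m := by exact_mod_cast hm
  set ψ : ℝ := k * (Real.pi / 2 + Real.pi / m) with hψ
  rw [mul_im, exp_ofReal_mul_I_re, exp_ofReal_mul_I_im, Real.cos_neg, Real.sin_neg] at h0
  set j : ℤ := round (ψ / Real.pi) with hj
  set t : ℝ := j * Real.pi - ψ with ht
  have hψt : ψ = j * Real.pi - t := by rw [ht]; ring
  have habs : |t| ≤ Real.pi / 2 := by
    have h1 := abs_sub_round (ψ / Real.pi)
    have h2 : t = -((ψ / Real.pi - j) * Real.pi) := by
      rw [ht]
      field_simp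
      ring
    rw [h2, abs_neg, abs_mul, abs_of_pos hpi]
    nlinarith
  obtain ⟨a1, a2⟩ := abs_le.1 habs
  have h1 : Real.sin t * Z.re + Real.cos t * Z.im = 0 := by
    rw [hψt, Real.sin_int_mul_pi_sub, Real.cos_int_mul_pi_sub] at h0
    have hne : ((-1 : ℝ) ^ j) ≠ 0 := zpow_ne_zero _ (by norm_num)
    refine (mul_eq_zero.1 ?_).resolve_left hne
    linarith
  have hcos : 0 < Real.cos t := by
    refine lt_of_le_of_ne (Real.cos_nonneg_of_mem_Icc ⟨a1, a2⟩) fun hc => ?_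
    rw [← hc, zero_mul, add_zero] at h1
    have h2 := Real.sin_sq_add_cos_sq t
    rw [← hc, (mul_eq_zero.1 h1).resolve_right hre.ne'] at h2
    norm_num at h2
  have hsin : 0 < Real.sin t := by
    by_contra hc
    push Not at hc
    nlinarith
  have ht0 : 0 < t := by
    by_contra hc
    push Not at hc
    linarith [Real.sin_nonpos_of_nonpos_of_neg_pi_le hc (by linarith)]
  have ht1 : t < Real.pi / 2 := lt_of_le_of_ne a2 fun hc => by
    rw [hc, Real.cos_pi_div_two] at hcos
    exact lt_irrefl _ hcos
  have htan := Real.lt_tan ht0 ht1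
  rw [Real.tan_eq_sin_div_cos, lt_div_iff₀ hcos] at htan
  have h2 : t < Real.pi / (4 * k + 2) := by
    by_contra hc
    push Not at hc
    have h3 : Real.pi / (4 * k + 2) * Z.re ≤ t * Z.re := mul_le_mul_of_nonneg_right hc hre.le
    nlinarith
  -- `t` is a positive multiple of `π / (2 m)`
  set r : ℤ := 2 * m * j - k * (m + 2) with hr
  have htr : t = Real.pi / (2 * m) * r := by
    rw [ht, hψ, hr]
    push_cast
    field_simp
  have hr0 : 0 < r := by
    rw [htr] at ht0
    exact_mod_cast pos_of_mul_pos_right ht0 (by positivity)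
  have h3 : r * (2 * k + 1) < (m : ℤ) := by
    rw [htr, div_mul_eq_mul_div, div_lt_div_iff₀ (by positivity) (by positivity)] at h2
    have h4 : (r : ℝ) * (2 * k + 1) < m := by
      have h5 : Real.pi * (r * (2 * k + 1)) < Real.pi * m := by nlinarith
      exact lt_of_mul_lt_mul_left h5 hpi.le
    exact_mod_cast h4
  have hk0 : (0 : ℤ) ≤ k := Int.natCast_nonneg k
  have hmz : (0 : ℤ) < m := by exact_mod_cast hm
  have hr2 : r = m * (2 * j - k) - 2 * k := by rw [hr]; ring
  have hi : 1 ≤ 2 * j - (k : ℤ) := by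
    by_contra hc
    push Not at hc
    nlinarith
  have h5 : (m : ℤ) - 2 * k ≤ r := by
    rw [hr2]
    nlinarith
  rcases hk0.eq_or_lt with hk1 | hk1
  · rw [← hk1] at h3 h5
    linarith
  · nlinarith

end NonVanishing

section NonVanishing

open Complex Set

variable {n : ℕ}

/-- The error of the two-term approximation is less than its imaginary part. -/
theorem coniErr_lt (hn : 2 ≤ n) {k : ℕ} (hk : 20 ≤ k) (h3 : n = 2 → 30 ≤ k) :
    (k - 1) * (4 * √((n + 1) / 2) / (Real.pi * √n) * foldErr k) <
      (n - 1) * (n + 2) / (12 * n) * Real.sin (coniAngle n) * Real.cos (coniAngle n) ∧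
    (k - 1) * (4 * √((n + 1) / 2) / (Real.pi * √n) * foldErr k) ≤ 14 / 100 := by
  have hn0 : (2 : ℝ) ≤ n := by exact_mod_cast hn
  have hsn : 0 < √(n : ℝ) := Real.sqrt_pos.2 (by linarith)
  have hpi := Real.pi_gt_d4
  have hpi0 := Real.pi_pos
  set κ : ℝ := 4 * √((n + 1) / 2) / (Real.pi * √n) with hκ
  have hκ0 : 0 ≤ κ := by positivity
  have hκ2 : κ ^ 2 * (Real.pi ^ 2 * n) = 8 * (n + 1) := by
    rw [hκ, div_pow, mul_pow, mul_pow, Real.sq_sqrt (by positivity), Real.sq_sqrt (by linarith)]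
    field_simp
    ring
  have hpi2 : 9.8690 ≤ Real.pi ^ 2 := by nlinarith
  have hsc : Real.sin (coniAngle n) * Real.cos (coniAngle n) = Real.sin (2 * coniAngle n) / 2 := by
    rw [Real.sin_two_mul]
    ring
  rw [mul_assoc _ (Real.sin _), hsc, mul_left_comm]
  rcases hn.eq_or_lt with h2 | h2
  · have hE := mul_foldErr_le (K := 30) (k := k) (by norm_num) (h3 h2.symm)
    have hE' : ((k : ℝ) - 1) * foldErr k ≤ 65 / 1000 := hE.trans (by norm_num)
    have hn2 : (n : ℝ) = 2 := by exact_mod_cast h2.symm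
    have hκ1 : κ ≤ 1103 / 1000 := by
      rw [hn2] at hκ2
      by_contra hc
      push Not at hc
      nlinarith
    have hsin : Real.sin (2 * coniAngle n) = √3 / 2 := by
      rw [coniAngle, hn2, show 2 * (Real.pi / (2 + 1)) = Real.pi - Real.pi / 3 by ring,
        Real.sin_pi_sub, Real.sin_pi_div_three]
    have h5 : (1.732 : ℝ) < √3 := Real.lt_sqrt_of_sq_lt (by norm_num)
    have h6 : κ * ((k - 1) * foldErr k) ≤ 1103 / 1000 * (65 / 1000) :=
      (mul_le_mul_of_nonneg_left hE' hκ0).trans (mul_le_mul_of_nonneg_right hκ1 (by norm_num))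
    rw [hsin, hn2]
    constructor <;> linarith
  · have hE := mul_foldErr_le (K := 20) (k := k) (by norm_num) hk
    have hE' : ((k : ℝ) - 1) * foldErr k ≤ 128 / 1000 := hE.trans (by norm_num)
    have hn3 : (3 : ℝ) ≤ n := by exact_mod_cast h2
    have hκ1 : κ ≤ 104 / 100 := by
      by_contra hc
      push Not at hc
      have h5 : (104 / 100) ^ 2 * (9.8690 * n) < κ ^ 2 * (Real.pi ^ 2 * n) := by
        have : (104 / 100 : ℝ) ^ 2 < κ ^ 2 := pow_lt_pow_left₀ hc (by norm_num) two_ne_zero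
        have h7 : 9.8690 * (n : ℝ) ≤ Real.pi ^ 2 * n := by gcongr
        exact mul_lt_mul this h7 (by positivity) (by positivity)
      rw [hκ2] at h5
      linarith
    have hsin : 4 / (n + 1) ≤ Real.sin (2 * coniAngle n) := by
      have h5 := Real.mul_le_sin (x := 2 * coniAngle n) (by have := coniAngle_pos (n := n); positivity)
        (by
          rw [coniAngle, mul_div_assoc', div_le_div_iff₀ (by positivity) (by norm_num)]
          nlinarith)
      refine le_trans (le_of_eq ?_) h5
      rw [coniAngle]
      field_simp
      norm_num
    have h6 : κ * ((k - 1) * foldErr k) ≤ 104 / 100 * (128 / 1000) :=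
      (mul_le_mul_of_nonneg_left hE' hκ0).trans (mul_le_mul_of_nonneg_right hκ1 (by norm_num))
    refine ⟨h6.trans_lt (lt_of_lt_of_le ?_ (mul_le_mul_of_nonneg_left
      (div_le_div_of_nonneg_right hsin two_pos.le) ?_)), by linarith⟩
    · have e : (4 : ℝ) / (n + 1) / 2 = 2 / (n + 1) := by ring
      rw [e, div_mul_div_comm (_ * _) (_ : ℝ) (2 : ℝ), lt_div_iff₀ (by positivity)]
      nlinarith
    · have : (0 : ℝ) ≤ n - 1 := by linarith
      positivity

set_option maxHeartbeats 800000 in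
theorem expectTop_one_ne_zero_of_le (hn : 2 ≤ n)
    (h1 : LGParam.expectTop n.succ_pos 1 1 = ((n : ℚ) - 1) * (n + 2) / 24) {k : ℕ} (hk : 20 ≤ k)
    (h3 : n = 2 → 30 ≤ k) : LGParam.expectTop n.succ_pos k 1 ≠ 0 := fun h0 => by
  obtain ⟨R⟩ := exists_coniRoot hn
  obtain ⟨Z, r, hr, hZ, hZE⟩ := R.exists_coniCoeff_eq hn (k := k) (by omega)
  obtain ⟨hE1, hE2⟩ := coniErr_lt hn hk h3
  have hn0 : (2 : ℝ) ≤ n := by exact_mod_cast hn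
  have hk0 : (20 : ℝ) ≤ k := by exact_mod_cast hk
  have hsin := sin_coniAngle_pos hn
  have hcos := cos_coniAngle_pos hn
  have hs : 0 < √(((n : ℝ) + 1) / 2) := Real.sqrt_pos.2 (by positivity)
  have hpi := Real.pi_gt_d2
  have hpi2 := Real.pi_lt_d2
  set f : ℝ := (n - 1) * (n + 2) / (6 * n) * Real.sin (coniAngle n) with hf
  have hf0 : 0 ≤ f := by
    have : (0 : ℝ) ≤ n - 1 := by linarith
    rw [hf]
    positivity
  have hf1 : f ≤ 53 / 100 := by
    have h5 : Real.sin (coniAngle n) ≤ Real.pi / (n + 1) := Real.sin_le coniAngle_pos.le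
    have h6 : f ≤ (n - 1) * (n + 2) / (6 * n) * (Real.pi / (n + 1)) :=
      mul_le_mul_of_nonneg_left h5 (by
        have : (0 : ℝ) ≤ n - 1 := by linarith
        positivity)
    refine h6.trans ?_
    rw [div_mul_div_comm, div_le_iff₀ (by positivity)]
    nlinarith [mul_nonneg (mul_nonneg (by linarith : (0 : ℝ) ≤ n - 1) (by linarith : (0 : ℝ) ≤ n + 2))
      (sub_nonneg.2 hpi2.le)]
  have hc : coniCoeff n 1 * coniDist n / coniCoeff n 0 = -f := by
    rw [coniCoeff, coniCoeff, h1, LGParam.expectTop_zero, coniDist, hf]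
    simp only [Finset.prod_range_one, Finset.prod_range_zero, Polynomial.eval_one]
    push_cast
    field_simp
    ring
  have hb : foldRatio k 1 = 1 / (2 * (k - 1)) := by
    rw [foldRatio, Finset.prod_range_one]
    push_cast
    ring_nf
  rw [hc, hb] at hZE
  set E := 4 * √((n + 1) / 2) / (Real.pi * √n) * foldErr k with hEdef
  set y : ℝ := (k : ℝ) - 1 with hy
  have hy0 : 19 ≤ y := by linarith
  set Z0 : ℂ := 1 + (-f : ℝ) * coniDir n * ((1 / (2 * y) : ℝ) : ℂ) with hZ0
  have hre0 : Z0.re = 1 - f * Real.sin (coniAngle n) * (1 / (2 * y)) := by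
    rw [hZ0, add_re, re_mul_ofReal, re_ofReal_mul, coniDir_re, one_re]
    ring
  have him0 : Z0.im = -(f * Real.cos (coniAngle n) * (1 / (2 * y))) := by
    rw [hZ0, add_im, im_mul_ofReal, im_ofReal_mul, coniDir_im, one_im]
    ring
  have hre := (abs_re_le_norm (Z - Z0)).trans hZE
  have him := (abs_im_le_norm (Z - Z0)).trans hZE
  rw [sub_re, hre0, abs_le] at hre
  rw [sub_im, him0, abs_le] at him
  have hEy : E ≤ 14 / 100 / y := by
    rw [le_div_iff₀ (by linarith)]
    linarith
  have hF : E < f * Real.cos (coniAngle n) * (1 / (2 * y)) := by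
    rw [mul_one_div, lt_div_iff₀ (by linarith), hf]
    have e : (n - 1) * (n + 2) / (6 * n) * Real.sin (coniAngle n) * Real.cos (coniAngle n) =
        2 * ((n - 1) * (n + 2) / (12 * n) * Real.sin (coniAngle n) * Real.cos (coniAngle n)) := by
      field_simp
      ring
    rw [e]
    linarith
  have hb2 : ∀ s : ℝ, s ≤ 1 → f * s * (1 / (2 * y)) ≤ 27 / 100 / y := fun s hs => by
    rw [mul_one_div, div_le_div_iff₀ (by linarith) (by linarith)]
    have h5 : f * s ≤ 54 / 100 := (mul_le_of_le_one_right hf0 hs).trans (by linarith)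
    nlinarith
  have hs1 := hb2 _ (Real.sin_le_one (coniAngle n))
  have hc1 := hb2 _ (Real.cos_le_one (coniAngle n))
  have e1 : 14 / 100 / y + 27 / 100 / y = 41 / 100 / y := by ring
  have hy1 : 41 / 100 / y ≤ 3 / 100 := by
    rw [div_le_iff₀ (by linarith)]
    linarith
  have hZre : 97 / 100 ≤ Z.re := by linarith
  have hne := im_exp_mul_ne_zero (Z := Z) (k := k) n.succ_pos (by linarith) (by linarith) (by
    have h5 : -Z.im ≤ 41 / 100 / y := by linarith
    refine h5.trans_lt ?_
    have h6 : Real.pi / (4 * k + 2) * (97 / 100) ≤ Real.pi / (4 * k + 2) * Z.re := by gcongr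
    refine lt_of_lt_of_le ?_ h6
    rw [div_mul_eq_mul_div, div_lt_div_iff₀ (by linarith) (by linarith)]
    nlinarith)
  refine hr ((mul_eq_zero.1 (hZ.symm.trans ?_)).resolve_right ?_)
  · rw [coniCoeff, h0, Rat.cast_zero, zero_div]
  · rw [coniAngle]
    push_cast at hne ⊢
    exact hne

end NonVanishing

namespace Saddle

section Recursion

variable {A : Type*} [Add A] [Mul A] [Zero A] [One A] [NatCast A] (inv : ℕ → A) (neg m : A) (k : ℕ)

/-- The coefficients of the power series `P` in `u` with `x u P' = 2 - (2 + (m + 1) u) P`, where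
`x = 1 + u`, over a semiring in which `inv i` is an inverse of `i` and `neg` is `-1`. -/
noncomputable def p (j : ℕ) : A :=
  Nat.rec 1 (fun j a => neg * (inv (j + 3) * ((m + (j + 1 : ℕ)) * a))) j

/-- The coefficients of `k (m + 1) P + (2 k + 1) (P - 1) / u`. -/
noncomputable def a (i : ℕ) : A :=
  k * (m + 1) * p inv neg m i + (2 * k + 1 : ℕ) * p inv neg m (i + 1)

/-- The coefficients of `(1 - x P) / u`. -/
noncomputable def b (i : ℕ) : A := neg * (p inv neg m i + p inv neg m (i + 1))

/-- The convolution in the recursion for `Saddle.h`. -/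
noncomputable def dot (l : List A) : ℕ → ℕ → A :=
  List.rec (fun _ _ => 0)
    (fun h _ f i r => (a inv neg m k i + r * b inv neg m i) * h + f (i + 1) (r - 1)) l

/-- The list `h N, …, h 0`. -/
noncomputable def list (N : ℕ) : List A :=
  Nat.rec [1] (fun N l => inv (N + 1) * dot inv neg m k l 0 N :: l) N

/-- The coefficients of `x ^ (-(m + 1) / 2) P ^ (-k - 1 / 2)`. The definition by lists is meant for
evaluation in the kernel. -/
noncomputable def h (N : ℕ) : A := (list inv neg m k N).headD 0

end Recursion

section Map

variable {A B : Type*} [CommSemiring A] [CommSemiring B] {inv : ℕ → A} {neg m : A} {k : ℕ}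

theorem p_zero : p inv neg m 0 = 1 := rfl

theorem h_zero : h inv neg m k 0 = 1 := rfl

theorem p_succ (j : ℕ) : p inv neg m (j + 1) =
    neg * (inv (j + 3) * ((m + (j + 1 : ℕ)) * p inv neg m j)) := rfl

theorem dot_list (N i : ℕ) : dot inv neg m k (list inv neg m k N) i N =
    ∑ j ∈ Finset.range (N + 1),
      (a inv neg m k (i + j) + (N - j : ℕ) * b inv neg m (i + j)) * h inv neg m k (N - j) := by
  induction N generalizing i with
  | zero => simp [list, dot, h]
  | succ N ih =>
    rw [Finset.sum_range_succ']
    change _ + dot inv neg m k (list inv neg m k N) (i + 1) N = _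
    rw [ih, add_comm]
    congr 1
    refine Finset.sum_congr rfl fun j _ => ?_
    rw [Nat.add_sub_add_right, add_right_comm i 1 j, add_assoc i j 1]

theorem h_succ (N : ℕ) : h inv neg m k (N + 1) = inv (N + 1) * ∑ j ∈ Finset.range (N + 1),
    (a inv neg m k j + (N - j : ℕ) * b inv neg m j) * h inv neg m k (N - j) := by
  have := dot_list (inv := inv) (neg := neg) (m := m) (k := k) N 0
  simp only [zero_add] at this
  rw [← this]
  rfl

variable {inv' : ℕ → B} {neg' m' : B} {φ : A →+* B} {M : ℕ}

theorem map_p (hi : ∀ i, 0 < i → i ≤ M → φ (inv i) = inv' i) (hneg : φ neg = neg') (hm : φ m = m')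
    {j : ℕ} (hj : j + 2 ≤ M) : φ (p inv neg m j) = p inv' neg' m' j := by
  induction j with
  | zero => exact map_one φ
  | succ j ih =>
    rw [p_succ, p_succ, map_mul, map_mul, map_mul, ih (by omega), hi _ (by omega) hj, map_add,
      map_natCast, hneg, hm]

theorem map_h (hi : ∀ i, 0 < i → i ≤ M → φ (inv i) = inv' i) (hneg : φ neg = neg') (hm : φ m = m')
    {N : ℕ} (hN : N + 2 ≤ M) : φ (h inv neg m k N) = h inv' neg' m' k N := by
  induction N using Nat.strong_induction_on with
  | _ N ih =>
    cases N with
    | zero => exact map_one φ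
    | succ N =>
      rw [h_succ, h_succ, map_mul, hi _ (by omega) (by omega), map_sum]
      congr 1
      refine Finset.sum_congr rfl fun j hj => ?_
      have hj := Finset.mem_range.1 hj
      simp only [a, b, map_mul, map_add, map_natCast, map_one, hneg, hm,
        map_p hi hneg hm (show j + 2 ≤ M by omega), map_p hi hneg hm (show j + 1 + 2 ≤ M by omega),
        ih (N - j) (by omega) (by omega)]

end Map

section Series

open PowerSeries

variable (m : ℚ)

/-- The series `P` over `ℚ`. -/
noncomputable def P : ℚ⟦X⟧ := mk (p (fun i => (i : ℚ)⁻¹) (-1) m)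

/-- The series `(P - 1) / u`. -/
noncomputable def Q : ℚ⟦X⟧ := mk fun j => p (fun i => (i : ℚ)⁻¹) (-1) m (j + 1)

/-- The series `x ^ (-(m + 1) / 2) P ^ (-k - 1 / 2)`. -/
noncomputable def H (k : ℕ) : ℚ⟦X⟧ := mk (h (fun i => (i : ℚ)⁻¹) (-1) m k)

theorem P_eq : P m = 1 + X * Q m := by
  ext (_ | j)
  · simp [P, p]
  · simp [P, Q, coeff_succ_X_mul, coeff_one]

theorem X_mul_derivative_P :
    (1 + X) * d⁄dX ℚ (P m) = -(2 * Q m + C (m + 1) * P m) := by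
  ext j
  have e : p (fun i => (i : ℚ)⁻¹) (-1) m (j + 1) * (j + 3) =
      -(m + (j + 1)) * p (fun i => (i : ℚ)⁻¹) (-1) m j := by
    rw [p_succ]
    push_cast
    field_simp
  have h1 : coeff j (X * d⁄dX ℚ (P m)) = j * p (fun i => (i : ℚ)⁻¹) (-1) m j := by
    cases j with
    | zero => simp
    | succ j => simp [coeff_succ_X_mul, coeff_derivative, P, mul_comm]
  rw [add_mul, one_mul, map_add, h1, map_neg, map_add, ← map_ofNat C, coeff_C_mul, coeff_C_mul]
  simp only [coeff_derivative, P, Q, coeff_mk]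
  linear_combination e

theorem derivative_H (k : ℕ) : (1 + X) * P m * d⁄dX ℚ (H m k) =
    (C ((k : ℚ) * (m + 1)) * P m + C (2 * (k : ℚ) + 1) * Q m) * H m k := by
  have hx : ∀ N, coeff N (X * d⁄dX ℚ (H m k)) = N * h (fun i => (i : ℚ)⁻¹) (-1) m k N := fun N => by
    cases N with
    | zero => simp
    | succ N => simp [coeff_succ_X_mul, coeff_derivative, H, mul_comm]
  have e : d⁄dX ℚ (H m k) = (C ((k : ℚ) * (m + 1)) * P m + C (2 * (k : ℚ) + 1) * Q m) * H m k +
      -(P m + Q m) * (X * d⁄dX ℚ (H m k)) := by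
    ext N
    rw [map_add, coeff_mul, coeff_mul, ← Finset.sum_add_distrib,
      Finset.Nat.sum_antidiagonal_eq_sum_range_succ_mk, coeff_derivative, H, coeff_mk, h_succ]
    rw [mul_comm, ← mul_assoc]
    push_cast
    rw [mul_inv_cancel₀ (by positivity), one_mul]
    refine Finset.sum_congr rfl fun j hj => ?_
    rw [← H, hx]
    rw [map_add, coeff_C_mul, coeff_C_mul, map_neg, map_add]
    simp only [P, Q, H, coeff_mk, a, b]
    push_cast
    ring
  linear_combination e + d⁄dX ℚ (H m k) * P_eq m

/-- Uniqueness of the solution of a linear differential equation. -/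
theorem eq_zero_of_derivative_eq_mul {f W : ℚ⟦X⟧} (h : d⁄dX ℚ f = W * f)
    (h0 : constantCoeff f = 0) : f = 0 := by
  ext N
  induction N using Nat.strong_induction_on with
  | _ N ih =>
    cases N with
    | zero => simpa using h0
    | succ N =>
      have h1 := congrArg (coeff N) h
      rw [coeff_derivative, coeff_mul, Finset.sum_eq_zero fun q hq => ?_] at h1
      · rw [map_zero]
        exact (mul_eq_zero.1 h1).resolve_right (by positivity)
      · rw [ih q.2 (by have := Finset.HasAntidiagonal.mem_antidiagonal.1 hq; omega), map_zero, mul_zero]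

theorem constantCoeff_P : constantCoeff (P m) = 1 := by
  rw [P_eq]
  simp

theorem constantCoeff_H (k : ℕ) : constantCoeff (H m k) = 1 := by
  rw [← coeff_zero_eq_constantCoeff_apply, H, coeff_mk]
  rfl

theorem H_succ_mul_P (k : ℕ) : H m (k + 1) * P m = H m k := by
  have hu : (1 + X) * P m * ((1 + X) * P m)⁻¹ = 1 :=
    PowerSeries.mul_inv_cancel _ (by simp [constantCoeff_P])
  refine sub_eq_zero.1 (eq_zero_of_derivative_eq_mul
    (W := (C ((k : ℚ) * (m + 1)) * P m + C (2 * (k : ℚ) + 1) * Q m) * ((1 + X) * P m)⁻¹) ?_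
    (by simp [constantCoeff_P, constantCoeff_H]))
  have h1 := derivative_H m k
  have h2 := derivative_H m (k + 1)
  have h3 := X_mul_derivative_P m
  set D := ((1 + X) * P m)⁻¹
  rw [map_sub, Derivation.leibniz, smul_eq_mul, smul_eq_mul]
  simp only [map_mul, map_add, map_natCast, map_one, Nat.cast_succ, map_ofNat] at h1 h2 h3 ⊢
  linear_combination D * (P m * h2 + H m (k + 1) * P m * h3 - h1) -
    (H m (k + 1) * d⁄dX ℚ (P m) + P m * d⁄dX ℚ (H m (k + 1)) - d⁄dX ℚ (H m k)) * hu

end Series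

end Saddle

namespace Saddle

open PowerSeries

variable (m : ℚ)

/-- The formal counterpart of the periods: up to a constant, the residue of
`φ e ^ (-n τ / 2) Ξ ^ (-k - 1 / 2) dτ`, where `x = e ^ τ = 1 + u` and `Ξ = m u ^ 2 P / 2`. -/
noncomputable def rho (k : ℕ) : ℚ⟦X⟧ →ₗ[ℚ] ℚ :=
  (2 / m) ^ k • (coeff (2 * k)).comp (LinearMap.mulRight ℚ (H m k))

theorem rho_apply (k : ℕ) (φ : ℚ⟦X⟧) : rho m k φ = (2 / m) ^ k * coeff (2 * k) (φ * H m k) := rfl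

/-- The series `x ^ (1 - m)`. -/
noncomputable def y : ℚ⟦X⟧ := 1 + X - C (m / 2) * (X * (2 - C (m - 1) * (X * P m)))

variable {m}

theorem rho_succ (hm : m ≠ 0) (k : ℕ) (φ : ℚ⟦X⟧) :
    rho m (k + 1) (C (m / 2) * (X ^ 2 * (P m * φ))) = rho m k φ := by
  have e : C (m / 2) * (X ^ 2 * (P m * φ)) * H m (k + 1) = C (m / 2) * (X ^ 2 * (φ * H m k)) := by
    rw [← H_succ_mul_P m k]
    ring
  rw [rho_apply, rho_apply, e, coeff_C_mul, mul_add 2 k 1, coeff_X_pow_mul, pow_succ]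
  field_simp

theorem rho_derivative (hm : m ≠ 0) (k : ℕ) (f : ℚ⟦X⟧) :
    rho m k ((1 + X) * d⁄dX ℚ f - C ((m - 1) / 2) * f) =
      (2 * k + 1) / 2 * rho m (k + 1) (f * (1 + X - y m)) := by
  have h2 : (C (1 / 2 : ℚ)) * 2 = 1 := by rw [← map_ofNat C, ← map_mul]; norm_num
  have hP : P m ≠ 0 := fun h0 => by
    have := constantCoeff_P m
    rw [h0, map_zero] at this
    exact zero_ne_one this
  have h1 : (1 + X) * d⁄dX ℚ (H m k) =
      (C ((k : ℚ) * (m + 1)) * P m + C (2 * (k : ℚ) + 1) * Q m) * H m (k + 1) := by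
    refine mul_left_cancel₀ hP ?_
    rw [← mul_assoc, mul_comm (P m) (1 + X), derivative_H, ← H_succ_mul_P]
    ring
  have h3 := X_mul_derivative_P m
  have e1 : ((1 + X) * d⁄dX ℚ f - C ((m - 1) / 2) * f) * H m k = d⁄dX ℚ (f * ((1 + X) * H m k)) +
      C (2 * (k : ℚ) + 1) * (C (1 / 2) * (f * ((1 + X) * d⁄dX ℚ (P m) * H m (k + 1)))) := by
    simp only [Derivation.leibniz, smul_eq_mul, map_add (d⁄dX ℚ), derivative_X, derivative_one]
    rw [← H_succ_mul_P] at h1 ⊢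
    rw [div_eq_mul_one_div]
    simp only [map_mul, map_add C, map_sub, map_natCast, map_one, map_ofNat] at h1 h3 ⊢
    linear_combination -f * h1 - (2 * k + 1) * C (1 / 2) * f * H m (k + 1) * h3 +
      f * H m (k + 1) * ((1 + k * (C m + 1)) * P m + (2 * k + 1) * Q m) * h2
  have e2 : f * ((1 + X) * H m k) +
      X * (C (1 / 2) * (f * ((1 + X) * d⁄dX ℚ (P m) * H m (k + 1)))) =
      C (1 / 2) * (f * (2 - C (m - 1) * (X * P m)) * H m (k + 1)) := by
    rw [← H_succ_mul_P, h3]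
    simp only [map_add, map_sub, map_one]
    linear_combination f * H m (k + 1) * (P_eq m - (X * P m + X * Q m + 1) * h2)
  have e3 : f * (1 + X - y m) * H m (k + 1) =
      C (m / 2) * (X * (f * (2 - C (m - 1) * (X * P m)) * H m (k + 1))) := by
    rw [y]
    ring
  have e4 := congrArg (coeff (2 * k + 1)) e2
  rw [map_add, coeff_succ_X_mul, coeff_C_mul, coeff_C_mul] at e4
  rw [rho_apply, rho_apply, e1, e3, map_add, coeff_derivative, coeff_C_mul, coeff_C_mul,
    show 2 * (k + 1) = 2 * k + 1 + 1 by ring, coeff_C_mul, coeff_succ_X_mul, pow_succ]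
  have e5 : 2 / m * (m / 2) = 1 := by field_simp
  push_cast
  linear_combination (2 / m) ^ k * (2 * k + 1) * e4 - (2 / m) ^ k * ((2 * k + 1) / 2) *
    coeff (2 * k + 1) (f * (2 - C (m - 1) * (X * P m)) * H m (k + 1)) * e5

theorem X_pow_mul_y (n : ℕ) : (1 + X) ^ n * y (n + 1) = 1 := by
  have h2 : (C (1 / 2 : ℚ)) * 2 = 1 := by rw [← map_ofNat C, ← map_mul]; norm_num
  have h3 := X_mul_derivative_P (n + 1)
  have hx : (1 + X : ℚ⟦X⟧) ≠ 0 := fun h => by simpa using congrArg constantCoeff h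
  have hy : (1 + X) * d⁄dX ℚ (y (n + 1)) = -((n : ℚ⟦X⟧) * y (n + 1)) := by
    rw [y, div_eq_mul_one_div]
    simp only [map_mul, map_add C, map_sub C, map_natCast, map_one C] at h3 ⊢
    simp only [← map_natCast C]
    simp only [Derivation.leibniz, smul_eq_mul, map_add, map_sub, derivative_X, derivative_one,
      derivative_C, ← map_ofNat C]
    simp only [map_ofNat, map_natCast]
    linear_combination ((n : ℚ⟦X⟧) + 1) * C (1 / 2) * n * X ^ 2 * h3 +
      ((n : ℚ⟦X⟧) + 1) * C (1 / 2) * n * X * 2 * P_eq (n + 1) - ((n : ℚ⟦X⟧) + 1) * (1 + X) * h2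
  refine derivative.ext (mul_left_cancel₀ hx ?_) (by simp [y])
  cases n with
  | zero =>
    rw [pow_zero, one_mul, hy]
    simp
  | succ n =>
    rw [Derivation.leibniz, Derivation.leibniz_pow, map_add, derivative_X, derivative_one]
    simp only [smul_eq_mul, nsmul_eq_mul, Nat.add_sub_cancel]
    linear_combination (1 + X) ^ (n + 1) * hy

/-- The leading coefficients in terms of the coefficients of a power series. -/
theorem expectTop_one_of_two_le {n : ℕ} (hn : 1 ≤ n) (k : ℕ) : LGParam.expectTop n.succ_pos k 1 =
    (∏ j ∈ Finset.range k, (-(2 * j + 1) : ℚ)) * h (fun i => (i : ℚ)⁻¹) (-1) (n + 1) k (2 * k) := by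
  have hm : (n + 1 : ℚ) ≠ 0 := by positivity
  have hd : ∀ f : ℚ[X], d⁄dX ℚ (Polynomial.aeval (1 + X : ℚ⟦X⟧) f) =
      Polynomial.aeval (1 + X : ℚ⟦X⟧) (Polynomial.derivative f) := fun f => by
    rw [Derivation.map_aeval, map_add, derivative_X, derivative_one, zero_add, smul_eq_mul, mul_one]
  have key := LGParam.prod_mul_apply_one hn (X_pow_mul_y n) (rho (n + 1)) (fun k f => ?_)
    (fun k => ?_) (fun k f hf => ?_) k
  · have e0 : rho (n + 1) 0 1 = 1 := by simp [rho_apply, constantCoeff_H]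
    rw [e0, rho_apply, one_mul, smul_eq_mul, smul_eq_mul, mul_one, H, coeff_mk, ← mul_assoc] at key
    rw [← key]
    congr 1
    rw [← Finset.card_range k, ← Finset.prod_const, Finset.card_range, ← Finset.prod_mul_distrib]
    refine Finset.prod_congr rfl fun j _ => ?_
    field_simp
  · have := rho_derivative hm k (Polynomial.aeval (1 + X : ℚ⟦X⟧) f)
    rw [hd, add_sub_cancel_right, ← smul_eq_C_mul] at this
    exact this
  · rw [← rho_succ hm, ← map_smul]
    congr 1
    rw [smul_eq_C_mul, smul_eq_C_mul, y, map_sub, Polynomial.aeval_X, map_one]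
    rw [div_eq_mul_one_div]
    have h2 : (C (1 / 2 : ℚ)) * 2 = 1 := by rw [← map_ofNat C, ← map_mul]; norm_num
    simp only [map_mul, map_add, map_sub, map_natCast, map_one]
    linear_combination ((n : ℚ⟦X⟧) + 1) * X * h2
  · rw [rho_apply]
    obtain ⟨g, rfl⟩ := hf
    rw [map_mul (Polynomial.aeval _), map_pow, map_sub, Polynomial.aeval_X, map_one,
      add_sub_cancel_left, mul_assoc,
      coeff_X_pow_mul', if_neg (by omega), mul_zero]

/-- The polynomial in `m` with values `h (2 k)`. -/
noncomputable def hPoly (k : ℕ) : ℚ[X] :=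
  h (fun i => Polynomial.C (i : ℚ)⁻¹) (-1) Polynomial.X k (2 * k)

theorem eval_hPoly (k : ℕ) (m : ℚ) :
    (hPoly k).eval m = h (fun i => (i : ℚ)⁻¹) (-1) m k (2 * k) :=
  map_h (φ := Polynomial.evalRingHom m) (M := 2 * k + 2) (fun i _ _ => by simp) (by simp) (by simp)
    le_rfl

/-- The case `m = 1` follows from the others because both sides are polynomials in `m`. -/
theorem expectTop_one {m : ℕ} (hm : 0 < m) (k : ℕ) : LGParam.expectTop hm k 1 =
    (∏ j ∈ Finset.range k, (-(2 * j + 1) : ℚ)) * (hPoly k).eval (m : ℚ) := by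
  obtain ⟨N, hN⟩ := LGParam.exists_map_eq_expectPoly k
  have h : ∀ {m : ℕ} (hm : 0 < m), LGParam.expectTop hm k 1 = (N.coeff k).eval (m : ℚ) :=
    fun {m} hm => by
      rw [LGParam.expectTop_apply, ← hN hm, Polynomial.coeff_map, Polynomial.coe_evalRingHom]
  have e : N.coeff k = Polynomial.C (∏ j ∈ Finset.range k, (-(2 * j + 1) : ℚ)) * hPoly k := by
    refine Polynomial.eq_of_infinite_eval_eq _ _ (Set.infinite_of_injective_forall_mem
      (f := fun n : ℕ => ((n + 2 : ℕ) : ℚ)) (fun i j hij => by simpa using hij) fun n => ?_)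
    rw [Set.mem_ofPred, ← h (by omega), expectTop_one_of_two_le (by omega : 1 ≤ n + 1) k,
      Polynomial.eval_mul, Polynomial.eval_C, eval_hPoly]
    push_cast
    rw [add_assoc, one_add_one_eq_two]
  rw [h hm, e, Polynomial.eval_mul, Polynomial.eval_C]

end Saddle

namespace Saddle

open PowerSeries

theorem padicNorm_inv_natCast_le {n : ℕ} (hn : 0 < n) : padicNorm 2 (n : ℚ)⁻¹ ≤ n := by
  have hq : (n : ℚ) ≠ 0 := by positivity
  rw [← one_div, padicNorm.div, padicNorm.one, one_div, padicNorm.eq_zpow_of_nonzero hq, zpow_neg, inv_inv, padicValRat.of_nat, zpow_natCast]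
  exact_mod_cast Nat.le_of_dvd hn pow_padicValNat_dvd

theorem padicNorm_mul_natCast_add_le {a b B : ℚ} (ha : padicNorm 2 a ≤ B) (hb : padicNorm 2 b ≤ B)
    (n : ℕ) : padicNorm 2 (n * (a + b)) ≤ B := by
  rw [padicNorm.mul]
  exact (mul_le_of_le_one_left (padicNorm.nonneg _) (padicNorm.of_nat n)).trans
    (padicNorm.nonarchimedean.trans (max_le ha hb))

theorem padicNorm_add_eq_one {a b : ℚ} (ha : padicNorm 2 a = 1) (hb : padicNorm 2 b < 1) :
    padicNorm 2 (a + b) = 1 := by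
  rw [padicNorm.add_eq_max_of_ne (by rw [ha]; exact hb.ne'), ha, max_eq_left hb.le]

/-- The `2`-adic valuation of the coefficients for `m = 1`: modulo `2`, only the summand with
`i = 1` counts. -/
theorem padicNorm_eq_one_of_recursion {R : ℕ → ℕ → ℚ} (h0 : R 0 0 = 1) (h0' : ∀ j, R 0 (j + 1) = 0)
    (h1 : ∀ k, R (k + 1) 1 = 0)
    (h2 : ∀ k j, R (k + 1) (j + 2) = 4 * (k + 1) * ((j + 1 : ℕ) * (R k (j + 1) + R k j)))
    (h3 : ∀ k, R (k + 1) 0 = ∑ i ∈ Finset.range (2 * k + 2), (-1) ^ (i + 1) * (4 * (i + 2)) *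
      (((i + 3 : ℕ) : ℚ)⁻¹ * ((i + 1 : ℕ) * (R k (i + 1) + R k i) + i * (R k i + R k (i - 1)))))
    (k : ℕ) : padicNorm 2 (R k 0) = 1 ∧ ∀ j, padicNorm 2 (R k j) ≤ 2⁻¹ ^ j := by
  have n2 : padicNorm 2 2 = 2⁻¹ := by simpa using padicNorm.padicNorm_p (p := 2) one_lt_two
  have n4 : padicNorm 2 4 = 2⁻¹ ^ 2 := by rw [show (4 : ℚ) = 2 * 2 by norm_num, padicNorm.mul, n2, sq]
  have n3 : padicNorm 2 3 = 1 := by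
    have := (padicNorm.nat_eq_one_iff (p := 2) 3).2 (by norm_num)
    exact_mod_cast this
  have half : ∀ {i j : ℕ}, j ≤ i → (2⁻¹ : ℚ) ^ i ≤ 2⁻¹ ^ j := fun h =>
    pow_le_pow_of_le_one (by norm_num) (by norm_num) h
  induction k with
  | zero =>
    refine ⟨by simp [h0], fun j => ?_⟩
    cases j with
    | zero => simp [h0]
    | succ j => rw [h0', padicNorm.zero]; positivity
  | succ k ih =>
    obtain ⟨ih1, ih2⟩ := ih
    have key : padicNorm 2 (R (k + 1) 0) = 1 := by
      set t : ℕ → ℚ := fun i => (-1) ^ (i + 1) * (4 * (i + 2)) *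
        (((i + 3 : ℕ) : ℚ)⁻¹ * ((i + 1 : ℕ) * (R k (i + 1) + R k i) + i * (R k i + R k (i - 1))))
      have ht : ∀ i, i ≠ 1 → padicNorm 2 (t i) < 1 := fun i hi => by
        have b1 : padicNorm 2 ((-1) ^ (i + 1) * (4 * (i + 2)) : ℚ) ≤ 2⁻¹ ^ 2 := by
          have e : ((-1) ^ (i + 1) * (4 * (i + 2)) : ℚ) = 4 * (((-1) ^ (i + 1) * (i + 2) : ℤ) : ℚ) := by
            push_cast
            ring
          rw [e, padicNorm.mul, n4]
          exact mul_le_of_le_one_right (by positivity) (padicNorm.of_int _)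
        have hb : ∀ j, i - 1 ≤ j → padicNorm 2 (R k j) ≤ 2⁻¹ ^ (i - 1) := fun j h =>
          (ih2 j).trans (half h)
        have b2 : padicNorm 2 ((i + 1 : ℕ) * (R k (i + 1) + R k i) + i * (R k i + R k (i - 1))) ≤
            2⁻¹ ^ (i - 1) :=
          padicNorm.nonarchimedean.trans (max_le
            (padicNorm_mul_natCast_add_le (hb _ (by omega)) (hb _ (by omega)) _)
            (padicNorm_mul_natCast_add_le (hb _ (by omega)) (ih2 _) _))
        rw [padicNorm.mul, padicNorm.mul (((i + 3 : ℕ) : ℚ)⁻¹)]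
        refine (mul_le_mul b1 (mul_le_mul (padicNorm_inv_natCast_le (n := i + 3) (by omega)) b2
          (padicNorm.nonneg _) (by positivity)) (mul_nonneg (padicNorm.nonneg _) (padicNorm.nonneg _))
          (by positivity)).trans_lt ?_
        rcases Nat.lt_or_ge i 2 with h | h
        · interval_cases i
          · norm_num
          · exact absurd rfl hi
        · obtain ⟨j, rfl⟩ := Nat.exists_eq_add_of_le h
          have hj : j + 1 ≤ 2 ^ j := Nat.lt_two_pow_self
          have hj : (j + 1 : ℚ) ≤ 2 ^ j := by exact_mod_cast hj
          rw [show 2 + j - 1 = j + 1 by omega, inv_pow, inv_pow, pow_succ (2 : ℚ) j]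
          push_cast
          have : (0 : ℚ) < 2 ^ j := by positivity
          field_simp
          linarith
      have h1t : padicNorm 2 (t 1) = 1 := by
        have e : t 1 = 3 * R k 0 +
            (3 : ℕ) * ((3 : ℕ) * (R k 1 + 0) + (2 : ℕ) * (R k 2 + 0)) := by
          simp only [t]
          norm_num
          ring
        rw [e]
        refine padicNorm_add_eq_one (by rw [padicNorm.mul, n3, ih1, one_mul])
          ((padicNorm_mul_natCast_add_le (B := 2⁻¹) ?_ ?_ _).trans_lt (by norm_num)) <;>
        refine padicNorm_mul_natCast_add_le ((ih2 _).trans (by norm_num)) ?_ _ <;>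
        simp
      rw [h3, ← Finset.add_sum_erase _ t (Finset.mem_range.2 (by omega : 1 < 2 * k + 2))]
      exact padicNorm_add_eq_one h1t
        (padicNorm.sum_lt' (fun i hi => ht i (Finset.ne_of_mem_erase hi)) one_pos)
    refine ⟨key, fun j => ?_⟩
    match j with
    | 0 => simpa using key.le
    | 1 => rw [h1, padicNorm.zero]; positivity
    | j + 2 =>
      have e : R (k + 1) (j + 2) =
          4 * ((k + 1 : ℕ) * ((j + 1 : ℕ) * (R k (j + 1) + R k j) + 0)) := by
        rw [h2]
        push_cast
        ring
      rw [e, padicNorm.mul, n4, pow_add, mul_comm (_ ^ j)]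
      refine mul_le_mul_of_nonneg_left (padicNorm_mul_natCast_add_le
        (padicNorm_mul_natCast_add_le ((ih2 _).trans (half (by omega))) (ih2 _) _) ?_ _)
        (by positivity)
      rw [padicNorm.zero]
      positivity

theorem rho_one_derivative (k : ℕ) (f : ℚ⟦X⟧) : (2 * k + 1) / 2 * rho 1 (k + 1) (f * X) =
    rho 1 k ((1 + X) * d⁄dX ℚ f) := by
  have h := rho_derivative one_ne_zero k f
  have e : 1 + X - y 1 = X := by
    have h2 : (C (1 / 2 : ℚ)) * 2 = 1 := by
      rw [← map_ofNat C, ← map_mul]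
      norm_num
    rw [y, sub_self, map_zero]
    linear_combination X * h2
  rw [e, sub_self, zero_div, map_zero, zero_mul, sub_zero] at h
  exact h.symm

theorem p_one (i : ℕ) : p (fun i => (i : ℚ)⁻¹) (-1) 1 i = (-1) ^ i * (2 * ((i + 2 : ℕ) : ℚ)⁻¹) := by
  induction i with
  | zero => simp [p]
  | succ i ih =>
    rw [p_succ, ih]
    push_cast
    field_simp
    ring

/-- For `m = 1`, the coefficients are those of Stirling's series. -/
theorem eval_hPoly_one_ne_zero (k : ℕ) : (hPoly k).eval 1 ≠ 0 := by
  let R : ℕ → ℕ → ℚ := fun k j => (2 * k).factorial * rho 1 k (X ^ j)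
  have hR : ∀ k j, R k j = (2 * k).factorial * rho 1 k (X ^ j) := fun _ _ => rfl
  have hf : ∀ k : ℕ, ((2 * (k + 1)).factorial : ℚ) = (2 * k + 2) * (2 * k + 1) * (2 * k).factorial :=
    fun k => by
      rw [mul_add, mul_one, Nat.factorial_succ, Nat.factorial_succ]
      push_cast
      ring
  have hc : ∀ k j, rho 1 k (X ^ j) = 2 ^ k * if j ≤ 2 * k then
      h (fun i => (i : ℚ)⁻¹) (-1) 1 k (2 * k - j) else 0 := fun k j => by
    rw [rho_apply, coeff_X_pow_mul', H, div_one]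
    simp only [coeff_mk]
  have h1 : ∀ k, R (k + 1) 1 = 0 := fun k => by
    have := rho_one_derivative k 1
    rw [derivative_one, mul_zero, map_zero, one_mul] at this
    rw [hR, pow_one, (mul_eq_zero.1 this).resolve_left (by positivity), mul_zero]
  have h2 : ∀ k j, R (k + 1) (j + 2) = 4 * (k + 1) * ((j + 1 : ℕ) * (R k (j + 1) + R k j)) :=
    fun k j => by
      have h := rho_one_derivative k (X ^ (j + 1))
      have e : (1 + X) * d⁄dX ℚ (X ^ (j + 1)) =
          ((j + 1 : ℕ) : ℚ) • (X ^ (j + 1) + X ^ j) := by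
        rw [Derivation.leibniz_pow, derivative_X, smul_eq_C_mul, map_natCast]
        simp only [smul_eq_mul, nsmul_eq_mul, Nat.add_sub_cancel]
        ring
      rw [e, map_smul, map_add, smul_eq_mul, ← pow_succ] at h
      rw [hR, hR, hR, hf]
      linear_combination (4 * k + 4) * (2 * k).factorial * h
  have hΞ : ∀ k, (2 * k + 2) * (2 * k + 1) * R k 0 =
      ∑ i ∈ Finset.range (2 * k + 1), (-1) ^ i * (((i + 2 : ℕ) : ℚ)⁻¹ * R (k + 1) (i + 2)) :=
    fun k => by
      have h0 := rho_succ one_ne_zero k 1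
      have e : C (1 / 2 : ℚ) * (X ^ 2 * (P 1 * 1)) * H 1 (k + 1) =
          C (1 / 2 : ℚ) * (X ^ 2 * (P 1 * H 1 (k + 1))) := by ring
      rw [rho_apply, e, coeff_C_mul, mul_add 2 k 1, coeff_X_pow_mul, coeff_mul,
        Finset.Nat.sum_antidiagonal_eq_sum_range_succ_mk] at h0
      simp only [hR]
      rw [pow_zero, ← h0, hf, ← mul_assoc, Finset.mul_sum, Finset.mul_sum, Finset.mul_sum]
      refine Finset.sum_congr rfl fun i hi => ?_
      have hi := Finset.mem_range.1 hi
      rw [hc, if_pos (by omega), P, coeff_mk, H, coeff_mk, p_one,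
        show 2 * (k + 1) - (i + 2) = 2 * k - i by omega]
      ring
  have h3 : ∀ k, R (k + 1) 0 = ∑ i ∈ Finset.range (2 * k + 2), (-1) ^ (i + 1) * (4 * (i + 2)) *
      (((i + 3 : ℕ) : ℚ)⁻¹ * ((i + 1 : ℕ) * (R k (i + 1) + R k i) + i * (R k i + R k (i - 1)))) :=
    fun k => by
      have h := hΞ (k + 1)
      have hk : (2 * k + 4) * (2 * k + 2) ≠ (0 : ℚ) := by positivity
      rw [show 2 * (k + 1) + 1 = (2 * k + 2) + 1 by ring, Finset.sum_range_succ'] at h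
      refine mul_left_cancel₀ hk ?_
      have e : ∀ i, (-1) ^ (i + 1) * (((i + 1 + 2 : ℕ) : ℚ)⁻¹ * R (k + 1 + 1) (i + 1 + 2)) =
          (2 * k + 4) * (2 * k + 2) * ((-1) ^ (i + 1) * (4 * (i + 2)) * (((i + 3 : ℕ) : ℚ)⁻¹ *
          ((i + 1 : ℕ) * (R k (i + 1) + R k i) + i * (R k i + R k (i - 1))))) := fun i => by
        have e2 : R (k + 1) (i + 1) = 4 * (k + 1) * (i * (R k i + R k (i - 1))) := by
          cases i with
          | zero => simp [h1]
          | succ i => rw [h2, Nat.add_sub_cancel]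
        rw [h2, h2, e2]
        push_cast
        ring
      simp only [e, ← Finset.mul_sum] at h
      rw [h2, h1] at h
      generalize (∑ i ∈ Finset.range (2 * k + 2), _ : ℚ) = S at h ⊢
      push_cast at h
      linear_combination h
  have h00 : R 0 0 = 1 := by simp [hR, rho_apply, constantCoeff_H]
  have key := (padicNorm_eq_one_of_recursion h00 (fun j => by simp [hR, hc]) h1 h2 h3 k).1
  intro h0
  rw [eval_hPoly] at h0
  rw [hR, hc, if_pos (Nat.zero_le _), Nat.sub_zero, h0, mul_zero, mul_zero, padicNorm.zero] at key
  exact zero_ne_one key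

end Saddle

namespace Saddle

open Polynomial

variable {p : ℕ} [Fact p.Prime] {k n : ℕ}

/-- An inverse of `i` modulo the power `q` of the prime `p`, by Euler's theorem. -/
def invMod (p q i : ℕ) : ℕ := i ^ (q / p * (p - 1) - 1) % q

/-- A natural number congruent modulo `q` to the value of `hPoly k` at `r`. -/
noncomputable def hMod (p q k r : ℕ) : ℕ := h (invMod p q) (q - 1) r k (2 * k)

theorem natCast_mul_invMod (hn : 0 < n) {i : ℕ} (hi : 0 < i) (hip : i < p) :
    (i : ZMod (p ^ n)) * (invMod p (p ^ n) i : ℕ) = 1 := by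
  have hp : p.Prime := Fact.out
  obtain ⟨n, rfl⟩ := Nat.exists_eq_succ_of_ne_zero hn.ne'
  have hc : i.Coprime (p ^ (n + 1)) :=
    Nat.Coprime.pow_right _ (Nat.coprime_of_lt_prime hi.ne' hip hp).symm
  have h1 := ZMod.pow_totient (ZMod.unitOfCoprime i hc)
  rw [Units.ext_iff, Units.val_pow_eq_pow_val, ZMod.coe_unitOfCoprime, Units.val_one,
    Nat.totient_prime_pow_succ hp] at h1
  rw [invMod, ZMod.natCast_mod, Nat.cast_pow, ← pow_succ', pow_succ p,
    Nat.mul_div_cancel _ hp.pos, Nat.sub_add_cancel (Nat.mul_pos (pow_pos hp.pos _) (by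
      have := hp.two_le; omega))]
  exact h1

theorem isUnit_natCast_padicInt {i : ℕ} (hi : 0 < i) (hip : i < p) : IsUnit (i : ℤ_[p]) := by
  rw [PadicInt.isUnit_iff, PadicInt.norm_natCast_eq_one_iff]
  exact Nat.coprime_of_lt_prime hi.ne' hip Fact.out

/-- The polynomial `hPoly` with coefficients in `ℤ_[p]`, for `p` not too small. -/
noncomputable def hPadic (p : ℕ) [Fact p.Prime] (k : ℕ) : ℤ_[p][X] :=
  h (fun i => C (Ring.inverse (i : ℤ_[p]))) (-1) X k (2 * k)

theorem eval_hPadic (m : ℤ_[p]) :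
    (hPadic p k).eval m = h (fun i => Ring.inverse (i : ℤ_[p])) (-1) m k (2 * k) :=
  map_h (φ := evalRingHom m) (M := 2 * k + 2) (fun i _ _ => by simp) (by simp) (by simp) le_rfl

theorem coe_eval_hPadic (hk : 2 * k + 2 < p) (m : ℤ) :
    (((hPadic p k).eval (m : ℤ_[p]) : ℤ_[p]) : ℚ_[p]) = ((hPoly k).eval (m : ℚ) : ℚ) := by
  rw [eval_hPadic, eval_hPoly]
  refine (map_h (φ := PadicInt.Coe.ringHom) (M := 2 * k + 2)
    (inv' := fun i => ((i : ℚ_[p]))⁻¹) (neg' := -1) (m' := (m : ℚ_[p])) (fun i hi hiM => ?_)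
    (by simp) (by simp) le_rfl).trans (map_h (φ := Rat.castHom ℚ_[p]) (M := 2 * k + 2)
    (fun i _ _ => by simp) (by simp) (by simp) le_rfl).symm
  refine eq_inv_of_mul_eq_one_left ?_
  have h1 := congrArg PadicInt.Coe.ringHom
    (Ring.inverse_mul_cancel _ (isUnit_natCast_padicInt hi (by omega : i < p)))
  rwa [map_mul, map_natCast, map_one] at h1

theorem eval_hPadic_eq_zero_iff (hk : 2 * k + 2 < p) (m : ℤ) :
    (hPadic p k).eval (m : ℤ_[p]) = 0 ↔ (hPoly k).eval (m : ℚ) = 0 := by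
  rw [← PadicInt.coe_eq_zero, coe_eval_hPadic hk, Rat.cast_eq_zero]

theorem toZModPow_eval_hPadic (hn : 0 < n) (hk : 2 * k + 2 < p) {m : ℤ_[p]} {r : ℕ}
    (hr : PadicInt.toZModPow n m = r) :
    PadicInt.toZModPow n ((hPadic p k).eval m) = (hMod p (p ^ n) k r : ℕ) := by
  rw [eval_hPadic, hMod]
  refine (map_h (φ := PadicInt.toZModPow n) (M := 2 * k + 2)
    (inv' := fun i => ((invMod p (p ^ n) i : ℕ) : ZMod (p ^ n))) (neg' := -1) (m' := r)
    (fun i hi hiM => ?_) (by simp) hr le_rfl).trans (map_h (φ := Nat.castRingHom (ZMod (p ^ n)))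
    (M := 2 * k + 2) (fun i _ _ => rfl) ?_ rfl le_rfl).symm
  · have h1 := congrArg (PadicInt.toZModPow n)
      (Ring.inverse_mul_cancel _ (isUnit_natCast_padicInt hi (by omega : i < p)))
    rw [map_mul, map_natCast, map_one] at h1
    exact left_inv_eq_right_inv h1 (natCast_mul_invMod hn hi (by omega))
  · have hp : 0 < p ^ n := pow_pos (Fact.out : p.Prime).pos n
    rw [eq_natCast, Nat.cast_sub hp, Nat.cast_one, ZMod.natCast_self, zero_sub]

/-- A residue class modulo `p` without zeros of `hPoly k` modulo `p`. -/
theorem eval_hPoly_ne_zero_of_mod (hk : 2 * k + 2 < p) {m : ℕ} (h : ¬p ∣ hMod p p k (m % p)) :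
    (hPoly k).eval (m : ℚ) ≠ 0 := by
  intro h0
  have h1 := (eval_hPadic_eq_zero_iff (p := p) hk m).2 (by exact_mod_cast h0)
  have h2 := toZModPow_eval_hPadic one_pos hk (m := ((m : ℤ) : ℤ_[p])) (r := m % p) (by
    rw [show m % p = m % p ^ 1 by rw [pow_one], ZMod.natCast_mod]
    simp)
  rw [h1, map_zero, eq_comm, ZMod.natCast_eq_zero_iff, pow_one] at h2
  exact h h2

/-- A root `ρ` of `hPoly k` that is simple modulo `p` is the only one in its residue class: as
`hPoly k` is `X - ρ` times a polynomial `G` over `ℤ_[p]`, a second root is a root of `G`, and then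
`p ^ 2` divides the value at `ρ + p`. -/
theorem eval_hPoly_ne_zero_of_root (hk : 2 * k + 2 < p) {ρ : ℤ} (hρ : (hPoly k).eval (ρ : ℚ) = 0)
    {m r : ℕ} (hm : (m : ℤ) ≠ ρ) (hmp : (p : ℤ) ∣ m - ρ) (hr : (r : ℤ) = ρ + p)
    (h : ¬p ^ 2 ∣ hMod p (p ^ 2) k r) : (hPoly k).eval (m : ℚ) ≠ 0 := by
  intro h0
  have h1 := (eval_hPadic_eq_zero_iff (p := p) hk m).2 (by exact_mod_cast h0)
  obtain ⟨G, hG⟩ := dvd_iff_isRoot.2 ((eval_hPadic_eq_zero_iff (p := p) hk ρ).2 hρ)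
  have hr' : ((r : ℤ) : ℤ_[p]) - (ρ : ℤ_[p]) = p := by
    rw [hr]
    push_cast
    ring
  rw [hG, eval_mul, eval_sub, eval_X, eval_C] at h1
  have h2 : G.eval ((m : ℤ) : ℤ_[p]) = 0 := (mul_eq_zero.1 h1).resolve_left fun h => by
    rw [sub_eq_zero] at h
    exact hm (by exact_mod_cast h)
  obtain ⟨c, hc⟩ := hmp
  have h3 : (p : ℤ_[p]) ∣ G.eval ((r : ℤ) : ℤ_[p]) := by
    have h4 := sub_dvd_eval_sub ((r : ℤ) : ℤ_[p]) ((m : ℤ) : ℤ_[p]) G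
    rw [h2, sub_zero] at h4
    refine Dvd.dvd.trans ⟨1 - (c : ℤ_[p]), ?_⟩ h4
    have hc' := congrArg (Int.cast : ℤ → ℤ_[p]) hc
    push_cast at hc' hr' ⊢
    linear_combination hr' - hc'
  obtain ⟨d, hd⟩ := h3
  have h5 := toZModPow_eval_hPadic two_pos hk (m := ((r : ℤ) : ℤ_[p])) (r := r) (by simp)
  rw [hG, eval_mul, eval_sub, eval_X, eval_C, hr', hd, ← mul_assoc, ← sq, map_mul, map_pow,
    map_natCast, ← Nat.cast_pow, ZMod.natCast_self, zero_mul, eq_comm, ZMod.natCast_eq_zero_iff] at h5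
  exact h h5

/-- Primes for which the conditions of the two preceding lemmas hold, indexed by `k - 1`. -/
def primes : List ℕ :=
  [5, 17, 19, 37, 31, 37, 43, 83, 79, 71, 67, 73, 109, 113, 97, 127, 103, 113, 127]

theorem primes_check : ∀ k < 19, 2 * (k + 1) + 2 < primes.getD k 0 ∧
    (∀ r < primes.getD k 0, r = 2 ∨ r + 1 = primes.getD k 0 ∨
      ¬primes.getD k 0 ∣ hMod (primes.getD k 0) (primes.getD k 0) (k + 1) r) ∧
    ¬primes.getD k 0 ^ 2 ∣ hMod (primes.getD k 0) (primes.getD k 0 ^ 2) (k + 1) (2 + primes.getD k 0) ∧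
    ¬primes.getD k 0 ^ 2 ∣ hMod (primes.getD k 0) (primes.getD k 0 ^ 2) (k + 1) (primes.getD k 0 - 1) := by
  decide +kernel

theorem roots_check : ∀ k < 19, h (fun i => (i : ℚ)⁻¹) (-1) 2 (k + 1) (2 * (k + 1)) = 0 ∧
    h (fun i => (i : ℚ)⁻¹) (-1) (-1) (k + 1) (2 * (k + 1)) = 0 := by
  decide +kernel

/-- Primes not dividing the value of `hPoly k` at `3`, indexed by `k - 20`. -/
def primes' : List ℕ := [43, 47, 47, 53, 53, 53, 59, 59, 59, 61]

theorem primes'_check : ∀ k < 10, 2 * (20 + k) + 2 < primes'.getD k 0 ∧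
    3 % primes'.getD k 0 = 3 ∧
    ¬primes'.getD k 0 ∣ hMod (primes'.getD k 0) (primes'.getD k 0) (20 + k) 3 := by
  decide +kernel

theorem eval_hPoly_ne_zero {k : ℕ} (hk0 : 0 < k) (hk : k < 20) {m : ℕ} (hm : 3 ≤ m) :
    (hPoly k).eval (m : ℚ) ≠ 0 := by
  obtain ⟨k, rfl⟩ := Nat.exists_eq_succ_of_ne_zero hk0.ne'
  have hk' : k < 19 := by omega
  obtain ⟨h1, h2, h3, h4⟩ := primes_check k hk'
  obtain ⟨r1, r2⟩ := roots_check k hk'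
  have hpr : ∀ q ∈ primes, q.Prime := by norm_num [primes]
  have hq : (primes.getD k 0).Prime := by
    rw [List.getD_eq_getElem _ _ (show k < primes.length from hk')]
    exact hpr _ (List.getElem_mem _)
  generalize primes.getD k 0 = q at *
  have : Fact q.Prime := ⟨hq⟩
  have hmod : ((m % q : ℕ) : ℤ) + q * (m / q : ℕ) = m := by exact_mod_cast Nat.mod_add_div m q
  rcases h2 (m % q) (Nat.mod_lt _ hq.pos) with h | h | h
  · refine eval_hPoly_ne_zero_of_root (ρ := 2) h1 (by rw [eval_hPoly]; exact_mod_cast r1) (by omega)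
      ⟨(m / q : ℕ), ?_⟩ (by push_cast; ring) h3
    rw [← hmod, h]
    push_cast
    ring
  · refine eval_hPoly_ne_zero_of_root (ρ := -1) h1 (by rw [eval_hPoly]; exact_mod_cast r2) (by omega)
      ⟨(m / q : ℕ) + 1, ?_⟩ (r := q - 1) (by omega) h4
    have hq2 : ((m % q : ℕ) : ℤ) + 1 = q := by exact_mod_cast h
    linear_combination hq2 - hmod
  · exact eval_hPoly_ne_zero_of_mod h1 h

theorem eval_hPoly_three_ne_zero {k : ℕ} (hk0 : 20 ≤ k) (hk : k < 30) :
    (hPoly k).eval ((3 : ℕ) : ℚ) ≠ 0 := by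
  obtain ⟨k, rfl⟩ := Nat.exists_eq_add_of_le hk0
  have hk' : k < 10 := by omega
  obtain ⟨h1, h2, h3⟩ := primes'_check k hk'
  have hpr : ∀ q ∈ primes', q.Prime := by norm_num [primes']
  have hq : (primes'.getD k 0).Prime := by
    rw [List.getD_eq_getElem _ _ (show k < primes'.length from hk')]
    exact hpr _ (List.getElem_mem _)
  have : Fact (primes'.getD k 0).Prime := ⟨hq⟩
  exact eval_hPoly_ne_zero_of_mod h1 (by rwa [h2])

end Saddle

theorem LGParam.expectTop_one_ne_zero {m : ℕ} (hm : 0 < m) (h2 : m ≠ 2) (k : ℕ) :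
    LGParam.expectTop hm k 1 ≠ 0 := by
  have hprod : ∀ k, (∏ j ∈ Finset.range k, (-(2 * j + 1) : ℚ)) ≠ 0 := fun k =>
    Finset.prod_ne_zero_iff.2 fun j _ => neg_ne_zero.2 (by positivity)
  rcases k.eq_zero_or_pos with rfl | hk
  · rw [LGParam.expectTop_zero, Polynomial.eval_one]
    exact one_ne_zero
  rcases Nat.lt_or_ge m 3 with h3 | h3
  · obtain rfl : m = 1 := by omega
    rw [Saddle.expectTop_one, Nat.cast_one]
    exact mul_ne_zero (hprod k) (Saddle.eval_hPoly_one_ne_zero k)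
  by_cases hs : k < 20
  · rw [Saddle.expectTop_one]
    exact mul_ne_zero (hprod k) (Saddle.eval_hPoly_ne_zero hk hs h3)
  by_cases hs' : m = 3 ∧ k < 30
  · obtain ⟨rfl, hs'⟩ := hs'
    rw [Saddle.expectTop_one]
    exact mul_ne_zero (hprod k) (Saddle.eval_hPoly_three_ne_zero (by omega) hs')
  obtain ⟨n, rfl⟩ := Nat.exists_eq_succ_of_ne_zero hm.ne'
  refine expectTop_one_ne_zero_of_le (by omega) ?_ (by omega) (by omega)
  rw [Saddle.expectTop_one, Saddle.eval_hPoly]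
  simp [show 2 * 1 = 0 + 1 + 1 from rfl, Saddle.h_succ, Finset.sum_range_succ, Saddle.a, Saddle.b,
    Saddle.p_succ, Saddle.p_zero, Saddle.h_zero]
  ring

/-- The coefficients of the expansion at the critical point, in terms of the polynomials
`expectPoly`. -/
theorem pow_mul_feynman_eq_aeval {m : ℕ} (hm : 0 < m) {ζ lam ℓ : ℂ} (hζ : IsPrimitiveRoot ζ m)
    (hlam : lam ≠ 0) (hℓ0 : ℓ ≠ 0) (hℓ : ℓ ^ m ≠ lam ^ m) (k : ℕ) :
    (m : ℂ) ^ k * (ℓ ^ k * (lgJet m ℂ).feynman (critC m ζ lam ℓ)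
          (lgV (fun i => ℓ - ζ ^ (i : ℕ) * lam) ℓ) k 1) =
      Polynomial.aeval (ℓ ^ m / lam ^ m) (LGParam.expectPoly hm k 1) := by
  have hlm : lam ^ m ≠ 0 := pow_ne_zero _ hlam
  let P : LGParam m ℂ :=
    { ζ := ζ
      β := lam / ℓ
      T := ℓ ^ m / lam ^ m
      U := (ℓ ^ m / lam ^ m - 1)⁻¹
      pos := hm
      primitive := hζ
      β_pow_mul := by
        have := pow_ne_zero m hℓ0
        rw [div_pow]
        field_simp
      U_mul := inv_mul_cancel₀ (by
        rw [sub_ne_zero, Ne, div_eq_one_iff_eq hlm]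
        exact hℓ) }
  have hx : ∀ i : Fin m, ℓ - ζ ^ (i : ℕ) * lam = ℓ * P.x i := fun i => by
    change _ = ℓ * (1 - ζ ^ (i : ℕ) * (lam / ℓ))
    field_simp
  have hpot := critC_isPotential hm hζ hlam hℓ
  simp only [hx] at hpot ⊢
  rw [P.pow_mul_feynman (mul_inv_cancel₀ hℓ0) hpot.inv, LGParam.expect_one hm]

theorem mainTheorem6 :
    -- the polynomials `P k ∈ ℚ[m][T]` depend on `k` only, the `p k ∈ ℚ[T]` on `k` and `m` only
    ∃ P : ℕ → ℚ[X][X], ∀ m : ℕ, 1 ≤ m → ∃ p : ℕ → ℚ[X],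
      -- regularity: `p k (L ^ m) ∈ L ^ k * ℚ[L]`
      (∀ k, (Polynomial.X ^ k : ℚ[X]) ∣ (p k).comp (Polynomial.X ^ m)) ∧
      -- degree
      (∀ k, (p k).natDegree ≤ k) ∧
      (m ≠ 2 → ∀ k, (p k).natDegree = k) ∧
      -- polynomiality in `m`
      (∀ k, Polynomial.C ((m : ℚ) ^ k) * p k =
        (P k).map (Polynomial.evalRingHom (m : ℚ))) ∧
      ∀ (ζ lam q κ L : ℂ) (α : Fin m) (s₀ : Fin m → ℂ)
        (γ : EuclideanSpace ℝ (Fin m) → (Fin m → ℂ)),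
        IsPrimitiveRoot ζ m → lam ≠ 0 → q ≠ 0 → κ ^ m = q⁻¹ →
        L ^ m * (1 - (m : ℂ) ^ m * q) = 1 →
        -- `γ` is the thimble of the critical point labelled by `α`
        IsLefschetzThimble (lgPotential (fun i : Fin m => ζ ^ (i : ℕ) * lam) κ) s₀ γ →
        κ * Complex.exp ((∑ i, s₀ i) / m) = m * (ζ ^ (α : ℕ) * lam * L) →
        -- the oscillatory integral converges for some `z < 0`
        (∃ z₀ : ℝ, z₀ < 0 ∧ Integrable
          (oscIntegrand (lgPotential (fun i : Fin m => ζ ^ (i : ℕ) * lam) κ) γ z₀)) →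
        (∀ᶠ z : ℝ in 𝓝[<] 0, Integrable
          (oscIntegrand (lgPotential (fun i : Fin m => ζ ^ (i : ℕ) * lam) κ) γ z)) ∧
        ∃ (Ψ : ℂ) (r : ℕ → ℂ),
          Ψ ^ 2 * (-lam ^ m) = 1 ∧ r 0 = 1 ∧
          HasOscExpansion m
            (oscIntegral (lgPotential (fun i : Fin m => ζ ^ (i : ℕ) * lam) κ) γ)
            (lgPotential (fun i : Fin m => ζ ^ (i : ℕ) * lam) κ s₀) Ψ r ∧
          ∀ k, (ζ ^ (α : ℕ) * lam * L) ^ k * r k = Polynomial.aeval (L ^ m) (p k) := by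
  choose P hP using LGParam.exists_map_eq_expectPoly
  refine ⟨P, fun m hm => ?_⟩
  have hmq : (m : ℚ) ≠ 0 := by
    have : 0 < m := hm
    exact_mod_cast this.ne'
  have hunit : ∀ k, Polynomial.C ((m : ℚ) ^ k) * Polynomial.C ((m : ℚ) ^ k)⁻¹ = 1 := fun k => by
    rw [← Polynomial.C_mul, mul_inv_cancel₀ (pow_ne_zero k hmq), Polynomial.C_1]
  refine ⟨fun k => Polynomial.C ((m : ℚ) ^ k)⁻¹ * LGParam.expectPoly hm k 1, fun k => ?_, fun k => ?_,
    fun h2 k => ?_, fun k => ?_, ?_⟩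
  · rw [Polynomial.mul_comp]
    exact Dvd.dvd.mul_left (LGParam.X_pow_dvd_expectPoly_comp hm k) _
  · exact (Polynomial.natDegree_C_mul_le _ _).trans (LGParam.natDegree_expectPoly_le hm k 1)
  · rw [Polynomial.natDegree_C_mul (inv_ne_zero (pow_ne_zero k hmq))]
    refine le_antisymm (LGParam.natDegree_expectPoly_le hm k 1)
      (Polynomial.le_natDegree_of_ne_zero ?_)
    exact LGParam.expectTop_one_ne_zero hm h2 k
  · rw [← mul_assoc, hunit, one_mul, hP]
  · intro ζ lam q κ L α s₀ γ hζ hlam _ _ hL hγ hcrit hint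
    have hζ0 : ζ ≠ 0 := hζ.ne_zero (Nat.pos_iff_ne_zero.1 hm)
    have hL0 : L ≠ 0 := by
      rintro rfl
      rw [zero_pow (Nat.pos_iff_ne_zero.1 hm), zero_mul] at hL
      exact zero_ne_one hL
    have hℓ0 : ζ ^ (α : ℕ) * lam * L ≠ 0 := mul_ne_zero (mul_ne_zero (pow_ne_zero _ hζ0) hlam) hL0
    have hpow : (ζ ^ (α : ℕ) * lam * L) ^ m / lam ^ m = L ^ m := by
      have := pow_ne_zero m hlam
      rw [mul_pow, mul_pow, ← pow_mul, mul_comm (α : ℕ), pow_mul, hζ.pow_eq_one, one_pow, one_mul]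
      field_simp
    obtain ⟨hne, hev, Ψ, hΨ, hexp⟩ := thimble_expansion hm hζ hlam hγ hcrit hint
    refine ⟨hev, Ψ, _, hΨ, ?_, hexp, fun k => ?_⟩
    · rw [JetAlgebra.feynman_zero_apply, map_one]
    · have h := pow_mul_feynman_eq_aeval hm hζ hlam hℓ0 hne k
      have hmc : (m : ℂ) ^ k ≠ 0 := by
        have : (m : ℂ) ≠ 0 := by exact_mod_cast hmq
        exact pow_ne_zero k this
      rw [hpow] at h
      rw [map_mul, Polynomial.aeval_C, ← h, map_inv₀, map_pow, map_natCast,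
        inv_mul_cancel_left₀ hmc]
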